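/- **Setting.** An $n$-manifold with corners is a paracompact Hausdorff space with a maximal atlas of smoothly compatible charts modelled on open subsets of $\mathbb R^n_k=[0,\infty)^k\times\mathbb R^{n-k}$, where maps between subsets of Euclidean spaces are smooth if they extend to smooth maps of open neighbourhoods. A local boundary component $\beta$ of $X$ at $x$ is a compatible choice, for all small open neighbourhoods $V$ of $x$, of a connected component of $V\cap S^1(X)$ with $x$ in its closure, where $S^k(X)$ is the set of points of depth $k$; the boundary $\partial X$ is the $(\dim X-1)$-manifold with corners of all pairs $(x,\beta)$, and $i_X:(x,\beta)\mapsto x$. A boundary defining function at $(x,\beta)$ is a smooth $b:V\to[0,\infty)$ on an open neighbourhood $V$ of $x$ with $\mathrm db|_x\ne0$ such that $i_X$ maps a neighbourhood of $(x,\beta)$ homeomorphically onto an open subset of $\{b=0\}$. A continuous map $f:X\to Y$ is smooth if it is smooth in charts and, for all $x\in X$, each boundary defining function $b$ of $Y$ at $(f(x),\beta)$ pulls back either to $0$ near $x$, or to a boundary defining function of $X$ at $(x,\tilde\beta)$ for a unique $\tilde\beta$. Let $\partial_-^fX\subseteq\partial X$ be the set of all $(x,\tilde\beta)$ that arise in the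 second case, and $\partial_+^fX=\partial X\setminus\partial_-^fX$; both are open and closed. Put $f_+=f\circ i_X|_{\partial_+^fX}$. A smooth $f$ is a submersion if $\mathrm df|_x:T_xX\to T_{f(x)}Y$ and $\mathrm df|_x:T_xS^k(X)\to T_{f(x)}S^l(Y)$ are surjective for all $x\in S^k(X)$, $f(x)\in S^l(Y)$, and b-submersive if the induced maps $T_xX/T_xS^k(X)\to T_{f(x)}Y/T_{f(x)}S^l(Y)$ are surjective. If $f$ is b-submersive, then $(x,\tilde\beta)\in\partial_-^fX$ arises from a unique $(f(x),\beta)$, and $f_-:\partial_-^fX\to\partial Y$ maps $(x,\tilde\beta)\mapsto(f(x),\beta)$. Smooth maps $f:X\to Z$, $g:Y\to Z$ are transverse if $T_zZ=\mathrm df(T_xX)+\mathrm dg(T_yY)$ and $T_zS^l(Z)=\mathrm df(T_xS^j(X))+\mathrm dg(T_yS^k(Y))$ whenever $f(x)=g(y)=z$ with $x\in S^j(X)$, $y\in S^k(Y)$, $z\in S^l(Z)$. Then $X\times_{f,Z,g}Y=\{(x,y):f(x)=g(y)\}$ is the manifold with corners of dimension $\dim X+\dim Y-\dim Z$ whose charts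 are those $(U,\phi)$ for which $\pi_X\circ\phi$, $\pi_Y\circ\phi$ are smooth with jointly injective differentials. **Orientation conventions.** $\partial X$ is oriented so that $i_X^*(TX)\cong\mathbb R_{\rm out}\oplus T(\partial X)$ preserves orientations, with the outward normal first. $W=X\times_ZY$ is oriented so that the isomorphism $TW\oplus TZ\cong TX\oplus TY$ obtained by splitting $0\to TW\xrightarrow{\mathrm d\pi_X\oplus\mathrm d\pi_Y}TX\oplus TY\xrightarrow{\mathrm df-\mathrm dg}TZ\to0$ changes the direct sum orientations by the factor $(-1)^{\dim Y\dim Z}$. Orientations of $0$-manifolds are signs at the points; $-X$ is $X$ with the opposite orientation. **Proposition.** Let $X,Y,Z$ be oriented manifolds with corners. (a) If $f:X\to Y$ is a submersion, then $f_-$ is a submersion, $f,i_Y$ are transverse, and there is an orientation-preserving diffeomorphism $$\partial_-^fX\cong(-1)^{\dim X+\dim Y}\,X\times_{f,Y,i_Y}\partial Y$$ which identifies $i_X|_{\partial^f_-X}$ with $\pi_X$ and $f_-$ with $\pi_{\partial Y}$. In (b)–(d) let $f:X\to Z$, $g:Y\to Z$ be smooth. In each case $X\times_{f,Z,g}Y$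 is an oriented manifold with corners, all the fibre products that occur are fibre products of transverse smooth maps, and there is an orientation-preserving diffeomorphism as stated, which commutes with the natural maps from both sides to $X\times Y$ (given by $i_{X\times_ZY}$ on the left, and by $i_X$, $i_Y$ and identities on the right). (b) If $Z$ is without boundary and $f,g$ are transverse, then $$\partial(X\times_{f,Z,g}Y)\cong(\partial X\times_{f\circ i_X,Z,g}Y)\amalg(-1)^{\dim X+\dim Z}(X\times_{f,Z,g\circ i_Y}\partial Y).$$ (c) If $f$ is a submersion, or if $f,g$ are transverse and $f$ is b-submersive, then $$\partial(X\times_{f,Z,g}Y)\cong(\partial_+^fX\times_{f_+,Z,g}Y)\amalg(-1)^{\dim X+\dim Z}(X\times_{f,Z,g\circ i_Y}\partial Y).$$ (d) If $f,g$ are both submersions, or if $f,g$ are transverse and both b-submersive, then $$\partial(X\times_{f,Z,g}Y)\cong(\partial_+^fX\times_{f_+,Z,g}Y)\amalg(-1)^{\dim X+\dim Z}(X\times_{f,Z,g_+}\partial_+^gY)\amalg(\partial_-^fX\times_{f_-,\partial Z,g_-}\partial_-^gY).$$ -/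

import Mathlib

open Set Topology
open scoped ContDiff

universe u v w

noncomputable section

namespace Corners

/-! ### Smooth maps between subsets of Euclidean spaces, charts, manifolds with corners -/

/-- The model space `[0,∞)^k × ℝ^(n-k)` inside `ℝ^n`. -/
def quadrant (n k : ℕ) : Set (Fin n → ℝ) := {a | ∀ i : Fin n, (i : ℕ) < k → 0 ≤ a i}

/-- A partial map, given by its graph `R`, is smooth if near each point of its domain it is the
restriction of a smooth map defined on an open set of the ambient vector space. -/
def SmoothGraph {E F : Type*} [NormedAddCommGroup E] [NormedSpace ℝ E]
    [NormedAddCommGroup F] [NormedSpace ℝ F] (R : E → F → Prop) : Prop :=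
  ∀ a b, R a b → ∃ O : Set E, IsOpen O ∧ a ∈ O ∧ ∃ G : E → F, ContDiffOn ℝ ∞ G O ∧
    ∀ a' ∈ O, ∀ b', R a' b' → b' = G a'

/-- `α` is smooth on the subset `A`: it extends to a smooth map on an open neighbourhood of `A`.
(The extensions are asked for near each point of `A`; a partition of unity patches them together
to one extension.) -/
def SmoothOn {E F : Type*} [NormedAddCommGroup E] [NormedSpace ℝ E]
    [NormedAddCommGroup F] [NormedSpace ℝ F] (α : E → F) (A : Set E) : Prop :=
  SmoothGraph fun a b => a ∈ A ∧ α a = b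

/-- An `n`-dimensional chart with corners `(U, φ)` on `X`: `U = source` is open in
`[0,∞)^k × ℝ^(n-k)` and `φ = toFun` is a homeomorphism from `U` onto a nonempty open subset
`target` of `X`. -/
structure CornerChart (n : ℕ) (X : Type u) [TopologicalSpace X] extends
    PartialEquiv (Fin n → ℝ) X where
  k : ℕ
  k_le : k ≤ n
  source_nonempty : source.Nonempty
  source_open : ∃ O : Set (Fin n → ℝ), IsOpen O ∧ source = O ∩ quadrant n k
  target_open : IsOpen target
  continuousOn_toFun : ContinuousOn toFun source
  continuousOn_invFun : ContinuousOn invFun target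

/-- Two charts are compatible if both transition maps are smooth. -/
def Compatible {m n : ℕ} {X : Type u} [TopologicalSpace X]
    (c : CornerChart m X) (d : CornerChart n X) : Prop :=
  SmoothOn (d.invFun ∘ c.toFun) (c.source ∩ c.toFun ⁻¹' d.target) ∧
  SmoothOn (c.invFun ∘ d.toFun) (d.source ∩ d.toFun ⁻¹' c.target)

/-- A topological space with a dimension and a collection of charts with corners; it is a manifold
with corners when `CSpace.IsManifold` holds. The dimension is an integer so that
`dim X - 1` and `dim X + dim Y - dim Z` make sense; only the empty space can be a manifold of
negative dimension. -/
structure CSpace : Type (u + 1) where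
  carrier : Type u
  [top : TopologicalSpace carrier]
  dim : ℤ
  charts : ∀ n : ℕ, Set (CornerChart n carrier)

attribute [instance] CSpace.top

instance : CoeSort CSpace.{u} (Type u) := ⟨CSpace.carrier⟩

/-- `X` is a manifold with corners of dimension `X.dim`: a paracompact Hausdorff space with a
maximal atlas of charts with corners. -/
structure CSpace.IsManifold (X : CSpace.{u}) : Prop where
  t2 : T2Space X
  paracompact : ParacompactSpace X
  dim_eq : ∀ n, ∀ c ∈ X.charts n, (n : ℤ) = X.dim
  cover : ∀ x : X, ∃ n, ∃ c ∈ X.charts n, x ∈ c.target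
  compatible : ∀ n, ∀ c ∈ X.charts n, ∀ d ∈ X.charts n, Compatible c d
  maximal : ∀ n, ∀ d : CornerChart n X, (n : ℤ) = X.dim →
    (∀ c ∈ X.charts n, Compatible c d) → d ∈ X.charts n

/-- `X` is a manifold without boundary: it has an atlas of charts with domains open in `ℝ^n`. -/
def CSpace.WithoutBoundary (X : CSpace.{u}) : Prop :=
  ∀ x : X, ∃ n, ∃ c ∈ X.charts n, c.k = 0 ∧ x ∈ c.target

/-- The stratum `S^j(X)` of points of depth `j`. -/
def CSpace.stratum (X : CSpace.{u}) (j : ℕ) : Set X :=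
  {x | ∃ n, ∃ c ∈ X.charts n, x ∈ c.target ∧
    {i : Fin n | (i : ℕ) < c.k ∧ c.invFun x i = 0}.ncard = j}

/-- A nonempty open subset `U` of some `[0,∞)^k × ℝ^(n-k)`, as an `n`-manifold with corners:
the charts are those compatible with the inclusion `U → ℝ^n`. -/
abbrev CSpace.domain (n : ℕ) (U : Set (Fin n → ℝ)) : CSpace.{0} where
  carrier := U
  dim := n
  charts m := {e | m = n ∧ SmoothOn (fun a => (e.toFun a : Fin n → ℝ)) e.source ∧
    SmoothGraph fun (b : Fin n → ℝ) (a : Fin m → ℝ) =>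
      ∃ h : b ∈ U, (⟨b, h⟩ : U) ∈ e.target ∧ e.invFun ⟨b, h⟩ = a}

/-- An open subset `S` of `X`, with the charts of `X` whose image lies in `S`. -/
abbrev CSpace.restrict (X : CSpace.{u}) (S : Set X) : CSpace.{u} where
  carrier := S
  dim := X.dim
  charts n := {d | ∃ c ∈ X.charts n, c.source = d.source ∧
    ∀ a ∈ d.source, c.toFun a = (d.toFun a : X)}

/-- The disjoint union of two manifolds with corners of the same dimension: its charts are those
compatible with all charts of the two pieces. -/
abbrev CSpace.sum (A : CSpace.{u}) (B : CSpace.{v}) : CSpace.{max u v} where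
  carrier := A ⊕ B
  dim := A.dim
  charts n := {d | (n : ℤ) = A.dim ∧
    (∀ c ∈ A.charts n,
      SmoothGraph (fun s t : Fin n → ℝ =>
        s ∈ d.source ∧ t ∈ c.source ∧ d.toFun s = Sum.inl (c.toFun t)) ∧
      SmoothGraph (fun t s : Fin n → ℝ =>
        s ∈ d.source ∧ t ∈ c.source ∧ d.toFun s = Sum.inl (c.toFun t))) ∧
    (∀ c ∈ B.charts n,
      SmoothGraph (fun s t : Fin n → ℝ =>
        s ∈ d.source ∧ t ∈ c.source ∧ d.toFun s = Sum.inr (c.toFun t)) ∧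
      SmoothGraph (fun t s : Fin n → ℝ =>
        s ∈ d.source ∧ t ∈ c.source ∧ d.toFun s = Sum.inr (c.toFun t)))}

/-! ### The boundary -/

/-- A local boundary component `β` of `X` at `x`: a choice, for each open neighbourhood `V` of `x`,
of a connected component of `V ∩ S¹(X)` with `x` in its closure, any two choices being compatible
near `x`. (A choice for all sufficiently small `V` extends uniquely to all `V`.) -/
structure LocalBoundaryComponent (X : CSpace.{u}) (x : X) where
  comp : TopologicalSpace.OpenNhdsOf x → Set X
  isComponent : ∀ V : TopologicalSpace.OpenNhdsOf x, ∃ p ∈ (V : Set X) ∩ X.stratum 1,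
    comp V = connectedComponentIn ((V : Set X) ∩ X.stratum 1) p
  mem_closure : ∀ V, x ∈ closure (comp V)
  compat : ∀ V V', x ∈ closure (comp V ∩ comp V')

/-- The points `(x, β)` of the boundary `∂X`. -/
structure BoundaryPt (X : CSpace.{u}) where
  pt : X
  comp : LocalBoundaryComponent X pt

/-- The topology of `∂X`: basic open sets are the sets of all `(x, β)` with `x ∈ V` and `β` given
over `V` by the component `W`, for `V` open in `X`. -/
instance (X : CSpace.{u}) : TopologicalSpace (BoundaryPt X) :=
  TopologicalSpace.generateFrom
    {N | ∃ (V : TopologicalSpace.Opens X) (W : Set X),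
      N = {p : BoundaryPt X | ∃ h : p.pt ∈ V, p.comp.comp ⟨V, h⟩ = W}}

/-- In the chart `c` around `x`, the local boundary component `β` of `p = (x, β)` is the one of the
face `x_i = 0`. -/
def IsFace {X : CSpace.{u}} {n : ℕ} (c : CornerChart n X) (i : Fin n) (p : BoundaryPt X) : Prop :=
  p.pt ∈ c.target ∧ (i : ℕ) < c.k ∧ c.invFun p.pt i = 0 ∧
  ∀ V, p.pt ∈ closure (p.comp.comp V ∩
    c.toFun '' {a ∈ c.source | a i = 0 ∧ ∀ j : Fin n, j ≠ i → (j : ℕ) < c.k → a j ≠ 0})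

/-- `p = φ_i(a)`, for the chart `(U_i, φ_i)` of `∂X` induced by a chart `c = (U, φ)` of `X`:
`U_i` is the face `x_i = 0` of `U`, with the coordinate `x_i` omitted. -/
def FaceChart {X : CSpace.{u}} {n : ℕ} (c : CornerChart (n + 1) X) (i : Fin (n + 1))
    (a : Fin n → ℝ) (p : BoundaryPt X) : Prop :=
  i.insertNth (α := fun _ => ℝ) 0 a ∈ c.source ∧
  p.pt = c.toFun (i.insertNth (α := fun _ => ℝ) 0 a) ∧ IsFace c i p

/-- The boundary `∂X`, with the maximal atlas of the charts compatible with all `(U_i, φ_i)`. -/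
abbrev CSpace.boundary (X : CSpace.{u}) : CSpace.{u} where
  carrier := BoundaryPt X
  dim := X.dim - 1
  charts n := {d | (n : ℤ) = X.dim - 1 ∧ ∀ c ∈ X.charts (n + 1), ∀ i : Fin (n + 1),
    (i : ℕ) < c.k →
      SmoothGraph (fun s t : Fin n → ℝ => s ∈ d.source ∧ FaceChart c i t (d.toFun s)) ∧
      SmoothGraph (fun t s : Fin n → ℝ => s ∈ d.source ∧ FaceChart c i t (d.toFun s))}

/-- The map `i_X : ∂X → X`. -/
def CSpace.incl (X : CSpace.{u}) : X.boundary → X := fun p => p.pt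

/-! ### Smooth maps -/

/-- The pair `(V, b)` is a boundary defining function for `X` at `p = (x, β)`; only the values of
`b` on `V` matter. -/
structure IsBDF (X : CSpace.{u}) (V : Set X) (b : X → ℝ) (p : BoundaryPt X) : Prop where
  isOpen : IsOpen V
  mem : p.pt ∈ V
  nonneg : ∀ x ∈ V, 0 ≤ b x
  smooth : ∀ n, ∀ c ∈ X.charts n, SmoothOn (b ∘ c.toFun) (c.source ∩ c.toFun ⁻¹' V)
  deriv_ne_zero : ∃ n, ∃ c ∈ X.charts n, p.pt ∈ c.target ∧
    fderivWithin ℝ (b ∘ c.toFun) c.source (c.invFun p.pt) ≠ 0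
  exists_nhd : ∃ T : Set (BoundaryPt X), IsOpen T ∧ p ∈ T ∧ (∀ q ∈ T, q.pt ∈ V ∧ b q.pt = 0) ∧
    IsEmbedding (fun q : T => q.1.pt) ∧
    ∃ O : Set X, IsOpen O ∧ BoundaryPt.pt '' T = O ∩ {x ∈ V | b x = 0}

/-- Weakly smooth maps: continuous, and smooth in all charts. -/
def WeaklySmooth (X : CSpace.{u}) (Y : CSpace.{v}) (f : X → Y) : Prop :=
  Continuous f ∧ ∀ m, ∀ c ∈ X.charts m, ∀ n, ∀ d ∈ Y.charts n,
    SmoothOn (d.invFun ∘ f ∘ c.toFun) (c.source ∩ (f ∘ c.toFun) ⁻¹' d.target)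

/-- Smooth maps of manifolds with corners: weakly smooth maps that pull back each boundary defining
function `b` either to zero locally, or to a boundary defining function at a unique local boundary
component. -/
def Smooth (X : CSpace.{u}) (Y : CSpace.{v}) (f : X → Y) : Prop :=
  WeaklySmooth X Y f ∧
  ∀ x : X, ∀ β : LocalBoundaryComponent Y (f x), ∀ (V : Set Y) (b : Y → ℝ),
    IsBDF Y V b ⟨f x, β⟩ →
    (∀ᶠ x' in 𝓝 x, b (f x') = 0) ∨
    ∃! β' : LocalBoundaryComponent X x, IsBDF X (f ⁻¹' V) (b ∘ f) ⟨x, β'⟩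

/-- The differential of `f` at `x`, in a chart `c` around `x` and a chart `d` around `f x`, which
identify the tangent spaces with `ℝ^m` and `ℝ^n`. -/
def chartDeriv {m n : ℕ} {A : Type u} {B : Type v} [TopologicalSpace A] [TopologicalSpace B]
    (f : A → B) (c : CornerChart m A) (d : CornerChart n B) (x : A) :
    (Fin m → ℝ) →L[ℝ] (Fin n → ℝ) :=
  fderivWithin ℝ (d.invFun ∘ f ∘ c.toFun) c.source (c.invFun x)

/-- The tangent space at `x` of the stratum containing `x`, in a chart `c` around `x`. -/
def CornerChart.stratumTangent {n : ℕ} {A : Type u} [TopologicalSpace A] (c : CornerChart n A)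
    (x : A) : Submodule ℝ (Fin n → ℝ) where
  carrier := {t | ∀ i : Fin n, (i : ℕ) < c.k → c.invFun x i = 0 → t i = 0}
  add_mem' h h' i hi hx := by simp [h i hi hx, h' i hi hx]
  zero_mem' i _ _ := rfl
  smul_mem' r t h i hi hx := by simp [h i hi hx]

/-- Submersions: smooth maps whose differential is surjective on tangent spaces and on the tangent
spaces of the strata. -/
def IsSubmersion (X : CSpace.{u}) (Y : CSpace.{v}) (f : X → Y) : Prop :=
  Smooth X Y f ∧ ∀ x : X, ∀ m, ∀ c ∈ X.charts m, ∀ n, ∀ d ∈ Y.charts n,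
    x ∈ c.target → f x ∈ d.target →
    LinearMap.range (chartDeriv f c d x).toLinearMap = ⊤ ∧
    (c.stratumTangent x).map (chartDeriv f c d x).toLinearMap = d.stratumTangent (f x)

/-- b-submersive maps: smooth maps for which the map induced by the differential, from the tangent
space modulo the tangent space of the stratum at `x` to the same quotient at `f x`, is
surjective. -/
def IsBSubmersive (X : CSpace.{u}) (Y : CSpace.{v}) (f : X → Y) : Prop :=
  Smooth X Y f ∧ ∀ x : X, ∀ m, ∀ c ∈ X.charts m, ∀ n, ∀ d ∈ Y.charts n,
    x ∈ c.target → f x ∈ d.target →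
    LinearMap.range (chartDeriv f c d x).toLinearMap ⊔ d.stratumTangent (f x) = ⊤

/-- `f : X → Z` and `g : Y → Z` are transverse smooth maps. -/
def AreTransverse (X : CSpace.{u}) (Y : CSpace.{v}) (Z : CSpace.{w}) (f : X → Z) (g : Y → Z) :
    Prop :=
  Smooth X Z f ∧ Smooth Y Z g ∧
  ∀ (x : X) (y : Y), f x = g y →
    ∀ m, ∀ c ∈ X.charts m, ∀ n, ∀ d ∈ Y.charts n, ∀ l, ∀ e ∈ Z.charts l,
    x ∈ c.target → y ∈ d.target → f x ∈ e.target →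
    LinearMap.range (chartDeriv f c e x).toLinearMap ⊔
      LinearMap.range (chartDeriv g d e y).toLinearMap = ⊤ ∧
    (c.stratumTangent x).map (chartDeriv f c e x).toLinearMap ⊔
      (d.stratumTangent y).map (chartDeriv g d e y).toLinearMap = e.stratumTangent (f x)

/-- The fibre product `X ×_{f,Z,g} Y`: the subspace `f x = g y` of `X × Y`, with all charts `(U, φ)`
of dimension `dim X + dim Y - dim Z` such that the two projections composed with `φ` are smooth maps
from `U` to `X` and `Y`, with jointly injective differentials. -/
abbrev CSpace.fibre (X : CSpace.{u}) (Y : CSpace.{v}) (Z : CSpace.{w}) (f : X → Z) (g : Y → Z) :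
    CSpace.{max u v} where
  carrier := {p : X × Y // f p.1 = g p.2}
  dim := X.dim + Y.dim - Z.dim
  charts n := {φ | (n : ℤ) = X.dim + Y.dim - Z.dim ∧
    Smooth (CSpace.domain n φ.source) X (fun a => (φ.toFun a.1).1.1) ∧
    Smooth (CSpace.domain n φ.source) Y (fun a => (φ.toFun a.1).1.2) ∧
    ∀ q ∈ φ.target, ∀ m, ∀ c ∈ X.charts m, ∀ l, ∀ d ∈ Y.charts l,
      q.1.1 ∈ c.target → q.1.2 ∈ d.target →
      ∀ t, chartDeriv (fun r : {p : X × Y // f p.1 = g p.2} => r.1.1) φ c q t = 0 →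
        chartDeriv (fun r : {p : X × Y // f p.1 = g p.2} => r.1.2) φ d q t = 0 → t = 0}

/-! ### The decomposition of `∂X` given by a smooth map -/

/-- For `p = (x, β')` in `∂X` and `q = (y, β)` in `∂Y`: the point `(x, q)` of `X ×_Y ∂Y` lies in
`Ξ_-^f`, and `ξ_-^f (x, q) = p`. -/
def XiMinus (X : CSpace.{u}) (Y : CSpace.{v}) (f : X → Y) (p : BoundaryPt X) (q : BoundaryPt Y) :
    Prop :=
  f p.pt = q.pt ∧ ∃ (V : Set Y) (b : Y → ℝ), IsBDF Y V b q ∧ IsBDF X (f ⁻¹' V) (b ∘ f) p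

/-- `∂_-^f X`, the image of `ξ_-^f`. -/
abbrev bdMinus (X : CSpace.{u}) (Y : CSpace.{v}) (f : X → Y) : CSpace.{u} :=
  X.boundary.restrict {p : X.boundary | ∃ q : BoundaryPt Y, XiMinus X Y f p q}

/-- `∂_+^f X`, the complement of `∂_-^f X` in `∂X`. -/
abbrev bdPlus (X : CSpace.{u}) (Y : CSpace.{v}) (f : X → Y) : CSpace.{u} :=
  X.boundary.restrict {p : X.boundary | ¬ ∃ q : BoundaryPt Y, XiMinus X Y f p q}

/-- `f_- : ∂_-^f X → ∂Y`, the inverse of the (injective, if `f` is b-submersive) map `ξ_-^f`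
followed by the projection to `∂Y`. -/
def fMinus (X : CSpace.{u}) (Y : CSpace.{v}) (f : X → Y) : bdMinus X Y f → Y.boundary :=
  fun p => p.2.choose

/-- `f_+ : ∂_+^f X → Y`, the restriction of `f ∘ i_X`. -/
def fPlus (X : CSpace.{u}) (Y : CSpace.{v}) (f : X → Y) : bdPlus X Y f → Y :=
  fun p => f p.1.pt

/-! ### Orientations -/

/-- For each chart and each point of the chart, a sign: whether the coordinate frame of the chart at
this point is an oriented (`1`) or an anti-oriented (`-1`) basis of the tangent space. -/
abbrev SignData (X : CSpace.{u}) : Type u := ∀ n : ℕ, CornerChart n X → X → ℤˣ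

/-- The sign data form an orientation of `X`: in each chart they are locally constant, and two
charts are related by the sign of the Jacobian determinant. -/
structure IsOrientation (X : CSpace.{u}) (o : SignData X) : Prop where
  locallyConstant : ∀ n, ∀ c ∈ X.charts n, ∀ x ∈ c.target, ∀ᶠ x' in 𝓝 x, o n c x' = o n c x
  transition : ∀ n, ∀ c ∈ X.charts n, ∀ d ∈ X.charts n, ∀ x ∈ c.target, x ∈ d.target →
    0 < ((o n c x * o n d x : ℤˣ) : ℝ) * (chartDeriv (id : X → X) c d x).det

/-- `(X, o)` is an oriented manifold with corners. -/
structure IsOrientedManifold (X : CSpace.{u}) (o : SignData X) : Prop where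
  isManifold : X.IsManifold
  isOrientation : IsOrientation X o

/-- `s X` for a sign `s`: if `s = -1` the orientation is replaced by the opposite one. -/
def signed {X : CSpace.{u}} (s : ℤˣ) (o : SignData X) : SignData X := fun n c x => s * o n c x

/-- The orientation of an open subset of an oriented manifold. -/
def restrictOr {X : CSpace.{u}} (o : SignData X) (S : Set X) : SignData (X.restrict S) :=
  open Classical in fun n d x =>
    if ∃ c ∈ X.charts n, c.source = d.source ∧ (∀ a ∈ d.source, c.toFun a = (d.toFun a : X)) ∧
      o n c x.1 = 1 then 1 else -1

/-- The orientation of a disjoint union of oriented manifolds. -/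
def sumOr {A : CSpace.{u}} {B : CSpace.{v}} (oA : SignData A) (oB : SignData B) :
    SignData (A.sum B) :=
  open Classical in fun n d x =>
    if (∃ a, x = Sum.inl a ∧ ∃ c ∈ A.charts n, a ∈ c.target ∧
          0 < (oA n c a : ℝ) * (chartDeriv (Sum.inl : A → A ⊕ B) c d a).det) ∨
       (∃ b, x = Sum.inr b ∧ ∃ c ∈ B.charts n, b ∈ c.target ∧
          0 < (oB n c b : ℝ) * (chartDeriv (Sum.inr : B → A ⊕ B) c d b).det)
    then 1 else -1

/-- The orientation of `∂X`: a frame `(e₁, …, e_n)` of `T(∂X)` is oriented if `(ν, e₁, …, e_n)` is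
an oriented frame of `TX`, where `ν` is an outward-pointing vector. -/
def boundaryOr {X : CSpace.{u}} (o : SignData X) : SignData X.boundary :=
  open Classical in fun n d p =>
    if ∃ c ∈ X.charts (n + 1), ∃ i : Fin (n + 1), IsFace c i p ∧
      ∃ ν : Fin (n + 1) → ℝ, ν i < 0 ∧
        0 < (o (n + 1) c p.pt : ℝ) *
          (Matrix.of (Matrix.vecCons ν
            fun j => chartDeriv X.incl d c p (Pi.single j 1))).det
    then 1 else -1

/-- The orientation of `W = X ×_{f,Z,g} Y`: for a splitting `s` of the exact sequence
`0 → TW → TX ⊕ TY → TZ → 0`, with maps `dπ_X ⊕ dπ_Y` and `df - dg`, the isomorphism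
`TW ⊕ TZ ≅ TX ⊕ TY` changes the direct sum orientations by the factor `(-1)^(dim Y dim Z)`. -/
def fibreOr {X : CSpace.{u}} {Y : CSpace.{v}} {Z : CSpace.{w}} (oX : SignData X) (oY : SignData Y)
    (oZ : SignData Z) (f : X → Z) (g : Y → Z) : SignData (X.fibre Y Z f g) :=
  open Classical in fun n φ q =>
    if ∃ m, ∃ c ∈ X.charts m, ∃ l, ∃ d ∈ Y.charts l, ∃ r, ∃ e ∈ Z.charts r,
      q.1.1 ∈ c.target ∧ q.1.2 ∈ d.target ∧ f q.1.1 ∈ e.target ∧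
      ∃ h : m + l = n + r, ∃ s : (Fin r → ℝ) →ₗ[ℝ] (Fin m → ℝ) × (Fin l → ℝ),
        (∀ t, chartDeriv f c e q.1.1 (s t).1 - chartDeriv g d e q.1.2 (s t).2 = t) ∧
        0 < ((Int.negOnePow (Y.dim * Z.dim) *
              oX m c q.1.1 * oY l d q.1.2 * oZ r e (f q.1.1) : ℤˣ) : ℝ) *
          (Matrix.of fun i : Fin (m + l) =>
            Fin.append
              (fun j : Fin n => Fin.append
                (chartDeriv (fun a : {p : X × Y // f p.1 = g p.2} => a.1.1) φ c q
                  (Pi.single j 1))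
                (chartDeriv (fun a : {p : X × Y // f p.1 = g p.2} => a.1.2) φ d q
                  (Pi.single j 1)))
              (fun j : Fin r => Fin.append (s (Pi.single j 1)).1 (s (Pi.single j 1)).2)
              (Fin.cast h i)).det
    then 1 else -1

/-- `Φ : A → B` is an isomorphism of oriented manifolds with corners `(A, oA) ≅ (B, oB)`:
a diffeomorphism (smooth with smooth inverse) that preserves orientations. -/
structure IsOrientedDiffeo (A : CSpace.{u}) (B : CSpace.{v}) (oA : SignData A) (oB : SignData B)
    (Φ : A → B) : Prop where
  source : IsOrientedManifold A oA
  target : IsOrientedManifold B oB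
  smooth : Smooth A B Φ
  smooth_inverse : ∃ Ψ : B → A, Smooth B A Ψ ∧ Function.LeftInverse Ψ Φ ∧
    Function.RightInverse Ψ Φ
  orientation : ∀ n, ∀ c ∈ A.charts n, ∀ d ∈ B.charts n, ∀ a ∈ c.target, Φ a ∈ d.target →
    0 < ((oA n c a * oB n d (Φ a) : ℤˣ) : ℝ) * (chartDeriv Φ c d a).det

end Corners

end

open Corners

universe u' v' w'

noncomputable section

namespace Corners

open Filter Function
open LinearMap (det det_id det_comp det_toMatrix det_toMatrix' det_prodMap det_conj)

local notation:max "ℝ^" n:max => (Fin n → ℝ)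
local notation "𝒞" => CornerChart
local notation "𝒟" => chartDeriv

variable {A : Type u} {B : Type v} {C : Type w} [TopologicalSpace A] [TopologicalSpace B]
  [TopologicalSpace C]
variable {E F : Type*} [NormedAddCommGroup E] [NormedSpace ℝ E]
  [NormedAddCommGroup F] [NormedSpace ℝ F]

/-! ### Quadrants -/

section
variable {G : E → F} {a : E}

lemma convex_quadrant (n k : ℕ) : Convex ℝ (quadrant n k) := by
  intro x hx y hy a b ha hb _ i hi
  simpa using add_nonneg (mul_nonneg ha (hx i hi)) (mul_nonneg hb (hy i hi))

lemma interior_quadrant_nonempty (n k : ℕ) : (interior (quadrant n k)).Nonempty := by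
  refine ⟨fun _ => 1, ?_⟩
  rw [mem_interior_iff_mem_nhds]
  have : ∀ᶠ a : Fin n → ℝ in 𝓝 (fun _ => 1), ∀ i, 0 < a i := by
    rw [eventually_all]
    intro i
    exact (continuous_apply i).continuousAt.eventually_const_lt (by norm_num)
  filter_upwards [this] with a ha i _ using (ha i).le

lemma isClosed_quadrant (n k : ℕ) : IsClosed (quadrant n k) := by
  have : quadrant n k = ⋂ i : Fin n, ⋂ _ : (i : ℕ) < k, {a | 0 ≤ a i} := by ext a; simp [quadrant]
  rw [this]
  exact isClosed_iInter fun i => isClosed_iInter fun _ =>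
    isClosed_le continuous_const (continuous_apply i)

namespace CornerChart

variable {n m : ℕ} (c : 𝒞 n A) {x : A}

variable {a : ℝ^n} {P : A → Prop} {t : ℝ^n}

lemma toInv (hx : x ∈ c.target) : c.toFun (c.invFun x) = x := c.right_inv' hx

lemma invTo (ha : a ∈ c.source) : c.invFun (c.toFun a) = a := c.left_inv' ha

lemma mapT (hx : x ∈ c.target) : c.invFun x ∈ c.source := c.map_target' hx

lemma mapS (ha : a ∈ c.source) : c.toFun a ∈ c.target := c.map_source' ha

lemma source_subset_quadrant : c.source ⊆ quadrant n c.k := by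
  obtain ⟨O, _, h⟩ := c.source_open
  rw [h]; exact inter_subset_right

lemma nhdsWithin_source (ha : a ∈ c.source) :
    𝓝[c.source] a = 𝓝[quadrant n c.k] a := by
  obtain ⟨O, hO, h⟩ := c.source_open
  rw [h, Set.inter_comm]
  exact nhdsWithin_inter_of_mem' (mem_nhdsWithin_of_mem_nhds (hO.mem_nhds (by rw [h] at ha; exact
      ha.1)))

lemma uniqueDiffWithinAt (ha : a ∈ c.source) :
    UniqueDiffWithinAt ℝ c.source a := by
  have : UniqueDiffWithinAt ℝ (quadrant n c.k) a :=
    uniqueDiffOn_convex (convex_quadrant _ _) (interior_quadrant_nonempty _ _) _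
      (c.source_subset_quadrant ha)
  exact this.mono_nhds (c.nhdsWithin_source ha).ge

lemma nonneg (hx : x ∈ c.target) {i : Fin n} (hi : (i : ℕ) < c.k) : 0 ≤ c.invFun x i :=
  c.source_subset_quadrant (c.mapT hx) i hi

lemma target_mem_nhds (hx : x ∈ c.target) : c.target ∈ 𝓝 x := c.target_open.mem_nhds hx

lemma eventually_target (hx : x ∈ c.target) : ∀ᶠ x' in 𝓝 x, x' ∈ c.target :=
  c.target_mem_nhds hx

lemma continuousAt_invFun (hx : x ∈ c.target) : ContinuousAt c.invFun x :=
  c.continuousOn_invFun.continuousAt (c.target_mem_nhds hx)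

lemma continuousAt_coord (hx : x ∈ c.target) (i : Fin n) :
    ContinuousAt (fun y => c.invFun y i) x :=
  (continuous_apply i).continuousAt.comp (c.continuousAt_invFun hx)

lemma tendsto_toFun (hx : x ∈ c.target) :
    Tendsto c.toFun (𝓝[c.source] (c.invFun x)) (𝓝 x) := by
  have := c.continuousOn_toFun _ (c.mapT hx)
  rw [ContinuousWithinAt] at this
  rwa [c.toInv hx] at this

lemma tendsto_invFun (hx : x ∈ c.target) :
    Tendsto c.invFun (𝓝 x) (𝓝[c.source] (c.invFun x)) :=
  tendsto_nhdsWithin_iff.2 ⟨c.continuousAt_invFun hx,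
    (c.eventually_target hx).mono fun _ h => c.mapT h⟩

lemma eventually_iff (hx : x ∈ c.target) :
    (∀ᶠ y in 𝓝 x, P y) ↔ ∀ᶠ a in 𝓝[c.source] (c.invFun x), P (c.toFun a) := by
  refine ⟨fun h => (c.tendsto_toFun hx).eventually h, fun h => ?_⟩
  filter_upwards [(c.tendsto_invFun hx).eventually h, c.eventually_target hx] with y hy hy'
  rwa [c.toInv hy'] at hy

/-- The indices of the faces of the chart through a point. -/
def act (x : A) : Set (Fin n) := {i | (i : ℕ) < c.k ∧ c.invFun x i = 0}

lemma eventually_act_subset (hx : x ∈ c.target) : ∀ᶠ y in 𝓝 x, c.act y ⊆ c.act x := by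
  have : ∀ᶠ y in 𝓝 x, ∀ i : Fin n, i ∉ c.act x → i ∉ c.act y := by
    rw [eventually_all]
    intro i
    by_cases hi : i ∈ c.act x
    · simp [hi]
    by_cases hk : (i : ℕ) < c.k
    · filter_upwards [(c.continuousAt_coord hx i).eventually_ne (fun h => hi ⟨hk, h⟩)] with y hy _ h
          using hy h.2
    · exact .of_forall fun y _ h => hk h.1
  filter_upwards [this] with y hy i hi
  by_contra h
  exact hy i h hi

/-- Along a direction in the tangent cone one stays in the chart. -/
lemma eventually_ray (hx : x ∈ c.target) (ht : ∀ i ∈ c.act x, 0 ≤ t i) :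
    ∀ᶠ ε : ℝ in 𝓝[>] 0, c.invFun x + ε • t ∈ c.source := by
  have hlim : Tendsto (fun ε : ℝ => c.invFun x + ε • t) (𝓝[>] 0) (𝓝 (c.invFun x)) := by
    have : Continuous fun ε : ℝ => c.invFun x + ε • t := by fun_prop
    have h := this.tendsto 0
    simp only [zero_smul, add_zero] at h
    exact h.mono_left nhdsWithin_le_nhds
  have hq : ∀ᶠ ε : ℝ in 𝓝[>] 0, c.invFun x + ε • t ∈ quadrant n c.k := by
    have : ∀ᶠ ε : ℝ in 𝓝[>] 0, ∀ i : Fin n, (i : ℕ) < c.k → 0 ≤ (c.invFun x + ε • t) i := by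
      rw [eventually_all]
      intro i
      by_cases hi : i ∈ c.act x
      · filter_upwards [self_mem_nhdsWithin] with ε hε _
        have := mul_nonneg (le_of_lt hε) (ht i hi)
        rw [Pi.add_apply, hi.2, zero_add]
        exact this
      by_cases hk : (i : ℕ) < c.k
      · have := ((continuous_apply i).tendsto _).comp hlim
        filter_upwards [this.eventually_const_lt (lt_of_le_of_ne (c.nonneg hx hk) fun h => hi ⟨hk,
            h.symm⟩)] with ε hε _ using le_of_lt hε
      · exact .of_forall fun y h => absurd h hk
    exact this
  have : ∀ᶠ ε : ℝ in 𝓝[>] 0, c.invFun x + ε • t ∈ quadrant n c.k →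
      c.invFun x + ε • t ∈ c.source := by
    have h1 : ∀ᶠ a in 𝓝[quadrant n c.k] (c.invFun x), a ∈ c.source := by
      rw [← c.nhdsWithin_source (c.mapT hx)]; exact self_mem_nhdsWithin
    rw [eventually_nhdsWithin_iff] at h1
    exact hlim.eventually h1
  filter_upwards [hq, this] with ε h1 h2 using h2 h1

lemma eventually_ray' (hx : x ∈ c.target) (ht : ∀ i ∈ c.act x, 0 ≤ t i) (hP : ∀ᶠ y in 𝓝 x, P y) :
    ∀ᶠ ε : ℝ in 𝓝[>] 0, c.toFun (c.invFun x + ε • t) ∈ c.target ∧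
      P (c.toFun (c.invFun x + ε • t)) ∧
      c.invFun (c.toFun (c.invFun x + ε • t)) = c.invFun x + ε • t := by
  have hlim : Tendsto (fun ε : ℝ => c.invFun x + ε • t) (𝓝[>] 0)
      (𝓝[c.source] (c.invFun x)) := by
    refine tendsto_nhdsWithin_iff.2 ⟨?_, c.eventually_ray hx ht⟩
    have : Continuous fun ε : ℝ => c.invFun x + ε • t := by fun_prop
    have h := this.tendsto 0
    simp only [zero_smul, add_zero] at h
    exact h.mono_left nhdsWithin_le_nhds
  filter_upwards [c.eventually_ray hx ht, hlim.eventually ((c.eventually_iff hx).1 hP)]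
    with ε h1 h2 using ⟨c.mapS h1, h2, c.invTo h1⟩

end CornerChart

/-! ### Germs of smooth functions -/

/-- `G` is smooth near `a`. -/
def GermSmooth (G : E → F) (a : E) : Prop := ∀ᶠ a' in 𝓝 a, ContDiffAt ℝ ∞ G a'

lemma GermSmooth.at (h : GermSmooth G a) : ContDiffAt ℝ ∞ G a :=
  h.self_of_nhds

lemma GermSmooth.differentiableAt (h : GermSmooth G a) :
    DifferentiableAt ℝ G a := h.at.differentiableAt (by simp)

lemma GermSmooth.continuousAt (h : GermSmooth G a) :
    ContinuousAt G a := h.at.continuousAt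

lemma GermSmooth.eventually (h : GermSmooth G a) :
    ∀ᶠ a' in 𝓝 a, GermSmooth G a' := h.eventually_nhds

lemma GermSmooth.comp {E' : Type*} [NormedAddCommGroup E'] [NormedSpace ℝ E'] {H : F → E'} {b : F}
    (hH : GermSmooth H b) (hG : GermSmooth G a) (hb : G a = b) :
    GermSmooth (H ∘ G) a := by
  subst hb
  filter_upwards [hG, hG.continuousAt.eventually hH] with a' h1 h2 using h2.comp a' h1

lemma ContDiff.germSmooth (h : ContDiff ℝ ∞ G) (a : E) : GermSmooth G a :=
  .of_forall fun _ => h.contDiffAt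

lemma GermSmooth.continuousAt_fderiv (h : GermSmooth G a) :
    ContinuousAt (fderiv ℝ G) a :=
  (h.at.fderiv_right (m := 0) (by simp)).continuousAt

lemma GermSmooth.sub {H : E → F} (h : GermSmooth G a) (h' : GermSmooth H a) :
    GermSmooth (fun x => G x - H x) a := by
  filter_upwards [h, h'] with x h1 h2 using h1.sub h2

lemma GermSmooth.prodMk {F' : Type*} [NormedAddCommGroup F'] [NormedSpace ℝ F'] {H : E → F'}
    (h : GermSmooth G a) (h' : GermSmooth H a) :
    GermSmooth (fun x => (G x, H x)) a := by
  filter_upwards [h, h'] with x h1 h2 using h1.prodMk h2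

lemma germSmooth_pi {n : ℕ} {G : E → Fin n → ℝ} :
    GermSmooth G a ↔ ∀ j, GermSmooth (fun x => G x j) a := by
  simp only [GermSmooth, contDiffAt_pi, eventually_all]

/-- Smoothness of a partial map in terms of germs. -/
lemma smoothGraph_iff (R : E → F → Prop) : SmoothGraph R ↔
    ∀ a b, R a b → ∃ G : E → F, GermSmooth G a ∧ ∀ᶠ a' in 𝓝 a, ∀ b', R a' b' → b' = G a' := by
  refine forall₂_congr fun a b => imp_congr_right fun _ => ?_
  constructor
  · rintro ⟨O, hO, ha, G, hG, h⟩
    refine ⟨G, ?_, ?_⟩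
    · filter_upwards [hO.mem_nhds ha] with a' ha' using hG.contDiffAt (hO.mem_nhds ha')
    · filter_upwards [hO.mem_nhds ha] with a' ha' using h a' ha'
  · rintro ⟨G, hG, h⟩
    obtain ⟨O, hO, hOo, ha⟩ := eventually_nhds_iff.1 (hG.and h)
    exact ⟨O, hOo, ha, G, fun a' ha' => (hO a' ha').1.contDiffWithinAt,
      fun a' ha' => (hO a' ha').2⟩

lemma smoothOn_iff (α : E → F) (S : Set E) : SmoothOn α S ↔
    ∀ a ∈ S, ∃ G : E → F, GermSmooth G a ∧ ∀ᶠ a' in 𝓝[S] a, α a' = G a' := by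
  rw [SmoothOn, smoothGraph_iff]
  constructor
  · intro h a ha
    obtain ⟨G, hG, h2⟩ := h a _ ⟨ha, rfl⟩
    refine ⟨G, hG, ?_⟩
    rw [eventually_nhdsWithin_iff]
    filter_upwards [h2] with a' h3 h4 using h3 _ ⟨h4, rfl⟩
  · rintro h a b ⟨ha, rfl⟩
    obtain ⟨G, hG, h2⟩ := h a ha
    rw [eventually_nhdsWithin_iff] at h2
    refine ⟨G, hG, ?_⟩
    filter_upwards [h2] with a' h3
    rintro b' ⟨h4, rfl⟩
    exact h3 h4

end

/-! ### Local representatives of maps in charts -/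

/-- Near `x`, the map `b` is given in the chart `c` by the smooth map `G`, which may be defined on
points outside the chart. -/
structure RepF {n : ℕ} (b : A → F) (c : 𝒞 n A) (x : A) (G : ℝ^n → F) : Prop where
  mem : x ∈ c.target
  smooth : GermSmooth G (c.invFun x)
  eq : ∀ᶠ y in 𝓝 x, b y = G (c.invFun y)

/-- Near `x`, the map `f` is continuous and given in the charts `c`, `d` by the smooth map `G`. -/
structure Rep {m n : ℕ} (f : A → B) (c : 𝒞 m A) (d : 𝒞 n B) (x : A)
    (G : ℝ^m → ℝ^n) : Prop where
  repF : RepF (fun y => d.invFun (f y)) c x G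
  mem' : f x ∈ d.target
  cont : ContinuousAt f x

section
variable {m n l : ℕ} {c : 𝒞 m A} {d : 𝒞 n B} {e : 𝒞 l C} {x : A}

variable {b : A → F} {G : ℝ^m → F} {f : A → B} {H : ℝ^n → F} {g : B → C}

lemma RepF.apply (h : RepF b c x G) : b x = G (c.invFun x) :=
  h.eq.self_of_nhds

lemma RepF.eventually (h : RepF b c x G) :
    ∀ᶠ y in 𝓝 x, RepF b c y G := by
  filter_upwards [h.eq.eventually_nhds, c.eventually_target h.mem,
    (c.continuousAt_invFun h.mem).eventually h.smooth.eventually] with y h1 h2 h3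
  exact ⟨h2, h3, h1⟩

lemma RepF.congr {b' : A → F} (h : RepF b c x G) (e : b' =ᶠ[𝓝 x] b) :
    RepF b' c x G := ⟨h.mem, h.smooth, by filter_upwards [h.eq, e] with y h1 h2; rw [h2, h1]⟩

lemma RepF.fderivWithin_eq (h : RepF b c x G) :
    fderivWithin ℝ (b ∘ c.toFun) c.source (c.invFun x) = fderiv ℝ G (c.invFun x) := by
  have h1 : ∀ᶠ a in 𝓝[c.source] (c.invFun x), (b ∘ c.toFun) a = G a := by
    filter_upwards [(c.eventually_iff h.mem).1 h.eq, self_mem_nhdsWithin] with a h2 h3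
    rw [c.invTo h3] at h2
    exact h2
  rw [EventuallyEq.fderivWithin_eq h1 (by rw [comp_apply, c.toInv h.mem, h.apply])]
  exact h.smooth.differentiableAt.fderivWithin (c.uniqueDiffWithinAt (c.mapT h.mem))

lemma Rep.mem {G} (h : Rep f c d x G) : x ∈ c.target := h.repF.mem

lemma Rep.smooth {G} (h : Rep f c d x G) : GermSmooth G (c.invFun x) := h.repF.smooth

lemma Rep.eq {G} (h : Rep f c d x G) :
    ∀ᶠ y in 𝓝 x, d.invFun (f y) = G (c.invFun y) := h.repF.eq

lemma Rep.apply {G} (h : Rep f c d x G) : G (c.invFun x) = d.invFun (f x) :=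
  h.repF.apply.symm

lemma Rep.chartDeriv_eq {G} (h : Rep f c d x G) :
    𝒟 f c d x = fderiv ℝ G (c.invFun x) := h.repF.fderivWithin_eq

lemma RepF.comp {b : B → F} {G} (hb : RepF b d (f x) H) (h : Rep f c d x G)
    : RepF (b ∘ f) c x (H ∘ G) where
  mem := h.mem
  smooth := hb.smooth.comp h.smooth h.apply
  eq := by
    filter_upwards [h.cont.eventually hb.eq, h.eq] with y h1 h2
    rw [comp_apply, comp_apply, h1, h2]

lemma Rep.comp {H G} (hg : Rep g d e (f x) H) (h : Rep f c d x G) :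
    Rep (g ∘ f) c e x (H ∘ G) :=
  ⟨hg.repF.comp h, hg.mem', hg.cont.comp h.cont⟩

lemma Rep.congr {f' : A → B} {G} (h : Rep f c d x G) (e : f' =ᶠ[𝓝 x] f) : Rep f' c d x G :=
  ⟨h.repF.congr (e.fun_comp _), by rw [e.self_of_nhds]; exact h.mem', h.cont.congr e.symm⟩

lemma RepF.fderiv_comp {b : B → F} {G} (hb : RepF b d (f x) H) (h : Rep f c d x G)
    : fderiv ℝ (H ∘ G) (c.invFun x) =
      (fderiv ℝ H (d.invFun (f x))).comp (fderiv ℝ G (c.invFun x)) := by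
  have h2 := hb.smooth.differentiableAt
  rw [← h.apply] at h2 ⊢
  exact _root_.fderiv_comp _ h2 h.smooth.differentiableAt

lemma Rep.chartDeriv_comp {H G} (hg : Rep g d e (f x) H) (h : Rep f c d x G) :
    𝒟 (g ∘ f) c e x = (𝒟 g d e (f x)).comp (𝒟 f c d x) := by
  rw [(hg.comp h).chartDeriv_eq, hg.chartDeriv_eq, h.chartDeriv_eq, hg.repF.fderiv_comp h]

lemma rep_id (c : 𝒞 m A) (hx : x ∈ c.target) : Rep (id : A → A) c c x id :=
  ⟨⟨hx, ContDiff.germSmooth contDiff_id _, .of_forall fun _ => rfl⟩, hx,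
    continuousAt_id⟩

lemma chartDeriv_id (c : 𝒞 m A) (hx : x ∈ c.target) :
    𝒟 (id : A → A) c c x = ContinuousLinearMap.id ℝ _ := by
  rw [(rep_id c hx).chartDeriv_eq, fderiv_id]

lemma Rep.eventually {G} (h : Rep f c d x G) (hf : ∀ᶠ y in 𝓝 x, ContinuousAt f y) :
    ∀ᶠ y in 𝓝 x, Rep f c d y G := by
  filter_upwards [h.repF.eventually, hf, h.cont.eventually (d.eventually_target h.mem')]
    with y h1 h2 h3 using ⟨h1, h3, h2⟩

lemma Rep.coord {G} (h : Rep f c d x G) (j : Fin n) :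
    RepF (fun y => d.invFun (f y) j) c x (fun a => G a j) :=
  ⟨h.mem, (germSmooth_pi.1 h.smooth) j, h.eq.mono fun y hy => by rw [hy]⟩

lemma Rep.fderiv_coord {G} (h : Rep f c d x G) (j : Fin n) (t : ℝ^m) :
    fderiv ℝ (fun a => G a j) (c.invFun x) t = 𝒟 f c d x t j := by
  rw [h.chartDeriv_eq, fderiv_apply (h.smooth.differentiableAt) j]
  rfl

lemma repF_coord (c : 𝒞 m A) (hx : x ∈ c.target) (i : Fin m) :
    RepF (fun y => c.invFun y i) c x (fun a => a i) :=
  (rep_id c hx).coord i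

/-- Two charts are compatible iff the identity is smooth near each common point in both
directions. -/
lemma compatible_iff {d : 𝒞 n A} : Compatible c d ↔
    ∀ x ∈ c.target, x ∈ d.target → (∃ G, Rep (id : A → A) c d x G) ∧
      ∃ G, Rep (id : A → A) d c x G := by
  have key : ∀ {m n : ℕ} (c : 𝒞 m A) (d : 𝒞 n A),
      SmoothOn (d.invFun ∘ c.toFun) (c.source ∩ c.toFun ⁻¹' d.target) ↔
      ∀ x ∈ c.target, x ∈ d.target → ∃ G, Rep (id : A → A) c d x G := by
    intro m n c d
    rw [smoothOn_iff]
    constructor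
    · intro h x hc hd
      obtain ⟨G, hG, h2⟩ := h (c.invFun x)
        ⟨c.mapT hc, by rw [mem_preimage, c.toInv hc]; exact hd⟩
      refine ⟨G, ⟨hc, hG, ?_⟩, hd, continuousAt_id⟩
      rw [eventually_nhdsWithin_iff] at h2
      filter_upwards [(c.continuousAt_invFun hc).eventually h2, c.eventually_target hc,
        d.eventually_target hd] with y h3 h4 h5
      have := h3 ⟨c.mapT h4, by rw [mem_preimage, c.toInv h4]; exact h5⟩
      rw [comp_apply, c.toInv h4] at this
      exact this
    · rintro h a ⟨ha, hd⟩
      obtain ⟨G, hG⟩ := h _ (c.mapS ha) hd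
      have h1 := hG.smooth
      rw [c.invTo ha] at h1
      refine ⟨G, h1, ?_⟩
      have h2 := (c.eventually_iff (c.mapS ha)).1 hG.eq
      rw [c.invTo ha] at h2
      have h3 := h2.filter_mono (nhdsWithin_mono a (inter_subset_left (t := c.toFun ⁻¹' d.target)))
      filter_upwards [h3, self_mem_nhdsWithin] with a' h4 h5
      rw [c.invTo h5.1] at h4
      exact h4
  rw [Compatible, key, key]
  exact ⟨fun h x h1 h2 => ⟨h.1 x h1 h2, h.2 x h2 h1⟩,
    fun h => ⟨fun x h1 h2 => (h x h1 h2).1, fun x h1 h2 => (h x h2 h1).2⟩⟩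

lemma Compatible.symm {d : 𝒞 n A} (h : Compatible c d) :
    Compatible d c := ⟨h.2, h.1⟩

lemma Compatible.rep {d : 𝒞 n A} (h : Compatible c d) (hc : x ∈ c.target)
    (hd : x ∈ d.target) : ∃ G, Rep (id : A → A) c d x G :=
  (compatible_iff.1 h x hc hd).1

lemma compatible_self (c : 𝒞 m A) : Compatible c c :=
  compatible_iff.2 fun _ hx _ => ⟨⟨_, rep_id c hx⟩, ⟨_, rep_id c hx⟩⟩

lemma Compatible.chartDeriv_comp {d : 𝒞 n A} (h : Compatible c d) (hc : x ∈ c.target)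
    (hd : x ∈ d.target) :
    (𝒟 (id : A → A) d c x).comp (𝒟 (id : A → A) c d x)
      = ContinuousLinearMap.id ℝ _ := by
  obtain ⟨G, hG⟩ := h.rep hc hd
  obtain ⟨H, hH⟩ := h.symm.rep hd hc
  exact (Rep.chartDeriv_comp hH hG).symm.trans (chartDeriv_id c hc)

end

variable {A : Type u} {B : Type v} {C : Type w} [TopologicalSpace A] [TopologicalSpace B]
  [TopologicalSpace C]

/-! ### Derivatives along the tangent cone -/

section
variable {m n l : ℕ} {c : 𝒞 m A} {d : 𝒞 n B} {e : 𝒞 l C} {x : A}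

variable {b : A → ℝ} {G : ℝ^m → ℝ} {t : ℝ^m} {i : Fin m} {f : A → B} {j : Fin n}

lemma RepF.fderiv_unique {F : Type*} [NormedAddCommGroup F] [NormedSpace ℝ F] {b : A → F}
    {G H : ℝ^m → F} (h : RepF b c x G) (h' : RepF b c x H) :
    fderiv ℝ G (c.invFun x) = fderiv ℝ H (c.invFun x) := by
  rw [← h.fderivWithin_eq, h'.fderivWithin_eq]

lemma RepF.fderiv_nonneg (h : RepF b c x G) (h0 : b x = 0) (ht : ∀ i ∈ c.act x, 0 ≤ t i)
    (hb : ∀ᶠ y in 𝓝 x, (∀ i, t i = 0 → c.invFun x i = 0 → c.invFun y i = 0) → 0 ≤ b y) :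
    0 ≤ fderiv ℝ G (c.invFun x) t := by
  have hd : HasDerivAt (fun ε : ℝ => G (c.invFun x + ε • t)) (fderiv ℝ G (c.invFun x) t) 0 := by
    have h1 : HasFDerivAt G (fderiv ℝ G (c.invFun x)) (c.invFun x + (0 : ℝ) • t) := by
      simpa using h.smooth.differentiableAt.hasFDerivAt
    have h2 : HasDerivAt (fun ε : ℝ => c.invFun x + ε • t) t 0 := by
      simpa using ((hasDerivAt_id (0 : ℝ)).smul_const t).const_add (c.invFun x)
    exact h1.comp_hasDerivAt (0 : ℝ) h2
  refine ge_of_tendsto hd.tendsto_slope_zero_right ?_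
  filter_upwards [c.eventually_ray' h.mem ht (hb.and h.eq), self_mem_nhdsWithin] with ε h1 hε
  obtain ⟨h2, ⟨h3, h4⟩, h5⟩ := h1
  rw [h5] at h3 h4
  have h6 : 0 ≤ b (c.toFun (c.invFun x + ε • t)) := h3 fun i hi hi' => by
    simp only [Pi.add_apply, Pi.smul_apply, smul_eq_mul, hi, hi']; simp
  rw [h4] at h6
  rw [h.apply] at h0
  simp only [zero_add, zero_smul, add_zero, h0, sub_zero, smul_eq_mul]
  exact mul_nonneg (inv_nonneg.2 (le_of_lt hε)) h6

lemma RepF.neg (h : RepF b c x G) :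
    RepF (fun y => -b y) c x (fun a => -G a) :=
  ⟨h.mem, h.smooth.mono fun _ h => h.neg, h.eq.mono fun y hy => by rw [hy]⟩

lemma RepF.fderiv_eq_zero (h : RepF b c x G) (h0 : b x = 0) (ht : ∀ i ∈ c.act x, 0 ≤ t i)
    (hb : ∀ᶠ y in 𝓝 x, (∀ i, t i = 0 → c.invFun x i = 0 → c.invFun y i = 0) → b y = 0) :
    fderiv ℝ G (c.invFun x) t = 0 := by
  have h2 := h.neg.fderiv_nonneg (by simp [h0]) ht (hb.mono fun y hy h' => by simp [hy h'])
  have : fderiv ℝ (fun a => -G a) (c.invFun x) = -fderiv ℝ G (c.invFun x) := fderiv_neg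
  rw [this] at h2
  simp at h2
  exact le_antisymm h2 (h.fderiv_nonneg h0 ht (hb.mono fun y hy h' => (hy h').ge))

/-- The derivative of a nonnegative function vanishes along the stratum of a zero. -/
lemma RepF.fderiv_stratum (h : RepF b c x G) (h0 : b x = 0) (hb : ∀ᶠ y in 𝓝 x, 0 ≤ b y)
    (ht : ∀ i ∈ c.act x, t i = 0) :
    fderiv ℝ G (c.invFun x) t = 0 := by
  have h1 := h.fderiv_nonneg h0 (fun i hi => (ht i hi).ge)
    (hb.mono fun y hy _ => hy)
  have h2 := h.fderiv_nonneg h0 (t := -t) (fun i hi => by simp [ht i hi])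
    (hb.mono fun y hy _ => hy)
  rw [map_neg] at h2
  linarith

lemma single_apply_nonneg (i j : Fin m) : (0 : ℝ) ≤ Pi.single (M := fun _ => ℝ) i 1 j := by
  by_cases h : j = i
  · subst h; simp
  · simp [h]

lemma linear_eq_sum (T : ℝ^n →L[ℝ] ℝ) (t : ℝ^n) :
    T t = ∑ i, t i * T (Pi.single i 1) := by
  conv_lhs => rw [← Finset.univ_sum_single t, map_sum]
  refine Finset.sum_congr rfl fun i _ => ?_
  have : (Pi.single i (t i) : ℝ^n) = t i • Pi.single i 1 := by rw [← Pi.single_smul]; simp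
  rw [this, map_smul, smul_eq_mul]

lemma linear_eq_coord (T : ℝ^n →L[ℝ] ℝ) (i : Fin n) (h : ∀ j, j ≠ i → T (Pi.single j 1) = 0)
    (t : ℝ^n) : T t = T (Pi.single i 1) * t i := by
  rw [linear_eq_sum T t, Finset.sum_eq_single i (fun j _ hj => by rw [h j hj, mul_zero]) (by simp),
    mul_comm]

/-- A function whose derivative in direction `i` is positive is monotone along that direction. -/
lemma GermSmooth.eventually_update_lt {G : ℝ^n → ℝ} {a : ℝ^n} (h : GermSmooth G a) {i : Fin n}
    (ha : a i = 0) (hpos : 0 < fderiv ℝ G a (Pi.single i 1)) :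
    ∀ᶠ a' in 𝓝 a, (0 < a' i → G (update a' i 0) < G a') ∧
      (a' i < 0 → G a' < G (update a' i 0)) := by
  obtain ⟨δ, hδ, hball⟩ := Metric.eventually_nhds_iff_ball.1 (((h.continuousAt_fderiv.clm_apply
      continuousAt_const).eventually_const_lt hpos).and h)
  filter_upwards [Metric.ball_mem_nhds a hδ] with a' ha'
  have hin : ∀ s : ℝ, |s| ≤ |a' i| → update a' i s ∈ Metric.ball a δ := by
    intro s hs
    rw [Metric.mem_ball, dist_pi_lt_iff hδ] at ha' ⊢
    intro j
    by_cases hj : j = i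
    · subst hj
      have := ha' j
      rw [ha, Real.dist_eq, sub_zero] at this
      rw [update_self, ha, Real.dist_eq, sub_zero]
      exact hs.trans_lt this
    · rw [update_of_ne hj]; exact ha' j
  have hder : ∀ s : ℝ, |s| ≤ |a' i| → HasDerivAt (fun s => G (update a' i s))
      (fderiv ℝ G (update a' i s) (Pi.single i 1)) s := by
    intro s hs
    exact (((hball _ (hin s hs)).2.differentiableAt (by simp)).hasFDerivAt).comp_hasDerivAt s
        (hasDerivAt_update a' i s)
  have mono : ∀ p q : ℝ, (∀ s ∈ Icc p q, |s| ≤ |a' i|) → p < q →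
      G (update a' i p) < G (update a' i q) := by
    intro p q hpq hlt
    refine strictMonoOn_of_deriv_pos (f := fun s => G (update a' i s)) (convex_Icc p q) ?_ ?_
      (left_mem_Icc.2 hlt.le) (right_mem_Icc.2 hlt.le) hlt
    · exact fun s hs => (hder s (hpq s hs)).continuousAt.continuousWithinAt
    · intro s hs
      rw [interior_Icc] at hs
      rw [(hder s (hpq s (Ioo_subset_Icc_self hs))).deriv]
      exact (hball _ (hin s (hpq s (Ioo_subset_Icc_self hs)))).1
  constructor
  · intro hp
    have := mono 0 (a' i) (fun s hs => by rw [abs_of_nonneg hs.1, abs_of_pos hp]; exact hs.2) hp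
    rwa [update_eq_self] at this
  · intro hp
    have := mono (a' i) 0 (fun s hs => by
      rw [abs_of_nonpos hs.2, abs_of_neg hp]; exact neg_le_neg hs.1) hp
    rwa [update_eq_self] at this

/-! ### Functions defining a face -/

/-- Near `x`, the nonnegative function `b` is a boundary defining function for the `i`-th face of
the chart `c`. -/
structure PullAt (b : A → ℝ) (c : 𝒞 m A) (x : A) (i : Fin m) : Prop where
  act : i ∈ c.act x
  nonneg : ∀ᶠ y in 𝓝 x, 0 ≤ b y
  zero : ∀ᶠ y in 𝓝 x, (b y = 0 ↔ c.invFun y i = 0)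
  rep : ∃ G μ, RepF b c x G ∧ (0 : ℝ) < μ ∧ ∀ t, fderiv ℝ G (c.invFun x) t = μ * t i

lemma CornerChart.tendsto_update (hx : x ∈ c.target) (hi : i ∈ c.act x) :
    Tendsto (fun y => c.toFun (update (c.invFun y) i 0)) (𝓝 x) (𝓝 x) ∧
    ∀ᶠ y in 𝓝 x, update (c.invFun y) i 0 ∈ c.source := by
  have h1 : Tendsto (fun y => update (c.invFun y) i 0) (𝓝 x)
      (𝓝 (c.invFun x)) := by
    have : Continuous fun a : Fin m → ℝ => update a i (0 : ℝ) := by fun_prop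
    have h2 := this.continuousAt.comp (c.continuousAt_invFun hx)
    rw [ContinuousAt] at h2
    have h3 : update (c.invFun x) i 0 = c.invFun x := by rw [← hi.2, update_eq_self]
    have h4 : Tendsto (fun y => update (c.invFun y) i 0) (𝓝 x)
      (𝓝 (update (c.invFun x) i 0)) := h2
    rwa [h3] at h4
  have h2 : Tendsto (fun y => update (c.invFun y) i 0) (𝓝 x)
      (𝓝[c.source] (c.invFun x)) := by
    rw [c.nhdsWithin_source (c.mapT hx)]
    refine tendsto_nhdsWithin_iff.2 ⟨h1, ?_⟩
    filter_upwards [c.eventually_target hx] with y hy j hj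
    by_cases h : j = i
    · subst h; simp
    · rw [update_of_ne h]; exact c.nonneg hy hj
  exact ⟨(c.tendsto_toFun hx).comp h2, (tendsto_nhdsWithin_iff.1 h2).2⟩

lemma RepF.pullAt (h : RepF b c x G) (hi : i ∈ c.act x) (hb : ∀ᶠ y in 𝓝 x, 0 ≤ b y)
    (hz : ∀ᶠ y in 𝓝 x, c.invFun y i = 0 → b y = 0) (hd : fderiv ℝ G (c.invFun x) ≠ 0) :
    PullAt b c x i := by
  have h0 := hz.self_of_nhds hi.2
  have heq := linear_eq_coord (fderiv ℝ G (c.invFun x)) i (fun j hj => h.fderiv_eq_zero h0 (fun k _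
      => single_apply_nonneg _ _) (hz.mono fun y hy h' => hy (h' i (by simp [hj.symm]) hi.2)))
  have hpos : 0 < fderiv ℝ G (c.invFun x) (Pi.single i 1) := by
    refine lt_of_le_of_ne (h.fderiv_nonneg h0 (fun k _ => single_apply_nonneg _ _) (hb.mono fun y hy
        _ => hy)) fun h' => hd ?_
    refine ContinuousLinearMap.ext fun t => ?_
    rw [heq t, ← h', zero_mul]; rfl
  refine ⟨hi, hb, ?_, G, _, h, hpos, heq⟩
  obtain ⟨hu1, hu2⟩ := c.tendsto_update h.mem hi
  filter_upwards [hz, h.eq, (c.continuousAt_invFun h.mem).eventually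
    (h.smooth.eventually_update_lt hi.2 hpos), c.eventually_target h.mem, hu2,
    hu1.eventually hz, hu1.eventually h.eq] with y h1 h2 h3 h4 h5 h6 h7
  refine ⟨fun hy => ?_, h1⟩
  by_contra hne
  have hlt := h3.1 (lt_of_le_of_ne (c.nonneg h4 hi.1) (Ne.symm hne))
  rw [c.invTo h5] at h6 h7
  rw [← h2, ← h7, h6 (by simp), hy] at hlt
  exact lt_irrefl _ hlt

lemma PullAt.mem (h : PullAt b c x i) : x ∈ c.target := by
  obtain ⟨G, μ, hG, _⟩ := h.rep
  exact hG.mem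

lemma PullAt.fderiv_eq (h : PullAt b c x i) {G} (hG : RepF b c x G) :
    ∃ μ : ℝ, 0 < μ ∧ ∀ t, fderiv ℝ G (c.invFun x) t = μ * t i := by
  obtain ⟨H, μ, hH, hμ, h1⟩ := h.rep
  exact ⟨μ, hμ, fun t => by rw [hG.fderiv_unique hH, h1]⟩

lemma PullAt.chartDeriv_eq {G} (h : PullAt (fun y => d.invFun (f y) j) c x i) (hG : Rep f c d x G) :
    ∃ μ : ℝ, 0 < μ ∧ ∀ t, 𝒟 f c d x t j = μ * t i := by
  obtain ⟨μ, hμ, h1⟩ := h.fderiv_eq (hG.coord j)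
  exact ⟨μ, hμ, fun t => by rw [← hG.fderiv_coord, h1]⟩

lemma pullAt_coord (hx : x ∈ c.target) (hi : i ∈ c.act x) :
    PullAt (fun y => c.invFun y i) c x i := by
  refine ⟨hi, (c.eventually_target hx).mono fun y hy => c.nonneg hy hi.1,
    .of_forall fun _ => Iff.rfl, _, 1, repF_coord c hx i, one_pos, fun t => ?_⟩
  have := (rep_id c hx).fderiv_coord i t
  rw [chartDeriv_id c hx] at this
  simpa using this

lemma PullAt.congr {b' : A → ℝ} (h : PullAt b c x i) (e : b' =ᶠ[𝓝 x] b) :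
    PullAt b' c x i := by
  obtain ⟨G, μ, hG, hμ, h1⟩ := h.rep
  refine ⟨h.act, ?_, ?_, G, μ, hG.congr e, hμ, h1⟩
  · filter_upwards [h.nonneg, e] with y h1 h2; rwa [h2]
  · filter_upwards [h.zero, e] with y h1 h2; rwa [h2]

lemma CornerChart.not_eventually_zero (hx : x ∈ c.target) (hi : i ∈ c.act x) :
    ¬ ∀ᶠ y in 𝓝 x, c.invFun y i = 0 := by
  intro h
  have := c.eventually_ray' hx (t := Pi.single i 1) (fun k _ => single_apply_nonneg _ _) h
  obtain ⟨ε, h1, h2⟩ := (this.and self_mem_nhdsWithin).exists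
  have h3 := h1.2.1
  rw [h1.2.2] at h3
  rw [Pi.add_apply, hi.2, zero_add, Pi.smul_apply, Pi.single_eq_same, smul_eq_mul, mul_one] at h3
  rw [h3] at h2
  exact lt_irrefl _ h2

lemma PullAt.not_eventually_zero (h : PullAt b c x i) :
    ¬ ∀ᶠ y in 𝓝 x, b y = 0 := fun h' =>
  c.not_eventually_zero h.mem h.act (by filter_upwards [h.zero, h'] with y h1 h2 using h1.1 h2)

lemma PullAt.unique {i' : Fin m} (h : PullAt b c x i) (h' : PullAt b c x i') :
    i = i' := by
  obtain ⟨G, μ, hG, hμ, h1⟩ := h.rep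
  obtain ⟨ν, hν, h2⟩ := h'.fderiv_eq hG
  by_contra hne
  have h3 := h1 (Pi.single i 1)
  rw [h2] at h3
  simp [Ne.symm hne] at h3
  exact hμ.ne h3

lemma PullAt.eventually (h : PullAt b c x i) :
    ∀ᶠ y in 𝓝 x, c.invFun y i = 0 → PullAt b c y i := by
  obtain ⟨G, μ, hG, hμ, h1⟩ := h.rep
  have hd : fderiv ℝ G (c.invFun x) (Pi.single i 1) ≠ 0 := by rw [h1]; simp [hμ.ne']
  filter_upwards [h.nonneg.eventually_nhds, h.zero.eventually_nhds, hG.eventually,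
    (c.continuousAt_invFun hG.mem).eventually (((hG.smooth.continuousAt_fderiv.clm_apply
        continuousAt_const).eventually_ne hd))] with y h2 h3 h4 h5 h6
  exact h4.pullAt ⟨h.act.1, h6⟩ h2 (h3.mono fun z hz => hz.2) fun h7 => h5 (by rw [h7]; rfl)

/-! ### Smooth maps in charts -/

/-- The map `f` is smooth at `x`, in the sense of manifolds with corners, in the charts `c`, `d`. -/
structure SmC (f : A → B) (c : 𝒞 m A) (d : 𝒞 n B) (x : A) : Prop where
  rep : ∃ G, Rep f c d x G
  face : ∀ j ∈ d.act (f x), (∀ᶠ y in 𝓝 x, d.invFun (f y) j = 0) ∨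
    ∃ i, PullAt (fun y => d.invFun (f y) j) c x i

lemma SmC.mem (h : SmC f c d x) : x ∈ c.target := h.rep.choose_spec.mem
lemma SmC.mem' {f : A → B} (h : SmC f c d x) : f x ∈ d.target := h.rep.choose_spec.mem'
lemma SmC.cont {f : A → B} (h : SmC f c d x) : ContinuousAt f x := h.rep.choose_spec.cont

lemma PullAt.comp_rep {b : B → ℝ} {G} (hb : PullAt b d (f x) j) (hG : Rep f c d x G)
    (hi : PullAt (fun y => d.invFun (f y) j) c x i) :
    PullAt (fun y => b (f y)) c x i := by
  obtain ⟨H, μ, hH, hμ, h1⟩ := hb.rep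
  obtain ⟨ν, hν, h2⟩ := hi.chartDeriv_eq hG
  refine ⟨hi.act, hG.cont.eventually hb.nonneg, ?_, H ∘ G, μ * ν, hH.comp hG,
    mul_pos hμ hν, fun t => ?_⟩
  · filter_upwards [hG.cont.eventually hb.zero, hi.zero] with y h3 h4
    exact h3.trans h4
  · rw [hH.fderiv_comp hG, ContinuousLinearMap.comp_apply, h1, ← hG.chartDeriv_eq, h2]
    ring

lemma PullAt.comp {b : B → ℝ} (hb : PullAt b d (f x) j) (hf : SmC f c d x)
    : (∀ᶠ y in 𝓝 x, b (f y) = 0) ∨ ∃ i, PullAt (fun y => b (f y)) c x i := by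
  obtain ⟨G, hG⟩ := hf.rep
  rcases hf.face j hb.act with h | ⟨i, hi⟩
  · left
    filter_upwards [h, hG.cont.eventually hb.zero] with y h1 h2 using h2.2 h1
  · exact Or.inr ⟨i, hb.comp_rep hG hi⟩

lemma SmC.comp {g : B → C} (hg : SmC g d e (f x)) (hf : SmC f c d x) :
    SmC (g ∘ f) c e x := by
  obtain ⟨G, hG⟩ := hf.rep
  obtain ⟨H, hH⟩ := hg.rep
  refine ⟨⟨_, hH.comp hG⟩, fun k hk => ?_⟩
  rcases hg.face k hk with h | ⟨j, hj⟩
  · exact Or.inl (hG.cont.eventually h)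
  · exact hj.comp hf

lemma SmC.congr {f' : A → B} (h : SmC f c d x) (e : f' =ᶠ[𝓝 x] f) : SmC f' c d x := by
  obtain ⟨G, hG⟩ := h.rep
  refine ⟨⟨G, hG.congr e⟩, fun j hj => ?_⟩
  rw [e.self_of_nhds] at hj
  rcases h.face j hj with h | ⟨i, hi⟩
  · left; filter_upwards [h, e] with y h1 h2; rw [h2, h1]
  · right
    exact ⟨i, hi.congr (by filter_upwards [e] with y h2; rw [h2])⟩

/-- A smooth map sends tangent vectors of strata to tangent vectors of strata. -/
lemma Rep.chartDeriv_stratum {G} (hG : Rep f c d x G) (ht : ∀ i ∈ c.act x, t i = 0)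
    : ∀ j ∈ d.act (f x), 𝒟 f c d x t j = 0 := by
  intro j hj
  rw [← hG.fderiv_coord]
  refine (hG.coord j).fderiv_stratum hj.2 ?_ ht
  filter_upwards [hG.cont.eventually (d.eventually_target hG.mem')] with y hy
  exact d.nonneg hy hj.1

/-! ### Compatible charts have the same faces -/

lemma Compatible.face {c d : 𝒞 n A} (h : Compatible c d) (hc : x ∈ c.target)
    (hd : x ∈ d.target) (hj : j ∈ d.act x) :
    ∃ i, PullAt (fun y => d.invFun y j) c x i := by
  obtain ⟨G, hG⟩ := h.rep hc hd
  obtain ⟨H, hH⟩ := h.symm.rep hd hc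
  set T := 𝒟 (id : A → A) c d x with hT
  set S := 𝒟 (id : A → A) d c x with hS
  have nonneg : ∀ {c d : 𝒞 n A} {G} {x : A}, Rep (id : A → A) c d x G → ∀ i j,
      j ∈ d.act x → 0 ≤ 𝒟 (id : A → A) c d x (Pi.single i 1) j := by
    intro c d G x hG i j hj
    rw [← hG.fderiv_coord]
    refine (hG.coord j).fderiv_nonneg hj.2 (fun k _ => single_apply_nonneg _ _) ?_
    filter_upwards [d.eventually_target hG.mem'] with y hy _ using d.nonneg hy hj.1
  have vanish : ∀ {c d : 𝒞 n A} {G} {x : A}, Rep (id : A → A) c d x G → ∀ i j,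
      j ∈ d.act x → i ∉ c.act x → 𝒟 (id : A → A) c d x (Pi.single i 1) j = 0 := by
    intro c d G x hG i j hj hi
    refine hG.chartDeriv_stratum (fun k hk => ?_) j hj
    have : k ≠ i := fun h => hi (h ▸ hk)
    simp [this]
  have hTS : ∀ t, T (S t) = t := fun t => by
    have := congrArg (fun L => L t) (h.symm.chartDeriv_comp hd hc)
    simpa using this
  have hST : ∀ t, S (T t) = t := fun t => by
    have := congrArg (fun L => L t) (h.chartDeriv_comp hc hd)
    simpa using this
  have expT := fun t j => by simpa using linear_eq_sum ((ContinuousLinearMap.proj j).comp T) t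
  have expS := fun t j => by simpa using linear_eq_sum ((ContinuousLinearMap.proj j).comp S) t
  have hex : ∃ i, T (Pi.single i 1) j ≠ 0 := by
    by_contra hcon
    push Not at hcon
    have h1 : T (S (Pi.single j 1)) j = 1 := by rw [hTS]; simp
    rw [expT] at h1
    simp [hcon] at h1
  obtain ⟨i, hi⟩ := hex
  have hia : i ∈ c.act x := by
    by_contra hcon
    exact hi (vanish hG i j hj hcon)
  have hS0 : ∀ j', j' ≠ j → S (Pi.single j' 1) i = 0 := by
    intro j' hj'
    by_cases hja : j' ∈ d.act x
    · have h1 : T (S (Pi.single j' 1)) j = 0 := by rw [hTS]; simp [hj'.symm]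
      rw [expT, Finset.sum_eq_zero_iff_of_nonneg] at h1
      · have := h1 i (Finset.mem_univ _)
        exact (mul_eq_zero.1 this).resolve_right hi
      · intro k _
        by_cases hk : k ∈ c.act x
        · exact mul_nonneg (nonneg hH j' k hk) (nonneg hG k j hj)
        · rw [vanish hG k j hj hk, mul_zero]
    · exact vanish hH j' i hia hja
  have hSj : S (Pi.single j 1) i ≠ 0 := by
    intro h0
    have h1 : S (T (Pi.single i 1)) i = 1 := by rw [hST]; simp
    rw [expS] at h1
    have : ∀ k, S (Pi.single k 1) i = 0 := fun k => by
      by_cases hk : k = j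
      · rw [hk, h0]
      · exact hS0 k hk
    simp [this] at h1
  have hne : ∀ᶠ y in 𝓝 x, 𝒟 (id : A → A) d c y (Pi.single j 1) i ≠ 0 := by
    have h1 : ContinuousAt (fun y => fderiv ℝ (fun a => H a i) (d.invFun y) (Pi.single j 1)) x :=
      (ContinuousAt.comp (((germSmooth_pi.1 hH.smooth) i).continuousAt_fderiv)
        (d.continuousAt_invFun hd)).clm_apply continuousAt_const
    filter_upwards [(h1.eventually_ne (by rw [hH.fderiv_coord]; exact hSj)), hH.eventually
        (.of_forall fun _ => continuousAt_id)]
      with y h3 h4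
    rwa [← h4.fderiv_coord]
  refine ⟨i, (hG.coord j).pullAt hia ?_ ?_ ?_⟩
  · filter_upwards [d.eventually_target hd] with y hy using d.nonneg hy hj.1
  · filter_upwards [hne, hH.eventually (.of_forall fun _ => continuousAt_id)]
      with y h3 h4 h5
    by_contra h6
    exact h3 (vanish h4 j i ⟨hia.1, h5⟩ fun h7 => h6 h7.2)
  · intro h0
    have := hG.fderiv_coord j (Pi.single i 1)
    rw [h0] at this
    exact hi this.symm

lemma Compatible.smC {c d : 𝒞 n A} (h : Compatible c d) (hc : x ∈ c.target)
    (hd : x ∈ d.target) : SmC (id : A → A) c d x :=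
  ⟨h.rep hc hd, fun _ hj => Or.inr (h.face hc hd hj)⟩

lemma SmC.change {c' : 𝒞 m A} {d' : 𝒞 n B} (h : SmC f c d x)
    (hc : Compatible c' c) (hd : Compatible d d') (hx : x ∈ c'.target) (hfx : f x ∈ d'.target)
    : SmC f c' d' x :=
  SmC.comp (g := id) (hd.smC h.mem' hfx) (SmC.comp (f := id) h (hc.smC hx h.mem))

lemma chartDeriv_bijective {c d : 𝒞 n A} (h : Compatible c d) (hc : x ∈ c.target)
    (hd : x ∈ d.target) : Bijective (𝒟 (id : A → A) c d x) := by
  refine bijective_iff_has_inverse.2 ⟨𝒟 (id : A → A) d c x, fun t => ?_,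
    fun t => ?_⟩
  · have := congrArg (fun L => L t) (h.chartDeriv_comp hc hd); simpa using this
  · have := congrArg (fun L => L t) (h.symm.chartDeriv_comp hd hc); simpa using this

/-- The depth of a point does not depend on the chart. -/
lemma Compatible.ncard_act_le {c d : 𝒞 n A} (h : Compatible c d) (hc : x ∈ c.target)
    (hd : x ∈ d.target) : (d.act x).ncard ≤ (c.act x).ncard := by
  choose! i hi using fun j (hj : j ∈ d.act x) => h.face hc hd hj
  obtain ⟨G, hG⟩ := h.rep hc hd
  refine Set.ncard_le_ncard_of_injOn i (fun j hj => (hi j hj).act) ?_ (Set.toFinite _)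
  intro j hj j' hj' e
  obtain ⟨μ, hμ, h1⟩ := (hi j hj).chartDeriv_eq (f := id) hG
  obtain ⟨ν, hν, h2⟩ := (hi j' hj').chartDeriv_eq (f := id) hG
  obtain ⟨t, ht⟩ := (chartDeriv_bijective h hc hd).2 (Pi.single j 1)
  by_contra hne
  have h3 := h1 t
  have h4 := h2 t
  rw [ht] at h3 h4
  simp [Ne.symm hne, e] at h3 h4
  rcases h4 with h4 | h4
  · exact hν.ne' h4
  · rw [h4, mul_zero] at h3; exact one_ne_zero h3

lemma Compatible.ncard_act {c d : 𝒞 n A} (h : Compatible c d) (hc : x ∈ c.target)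
    (hd : x ∈ d.target) : (d.act x).ncard = (c.act x).ncard :=
  le_antisymm (h.ncard_act_le hc hd) (h.symm.ncard_act_le hd hc)

lemma mem_stratumTangent :
    t ∈ c.stratumTangent x ↔ ∀ i ∈ c.act x, t i = 0 :=
  ⟨fun h i hi => h i hi.1 hi.2, fun h i hi hi' => h i ⟨hi, hi'⟩⟩

end

/-! ### Small neighbourhoods in a chart -/

namespace CornerChart
variable {A : Type u} [TopologicalSpace A] {n : ℕ} (c : 𝒞 n A)

/-- The part of a chart in a ball around `x`. -/
def ballNhd (x : A) (ε : ℝ) : Set A := c.target ∩ c.invFun ⁻¹' Metric.ball (c.invFun x) ε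

/-- The ball of radius `ε` around `x` meets only faces through `x` and does not leave the chart. -/
structure Good (x : A) (ε : ℝ) : Prop where
  pos : 0 < ε
  mem : x ∈ c.target
  sub : Metric.ball (c.invFun x) ε ∩ quadrant n c.k ⊆ c.source
  act : ∀ y ∈ c.ballNhd x ε, c.act y ⊆ c.act x

variable {x : A} {N : Set A} {ε : ℝ} {i : Fin n}

lemma isOpen_ballNhd (x : A) (ε : ℝ) : IsOpen (c.ballNhd x ε) :=
  c.continuousOn_invFun.isOpen_inter_preimage c.target_open Metric.isOpen_ball

lemma exists_good (hx : x ∈ c.target) (hN : N ∈ 𝓝 x) :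
    ∃ ε, c.Good x ε ∧ c.ballNhd x ε ⊆ N := by
  have h1 := Eventually.and hN (c.eventually_act_subset hx)
  rw [c.eventually_iff hx] at h1
  have h3 := h1.and self_mem_nhdsWithin
  rw [c.nhdsWithin_source (c.mapT hx), eventually_nhdsWithin_iff,
    Metric.eventually_nhds_iff_ball] at h3
  obtain ⟨ε, hε, h⟩ := h3
  have key : ∀ y ∈ c.ballNhd x ε, y ∈ N ∧ c.act y ⊆ c.act x := by
    intro y hy
    have := (h _ hy.2 (c.source_subset_quadrant (c.mapT hy.1))).1
    rwa [c.toInv hy.1] at this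
  exact ⟨ε, ⟨hε, hx, fun a ha => (h a ha.1 ha.2).2, fun y hy => (key y hy).2⟩,
    fun y hy => (key y hy).1⟩

variable {c} in
lemma Good.mem_ballNhd (h : c.Good x ε) : x ∈ c.ballNhd x ε :=
  ⟨h.mem, Metric.mem_ball_self h.pos⟩

/-- The interior of the `i`-th face in a ball around `x`. -/
def faceSet (x : A) (ε : ℝ) (i : Fin n) : Set A := {y ∈ c.ballNhd x ε | c.act y = {i}}

lemma exists_act_eq_singleton (hx : x ∈ c.target) (hi : i ∈ c.act x) (hN : N ∈ 𝓝 x)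
    : ∃ y ∈ N, y ∈ c.target ∧ c.act y = {i} := by
  have h1 := c.eventually_ray' hx (t := fun j => if j = i then 0 else 1)
    (fun k _ => by by_cases h : k = i <;> simp [h]) hN
  obtain ⟨ε, ⟨h2, h3, h4⟩, hε⟩ := (h1.and self_mem_nhdsWithin).exists
  refine ⟨_, h3, h2, ?_⟩
  ext j
  rw [mem_singleton_iff]
  refine ⟨fun hj => ?_, fun hj => ?_⟩
  · by_contra hne
    have h5 := hj.2
    rw [h4, Pi.add_apply, Pi.smul_apply, if_neg hne, smul_eq_mul, mul_one] at h5
    linarith [c.nonneg hx hj.1]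
  · subst hj
    refine ⟨hi.1, ?_⟩
    rw [h4, Pi.add_apply, Pi.smul_apply, if_pos rfl, hi.2]; simp

lemma isPreconnected_faceSet (h : c.Good x ε) :
    IsPreconnected (c.faceSet x ε i) := by
  by_cases hk : (i : ℕ) < c.k
  swap
  · have : c.faceSet x ε i = ∅ := by
      ext y
      simp only [mem_empty_iff_false, iff_false]
      intro hy
      have : i ∈ c.act y := by rw [hy.2]; rfl
      exact hk this.1
    rw [this]; exact isPreconnected_empty
  set S : Set ℝ^n := Metric.ball (c.invFun x) ε ∩
    {a | ∀ j : Fin n, (j : ℕ) < c.k → (j = i → a j = 0) ∧ (j ≠ i → 0 < a j)} with hS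
  have hSq : S ⊆ quadrant n c.k := by
    intro a ha j hj
    by_cases hji : j = i
    · exact ((ha.2 j hj).1 hji).ge
    · exact ((ha.2 j hj).2 hji).le
  have hSs : S ⊆ c.source := fun a ha => h.sub ⟨ha.1, hSq ha⟩
  have hconv : Convex ℝ S := by
    refine (convex_ball _ _).inter ?_
    intro a ha b hb s t hs ht hst j hj
    refine ⟨fun hji => ?_, fun hji => ?_⟩
    · simp [(ha j hj).1 hji, (hb j hj).1 hji]
    · have h2 := (hb j hj).2 hji
      simp only [Pi.add_apply, Pi.smul_apply, smul_eq_mul]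
      rcases hs.eq_or_lt with rfl | hs'
      · have : t = 1 := by linarith
        subst this; simpa using h2
      · have := mul_pos hs' ((ha j hj).2 hji)
        have := mul_nonneg ht h2.le
        linarith
  have : c.faceSet x ε i = c.toFun '' S := by
    ext y
    constructor
    · rintro ⟨hy, hact⟩
      refine ⟨c.invFun y, ⟨hy.2, fun j hj => ⟨fun hji => ?_, fun hji => ?_⟩⟩, c.toInv hy.1⟩
      · have : j ∈ c.act y := by rw [hact]; exact hji
        exact this.2
      · refine lt_of_le_of_ne (c.nonneg hy.1 hj) fun h0 => hji ?_
        have : j ∈ c.act y := ⟨hj, h0.symm⟩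
        rwa [hact] at this
    · rintro ⟨a, ha, rfl⟩
      have hs := hSs ha
      refine ⟨⟨c.mapS hs, ?_⟩, ?_⟩
      · rw [mem_preimage, c.invTo hs]; exact ha.1
      · ext j
        rw [act, mem_ofPred_eq, c.invTo hs, mem_singleton_iff]
        refine ⟨fun hj => ?_, fun hj => ?_⟩
        · by_contra hne
          exact ((ha.2 j hj.1).2 hne).ne' hj.2
        · subst hj
          exact ⟨hk, (ha.2 j hk).1 rfl⟩
  rw [this]
  exact hconv.isPreconnected.image _ (c.continuousOn_toFun.mono hSs)

end CornerChart

/-! ### Local boundary components and faces of charts -/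

section
variable {X : CSpace.{u}} {n m : ℕ}

variable {d : 𝒞 n X} {x : X} {j : Fin n} {ε : ℝ} {y : X} {p q : BoundaryPt X}

lemma CSpace.IsManifold.dim_unique (hX : X.IsManifold) (hc : c ∈ X.charts n) {d : 𝒞 m X}
    (hd : d ∈ X.charts m) : n = m := by
  exact_mod_cast (hX.dim_eq n c hc).trans (hX.dim_eq m d hd).symm

lemma CSpace.IsManifold.mem_stratum (hX : X.IsManifold) (hc : c ∈ X.charts n) (hx : x ∈ c.target)
    {j : ℕ} :
    x ∈ X.stratum j ↔ (c.act x).ncard = j := by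
  constructor
  · rintro ⟨m, d, hd, hxd, h⟩
    obtain rfl := hX.dim_unique hc hd
    rw [← h]
    exact ((hX.compatible _ c hc d hd).ncard_act hx hxd).symm
  · exact fun h => ⟨n, c, hc, hx, h⟩

variable {c : 𝒞 n X} {i : Fin n}

lemma CSpace.IsManifold.connectedComponentIn_eq_faceSet (hX : X.IsManifold) (hc : c ∈ X.charts n)
    (h : c.Good x ε) (hy : y ∈ c.faceSet x ε i) :
    connectedComponentIn (c.ballNhd x ε ∩ X.stratum 1) y = c.faceSet x ε i := by
  have hsub : c.faceSet x ε i ⊆ c.ballNhd x ε ∩ X.stratum 1 := fun z hz =>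
    ⟨hz.1, (hX.mem_stratum hc hz.1.1).2 (by rw [hz.2, ncard_singleton])⟩
  refine Subset.antisymm (fun z hz => ?_)
    ((c.isPreconnected_faceSet h).subset_connectedComponentIn hy hsub)
  have hzV := connectedComponentIn_subset _ _ hz
  refine ⟨hzV.1, ?_⟩
  have act1 : ∀ w ∈ c.ballNhd x ε ∩ X.stratum 1, ∃ i', c.act w = {i'} := fun w hw =>
    ncard_eq_one.1 ((hX.mem_stratum hc hw.1.1).1 hw.2)
  by_contra hne
  have hik : (i : ℕ) < c.k := by
    have : i ∈ c.act y := by rw [hy.2]; rfl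
    exact this.1
  have hop : ∀ j : Fin n, IsOpen (c.ballNhd x ε ∩ {w | 0 < c.invFun w j}) := fun j =>
    (c.continuousOn_invFun.mono inter_subset_left).isOpen_inter_preimage (c.isOpen_ballNhd x ε)
      (isOpen_lt continuous_const (continuous_apply j))
  have hU1 : IsOpen (c.ballNhd x ε ∩ ⋂ j : {j : Fin n // j ≠ i ∧ (j : ℕ) < c.k},
      (c.ballNhd x ε ∩ {w | 0 < c.invFun w j})) :=
    (c.isOpen_ballNhd x ε).inter (isOpen_iInter_of_finite fun j => hop j)
  have hpc := isPreconnected_connectedComponentIn (x := y) (F := c.ballNhd x ε ∩ X.stratum 1)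
  have hcov : connectedComponentIn (c.ballNhd x ε ∩ X.stratum 1) y ⊆
      (c.ballNhd x ε ∩ ⋂ j : {j : Fin n // j ≠ i ∧ (j : ℕ) < c.k},
      (c.ballNhd x ε ∩ {w | 0 < c.invFun w j})) ∪
      (c.ballNhd x ε ∩ {w | 0 < c.invFun w i}) := by
    intro w hw
    have hwV := connectedComponentIn_subset _ _ hw
    obtain ⟨i', hi'⟩ := act1 w hwV
    have hpos : ∀ j : Fin n, (j : ℕ) < c.k → j ≠ i' → 0 < c.invFun w j := fun j hj hj' => by
      refine lt_of_le_of_ne (c.nonneg hwV.1.1 hj) fun h0 => hj' ?_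
      have : j ∈ c.act w := ⟨hj, h0.symm⟩
      rwa [hi'] at this
    by_cases h' : i' = i
    · left
      exact ⟨hwV.1, mem_iInter.2 fun j => ⟨hwV.1, hpos j j.2.2 (h' ▸ j.2.1)⟩⟩
    · right
      exact ⟨hwV.1, hpos i hik (Ne.symm h')⟩
  have hy1 : y ∈ (c.ballNhd x ε ∩ ⋂ j : {j : Fin n // j ≠ i ∧ (j : ℕ) < c.k},
      (c.ballNhd x ε ∩ {w | 0 < c.invFun w j})) := by
    refine ⟨hy.1, mem_iInter.2 fun j => ⟨hy.1, lt_of_le_of_ne (c.nonneg hy.1.1 j.2.2)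
      fun h0 => j.2.1 ?_⟩⟩
    have : (j : Fin n) ∈ c.act y := ⟨j.2.2, h0.symm⟩
    rwa [hy.2] at this
  have hz2 : z ∈ c.ballNhd x ε ∩ {w | 0 < c.invFun w i} := by
    refine ⟨hzV.1, lt_of_le_of_ne (c.nonneg hzV.1.1 hik) fun h0 => hne ?_⟩
    obtain ⟨i', hi'⟩ := act1 z hzV
    have : i ∈ c.act z := ⟨hik, h0.symm⟩
    rw [hi'] at this ⊢
    rw [mem_singleton_iff.1 this]
  obtain ⟨w, hw, hw1, hw2⟩ := hpc _ _ hU1 (hop i) hcov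
    ⟨y, mem_connectedComponentIn (hsub hy), hy1⟩ ⟨z, hz, hz2⟩
  obtain ⟨i', hi'⟩ := act1 w (connectedComponentIn_subset _ _ hw)
  have hmem : i' ∈ c.act w := by rw [hi']; rfl
  by_cases h' : i' = i
  · subst h'
    exact hw2.2.ne' hmem.2
  · have := (mem_iInter.1 hw1.2 ⟨i', h', hmem.1⟩).2
    exact ne_of_gt this hmem.2

lemma LocalBoundaryComponent.subset (β : LocalBoundaryComponent X x)
    (V : TopologicalSpace.OpenNhdsOf x) : β.comp V ⊆ (V : Set X) ∩ X.stratum 1 := by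
  obtain ⟨p, _, h⟩ := β.isComponent V
  rw [h]; exact connectedComponentIn_subset _ _

lemma LocalBoundaryComponent.eq_component (β : LocalBoundaryComponent X x)
    (V : TopologicalSpace.OpenNhdsOf x) (hy : y ∈ β.comp V) :
    β.comp V = connectedComponentIn ((V : Set X) ∩ X.stratum 1) y := by
  obtain ⟨p, _, h⟩ := β.isComponent V
  rw [h] at hy ⊢
  exact connectedComponentIn_eq hy

lemma LocalBoundaryComponent.inter_nonempty (β : LocalBoundaryComponent X x)
    (V V' : TopologicalSpace.OpenNhdsOf x) : (β.comp V ∩ β.comp V').Nonempty :=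
  closure_nonempty_iff.1 ⟨x, β.compat V V'⟩

lemma LocalBoundaryComponent.mono (β : LocalBoundaryComponent X x)
    {V V' : TopologicalSpace.OpenNhdsOf x} (h : (V' : Set X) ⊆ V) : β.comp V' ⊆ β.comp V := by
  obtain ⟨y, hy, hy'⟩ := β.inter_nonempty V V'
  rw [β.eq_component V hy]
  refine IsPreconnected.subset_connectedComponentIn ?_ hy' ?_
  · rw [β.eq_component V' hy']; exact isPreconnected_connectedComponentIn
  · exact (β.subset V').trans (inter_subset_inter_left _ h)

/-- The ball as an open neighbourhood. -/
def CornerChart.Good.nhd {x : X} {ε : ℝ} (h : c.Good x ε) : TopologicalSpace.OpenNhdsOf x :=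
  ⟨⟨c.ballNhd x ε, c.isOpen_ballNhd x ε⟩, h.mem_ballNhd⟩

lemma CornerChart.Good.faceSet_subset :
    c.faceSet x ε i ⊆ c.toFun '' {a ∈ c.source | a i = 0 ∧
      ∀ j : Fin n, j ≠ i → (j : ℕ) < c.k → a j ≠ 0} := by
  rintro y ⟨hy, hact⟩
  refine ⟨c.invFun y, ⟨c.mapT hy.1, ?_, fun j hj hjk h0 => hj ?_⟩, c.toInv hy.1⟩
  · have : i ∈ c.act y := by rw [hact]; rfl
    exact this.2
  · have : j ∈ c.act y := ⟨hjk, h0⟩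
    rwa [hact] at this

lemma CSpace.IsManifold.exists_comp_eq (hX : X.IsManifold) (hc : c ∈ X.charts n) (p : BoundaryPt X)
    (h : c.Good p.pt ε) :
    ∃ i ∈ c.act p.pt, p.comp.comp h.nhd = c.faceSet p.pt ε i := by
  obtain ⟨y, hy, he⟩ := p.comp.isComponent h.nhd
  have hyV := hy.1
  obtain ⟨i, hi⟩ := ncard_eq_one.1 ((hX.mem_stratum hc hyV.1).1 hy.2)
  refine ⟨i, h.act y hyV (by rw [hi]; rfl), ?_⟩
  rw [he]
  exact hX.connectedComponentIn_eq_faceSet hc h ⟨hyV, hi⟩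

lemma isFace_of_comp_subset {V : TopologicalSpace.OpenNhdsOf p.pt} (hp : p.pt ∈ c.target)
    (hi : i ∈ c.act p.pt) (h : p.comp.comp V ⊆ c.toFun '' {a ∈ c.source | a i = 0 ∧ ∀ j : Fin n, j ≠
      i → (j : ℕ) < c.k → a j ≠ 0}) : IsFace c i p :=
  ⟨hp, hi.1, hi.2, fun V' =>
    closure_mono (inter_subset_inter_right _ h) (p.comp.compat V' V)⟩

lemma CSpace.IsManifold.exists_isFace (hX : X.IsManifold) (hc : c ∈ X.charts n)
    (hp : p.pt ∈ c.target) : ∃ i, IsFace c i p := by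
  obtain ⟨ε, h, _⟩ := c.exists_good hp univ_mem
  obtain ⟨i, hi, he⟩ := hX.exists_comp_eq hc p h
  exact ⟨i, isFace_of_comp_subset hp hi (he.subset.trans CornerChart.Good.faceSet_subset)⟩

lemma IsFace.mem_act (h : IsFace c i p) : i ∈ c.act p.pt := ⟨h.2.1, h.2.2.1⟩

lemma CSpace.IsManifold.comp_eq_faceSet (hX : X.IsManifold) (hc : c ∈ X.charts n)
    (hp : IsFace c i p) (h : c.Good p.pt ε) :
    p.comp.comp h.nhd = c.faceSet p.pt ε i := by
  obtain ⟨i', hi', he⟩ := hX.exists_comp_eq hc p h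
  obtain ⟨y, hy, a, ⟨ha, ha0, ha'⟩, rfl⟩ := closure_nonempty_iff.1 ⟨_, hp.2.2.2 h.nhd⟩
  rw [he] at hy ⊢
  have hmem : i ∈ c.act (c.toFun a) := ⟨hp.2.1, by rw [c.invTo ha]; exact ha0⟩
  rw [hy.2] at hmem
  rw [mem_singleton_iff.1 hmem]

lemma CSpace.IsManifold.isFace_unique (hX : X.IsManifold) (hc : c ∈ X.charts n) {i' : Fin n}
    (hp : IsFace c i p) (hp' : IsFace c i' p) : i = i' := by
  obtain ⟨ε, h, _⟩ := c.exists_good hp.1 univ_mem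
  obtain ⟨y, hy, _⟩ := p.comp.inter_nonempty h.nhd h.nhd
  exact singleton_injective ((((hX.comp_eq_faceSet hc hp h) ▸ hy).2).symm.trans
      (((hX.comp_eq_faceSet hc hp' h) ▸ hy).2))

lemma CSpace.IsManifold.comp_eq_of_isFace (hX : X.IsManifold) (hc : c ∈ X.charts n)
    {V : TopologicalSpace.Opens X} (hpV : p.pt ∈ V) (hqV : q.pt ∈ V) (hp : IsFace c i p)
    (hq : IsFace c i q) (h : c.Good p.pt ε) (hV : c.ballNhd p.pt ε ⊆ V)
    (hqε : q.pt ∈ c.ballNhd p.pt ε) :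
    q.comp.comp ⟨V, hqV⟩ = p.comp.comp ⟨V, hpV⟩ := by
  obtain ⟨δ, hδ, hsub⟩ := c.exists_good hq.1 ((c.isOpen_ballNhd p.pt ε).mem_nhds hqε)
  have h3 := p.comp.mono (V := ⟨V, hpV⟩) (V' := h.nhd) hV
  have h4 := q.comp.mono (V := ⟨V, hqV⟩) (V' := hδ.nhd) (hsub.trans hV)
  obtain ⟨y, hy, _⟩ := q.comp.inter_nonempty hδ.nhd hδ.nhd
  have h5 : y ∈ p.comp.comp h.nhd := by
    rw [hX.comp_eq_faceSet hc hp h]; rw [hX.comp_eq_faceSet hc hq hδ] at hy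
    exact ⟨hsub hy.1, hy.2⟩
  rw [q.comp.eq_component _ (h4 hy), p.comp.eq_component _ (h3 h5)]
  rfl

lemma LocalBoundaryComponent.ext_comp {β β' : LocalBoundaryComponent X x}
    (h : ∀ V, β.comp V = β'.comp V) : β = β' := by
  cases β; cases β'
  congr
  exact funext h

lemma CSpace.IsManifold.isFace_inj (hX : X.IsManifold) (hc : c ∈ X.charts n) (hp : IsFace c i p)
    (hq : IsFace c i q) (h : p.pt = q.pt) : p = q := by
  obtain ⟨x, β⟩ := p
  obtain ⟨x', β'⟩ := q
  obtain rfl : x = x' := h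
  congr 1
  refine LocalBoundaryComponent.ext_comp fun V => ?_
  obtain ⟨ε, hg, hV⟩ := c.exists_good hp.1 (V.1.2.mem_nhds V.2)
  exact (hX.comp_eq_of_isFace hc V.2 V.2 hp hq hg hV hg.mem_ballNhd).symm

lemma CSpace.IsManifold.exists_boundaryPt (hX : X.IsManifold) (hc : c ∈ X.charts n)
    (hx : x ∈ c.target) (hi : i ∈ c.act x) : ∃ p : BoundaryPt X, p.pt = x ∧ IsFace c i p := by
  have hgood : ∀ V : TopologicalSpace.OpenNhdsOf x, ∃ ε, c.Good x ε ∧ c.ballNhd x ε ⊆ V := fun V =>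
    c.exists_good hx (V.1.2.mem_nhds V.2)
  choose ε hε hsub using hgood
  have hpt : ∀ V, ∃ y, y ∈ c.faceSet x (ε V) i := fun V => by
    obtain ⟨y, hy, _, hy'⟩ := c.exists_act_eq_singleton hx hi
      ((c.isOpen_ballNhd x (ε V)).mem_nhds (hε V).mem_ballNhd)
    exact ⟨y, hy, hy'⟩
  choose y hy using hpt
  have hS1 : ∀ V, c.faceSet x (ε V) i ⊆ (V : Set X) ∩ X.stratum 1 := fun V z hz =>
    ⟨hsub V hz.1, (hX.mem_stratum hc hz.1.1).2 (by rw [hz.2, ncard_singleton])⟩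
  have hface := fun V => (c.isPreconnected_faceSet (hε V)).subset_connectedComponentIn (hy V) (hS1
      V)
  have hcl : ∀ V V', x ∈ closure (c.faceSet x (ε V) i ∩ c.faceSet x (ε V') i) := by
    intro V V'
    rw [mem_closure_iff_nhds]
    intro N hN
    obtain ⟨z, hz, _, hz'⟩ := c.exists_act_eq_singleton hx hi (inter_mem hN
      (inter_mem ((c.isOpen_ballNhd x (ε V)).mem_nhds (hε V).mem_ballNhd)
        ((c.isOpen_ballNhd x (ε V')).mem_nhds (hε V').mem_ballNhd)))
    exact ⟨z, hz.1, ⟨hz.2.1, hz'⟩, ⟨hz.2.2, hz'⟩⟩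
  let β : LocalBoundaryComponent X x :=
    { comp := fun V => connectedComponentIn ((V : Set X) ∩ X.stratum 1) (y V)
      isComponent := fun V => ⟨y V, hS1 V (hy V), rfl⟩
      mem_closure := fun V => closure_mono (fun z hz => hface V hz.1) (hcl V V)
      compat := fun V V' => closure_mono (inter_subset_inter (hface V) (hface V')) (hcl V V') }
  refine ⟨⟨x, β⟩, rfl, hx, hi.1, hi.2, fun V => ?_⟩
  refine closure_mono (fun z hz => ?_) (hcl V V)
  exact ⟨hface V hz.1, CornerChart.Good.faceSet_subset hz.1⟩

/-! ### The topology of the boundary -/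

lemma continuous_pt : Continuous (BoundaryPt.pt : BoundaryPt X → X) := by
  refine continuous_def.2 fun V hV => ?_
  have : BoundaryPt.pt ⁻¹' V = ⋃ W : Set X,
      {p : BoundaryPt X | ∃ h : p.pt ∈ (⟨V, hV⟩ : TopologicalSpace.Opens X),
        p.comp.comp ⟨⟨V, hV⟩, h⟩ = W} := by
    ext p
    simp only [mem_preimage, mem_iUnion, mem_ofPred_eq]
    exact ⟨fun h => ⟨_, h, rfl⟩, fun ⟨_, h, _⟩ => h⟩
  rw [this]
  exact isOpen_iUnion fun W => TopologicalSpace.isOpen_generateFrom_of_mem ⟨_, W, rfl⟩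

lemma CSpace.IsManifold.isOpen_isFace (hX : X.IsManifold) (hc : c ∈ X.charts n) (i : Fin n) :
    IsOpen {p : BoundaryPt X | IsFace c i p} := by
  rw [isOpen_iff_mem_nhds]
  intro p hp
  obtain ⟨ε, h, _⟩ := c.exists_good hp.1 univ_mem
  have hopen : IsOpen {q : BoundaryPt X | ∃ h' : q.pt ∈ h.nhd.1,
      q.comp.comp ⟨h.nhd.1, h'⟩ = c.faceSet p.pt ε i} :=
    TopologicalSpace.isOpen_generateFrom_of_mem ⟨_, _, rfl⟩
  refine mem_of_superset (hopen.mem_nhds ⟨h.nhd.2, hX.comp_eq_faceSet hc hp h⟩) ?_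
  rintro q ⟨h', hq⟩
  have hqt := h'
  refine isFace_of_comp_subset hqt.1 ⟨hp.2.1, ?_⟩
    (hq.subset.trans CornerChart.Good.faceSet_subset)
  have hcl := q.comp.mem_closure ⟨h.nhd.1, h'⟩
  rw [hq] at hcl
  by_contra hne
  have := (c.continuousAt_coord hqt.1 i).eventually_ne hne
  obtain ⟨z, hz, hz'⟩ := mem_closure_iff_nhds.1 hcl _ this
  have hmem : i ∈ c.act z := by rw [hz'.2]; rfl
  exact hz hmem.2

lemma CSpace.IsManifold.tendsto_boundary (hX : X.IsManifold) (hc : c ∈ X.charts n)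
    (hp : IsFace c i p) {ι : Type*} {l : Filter ι} {h : ι → BoundaryPt X} :
    Tendsto h l (𝓝 p) ↔ Tendsto (fun a => (h a).pt) l (𝓝 p.pt) ∧
      ∀ᶠ a in l, IsFace c i (h a) := by
  refine ⟨fun H => ⟨(continuous_pt.tendsto p).comp H,
    H.eventually ((hX.isOpen_isFace hc i).mem_nhds hp)⟩, fun ⟨H, H'⟩ => ?_⟩
  rw [TopologicalSpace.tendsto_nhds_generateFrom_iff]
  rintro _ ⟨V, W, rfl⟩ ⟨hpV, hpW⟩
  obtain ⟨ε, hg, hV⟩ := c.exists_good hp.1 (V.2.mem_nhds hpV)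
  filter_upwards [H', H.eventually ((c.isOpen_ballNhd p.pt ε).mem_nhds hg.mem_ballNhd)]
    with a h1 h2
  refine ⟨hV h2, ?_⟩
  rw [← hpW]
  exact hX.comp_eq_of_isFace hc hpV (hV h2) hp h1 hg hV h2

lemma CSpace.IsManifold.eventually_boundary (hX : X.IsManifold) (hc : c ∈ X.charts n)
    (hp : IsFace c i p) {T : Set (BoundaryPt X)} (hT : T ∈ 𝓝 p) :
    ∀ᶠ y in 𝓝 p.pt, c.invFun y i = 0 → ∃ q ∈ T, q.pt = y ∧ IsFace c i q := by
  have key : ∀ y, ∃ q : BoundaryPt X, y ∈ c.target → c.invFun y i = 0 →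
      q.pt = y ∧ IsFace c i q := by
    intro y
    by_cases h : y ∈ c.target ∧ c.invFun y i = 0
    · obtain ⟨q, hq⟩ := hX.exists_boundaryPt hc h.1 ⟨hp.2.1, h.2⟩
      exact ⟨q, fun _ _ => hq⟩
    · exact ⟨p, fun h1 h2 => absurd ⟨h1, h2⟩ h⟩
  choose q hq using key
  have ht : Tendsto q (𝓝[{y | y ∈ c.target ∧ c.invFun y i = 0}] p.pt) (𝓝 p) := by
    rw [hX.tendsto_boundary hc hp]
    constructor
    · refine Tendsto.congr' ?_ (tendsto_id.mono_left nhdsWithin_le_nhds)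
      filter_upwards [self_mem_nhdsWithin] with y hy using ((hq y hy.1 hy.2).1).symm
    · filter_upwards [self_mem_nhdsWithin] with y hy using (hq y hy.1 hy.2).2
  have h1 := ht.eventually hT
  rw [eventually_nhdsWithin_iff] at h1
  filter_upwards [h1, c.eventually_target hp.1] with y h2 h3 h4
  exact ⟨q y, h2 ⟨h3, h4⟩, hq y h3 h4⟩

/-! ### Change of chart -/

lemma CSpace.IsManifold.isFace_of_pullAt (hX : X.IsManifold) (hc : c ∈ X.charts n)
    (hd : d ∈ X.charts n) (hp : IsFace c i p) (hpd : p.pt ∈ d.target) (hjk : (j : ℕ) < d.k)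
    (h : PullAt (fun y => d.invFun y j) c p.pt i) : IsFace d j p := by
  obtain ⟨j', hj'⟩ := hX.exists_isFace hd hpd
  obtain ⟨ε, hg, hV⟩ := c.exists_good hp.1 h.zero
  obtain ⟨y, hy, a, ⟨ha, ha0, ha'⟩, rfl⟩ := closure_nonempty_iff.1 ⟨_, hj'.2.2.2 hg.nhd⟩
  rw [hX.comp_eq_faceSet hc hp hg] at hy
  have hmem : i ∈ c.act (d.toFun a) := by rw [hy.2]; rfl
  have h2 := (hV hy.1).2 hmem.2
  rw [d.invTo ha] at h2
  have : j = j' := by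
    by_contra hne
    exact ha' j hne hjk h2
  exact this ▸ hj'

lemma CSpace.IsManifold.pullAt_of_isFace (hX : X.IsManifold) (hc : c ∈ X.charts n)
    (hd : d ∈ X.charts n) (hp : IsFace c i p) (hj : IsFace d j p)
    : PullAt (fun y => d.invFun y j) c p.pt i := by
  obtain ⟨i', hi'⟩ := (hX.compatible n c hc d hd).face hp.1 hj.1 hj.mem_act
  obtain ⟨p', hp', hf⟩ := hX.exists_boundaryPt hc hp.1 hi'.act
  rw [← hp'] at hi'
  have := hX.isFace_of_pullAt hc hd hf (hp' ▸ hj.1) hj.2.1 hi'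
  have : p' = p := hX.isFace_inj hd this hj hp'
  subst this
  rw [hX.isFace_unique hc hp hf]
  exact hi'

/-! ### Boundary defining functions -/

lemma smoothOn_comp_iff {F : Type*} [NormedAddCommGroup F] [NormedSpace ℝ F]
    {A : Type u} [TopologicalSpace A] {c : 𝒞 n A} {V : Set A}
    (hV : IsOpen V) {b : A → F} :
    SmoothOn (b ∘ c.toFun) (c.source ∩ c.toFun ⁻¹' V) ↔
      ∀ x ∈ c.target, x ∈ V → ∃ G, RepF b c x G := by
  rw [smoothOn_iff]
  have hnhds : ∀ x ∈ c.target, x ∈ V →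
      𝓝[c.source ∩ c.toFun ⁻¹' V] (c.invFun x) = 𝓝[c.source] (c.invFun x) := fun x hx hxV => by
    refine le_antisymm (nhdsWithin_mono _ inter_subset_left) ?_
    refine nhdsWithin_le_iff.2 (inter_mem self_mem_nhdsWithin ?_)
    exact (c.eventually_iff hx).1 (hV.mem_nhds hxV)
  constructor
  · intro h x hx hxV
    obtain ⟨G, hG, h1⟩ := h (c.invFun x) ⟨c.mapT hx, by rw [mem_preimage, c.toInv hx]; exact hxV⟩
    rw [hnhds x hx hxV] at h1
    refine ⟨G, hx, hG, ?_⟩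
    rw [c.eventually_iff hx]
    filter_upwards [h1, self_mem_nhdsWithin] with a h2 h3
    rw [c.invTo h3]; exact h2
  · rintro h a ⟨ha, haV⟩
    obtain ⟨G, hG⟩ := h _ (c.mapS ha) haV
    have h1 := hG.smooth
    have h2 := (c.eventually_iff (c.mapS ha)).1 hG.eq
    have h3 := hnhds _ (c.mapS ha) haV
    rw [c.invTo ha] at h1 h2 h3
    refine ⟨G, h1, ?_⟩
    rw [h3]
    filter_upwards [h2, self_mem_nhdsWithin] with a' h4 h5
    rw [c.invTo h5] at h4
    exact h4

lemma CSpace.IsManifold.isBDF_iff (hX : X.IsManifold) (hc : c ∈ X.charts n) (hp : IsFace c i p)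
    {V : Set X} {b : X → ℝ} : IsBDF X V b p ↔
      IsOpen V ∧ p.pt ∈ V ∧ (∀ x ∈ V, 0 ≤ b x) ∧
      (∀ x ∈ V, ∀ m, ∀ d ∈ X.charts m, x ∈ d.target → ∃ G, RepF b d x G) ∧
      PullAt b c p.pt i := by
  constructor
  · intro h
    have hrep := fun x hx m d hd hxd => (smoothOn_comp_iff h.isOpen).1 (h.smooth m d hd) x hxd hx
    refine ⟨h.isOpen, h.mem, h.nonneg, hrep, ?_⟩
    obtain ⟨G, hG⟩ := hrep _ h.mem n c hc hp.1
    refine hG.pullAt hp.mem_act ((h.isOpen.eventually_mem h.mem).mono h.nonneg) ?_ ?_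
    · obtain ⟨T, hT, hpT, hT0, -⟩ := h.exists_nhd
      filter_upwards [hX.eventually_boundary hc hp (hT.mem_nhds hpT)] with y hy hy'
      obtain ⟨q, hq, rfl, _⟩ := hy hy'
      exact (hT0 q hq).2
    · obtain ⟨m, d, hd, hpd, hne⟩ := h.deriv_ne_zero
      obtain rfl := hX.dim_unique hc hd
      obtain ⟨H, hH⟩ := hrep _ h.mem _ d hd hpd
      rw [hH.fderivWithin_eq] at hne
      obtain ⟨τ, hτ⟩ := (hX.compatible _ d hd c hc).rep hpd hp.1
      rw [hH.fderiv_unique (RepF.comp hG hτ), RepF.fderiv_comp (f := id) hG hτ] at hne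
      intro h0
      apply hne
      change (fderiv ℝ G (c.invFun p.pt)).comp _ = 0
      rw [h0, ContinuousLinearMap.zero_comp]
  · rintro ⟨hV, hpV, hnn, hrep, hpull⟩
    refine ⟨hV, hpV, hnn, fun m d hd => (smoothOn_comp_iff hV).2
      fun x hx hxV => hrep x hxV m d hd hx, ⟨n, c, hc, hp.1, ?_⟩, ?_⟩
    · obtain ⟨G, μ, hG, hμ, h1⟩ := hpull.rep
      rw [hG.fderivWithin_eq]
      intro h0
      have := h1 (Pi.single i 1)
      rw [h0] at this
      simp at this
      exact hμ.ne this
    · obtain ⟨U, hU, hUo, hpU⟩ := eventually_nhds_iff.1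
        ((hpull.zero.and (hV.eventually_mem hpV)).and (c.eventually_target hp.1))
      refine ⟨{q | IsFace c i q ∧ q.pt ∈ U}, (hX.isOpen_isFace hc i).inter
        (hUo.preimage continuous_pt), ⟨hp, hpU⟩, fun q hq => ⟨(hU _ hq.2).1.2,
          (hU _ hq.2).1.1.2 hq.1.2.2.1⟩, ⟨?_, ?_⟩, U, hUo, ?_⟩
      · rw [isInducing_iff_nhds]
        intro q
        refine le_antisymm
          (continuous_pt.comp continuous_subtype_val).continuousAt.le_comap ?_
        rw [nhds_subtype, ← tendsto_iff_comap, hX.tendsto_boundary hc q.2.1]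
        exact ⟨tendsto_comap, .of_forall fun a => a.2.1⟩
      · exact fun q q' h => Subtype.ext (hX.isFace_inj hc q.2.1 q'.2.1 h)
      · ext y
        constructor
        · rintro ⟨q, hq, rfl⟩
          exact ⟨hq.2, (hU _ hq.2).1.2, (hU _ hq.2).1.1.2 hq.1.2.2.1⟩
        · rintro ⟨hy, hyV, hy0⟩
          have h1 := hU y hy
          obtain ⟨q, rfl, hq'⟩ := hX.exists_boundaryPt hc h1.2 ⟨hp.2.1, h1.1.1.1 hy0⟩
          exact ⟨q, ⟨hq', hy⟩, rfl⟩

lemma CSpace.IsManifold.isBDF_coord (hX : X.IsManifold) (hc : c ∈ X.charts n) (hp : IsFace c i p)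
    : IsBDF X c.target (fun y => c.invFun y i) p := by
  rw [hX.isBDF_iff hc hp]
  refine ⟨c.target_open, hp.1, fun x hx => c.nonneg hx hp.2.1, fun x hx m d hd hxd => ?_,
    pullAt_coord hp.1 hp.mem_act⟩
  obtain rfl := hX.dim_unique hc hd
  obtain ⟨G, hG⟩ := (hX.compatible _ d hd c hc).rep hxd hx
  exact ⟨_, hG.coord i⟩

end

/-! ### Smooth maps -/

section
variable {X : CSpace.{u}} {Y : CSpace.{v}} {f : X → Y}

variable {m n : ℕ} {c : 𝒞 m X} {d : 𝒞 n Y}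

lemma weaklySmooth_iff : WeaklySmooth X Y f ↔ Continuous f ∧
    ∀ m, ∀ c ∈ X.charts m, ∀ n, ∀ d ∈ Y.charts n, ∀ x ∈ c.target, f x ∈ d.target →
      ∃ G, Rep f c d x G := by
  refine and_congr_right fun hf => ?_
  have : ∀ m, ∀ c ∈ X.charts m, ∀ n, ∀ d ∈ Y.charts n,
      (SmoothOn (d.invFun ∘ f ∘ c.toFun) (c.source ∩ (f ∘ c.toFun) ⁻¹' d.target) ↔
      ∀ x ∈ c.target, f x ∈ d.target → ∃ G, Rep f c d x G) := by
    intro m c _ n d _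
    have h := smoothOn_comp_iff (c := c) (d.target_open.preimage hf)
      (b := fun y => d.invFun (f y))
    refine h.trans (forall₃_congr fun x hx hfx => exists_congr fun G => ?_)
    exact ⟨fun h => ⟨h, hfx, hf.continuousAt⟩, fun h => h.repF⟩
  exact forall₂_congr fun m c => forall_congr' fun hc => forall₂_congr fun n d =>
    forall_congr' fun hd => this m c hc n d hd

lemma CSpace.IsManifold.smC_of_smooth (hX : X.IsManifold) (hY : Y.IsManifold) (h : Smooth X Y f)
    (hc : c ∈ X.charts m) (hd : d ∈ Y.charts n) {x : X} (hx : x ∈ c.target) (hfx : f x ∈ d.target)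
    : SmC f c d x := by
  refine ⟨(weaklySmooth_iff.1 h.1).2 m c hc n d hd x hx hfx, fun j hj => ?_⟩
  obtain ⟨⟨y, β⟩, hy, hq⟩ := hY.exists_boundaryPt hd hfx hj
  obtain rfl : y = f x := hy
  rcases h.2 x β _ _ (hY.isBDF_coord hd hq) with h0 | ⟨β', hβ', _⟩
  · exact Or.inl h0
  · obtain ⟨i, hi⟩ := hX.exists_isFace hc (p := ⟨x, β'⟩) hx
    exact Or.inr ⟨i, ((hX.isBDF_iff hc hi).1 hβ').2.2.2.2⟩

lemma CSpace.IsManifold.smooth_of_smC (hX : X.IsManifold) (hY : Y.IsManifold)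
    (h : ∀ x, ∃ m, ∃ c ∈ X.charts m, ∃ n, ∃ d ∈ Y.charts n, SmC f c d x) : Smooth X Y f := by
  have hcont : Continuous f := continuous_iff_continuousAt.2 fun x => by
    obtain ⟨m, c, hc, n, d, hd, hs⟩ := h x
    exact hs.cont
  have all : ∀ x, ∀ m, ∀ c ∈ X.charts m, ∀ n, ∀ d ∈ Y.charts n, x ∈ c.target → f x ∈ d.target →
      SmC f c d x := by
    intro x m c hc n d hd hx hfx
    obtain ⟨m', c', hc', n', d', hd', hs⟩ := h x
    obtain rfl := hX.dim_unique hc hc'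
    obtain rfl := hY.dim_unique hd hd'
    exact hs.change (hX.compatible _ c hc c' hc') (hY.compatible _ d' hd' d hd) hx hfx
  refine ⟨weaklySmooth_iff.2 ⟨hcont, fun m c hc n d hd x hx hfx =>
    (all x m c hc n d hd hx hfx).rep⟩, fun x β V b hb => ?_⟩
  obtain ⟨m, c, hc, hx⟩ := hX.cover x
  obtain ⟨n, d, hd, hfx⟩ := hY.cover (f x)
  obtain ⟨j, hj⟩ := hY.exists_isFace hd (p := ⟨f x, β⟩) hfx
  obtain ⟨hV, hpV, hnn, hrep, hpull⟩ := (hY.isBDF_iff hd hj).1 hb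
  have hpull : PullAt b d (f x) j := hpull
  rcases hpull.comp (all x m c hc n d hd hx hfx) with h0 | ⟨i, hi⟩
  · exact Or.inl h0
  · right
    obtain ⟨⟨x', β'⟩, hx', hp⟩ := hX.exists_boundaryPt hc hx hi.act
    obtain rfl : x' = x := hx'
    refine ⟨β', (hX.isBDF_iff hc hp).2 ⟨hV.preimage hcont, hpV, fun y hy => hnn _ hy, ?_, hi⟩,
      fun β'' hβ'' => ?_⟩
    · intro y hy m' c' hc' hyc
      obtain ⟨n', d', hd', hyd⟩ := hY.cover (f y)
      obtain ⟨G, hG⟩ := hrep (f y) hy n' d' hd' hyd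
      obtain ⟨H, hH⟩ := (all y m' c' hc' n' d' hd' hyc hyd).rep
      exact ⟨_, hG.comp hH⟩
    · obtain ⟨i', hi'⟩ := hX.exists_isFace hc (p := ⟨x', β''⟩) hx
      obtain rfl := hi.unique (((hX.isBDF_iff hc hi').1 hβ'').2.2.2.2)
      have := hX.isFace_inj hc hi' hp rfl
      cases this
      rfl

lemma Smooth.continuous (h : Smooth X Y f) : Continuous f := h.1.1

lemma Smooth.comp' {Z : CSpace.{w}} {g : Y → Z} (hX : X.IsManifold) (hY : Y.IsManifold)
    (hZ : Z.IsManifold) (hg : Smooth Y Z g) (hf : Smooth X Y f) : Smooth X Z (g ∘ f) := by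
  refine hX.smooth_of_smC hZ fun x => ?_
  obtain ⟨m, c, hc, hx⟩ := hX.cover x
  obtain ⟨n, d, hd, hfx⟩ := hY.cover (f x)
  obtain ⟨l, e, he, hgx⟩ := hZ.cover (g (f x))
  exact ⟨m, c, hc, l, e, he, (hY.smC_of_smooth hZ hg hd he hfx hgx).comp
    (hX.smC_of_smooth hY hf hc hd hx hfx)⟩

lemma xiMinus_iff (hX : X.IsManifold) (hY : Y.IsManifold) (hf : Smooth X Y f) (hc : c ∈ X.charts m)
    (hd : d ∈ Y.charts n) {p : BoundaryPt X} {q : BoundaryPt Y} {i : Fin m} {j : Fin n}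
    (hp : IsFace c i p) (hq : IsFace d j q) : XiMinus X Y f p q ↔ f p.pt = q.pt ∧
      PullAt (fun y => d.invFun (f y) j) c p.pt i := by
  refine and_congr_right fun hpq => ?_
  have hfp := hpq ▸ hq.1
  have hs := hX.smC_of_smooth hY hf hc hd hp.1 hfp
  obtain ⟨G, hG⟩ := hs.rep
  constructor
  · rintro ⟨V, b, hb, hb'⟩
    have h1 := ((hY.isBDF_iff hd hq).1 hb).2.2.2.2
    have h2 := ((hX.isBDF_iff hc hp).1 hb').2.2.2.2
    rw [← hpq] at h1
    rcases hs.face j h1.act with h0 | ⟨i', hi'⟩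
    · refine absurd ?_ h2.not_eventually_zero
      filter_upwards [h0, hf.continuous.continuousAt.eventually h1.zero] with y h3 h4
      exact h4.2 h3
    · obtain rfl := (h1.comp_rep hG hi').unique h2
      exact hi'
  · intro h
    refine ⟨d.target, fun y => d.invFun y j, hY.isBDF_coord hd hq, ?_⟩
    rw [hX.isBDF_iff hc hp]
    refine ⟨d.target_open.preimage hf.continuous, hfp, fun x hx => d.nonneg hx hq.2.1,
      fun x hx m' c' hc' hxc => ?_, h⟩
    obtain ⟨G, hG⟩ := (hX.smC_of_smooth hY hf hc' hd hxc hx).rep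
    exact ⟨_, hG.coord j⟩

end

/-! ### Paracompactness -/

section
variable {A : Type u} {B : Type v} [TopologicalSpace A] [TopologicalSpace B]

lemma finite_sigma_fst {ι : Type*} {κ : ι → Type*} [∀ i, Finite (κ i)] {F : Set ι}
    (hF : F.Finite) : {x : Σ i, κ i | x.1 ∈ F}.Finite := by
  refine (hF.biUnion fun i _ => Set.finite_range (Sigma.mk i)).subset ?_
  rintro ⟨i, k⟩ hi
  exact mem_biUnion hi ⟨k, rfl⟩

lemma paracompactSpace_of_finite_fibres {A B : Type u} [TopologicalSpace A] [TopologicalSpace B]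
    [ParacompactSpace B] {f : A → B} (hf : Continuous f)
    (hfin : ∀ b, (f ⁻¹' {b}).Finite)
    (h : ∀ b, ∀ U : Set A, IsOpen U → f ⁻¹' {b} ⊆ U → ∀ᶠ y in 𝓝 b, f ⁻¹' {y} ⊆ U) :
    ParacompactSpace A := by
  refine ⟨fun α s ho hc => ?_⟩
  have step : ∀ b, ∃ (t : Finset α) (N : Set B), IsOpen N ∧ b ∈ N ∧ f ⁻¹' N ⊆ ⋃ a ∈ t, s a := by
    intro b
    obtain ⟨t, ht⟩ := (hfin b).isCompact.elim_finite_subcover s ho (by rw [hc]; exact subset_univ _)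
    obtain ⟨N, hN, hNo, hb⟩ := eventually_nhds_iff.1
      (h b _ (isOpen_biUnion fun a _ => ho a) ht)
    exact ⟨t, N, hNo, hb, fun y hy => hN (f y) hy rfl⟩
  choose t N hNo hbN hN using step
  obtain ⟨v, hvo, hvc, hvl, hvs⟩ := precise_refinement N hNo
    (eq_univ_of_forall fun b => mem_iUnion.2 ⟨b, hbN b⟩)
  refine ⟨Σ b : B, t b, fun x => f ⁻¹' v x.1 ∩ s x.2, fun x => ((hvo _).preimage hf).inter (ho _),
    eq_univ_of_forall fun y => ?_, fun y => ?_, fun x => ⟨x.2, inter_subset_right⟩⟩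
  · obtain ⟨b, hb⟩ := mem_iUnion.1 (hvc.symm ▸ mem_univ (f y) : f y ∈ ⋃ i, v i)
    obtain ⟨a, ha, hya⟩ := mem_iUnion₂.1 (hN b (hvs b hb : y ∈ f ⁻¹' N b))
    exact mem_iUnion.2 ⟨⟨b, ⟨a, ha⟩⟩, hb, hya⟩
  · obtain ⟨W, hW, hfW⟩ := hvl (f y)
    refine ⟨f ⁻¹' W, hf.continuousAt hW, (finite_sigma_fst hfW).subset ?_⟩
    rintro x ⟨z, hz, hz'⟩
    exact ⟨f z, hz.1, hz'⟩

lemma paracompactSpace_prod [ParacompactSpace A] [WeaklyLocallyCompactSpace A]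
    [ParacompactSpace B] : ParacompactSpace (A × B) := by
  refine ⟨fun α s ho hc => ?_⟩
  choose K hK hKn using fun a : A => exists_compact_mem_nhds a
  obtain ⟨u, huo, huc, hul, hus⟩ := precise_refinement (fun a => interior (K a))
    (fun _ => isOpen_interior)
    (eq_univ_of_forall fun a => mem_iUnion.2 ⟨a, mem_interior_iff_mem_nhds.2 (hKn a)⟩)
  have step : ∀ a b, ∃ (t : Finset α) (V : Set B), IsOpen V ∧ b ∈ V ∧
      K a ×ˢ V ⊆ ⋃ i ∈ t, s i := by
    intro a b
    obtain ⟨t, ht⟩ := ((hK a).prod isCompact_singleton).elim_finite_subcover s ho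
      (by rw [hc]; exact subset_univ (K a ×ˢ {b}))
    obtain ⟨U, V, hU, hV, hKU, hbV, hsub⟩ := generalized_tube_lemma (hK a) isCompact_singleton
      (isOpen_biUnion fun i (_ : i ∈ t) => ho i) ht
    exact ⟨t, V, hV, hbV rfl, (prod_mono_left hKU).trans hsub⟩
  choose t V hVo hbV hV using step
  choose v hvo hvc hvl hvs using fun a => precise_refinement (V a) (hVo a)
    (eq_univ_of_forall fun b => mem_iUnion.2 ⟨b, hbV a b⟩)
  refine ⟨Σ x : A × B, t x.1 x.2, fun x => (u x.1.1 ×ˢ v x.1.1 x.1.2) ∩ s x.2,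
    fun x => ((huo _).prod (hvo _ _)).inter (ho _),
    eq_univ_of_forall fun y => ?_, fun y => ?_, fun x => ⟨x.2, inter_subset_right⟩⟩
  · obtain ⟨a, ha⟩ := mem_iUnion.1 (huc.symm ▸ mem_univ y.1 : y.1 ∈ ⋃ i, u i)
    obtain ⟨b, hb⟩ := mem_iUnion.1 ((hvc a).symm ▸ mem_univ y.2 : y.2 ∈ ⋃ i, v a i)
    obtain ⟨i, hi, hyi⟩ := mem_iUnion₂.1
      (hV a b (mk_mem_prod (interior_subset (hus a ha)) (hvs a b hb)))
    exact mem_iUnion.2 ⟨⟨(a, b), ⟨i, hi⟩⟩, ⟨ha, hb⟩, hyi⟩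
  · obtain ⟨W, hW, hfW⟩ := hul y.1
    choose W' hW' hfW' using fun a => hvl a y.2
    refine ⟨W ×ˢ ⋂ a ∈ {a | (u a ∩ W).Nonempty}, W' a,
      prod_mem_nhds hW ((biInter_mem hfW).2 fun a _ => hW' a), ?_⟩
    have hfin : (⋃ a ∈ {a | (u a ∩ W).Nonempty},
        Prod.mk a '' {b | (v a b ∩ W' a).Nonempty}).Finite :=
      hfW.biUnion fun a _ => (hfW' a).image _
    refine (finite_sigma_fst hfin).subset ?_
    rintro ⟨⟨a, b⟩, i⟩ ⟨z, ⟨⟨hz1, hz2⟩, _⟩, hz3, hz4⟩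
    have ha : (u a ∩ W).Nonempty := ⟨z.1, hz1, hz3⟩
    exact mem_biUnion ha ⟨b, ⟨z.2, hz2, mem_iInter₂.1 hz4 a ha⟩, rfl⟩

end

lemma CSpace.IsManifold.weaklyLocallyCompactSpace {X : CSpace.{u}} (hX : X.IsManifold) :
    WeaklyLocallyCompactSpace X := by
  refine ⟨fun x => ?_⟩
  obtain ⟨n, c, hc, hx⟩ := hX.cover x
  obtain ⟨ε, hg, -⟩ := c.exists_good hx univ_mem
  refine ⟨c.toFun '' (Metric.closedBall (c.invFun x) (ε / 2) ∩ quadrant n c.k), ?_, ?_⟩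
  · refine IsCompact.image_of_continuousOn
      ((isCompact_closedBall _ _).inter_right (isClosed_quadrant _ _))
      (c.continuousOn_toFun.mono fun a ha => hg.sub ⟨?_, ha.2⟩)
    exact Metric.closedBall_subset_ball (half_lt_self hg.pos) ha.1
  · refine mem_of_superset ((c.isOpen_ballNhd x (ε / 2)).mem_nhds
      ⟨hx, Metric.mem_ball_self (half_pos hg.pos)⟩) fun y hy => ?_
    exact ⟨c.invFun y, ⟨Metric.ball_subset_closedBall hy.2,
      c.source_subset_quadrant (c.mapT hy.1)⟩, c.toInv hy.1⟩

/-! ### Atlases -/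

section
variable {A : Type u} [TopologicalSpace A] {m n : ℕ}

variable {c : 𝒞 m A} {d : 𝒞 n A}

lemma smoothGraph_overlap :
    SmoothGraph (fun s t => s ∈ c.source ∧ t ∈ d.source ∧ c.toFun s = d.toFun t) ↔
      ∀ x ∈ c.target, x ∈ d.target → ∃ G, Rep (id : A → A) c d x G := by
  rw [smoothGraph_iff]
  constructor
  · intro h x hc hd
    obtain ⟨G, hG, h1⟩ := h (c.invFun x) (d.invFun x)
      ⟨c.mapT hc, d.mapT hd, by rw [c.toInv hc, d.toInv hd]⟩
    refine ⟨G, ⟨hc, hG, ?_⟩, hd, continuousAt_id⟩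
    filter_upwards [(c.continuousAt_invFun hc).eventually h1, c.eventually_target hc,
      d.eventually_target hd] with y h2 h3 h4
    exact h2 _ ⟨c.mapT h3, d.mapT h4, by rw [id, c.toInv h3, d.toInv h4]⟩
  · rintro h a b ⟨ha, hb, hab⟩
    obtain ⟨G, hG⟩ := h _ (c.mapS ha) (hab ▸ d.mapS hb)
    have h1 := hG.smooth
    have h2 := (c.eventually_iff (c.mapS ha)).1 hG.eq
    rw [c.invTo ha] at h1 h2
    rw [eventually_nhdsWithin_iff] at h2
    refine ⟨G, h1, ?_⟩
    filter_upwards [h2] with a' h3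
    rintro b' ⟨h4, h5, h6⟩
    have := h3 h4
    rw [c.invTo h4, id, h6, d.invTo h5] at this
    exact this

lemma compatible_iff_overlap : Compatible c d ↔
    SmoothGraph (fun s t => s ∈ c.source ∧ t ∈ d.source ∧ c.toFun s = d.toFun t) ∧
    SmoothGraph (fun t s => s ∈ c.source ∧ t ∈ d.source ∧ c.toFun s = d.toFun t) := by
  have : (fun t s => s ∈ c.source ∧ t ∈ d.source ∧ c.toFun s = d.toFun t) =
      (fun t s => t ∈ d.source ∧ s ∈ c.source ∧ d.toFun t = c.toFun s) := by
    funext t s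
    rw [eq_comm (a := c.toFun s), ← and_assoc, ← and_assoc, and_comm (a := s ∈ c.source)]
  rw [this, smoothGraph_overlap, smoothGraph_overlap, compatible_iff]
  exact ⟨fun h => ⟨fun x h1 h2 => (h x h1 h2).1, fun x h1 h2 => (h x h2 h1).2⟩,
    fun h x h1 h2 => ⟨h.1 x h1 h2, h.2 x h2 h1⟩⟩

lemma isManifold_of_atlas (S : CSpace.{u}) (ht : T2Space S) (hp : ParacompactSpace S)
    (𝒜 : ∀ n, Set (𝒞 n S)) (hdim : ∀ n, ∀ c ∈ 𝒜 n, (n : ℤ) = S.dim)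
    (hcover : ∀ x : S, ∃ n, ∃ c ∈ 𝒜 n, x ∈ c.target)
    (hcompat : ∀ n, ∀ c ∈ 𝒜 n, ∀ d ∈ 𝒜 n, Compatible c d)
    (hcharts : ∀ n d, d ∈ S.charts n ↔ (n : ℤ) = S.dim ∧ ∀ c ∈ 𝒜 n, Compatible c d) :
    S.IsManifold ∧ ∀ n, 𝒜 n ⊆ S.charts n := by
  have hsub : ∀ n, 𝒜 n ⊆ S.charts n := fun n c hc =>
    (hcharts n c).2 ⟨hdim n c hc, fun d hd => hcompat n d hd c hc⟩
  refine ⟨⟨ht, hp, fun n c hc => ((hcharts n c).1 hc).1, fun x => ?_, fun n c hc d hd => ?_,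
    fun n d hn h => (hcharts n d).2 ⟨hn, fun c hc => h c (hsub n hc)⟩⟩, hsub⟩
  · obtain ⟨n, c, hc, hx⟩ := hcover x
    exact ⟨n, c, hsub n hc, hx⟩
  · rw [compatible_iff]
    intro x hxc hxd
    obtain ⟨m, e, he, hxe⟩ := hcover x
    have : m = n := by exact_mod_cast (hdim m e he).trans ((hcharts n c).1 hc).1.symm
    subst this
    have h1 := ((hcharts m c).1 hc).2 e he
    have h2 := ((hcharts m d).1 hd).2 e he
    obtain ⟨G, hG⟩ := h1.symm.rep hxc hxe
    obtain ⟨H, hH⟩ := h2.rep hxe hxd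
    obtain ⟨G', hG'⟩ := h1.rep hxe hxc
    obtain ⟨H', hH'⟩ := h2.symm.rep hxd hxe
    exact ⟨⟨_, Rep.comp (f := id) hH hG⟩, ⟨_, Rep.comp (f := id) hG' hH'⟩⟩

lemma CSpace.IsManifold.mem_charts {X : CSpace.{u}} (hX : X.IsManifold) {d : 𝒞 n X}
    (h : ∀ x ∈ d.target, ∃ c ∈ X.charts n, x ∈ c.target ∧ (∃ G, Rep (id : X → X) c d x G) ∧
      ∃ G, Rep (id : X → X) d c x G) : d ∈ X.charts n := by
  have hn : (n : ℤ) = X.dim := by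
    obtain ⟨a, ha⟩ := d.source_nonempty
    obtain ⟨c, hc, _⟩ := h _ (d.mapS ha)
    exact hX.dim_eq n c hc
  refine hX.maximal n d hn fun e he => compatible_iff.2 fun x hxe hxd => ?_
  obtain ⟨c, hc, hxc, ⟨G, hG⟩, ⟨H, hH⟩⟩ := h x hxd
  obtain ⟨τ, hτ⟩ := (hX.compatible n e he c hc).rep hxe hxc
  obtain ⟨σ, hσ⟩ := (hX.compatible n c hc e he).rep hxc hxe
  exact ⟨⟨_, Rep.comp (f := id) hG hτ⟩, ⟨_, Rep.comp (f := id) hσ hH⟩⟩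

end

/-! ### Open embeddings -/

section
variable {A : Type u} {B : Type v} {C : Type w} [TopologicalSpace A] [TopologicalSpace B]
  [TopologicalSpace C] {m n : ℕ}

/-- The chart `c` followed by an open embedding. -/
def CornerChart.push (c : 𝒞 n A) {e : A → B} (he : IsOpenEmbedding e) :
    𝒞 n B where
  toFun a := e (c.toFun a)
  invFun := extend e c.invFun 0
  source := c.source
  target := e '' c.target
  map_source' _ ha := ⟨_, c.mapS ha, rfl⟩
  map_target' := by
    rintro _ ⟨x, hx, rfl⟩
    rw [he.injective.extend_apply]
    exact c.mapT hx
  left_inv' a ha := by rw [he.injective.extend_apply]; exact c.invTo ha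
  right_inv' := by
    rintro _ ⟨x, hx, rfl⟩
    rw [he.injective.extend_apply, c.toInv hx]
  k := c.k
  k_le := c.k_le
  source_nonempty := c.source_nonempty
  source_open := c.source_open
  target_open := he.isOpenMap _ c.target_open
  continuousOn_toFun := he.continuous.comp_continuousOn c.continuousOn_toFun
  continuousOn_invFun := by
    rintro _ ⟨x, hx, rfl⟩
    refine ContinuousAt.continuousWithinAt ?_
    rw [ContinuousAt, he.injective.extend_apply, ← he.map_nhds_eq, tendsto_map'_iff,
      show extend e c.invFun 0 ∘ e = c.invFun from
        funext fun y => he.injective.extend_apply _ _ _]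
    exact c.continuousAt_invFun hx

variable {e : A → B} {x : A}

lemma CornerChart.push_invFun (c : 𝒞 n A) (he : IsOpenEmbedding e) (x : A) :
    (c.push he).invFun (e x) = c.invFun x := he.injective.extend_apply _ _ _

/-- The restriction of a chart to the source of an open embedding. -/
def CornerChart.pull (c : 𝒞 n B) {e : A → B} (he : IsOpenEmbedding e)
    (hne : ∃ x, e x ∈ c.target) : 𝒞 n A where
  toFun a := @invFun A B ⟨hne.choose⟩ e (c.toFun a)
  invFun x := c.invFun (e x)
  source := c.source ∩ c.toFun ⁻¹' range e
  target := e ⁻¹' c.target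
  map_source' := by
    rintro a ⟨ha, x, hx⟩
    have : e x ∈ c.target := by rw [hx]; exact c.mapS ha
    rw [← hx, @leftInverse_invFun _ _ ⟨hne.choose⟩ _ he.injective]
    exact this
  map_target' x hx := ⟨c.mapT hx, by rw [mem_preimage, c.toInv hx]; exact ⟨x, rfl⟩⟩
  left_inv' := by
    rintro a ⟨ha, x, hx⟩
    rw [← hx, @leftInverse_invFun _ _ ⟨hne.choose⟩ _ he.injective, hx, c.invTo ha]
  right_inv' x hx := by
    rw [c.toInv hx, @leftInverse_invFun _ _ ⟨hne.choose⟩ _ he.injective]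
  k := c.k
  k_le := c.k_le
  source_nonempty := by
    obtain ⟨x, hx⟩ := hne
    exact ⟨c.invFun (e x), c.mapT hx, by rw [mem_preimage, c.toInv hx]; exact ⟨x, rfl⟩⟩
  source_open := by
    obtain ⟨O, hO, h⟩ := c.source_open
    obtain ⟨O', hO', h'⟩ := continuousOn_iff'.1 c.continuousOn_toFun _ he.isOpen_range
    refine ⟨O ∩ O', hO.inter hO', ?_⟩
    rw [inter_comm, h', h, inter_comm O', inter_assoc, inter_assoc, inter_comm O']
  target_open := c.target_open.preimage he.continuous
  continuousOn_toFun := by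
    rw [he.isInducing.continuousOn_iff]
    refine (c.continuousOn_toFun.mono inter_subset_left).congr ?_
    rintro a ⟨ha, x, hx⟩
    rw [comp_apply, ← hx, @leftInverse_invFun _ _ ⟨hne.choose⟩ _ he.injective]
  continuousOn_invFun := c.continuousOn_invFun.comp he.continuous.continuousOn fun x hx => hx

/-- The chart `c'` is near `x` the image of the chart `c` under the open embedding `e`. -/
structure LiftAt (e : A → B) (c : 𝒞 n A) (c' : 𝒞 n B) (x : A) : Prop where
  emb : IsOpenEmbedding e
  mem : x ∈ c.target
  mem' : e x ∈ c'.target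
  eq : ∀ᶠ y in 𝓝 x, c'.invFun (e y) = c.invFun y

lemma liftAt_push (c : 𝒞 n A) (he : IsOpenEmbedding e) (hx : x ∈ c.target)
    : LiftAt e c (c.push he) x :=
  ⟨he, hx, ⟨x, hx, rfl⟩, .of_forall fun y => c.push_invFun he y⟩

lemma liftAt_pull (c : 𝒞 n B) (he : IsOpenEmbedding e) (hne : ∃ x, e x ∈ c.target)
    (hx : e x ∈ c.target) : LiftAt e (c.pull he hne) c x :=
  ⟨he, hx, hx, .of_forall fun _ => rfl⟩

namespace LiftAt
variable {e : A → B} {c : 𝒞 n A} {c' : 𝒞 n B} {x : A}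

variable {f : B → C} {d : 𝒞 m C} {z : C}

lemma apply (h : LiftAt e c c' x) : c'.invFun (e x) = c.invFun x := h.eq.self_of_nhds

lemma act (h : LiftAt e c c' x) (hk : c.k = c'.k) : c'.act (e x) = c.act x := by
  ext i; simp only [CornerChart.act, mem_ofPred_eq, h.apply, hk]

lemma eventually_iff (h : LiftAt e c c' x) {P : B → Prop} :
    (∀ᶠ y in 𝓝 (e x), P y) ↔ ∀ᶠ y in 𝓝 x, P (e y) := by
  rw [← h.emb.map_nhds_eq, eventually_map]

lemma rep (h : LiftAt e c c' x) : Rep e c c' x id :=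
  ⟨⟨h.mem, ContDiff.germSmooth contDiff_id _, h.eq⟩, h.mem', h.emb.continuous.continuousAt⟩

lemma repF_iff {F : Type*} [NormedAddCommGroup F] [NormedSpace ℝ F] (h : LiftAt e c c' x)
    {b : B → F} {G} : RepF b c' (e x) G ↔ RepF (fun y => b (e y)) c x G := by
  refine ⟨fun h1 => h1.comp h.rep, fun h1 => ⟨h.mem', h.apply.symm ▸ h1.smooth, ?_⟩⟩
  rw [h.eventually_iff]
  filter_upwards [h1.eq, h.eq] with y h2 h3
  rw [h2, h3]

lemma rep_iff (h : LiftAt e c c' x) {G} :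
    Rep f c' d (e x) G ↔ Rep (fun y => f (e y)) c d x G := by
  refine ⟨fun h1 => h1.comp h.rep, fun h1 => ⟨h.repF_iff.2 h1.repF, h1.mem', ?_⟩⟩
  rw [ContinuousAt, ← h.emb.map_nhds_eq, tendsto_map'_iff]
  exact h1.cont

lemma rep_iff' {f : C → A} (h : LiftAt e c c' (f z)) {G} :
    Rep f d c z G ↔ Rep (fun y => e (f y)) d c' z G := by
  refine ⟨fun h1 => Rep.comp (H := id) h.rep h1, fun h1 => ?_⟩
  have hc := h.emb.isInducing.continuousAt_iff.2 h1.cont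
  refine ⟨⟨h1.mem, h1.smooth, ?_⟩, h.mem, hc⟩
  filter_upwards [h1.eq, hc.eventually h.eq] with y h2 h3
  rw [← h3, h2]

lemma pullAt_iff (h : LiftAt e c c' x) (hk : c.k = c'.k) {b : B → ℝ} {i : Fin n} :
    PullAt b c' (e x) i ↔ PullAt (fun y => b (e y)) c x i := by
  constructor
  · rintro ⟨h1, h2, h3, G, μ, hG, hμ, h4⟩
    refine ⟨h.act hk ▸ h1, h.eventually_iff.1 h2, ?_, G, μ, h.repF_iff.1 hG, hμ, ?_⟩
    · filter_upwards [h.eventually_iff.1 h3, h.eq] with y h5 h6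
      rw [h5, h6]
    · rwa [h.apply] at h4
  · rintro ⟨h1, h2, h3, G, μ, hG, hμ, h4⟩
    refine ⟨(h.act hk).symm ▸ h1, h.eventually_iff.2 h2, ?_, G, μ, h.repF_iff.2 hG, hμ, ?_⟩
    · rw [h.eventually_iff]
      filter_upwards [h3, h.eq] with y h5 h6
      rw [h5, h6]
    · rwa [h.apply]

lemma smC (h : LiftAt e c c' x) (hk : c.k = c'.k) : SmC e c c' x := by
  refine ⟨⟨_, h.rep⟩, fun j hj => Or.inr ⟨j, ?_⟩⟩
  exact (h.pullAt_iff hk).1 (pullAt_coord h.mem' hj)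

lemma smC_iff (h : LiftAt e c c' x) (hk : c.k = c'.k) :
    SmC f c' d (e x) ↔ SmC (fun y => f (e y)) c d x := by
  refine ⟨fun h1 => h1.comp (h.smC hk), fun h1 => ?_⟩
  obtain ⟨G, hG⟩ := h1.rep
  refine ⟨⟨G, h.rep_iff.2 hG⟩, fun j hj => ?_⟩
  rcases h1.face j hj with h2 | ⟨i, hi⟩
  · exact Or.inl (h.eventually_iff.2 h2)
  · exact Or.inr ⟨i, (h.pullAt_iff hk).2 hi⟩

lemma chartDeriv_eq {G} (h : LiftAt e c c' x) (hf : Rep f c' d (e x) G) :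
    𝒟 f c' d (e x) = 𝒟 (fun y => f (e y)) c d x := by
  rw [hf.chartDeriv_eq, (h.rep_iff.1 hf).chartDeriv_eq, h.apply]

lemma chartDeriv_eq' {f : C → A} {G} (h : LiftAt e c c' (f z)) (hf : Rep f d c z G) :
    𝒟 (fun y => e (f y)) d c' z = 𝒟 f d c z := by
  rw [hf.chartDeriv_eq, (h.rep_iff'.1 hf).chartDeriv_eq]

end LiftAt

lemma Compatible.push {c d : 𝒞 n A} (h : Compatible c d) (he : IsOpenEmbedding e)
    : Compatible (c.push he) (d.push he) := by
  have key : ∀ {c d : 𝒞 n A}, Compatible c d → ∀ x ∈ c.target, x ∈ d.target →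
      ∃ G, Rep (id : B → B) (c.push he) (d.push he) (e x) G := by
    intro c d h x hxc hxd
    obtain ⟨G, hG⟩ := h.rep hxc hxd
    exact ⟨G, (liftAt_push c he hxc).rep_iff.2
      ((LiftAt.rep_iff' (liftAt_push d he hxd)).1 hG)⟩
  rw [compatible_iff]
  rintro _ ⟨x, hx, rfl⟩ ⟨x', hx', h'⟩
  obtain rfl := he.injective h'
  exact ⟨key h x' hx hx', key h.symm x' hx' hx⟩

end

section
variable {A : Type u} {B : Type v} [TopologicalSpace A] [TopologicalSpace B] {m n : ℕ}

variable {c d : 𝒞 n A} {x : A} {e : A → B}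

lemma rep_of_invFun_eq (hc : x ∈ c.target) (hd : x ∈ d.target)
    (h : ∀ᶠ y in 𝓝 x, d.invFun y = c.invFun y) : Rep (id : A → A) c d x id :=
  ⟨⟨hc, ContDiff.germSmooth contDiff_id _, h⟩, hd, continuousAt_id⟩

lemma Compatible.of_push (he : IsOpenEmbedding e) (h : Compatible (c.push he) (d.push he))
    : Compatible c d := by
  have key : ∀ {c d : 𝒞 n A}, Compatible (c.push he) (d.push he) →
      ∀ x ∈ c.target, x ∈ d.target → ∃ G, Rep (id : A → A) c d x G := by
    intro c d h x hxc hxd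
    obtain ⟨G, hG⟩ := h.rep ⟨x, hxc, rfl⟩ ⟨x, hxd, rfl⟩
    exact ⟨G, (LiftAt.rep_iff' (liftAt_push d he hxd)).2
      ((liftAt_push c he hxc).rep_iff.1 hG)⟩
  exact compatible_iff.2 fun x hx hx' => ⟨key h x hx hx', key h.symm x hx' hx⟩

lemma push_pull_rep (c : 𝒞 n B) (he : IsOpenEmbedding e) (hne : ∃ x, e x ∈ c.target)
    (hx : e x ∈ c.target) :
    Rep (id : B → B) c ((c.pull he hne).push he) (e x) id ∧
    Rep (id : B → B) ((c.pull he hne).push he) c (e x) id := by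
  have h1 : ∀ᶠ y in 𝓝 (e x), ((c.pull he hne).push he).invFun y = c.invFun y := by
    rw [← he.map_nhds_eq, eventually_map]
    exact .of_forall fun y => CornerChart.push_invFun _ he y
  exact ⟨rep_of_invFun_eq hx ⟨x, hx, rfl⟩ h1,
    rep_of_invFun_eq ⟨x, hx, rfl⟩ hx (h1.mono fun _ h => h.symm)⟩

end

/-! ### Open subspaces -/

/-- An open embedding that sends charts to charts. -/
structure Etale (A : CSpace.{u}) (B : CSpace.{v}) (e : A → B) : Prop where
  emb : IsOpenEmbedding e
  charts : ∀ n, ∀ c ∈ A.charts n, c.push emb ∈ B.charts n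

section
variable {X : CSpace.{u}} {S : Set X}

lemma CSpace.IsManifold.mem_restrict_charts (hX : X.IsManifold) (hS : IsOpen S) {n : ℕ}
    {d : 𝒞 n (X.restrict S)} : d ∈ (X.restrict S).charts n ↔
      d.push hS.isOpenEmbedding_subtypeVal ∈ X.charts n := by
  refine ⟨?_, fun h => ⟨_, h, rfl, fun _ _ => rfl⟩⟩
  rintro ⟨c, hc, hs, ht⟩
  refine hX.mem_charts fun x hx => ?_
  have key : ∀ z ∈ (d.push hS.isOpenEmbedding_subtypeVal).target, z ∈ c.target ∧
      (d.push hS.isOpenEmbedding_subtypeVal).invFun z = c.invFun z := by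
    rintro _ ⟨y, hy, rfl⟩
    have h1 := ht _ (d.mapT hy)
    have h2 := hs ▸ d.mapT hy
    rw [d.toInv hy] at h1
    refine ⟨h1 ▸ c.mapS h2, ?_⟩
    rw [d.push_invFun, ← h1, c.invTo h2]
  have hev := (CornerChart.eventually_target _ hx).mono fun z hz => (key z hz).2
  exact ⟨c, hc, (key x hx).1, ⟨_, rep_of_invFun_eq (key x hx).1 hx hev⟩,
    ⟨_, rep_of_invFun_eq hx (key x hx).1 (hev.mono fun _ h => h.symm)⟩⟩

lemma CSpace.IsManifold.pull_mem_restrict (hX : X.IsManifold) (hS : IsOpen S) {n : ℕ}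
    {c : 𝒞 n X} (hc : c ∈ X.charts n) (hne : ∃ x : S, (x : X) ∈ c.target) :
    c.pull hS.isOpenEmbedding_subtypeVal hne ∈ (X.restrict S).charts n := by
  rw [hX.mem_restrict_charts hS]
  refine hX.mem_charts ?_
  rintro _ ⟨x, hx, rfl⟩
  obtain ⟨h1, h2⟩ := push_pull_rep c hS.isOpenEmbedding_subtypeVal hne hx
  exact ⟨c, hc, hx, ⟨_, h1⟩, ⟨_, h2⟩⟩

lemma CSpace.IsManifold.restrict (hX : X.IsManifold) (hS : IsClopen S) :
    (X.restrict S).IsManifold := by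
  have := hX.t2
  have := hX.paracompact
  have hval := hS.isOpen.isOpenEmbedding_subtypeVal
  refine ⟨inferInstanceAs (T2Space S), hS.isClosed.isClosedEmbedding_subtypeVal.paracompactSpace,
    fun n d hd => hX.dim_eq n _ ((hX.mem_restrict_charts hS.isOpen).1 hd), fun x => ?_,
    fun n c hc d hd => ?_, fun n d hn h => ?_⟩
  · obtain ⟨n, c, hc, hx⟩ := hX.cover x.1
    exact ⟨n, _, hX.pull_mem_restrict hS.isOpen hc ⟨x, hx⟩, hx⟩
  · rw [hX.mem_restrict_charts hS.isOpen] at hc hd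
    exact (hX.compatible n _ hc _ hd).of_push hval
  · rw [hX.mem_restrict_charts hS.isOpen]
    refine hX.mem_charts ?_
    rintro _ ⟨x, hx, rfl⟩
    obtain ⟨m, c, hc, hxc⟩ := hX.cover x.1
    have : m = n := by exact_mod_cast (hX.dim_eq m c hc).trans hn.symm
    subst this
    have hp := h _ (hX.pull_mem_restrict hS.isOpen hc ⟨x, hxc⟩)
    obtain ⟨G, hG⟩ := hp.rep hxc hx
    obtain ⟨H, hH⟩ := hp.symm.rep hx hxc
    have hl := liftAt_pull c hval ⟨x, hxc⟩ hxc
    have hl' := liftAt_push d hval hx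
    exact ⟨c, hc, hxc, ⟨G, hl.rep_iff.2 ((LiftAt.rep_iff' (f := id) hl').1 hG)⟩,
      ⟨H, hl'.rep_iff.2 ((LiftAt.rep_iff' (f := id) hl).1 hH)⟩⟩

lemma CSpace.IsManifold.etale_restrict (hX : X.IsManifold) (hS : IsOpen S) :
    Etale (X.restrict S) X Subtype.val :=
  ⟨hS.isOpenEmbedding_subtypeVal, fun _ _ h => (hX.mem_restrict_charts hS).1 h⟩

lemma CSpace.IsManifold.etale_id (hX : X.IsManifold) : Etale X X id := by
  refine ⟨IsOpenEmbedding.id, fun n c hc => hX.mem_charts ?_⟩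
  rintro _ ⟨x, hx, rfl⟩
  have h1 : ∀ᶠ y in 𝓝 x, (c.push IsOpenEmbedding.id).invFun y = c.invFun y :=
    .of_forall fun y => c.push_invFun IsOpenEmbedding.id y
  exact ⟨c, hc, hx, ⟨_, rep_of_invFun_eq hx ⟨x, hx, rfl⟩ h1⟩,
    ⟨_, rep_of_invFun_eq ⟨x, hx, rfl⟩ hx (h1.mono fun _ h => h.symm)⟩⟩

lemma Etale.smooth {A : CSpace.{u}} {B : CSpace.{v}} {e : A → B} (he : Etale A B e)
    (hA : A.IsManifold) (hB : B.IsManifold) : Smooth A B e := by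
  refine hA.smooth_of_smC hB fun x => ?_
  obtain ⟨n, c, hc, hx⟩ := hA.cover x
  exact ⟨n, c, hc, n, _, he.charts n c hc, (liftAt_push c he.emb hx).smC rfl⟩

end

/-! ### Disjoint unions -/

section
variable {A : CSpace.{u}} {B : CSpace.{v}}

lemma sum_isManifold (hA : A.IsManifold) (hB : B.IsManifold) (h : A.dim = B.dim) :
    (A.sum B).IsManifold ∧ Etale A (A.sum B) Sum.inl ∧ Etale B (A.sum B) Sum.inr := by
  have := hA.t2
  have := hB.t2
  have := hA.paracompact
  have := hB.paracompact
  have hl : IsOpenEmbedding (Sum.inl : A → A ⊕ B) := IsOpenEmbedding.inl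
  have hr : IsOpenEmbedding (Sum.inr : B → A ⊕ B) := IsOpenEmbedding.inr
  have hpc : ParacompactSpace (A ⊕ B) := by
    refine ⟨fun α s ho hc => ?_⟩
    obtain ⟨v1, hvo1, hvc1, hvl1, hvs1⟩ := precise_refinement _ (fun a => (ho a).preimage
        continuous_inl) (by rw [← preimage_iUnion, hc, preimage_univ])
    obtain ⟨v2, hvo2, hvc2, hvl2, hvs2⟩ := precise_refinement _ (fun a => (ho a).preimage
        continuous_inr) (by rw [← preimage_iUnion, hc, preimage_univ])
    refine ⟨α, fun a => Sum.inl '' v1 a ∪ Sum.inr '' v2 a, fun a =>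
      (hl.isOpenMap _ (hvo1 a)).union (hr.isOpenMap _ (hvo2 a)), ?_, ?_, fun a => ⟨a, ?_⟩⟩
    · refine eq_univ_of_forall fun x => ?_
      rcases x with x | x
      · obtain ⟨a, ha⟩ := mem_iUnion.1 (hvc1.symm ▸ mem_univ x : x ∈ ⋃ i, v1 i)
        exact mem_iUnion.2 ⟨a, Or.inl ⟨x, ha, rfl⟩⟩
      · obtain ⟨a, ha⟩ := mem_iUnion.1 (hvc2.symm ▸ mem_univ x : x ∈ ⋃ i, v2 i)
        exact mem_iUnion.2 ⟨a, Or.inr ⟨x, ha, rfl⟩⟩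
    · rintro (x | x)
      · obtain ⟨N, hN, hf⟩ := hvl1 x
        refine ⟨Sum.inl '' N, hl.isOpenMap.image_mem_nhds hN, hf.subset ?_⟩
        rintro a ⟨_, h1, y, hy, rfl⟩
        rcases h1 with ⟨z, hz, hz'⟩ | ⟨z, hz, hz'⟩
        · obtain rfl := Sum.inl_injective hz'
          exact ⟨z, hz, hy⟩
        · cases hz'
      · obtain ⟨N, hN, hf⟩ := hvl2 x
        refine ⟨Sum.inr '' N, hr.isOpenMap.image_mem_nhds hN, hf.subset ?_⟩
        rintro a ⟨_, h1, y, hy, rfl⟩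
        rcases h1 with ⟨z, hz, hz'⟩ | ⟨z, hz, hz'⟩
        · cases hz'
        · obtain rfl := Sum.inr_injective hz'
          exact ⟨z, hz, hy⟩
    · rintro _ (⟨z, hz, rfl⟩ | ⟨z, hz, rfl⟩)
      · exact hvs1 a hz
      · exact hvs2 a hz
  have main := isManifold_of_atlas (A.sum B) (inferInstanceAs (T2Space (A ⊕ B))) hpc
    (fun n => (fun c => c.push hl) '' A.charts n ∪ (fun c => c.push hr) '' B.charts n)
    ?_ ?_ ?_ ?_
  · exact ⟨main.1, ⟨hl, fun n c hc => main.2 n (Or.inl ⟨c, hc, rfl⟩)⟩,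
      ⟨hr, fun n c hc => main.2 n (Or.inr ⟨c, hc, rfl⟩)⟩⟩
  · rintro n _ (⟨c, hc, rfl⟩ | ⟨c, hc, rfl⟩)
    · exact hA.dim_eq n c hc
    · exact (hB.dim_eq n c hc).trans h.symm
  · rintro (x | x)
    · obtain ⟨n, c, hc, hx⟩ := hA.cover x
      exact ⟨n, _, Or.inl ⟨c, hc, rfl⟩, ⟨x, hx, rfl⟩⟩
    · obtain ⟨n, c, hc, hx⟩ := hB.cover x
      exact ⟨n, _, Or.inr ⟨c, hc, rfl⟩, ⟨x, hx, rfl⟩⟩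
  · rintro n _ (⟨c, hc, rfl⟩ | ⟨c, hc, rfl⟩) _ (⟨d, hd, rfl⟩ | ⟨d, hd, rfl⟩)
    · exact (hA.compatible n c hc d hd).push hl
    · refine compatible_iff.2 ?_
      rintro _ ⟨x, hx, rfl⟩ ⟨y, hy, h'⟩
      cases h'
    · refine compatible_iff.2 ?_
      rintro _ ⟨x, hx, rfl⟩ ⟨y, hy, h'⟩
      cases h'
    · exact (hB.compatible n c hc d hd).push hr
  · intro n d
    have e1 : ∀ c : 𝒞 n A, Compatible (c.push hl) d ↔
        SmoothGraph (fun s t : Fin n → ℝ =>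
          s ∈ d.source ∧ t ∈ c.source ∧ d.toFun s = Sum.inl (c.toFun t)) ∧
        SmoothGraph (fun t s : Fin n → ℝ =>
          s ∈ d.source ∧ t ∈ c.source ∧ d.toFun s = Sum.inl (c.toFun t)) := fun c =>
      ⟨fun h => compatible_iff_overlap.1 h.symm,
        fun h => (compatible_iff_overlap.2 h).symm⟩
    have e2 : ∀ c : 𝒞 n B, Compatible (c.push hr) d ↔
        SmoothGraph (fun s t : Fin n → ℝ =>
          s ∈ d.source ∧ t ∈ c.source ∧ d.toFun s = Sum.inr (c.toFun t)) ∧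
        SmoothGraph (fun t s : Fin n → ℝ =>
          s ∈ d.source ∧ t ∈ c.source ∧ d.toFun s = Sum.inr (c.toFun t)) := fun c =>
      ⟨fun h => compatible_iff_overlap.1 h.symm,
        fun h => (compatible_iff_overlap (c := d).2 h).symm⟩
    constructor
    · rintro ⟨hn, h1, h2⟩
      refine ⟨hn, ?_⟩
      rintro _ (⟨c, hc, rfl⟩ | ⟨c, hc, rfl⟩)
      · exact (e1 c).2 (h1 c hc)
      · exact (e2 c).2 (h2 c hc)
    · rintro ⟨hn, h1⟩
      exact ⟨hn, fun c hc => (e1 c).1 (h1 _ (Or.inl ⟨c, hc, rfl⟩)),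
        fun c hc => (e2 c).1 (h1 _ (Or.inr ⟨c, hc, rfl⟩))⟩

end

/-! ### Domains of charts -/

section
variable {n : ℕ} {A : Type u} [TopologicalSpace A]

/-- The tautological chart on the domain of a chart. -/
def CornerChart.dom (c : 𝒞 n A) : 𝒞 n c.source where
  toFun a := open Classical in if h : a ∈ c.source then ⟨a, h⟩ else
    ⟨c.source_nonempty.choose, c.source_nonempty.choose_spec⟩
  invFun a := a
  source := c.source
  target := univ
  map_source' _ _ := mem_univ _
  map_target' a _ := a.2
  left_inv' a ha := by simp [ha]
  right_inv' a _ := by simp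
  k := c.k
  k_le := c.k_le
  source_nonempty := c.source_nonempty
  source_open := c.source_open
  target_open := isOpen_univ
  continuousOn_toFun := by
    rw [IsInducing.subtypeVal.continuousOn_iff]
    exact continuousOn_id.congr fun a ha => by simp [ha]
  continuousOn_invFun := continuous_subtype_val.continuousOn

lemma domain_isManifold (c : 𝒞 n A) :
    (CSpace.domain n c.source).IsManifold ∧ c.dom ∈ (CSpace.domain n c.source).charts n := by
  have main := isManifold_of_atlas (CSpace.domain n c.source)
    (inferInstanceAs (T2Space c.source)) (inferInstanceAs (ParacompactSpace c.source))
    (fun m => {e | ∃ h : m = n, h ▸ e = c.dom}) ?_ ?_ ?_ ?_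
  · exact ⟨main.1, main.2 n ⟨rfl, rfl⟩⟩
  · rintro m e ⟨rfl, -⟩; rfl
  · exact fun x => ⟨n, c.dom, ⟨rfl, rfl⟩, mem_univ _⟩
  · rintro m d ⟨rfl, rfl⟩ e ⟨_, rfl⟩; exact compatible_self _
  · intro m e
    have key : ∀ e : 𝒞 n c.source, Compatible c.dom e ↔
        SmoothOn (fun a => (e.toFun a : ℝ^n)) e.source ∧
        SmoothGraph fun (b : ℝ^n) (a : ℝ^n) =>
          ∃ h : b ∈ c.source, (⟨b, h⟩ : c.source) ∈ e.target ∧ e.invFun ⟨b, h⟩ = a := by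
      intro e
      rw [compatible_iff_overlap, and_comm, SmoothOn]
      have dval : ∀ s (hs : s ∈ c.source), c.dom.toFun s = ⟨s, hs⟩ := fun s hs => by
        simp [CornerChart.dom, hs]
      have h1 : (fun (t s : ℝ^n) => s ∈ c.dom.source ∧ t ∈ e.source ∧
          c.dom.toFun s = e.toFun t) = fun a b => a ∈ e.source ∧ (e.toFun a : ℝ^n) = b := by
        funext t s
        refine propext ⟨?_, ?_⟩
        · rintro ⟨hs, ht, h⟩
          refine ⟨ht, ?_⟩
          rw [← h, dval s hs]
        · rintro ⟨ht, h⟩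
          have hs := h ▸ (e.toFun t).2
          exact ⟨hs, ht, by rw [dval s hs]; exact Subtype.ext h.symm⟩
      have h2 : (fun (s t : ℝ^n) => s ∈ c.dom.source ∧ t ∈ e.source ∧
          c.dom.toFun s = e.toFun t) = fun b a => ∃ h : b ∈ c.source,
            (⟨b, h⟩ : c.source) ∈ e.target ∧ e.invFun ⟨b, h⟩ = a := by
        funext s t
        refine propext ⟨?_, ?_⟩
        · rintro ⟨hs, ht, h⟩
          rw [dval s hs] at h
          exact ⟨hs, h ▸ e.mapS ht, by rw [h, e.invTo ht]⟩
        · rintro ⟨hs, ht, h⟩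
          exact ⟨hs, h ▸ e.mapT ht, by rw [dval s hs, ← h, e.toInv ht]⟩
      rw [h1, h2]
    constructor
    · rintro ⟨rfl, h⟩
      refine ⟨rfl, ?_⟩
      rintro d ⟨_, rfl⟩
      exact (key e).2 h
    · rintro ⟨hm, h⟩
      have hm : m = n := by
        have h' : (m : ℤ) = (n : ℤ) := hm
        exact_mod_cast h'
      subst hm
      exact ⟨rfl, (key e).1 (h c.dom ⟨rfl, rfl⟩)⟩

lemma dom_liftAt (c : 𝒞 n A) (a : c.source) :
    IsOpenEmbedding (fun a : c.source => c.toFun a) ∧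
    LiftAt (fun a : c.source => c.toFun a) c.dom c a := by
  have he : IsOpenEmbedding (fun a : c.source => c.toFun a) := by
    refine ⟨⟨?_, fun a b h => ?_⟩, ?_⟩
    · rw [isInducing_iff_nhds]
      intro a
      refine le_antisymm (map_le_iff_le_comap.1 ?_) ?_
      · exact (continuousOn_iff_continuous_domRestrict.1 c.continuousOn_toFun).continuousAt
      · rw [nhds_subtype, ← tendsto_iff_comap]
        have h1 := c.continuousAt_invFun (c.mapS a.2)
        rw [ContinuousAt, c.invTo a.2] at h1
        refine (h1.comp tendsto_comap).congr fun b => ?_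
        exact c.invTo b.2
    · have := congrArg c.invFun h
      simp only [c.invTo a.2, c.invTo b.2] at this
      exact Subtype.ext this
    · have : range (fun a : c.source => c.toFun a) = c.target := by
        ext x
        exact ⟨fun ⟨a, h⟩ => h ▸ c.mapS a.2, fun h => ⟨⟨_, c.mapT h⟩, c.toInv h⟩⟩
      rw [this]; exact c.target_open
  exact ⟨he, he, mem_univ _, c.mapS a.2, .of_forall fun b => c.invTo b.2⟩

end

/-! ### The boundary as a manifold with corners -/

section
variable {X : CSpace.{u}} {n : ℕ}

variable {a : ℝ^n} {t : ℝ^(n + 1)} {p : BoundaryPt X} {c : 𝒞 (n + 1) X} {i : Fin (n + 1)}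

lemma insertNth_mem_quadrant {k : ℕ} (hi : (i : ℕ) < k) :
    i.insertNth (α := fun _ => ℝ) 0 a ∈ quadrant (n + 1) k ↔ a ∈ quadrant n (k - 1) := by
  have hs : ∀ j : Fin n, ((i.succAbove j : Fin (n + 1)) : ℕ) < k ↔ (j : ℕ) < k - 1 := by
    intro j
    rw [Fin.succAbove]
    split_ifs with h
    · have h' : (j : ℕ) < i := h
      omega
    · simp only [Fin.val_succ]
      omega
  constructor
  · intro h j hj
    have := h (i.succAbove j) ((hs j).2 hj)
    rwa [Fin.insertNth_apply_succAbove] at this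
  · intro h j
    refine Fin.succAboveCases i (fun _ => ?_) (fun j hj => ?_) j
    · rw [Fin.insertNth_apply_same]
    · rw [Fin.insertNth_apply_succAbove]
      exact h j ((hs j).1 hj)

lemma continuous_insertNth (i : Fin (n + 1)) :
    Continuous fun a : Fin n → ℝ => i.insertNth (α := fun _ => ℝ) 0 a :=
  continuous_const.finInsertNth i continuous_id

/-- The inclusion of the hyperplane where the `i`-th coordinate vanishes. -/
def insL (i : Fin (n + 1)) : ℝ^n →L[ℝ] ℝ^(n + 1) :=
  LinearMap.toContinuousLinearMap
    { toFun := fun a => i.insertNth (α := fun _ => ℝ) 0 a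
      map_add' := fun a b => by
        funext j
        refine Fin.succAboveCases i ?_ (fun j => ?_) j <;> simp
      map_smul' := fun r a => by
        funext j
        refine Fin.succAboveCases i ?_ (fun j => ?_) j <;> simp }

@[simp] lemma insL_apply (i : Fin (n + 1)) (a : ℝ^n) :
    insL i a = i.insertNth (α := fun _ => ℝ) 0 a := rfl

lemma insL_same (i : Fin (n + 1)) (a : ℝ^n) : insL i a i = 0 := by simp

lemma insL_succAbove (i : Fin (n + 1)) (a : ℝ^n) (j : Fin n) :
    insL i a (i.succAbove j) = a j := by simp

lemma insL_injective (i : Fin (n + 1)) : Injective (insL i) := fun a b h => by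
  funext j
  rw [← insL_succAbove i a, h, insL_succAbove]

lemma exists_insL_eq (h : t i = 0) :
    insL i (i.removeNth t) = t := by
  rw [insL_apply, ← h, Fin.insertNth_self_removeNth]

lemma IsFace.lt {c : 𝒞 n X} {i : Fin n} (h : IsFace c i p) :
    (i : ℕ) < c.k := h.2.1

/-- The point of the boundary on the `i`-th face of a chart with the given remaining
coordinates. -/
def CSpace.IsManifold.facePt (hX : X.IsManifold) {c : 𝒞 (n + 1) X}
    (hc : c ∈ X.charts (n + 1)) {i : Fin (n + 1)} (hi : (i : ℕ) < c.k) (a : ℝ^n)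
    (h : i.insertNth (α := fun _ => ℝ) 0 a ∈ c.source) : BoundaryPt X :=
  (hX.exists_boundaryPt hc (c.mapS h) (i := i)
    ⟨hi, by rw [c.invTo h, Fin.insertNth_apply_same]⟩).choose

lemma CSpace.IsManifold.facePt_spec (hX : X.IsManifold) (hc : c ∈ X.charts (n + 1))
    (hi : (i : ℕ) < c.k) (a : ℝ^n) (h : i.insertNth (α := fun _ => ℝ) 0 a ∈ c.source) :
    (hX.facePt hc hi a h).pt = c.toFun (i.insertNth (α := fun _ => ℝ) 0 a) ∧
      IsFace c i (hX.facePt hc hi a h) :=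
  (hX.exists_boundaryPt hc (c.mapS h) (i := i)
    ⟨hi, by rw [c.invTo h, Fin.insertNth_apply_same]⟩).choose_spec

/-- The chart of the boundary induced by a face of a chart. -/
def CSpace.IsManifold.faceChart (hX : X.IsManifold) {c : 𝒞 (n + 1) X}
    (hc : c ∈ X.charts (n + 1)) (i : Fin (n + 1)) (p₀ : ∃ p, IsFace c i p) :
    𝒞 n (BoundaryPt X) where
  toFun a := open Classical in if h : i.insertNth (α := fun _ => ℝ) 0 a ∈ c.source then
      hX.facePt hc p₀.choose_spec.lt a h
    else p₀.choose
  invFun p := i.removeNth (c.invFun p.pt)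
  source := {a | i.insertNth (α := fun _ => ℝ) 0 a ∈ c.source}
  target := {p | IsFace c i p}
  map_source' a h := by
    simp only [mem_ofPred_eq] at h
    simp only [dif_pos h, mem_ofPred_eq]
    exact (hX.facePt_spec hc p₀.choose_spec.lt _ h).2
  map_target' p hp := by
    have := exists_insL_eq hp.mem_act.2
    rw [insL_apply] at this
    rw [mem_ofPred_eq, this]
    exact c.mapT hp.1
  left_inv' a h := by
    simp only [mem_ofPred_eq] at h
    simp only [dif_pos h]
    rw [(hX.facePt_spec hc p₀.choose_spec.lt _ h).1,
        c.invTo h, Fin.removeNth_insertNth]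
  right_inv' p hp := by
    have h1 := exists_insL_eq hp.mem_act.2
    rw [insL_apply] at h1
    have h : i.insertNth (α := fun _ => ℝ) 0 (i.removeNth (c.invFun p.pt)) ∈ c.source := by
      rw [h1]; exact c.mapT hp.1
    simp only [dif_pos h]
    have h2 := (hX.facePt_spec hc p₀.choose_spec.lt _ h)
    refine hX.isFace_inj hc h2.2 hp (h2.1.trans ?_)
    rw [h1, c.toInv hp.1]
  k := c.k - 1
  k_le := by have := c.k_le; omega
  source_nonempty := by
    refine ⟨i.removeNth (c.invFun p₀.choose.pt), ?_⟩
    have := exists_insL_eq p₀.choose_spec.mem_act.2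
    rw [insL_apply] at this
    rw [mem_ofPred_eq, this]
    exact c.mapT p₀.choose_spec.1
  source_open := by
    obtain ⟨O, hO, h⟩ := c.source_open
    refine ⟨_, hO.preimage (continuous_insertNth i), ?_⟩
    ext a
    rw [mem_ofPred_eq, h]
    exact and_congr_right fun _ => insertNth_mem_quadrant p₀.choose_spec.2.1
  target_open := hX.isOpen_isFace hc i
  continuousOn_toFun := by
    have key : ∀ a (h : i.insertNth (α := fun _ => ℝ) 0 a ∈ c.source), _ :=
      fun a h => (hX.facePt_spec hc p₀.choose_spec.lt _ h)
    classical
    have hto : ∀ a (h : i.insertNth (α := fun _ => ℝ) 0 a ∈ c.source),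
        (if h : i.insertNth (α := fun _ => ℝ) 0 a ∈ c.source then
          hX.facePt hc p₀.choose_spec.lt a h else p₀.choose) =
          hX.facePt hc p₀.choose_spec.lt a h := fun _ h => dif_pos h
    intro a h
    simp only [mem_ofPred_eq] at h
    rw [ContinuousWithinAt, hX.tendsto_boundary hc (i := i)]
    · simp only [dif_pos h]
      rw [(key a h).1]
      constructor
      · have h1 := (c.continuousOn_toFun _ h).comp (s := {a | i.insertNth (α := fun _ => ℝ) 0 a ∈
          c.source}) (continuous_insertNth i).continuousWithinAt (fun _ h => h)
        refine Tendsto.congr' ?_ h1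
        filter_upwards [self_mem_nhdsWithin] with a' ha'
        rw [comp_apply, hto a' ha']
        exact (key a' ha').1.symm
      · filter_upwards [self_mem_nhdsWithin] with a' ha'
        rw [hto a' ha']
        exact (key a' ha').2
    · simp only [dif_pos h]
      exact (key a h).2
  continuousOn_invFun := by
    intro p hp
    refine ContinuousAt.continuousWithinAt ?_
    have h1 : ContinuousAt (fun p : BoundaryPt X => c.invFun p.pt) p :=
      (c.continuousAt_invFun hp.1).comp continuous_pt.continuousAt
    exact continuousAt_pi.2 fun j => continuousAt_pi.1 h1 _

lemma CSpace.IsManifold.faceChart_eq_iff (hX : X.IsManifold) (hc : c ∈ X.charts (n + 1))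
    (p₀ : ∃ p, IsFace c i p) : FaceChart c i a p ↔
      a ∈ (hX.faceChart hc i p₀).source ∧ p = (hX.faceChart hc i p₀).toFun a := by
  refine and_congr_right fun h => ?_
  have h1 := (hX.faceChart hc i p₀).mapS h
  have h3 : ((hX.faceChart hc i p₀).toFun a).pt =
      c.toFun (i.insertNth 0 a) := by
    have h4 := exists_insL_eq (IsFace.mem_act h1).2
    have h5 : i.removeNth (c.invFun ((hX.faceChart hc i p₀).toFun a).pt) = a := (hX.faceChart hc i
        p₀).invTo h
    rw [h5, insL_apply] at h4
    rw [h4, c.toInv (IsFace.mem_act h1 |> fun _ => h1.1)]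
  constructor
  · rintro ⟨h4, h5⟩
    exact hX.isFace_inj hc h5 h1 (h4.trans h3.symm)
  · rintro rfl
    exact ⟨h3, h1⟩

lemma insL_contDiff (i : Fin (n + 1)) : ContDiff ℝ ∞ (insL i) := (insL i).contDiff

/-- The projection which omits the `i`-th coordinate. -/
def remL (i : Fin (n + 1)) : ℝ^(n + 1) →L[ℝ] ℝ^n :=
  ContinuousLinearMap.pi fun j => ContinuousLinearMap.proj (i.succAbove j)

@[simp] lemma remL_apply (i : Fin (n + 1)) (a : ℝ^(n + 1)) (j : Fin n) :
    remL i a j = a (i.succAbove j) := rfl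

lemma remL_insL (i : Fin (n + 1)) (a : ℝ^n) : remL i (insL i a) = a := by
  funext j; simp

lemma insL_remL (h : t i = 0) : insL i (remL i t) = t :=
  exists_insL_eq h

lemma CSpace.IsManifold.rep_incl (hX : X.IsManifold) (hc : c ∈ X.charts (n + 1))
    (p₀ : ∃ p, IsFace c i p) (hp : IsFace c i p) :
    Rep BoundaryPt.pt (hX.faceChart hc i p₀) c p (insL i) := by
  refine ⟨⟨hp, ContDiff.germSmooth (insL_contDiff i) _, ?_⟩, hp.1, continuous_pt.continuousAt⟩
  filter_upwards [(hX.isOpen_isFace hc i).mem_nhds hp] with q hq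
  exact (exists_insL_eq (IsFace.mem_act hq).2).symm

lemma CSpace.IsManifold.boundary_isManifold (hX : X.IsManifold) : X.boundary.IsManifold ∧
    ∀ n, ∀ c ∈ X.charts (n + 1), ∀ (hc : c ∈ X.charts (n + 1)) (i : Fin (n + 1))
      (p₀ : ∃ p, IsFace c i p), hX.faceChart hc i p₀ ∈ X.boundary.charts n := by
  have t2X := hX.t2
  have pcX := hX.paracompact
  have hdim : ∀ n (c : 𝒞 (n + 1) X), c ∈ X.charts (n + 1) → (n : ℤ) = X.dim - 1 := by
    intro n c hc
    have := hX.dim_eq _ c hc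
    push_cast at this
    omega
  have ht2 : T2Space (BoundaryPt X) := by
    refine ⟨fun p q hpq => ?_⟩
    by_cases h : p.pt = q.pt
    · obtain ⟨m, c, hc, hx⟩ := hX.cover p.pt
      obtain ⟨i, hi⟩ := hX.exists_isFace hc hx
      obtain ⟨j, hj⟩ := hX.exists_isFace hc (h ▸ hx)
      refine ⟨_, _, hX.isOpen_isFace hc i, hX.isOpen_isFace hc j, hi, hj, ?_⟩
      rw [disjoint_left]
      intro r hr hr'
      obtain rfl := hX.isFace_unique hc hr hr'
      exact hpq (hX.isFace_inj hc hi hj h)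
    · obtain ⟨U, V, hU, hV, hpU, hqV, hUV⟩ := t2_separation h
      exact ⟨_, _, hU.preimage continuous_pt, hV.preimage continuous_pt, hpU, hqV,
        hUV.preimage _⟩
  have hpc : ParacompactSpace (BoundaryPt X) := by
    refine paracompactSpace_of_finite_fibres continuous_pt (fun x => ?_) (fun x U hU hsub => ?_)
    · obtain ⟨m, c, hc, hx⟩ := hX.cover x
      choose i hi using fun p : {p : BoundaryPt X // p.pt = x} =>
        hX.exists_isFace hc (by rw [p.2]; exact hx)
      have : Finite {p : BoundaryPt X // p.pt = x} := by
        refine Finite.of_injective i fun p q hpq => Subtype.ext ?_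
        have h1 := hi p
        rw [hpq] at h1
        exact hX.isFace_inj hc h1 (hi q) (p.2.trans q.2.symm)
      exact (Set.finite_coe_iff).1 this
    · obtain ⟨m, c, hc, hx⟩ := hX.cover x
      have h1 : ∀ᶠ y in 𝓝 x, ∀ i ∈ c.act x, c.invFun y i = 0 →
          ∃ q ∈ U, q.pt = y ∧ IsFace c i q := by
        simp only [eventually_all]
        intro i hi
        obtain ⟨p, rfl, hp⟩ := hX.exists_boundaryPt hc hx hi
        exact hX.eventually_boundary hc hp (hU.mem_nhds (hsub rfl))
      filter_upwards [h1, c.eventually_act_subset hx, c.eventually_target hx] with y h2 h3 h4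
      rintro q rfl
      obtain ⟨i, hi⟩ := hX.exists_isFace hc h4
      obtain ⟨q', hq', h5, h6⟩ := h2 i (h3 hi.mem_act) hi.mem_act.2
      rwa [hX.isFace_inj hc hi h6 h5.symm]
  have main := isManifold_of_atlas X.boundary ht2 hpc
    (fun n => {d | ∃ c, ∃ (hc : c ∈ X.charts (n + 1)) (i : Fin (n + 1))
      (p₀ : ∃ p, IsFace c i p), d = hX.faceChart hc i p₀}) ?_ ?_ ?_ ?_
  · exact ⟨main.1, fun n c hc hc' i p₀ => main.2 n ⟨c, hc', i, p₀, rfl⟩⟩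
  · rintro n _ ⟨c, hc, i, p₀, rfl⟩
    exact hdim n c hc
  · intro p
    obtain ⟨m, c, hc, hx⟩ := hX.cover p.pt
    obtain ⟨i, hi⟩ := hX.exists_isFace hc hx
    obtain ⟨n, rfl⟩ : ∃ n, m = n + 1 := ⟨m - 1, by have := i.2; omega⟩
    exact ⟨n, _, ⟨c, hc, i, ⟨p, hi⟩, rfl⟩, hi⟩
  · have key : ∀ n (c : 𝒞 (n + 1) X) (hc : c ∈ X.charts (n + 1)) i
        (p₀ : ∃ p, IsFace c i p) (d : 𝒞 (n + 1) X) (hd : d ∈ X.charts (n + 1)) j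
        (q₀ : ∃ p, IsFace d j p), ∀ p, IsFace c i p → IsFace d j p →
        ∃ G, Rep (id : BoundaryPt X → BoundaryPt X) (hX.faceChart hc i p₀)
          (hX.faceChart hd j q₀) p G := by
      intro n c hc i p₀ d hd j q₀ p hp hq
      obtain ⟨τ, hτ⟩ := (hX.compatible _ c hc d hd).rep hp.1 hq.1
      have h1 : Rep BoundaryPt.pt (hX.faceChart hc i p₀) d p (τ ∘ insL i) :=
        Rep.comp (g := id) hτ (hX.rep_incl hc p₀ hp)
      refine ⟨fun a => remL j (τ (insL i a)), ⟨hp, ?_, ?_⟩, hq, continuousAt_id⟩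
      · exact (ContDiff.germSmooth (remL j).contDiff _).comp h1.smooth rfl
      · filter_upwards [h1.eq] with q hq'
        change remL j (d.invFun q.pt) = _
        rw [hq']; rfl
    rintro n _ ⟨c, hc, i, p₀, rfl⟩ _ ⟨d, hd, j, q₀, rfl⟩
    exact compatible_iff.2 fun p hp hq =>
      ⟨key n c hc i p₀ d hd j q₀ p hp hq, key n d hd j q₀ c hc i p₀ p hq hp⟩
  · intro n d
    have e1 : ∀ c (hc : c ∈ X.charts (n + 1)) i (p₀ : ∃ p, IsFace c i p),
        Compatible (hX.faceChart hc i p₀) d ↔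
        SmoothGraph (fun s t : Fin n → ℝ => s ∈ d.source ∧ FaceChart c i t (d.toFun s)) ∧
        SmoothGraph (fun t s : Fin n → ℝ => s ∈ d.source ∧ FaceChart c i t (d.toFun s)) := by
      intro c hc i p₀
      simp only [hX.faceChart_eq_iff hc p₀]
      exact ⟨fun h => compatible_iff_overlap.1 h.symm,
        fun h => (compatible_iff_overlap.2 h).symm⟩
    constructor
    · rintro ⟨hn, h1⟩
      refine ⟨hn, ?_⟩
      rintro _ ⟨c, hc, i, p₀, rfl⟩
      exact (e1 c hc i p₀).2 (h1 c hc i p₀.choose_spec.2.1)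
    · rintro ⟨hn, h1⟩
      refine ⟨hn, fun c hc i hi => ?_⟩
      by_cases p₀ : ∃ p, IsFace c i p
      · exact (e1 c hc i p₀).1 (h1 _ ⟨c, hc, i, p₀, rfl⟩)
      · have hno : ∀ t p, ¬ FaceChart c i t p := fun t p h => p₀ ⟨p, h.2.2⟩
        constructor
        · rintro a b ⟨_, h⟩; exact absurd h (hno _ _)
        · rintro a b ⟨_, h⟩; exact absurd h (hno _ _)

lemma CSpace.IsManifold.boundary (hX : X.IsManifold) : X.boundary.IsManifold :=
  hX.boundary_isManifold.1

lemma CSpace.IsManifold.faceChart_mem (hX : X.IsManifold) (hc : c ∈ X.charts (n + 1))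
    (p₀ : ∃ p, IsFace c i p) : hX.faceChart hc i p₀ ∈ X.boundary.charts n :=
  hX.boundary_isManifold.2 n c hc hc i p₀

lemma CSpace.IsManifold.exists_faceChart (hX : X.IsManifold) (p : BoundaryPt X) :
    ∃ n, ∃ c ∈ X.charts (n + 1), ∃ i : Fin (n + 1), IsFace c i p := by
  obtain ⟨m, c, hc, hx⟩ := hX.cover p.pt
  obtain ⟨i, hi⟩ := hX.exists_isFace hc hx
  obtain ⟨n, rfl⟩ : ∃ n, m = n + 1 := ⟨m - 1, by have := i.2; omega⟩
  exact ⟨n, c, hc, i, hi⟩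

lemma faceChart_act (hX : X.IsManifold) (hc : c ∈ X.charts (n + 1))
    (p₀ : ∃ p, IsFace c i p) (p : BoundaryPt X) :
    (hX.faceChart hc i p₀).act p = {j | i.succAbove j ∈ c.act p.pt} := by
  ext j
  have h := insertNth_mem_quadrant p₀.choose_spec.2.1 (a := - Pi.single j 1)
  have hk : (j : ℕ) < c.k - 1 ↔ ((i.succAbove j : Fin (n + 1)) : ℕ) < c.k := by
    have hi := p₀.choose_spec.2.1
    rw [Fin.succAbove]
    split_ifs with h
    · have h' : (j : ℕ) < i := h
      omega
    · simp only [Fin.val_succ]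
      omega
  exact and_congr hk Iff.rfl

end

/-! ### Initial maps -/

/-- The maps `κ` and `κ'` jointly determine the smooth structure near `b`: they are jointly
immersive, and each face through `b` is the pullback of a face along one of them. -/
structure InitAt {P : Type*} {A : Type*} {B : Type*} [TopologicalSpace P] [TopologicalSpace A]
    [TopologicalSpace B] {n m l : ℕ} (κ : P → A) (κ' : P → B) (δ : 𝒞 n P)
    (c : 𝒞 m A) (d : 𝒞 l B) (b : P) : Prop where
  smC : SmC κ δ c b
  smC' : SmC κ' δ d b
  inj : ∀ t, 𝒟 κ δ c b t = 0 → 𝒟 κ' δ d b t = 0 → t = 0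
  face : ∀ r ∈ δ.act b, (∃ i ∈ c.act (κ b), PullAt (fun y => c.invFun (κ y) i) δ b r) ∨
    ∃ i ∈ d.act (κ' b), PullAt (fun y => d.invFun (κ' y) i) δ b r

section
variable {E F : Type*} [NormedAddCommGroup E] [NormedSpace ℝ E] [CompleteSpace E]
  [NormedAddCommGroup F] [NormedSpace ℝ F]

/-- The inverse function theorem for smooth germs. -/
lemma GermSmooth.exists_inverse {K : E → F} {a : E} (hK : GermSmooth K a) (e : E ≃L[ℝ] F)
    (he : fderiv ℝ K a = e) : ∃ φ : OpenPartialHomeomorph E F, a ∈ φ.source ∧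
      (∀ x ∈ φ.source, φ x = K x) ∧ (∀ y ∈ φ.target, ContDiffAt ℝ ∞ φ.symm y) ∧
      ∀ x ∈ φ.source, ContDiffAt ℝ ∞ K x := by
  have hd := he ▸ hK.differentiableAt.hasFDerivAt
  have h1 : ∀ᶠ x in 𝓝 a, ∃ e' : E ≃L[ℝ] F, (e' : E →L[ℝ] F) = fderiv ℝ K x := by
    have := hK.continuousAt_fderiv.eventually_mem (s := range ((↑) : (E ≃L[ℝ] F) → E →L[ℝ] F))
      (he ▸ ContinuousLinearEquiv.nhds e)
    exact this
  obtain ⟨U, hU, hUo, haU⟩ := eventually_nhds_iff.1 (hK.and h1)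
  let φ₀ := hK.at.toOpenPartialHomeomorph K hd (by simp)
  have hcoe := hK.at.toOpenPartialHomeomorph_coe hd (by simp)
  refine ⟨φ₀.restrOpen U hUo, ⟨(hK.at.mem_toOpenPartialHomeomorph_source hd (by simp)), haU⟩, fun x
      _ => congrFun hcoe x, fun y hy => ?_,
    fun x hx => (hU x hx.2).1⟩
  obtain ⟨h2, e', he'⟩ := hU _ ((φ₀.restrOpen U hUo).map_target hy).2
  have hcoe' : ((φ₀.restrOpen U hUo : OpenPartialHomeomorph E F) : E → F) = K := hcoe
  refine (φ₀.restrOpen U hUo).contDiffAt_symm (f₀' := e') hy ?_ ?_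
  · rw [he', hcoe']
    exact (h2.differentiableAt (by simp)).hasFDerivAt
  · rw [hcoe']; exact h2

end

section
variable {n : ℕ} {X : CSpace.{u}} {c : 𝒞 (n + 1) X} {i : Fin (n + 1)} {p : BoundaryPt X}

lemma GermSmooth.exists_leftInverse {F : Type*} [NormedAddCommGroup F] [NormedSpace ℝ F]
    [FiniteDimensional ℝ F] {K : ℝ^n → F} {a : ℝ^n} (hK : GermSmooth K a)
    (hinj : ∀ t, fderiv ℝ K a t = 0 → t = 0) :
    ∃ L : F → ℝ^n, GermSmooth L (K a) ∧ ∀ᶠ x in 𝓝 a, L (K x) = x := by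
  obtain ⟨P, hP⟩ := LinearMap.exists_leftInverse_of_injective (fderiv ℝ K a).toLinearMap
    (LinearMap.ker_eq_bot'.2 hinj)
  let P' : F →L[ℝ] ℝ^n := LinearMap.toContinuousLinearMap P
  have hd : fderiv ℝ (P' ∘ K) a = (ContinuousLinearEquiv.refl ℝ ℝ^n :
      ℝ^n →L[ℝ] ℝ^n) := by
    rw [_root_.fderiv_comp _ P'.differentiableAt hK.differentiableAt, P'.fderiv]
    exact ContinuousLinearMap.ext fun t => LinearMap.congr_fun hP t
  obtain ⟨φ, ha, hφ, hs, _⟩ := ((ContDiff.germSmooth P'.contDiff _).comp hK rfl).exists_inverse _ hd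
  refine ⟨fun y => φ.symm (P' y), ?_, ?_⟩
  · have : GermSmooth φ.symm (P' (K a)) := by
      have h1 : P' (K a) ∈ φ.target := by
        have := φ.map_source ha
        rwa [hφ a ha] at this
      filter_upwards [φ.open_target.mem_nhds h1] with y hy using hs y hy
    exact this.comp (ContDiff.germSmooth P'.contDiff _) rfl
  · filter_upwards [φ.open_source.mem_nhds ha] with x hx
    have := hφ x hx
    rw [comp_apply] at this
    rw [← this, φ.left_inv hx]

section
variable {P Q A A' B B' : Type*} [TopologicalSpace P] [TopologicalSpace Q] [TopologicalSpace A]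
  [TopologicalSpace A'] [TopologicalSpace B] [TopologicalSpace B'] {n m l k m' l' : ℕ}
  {κ : P → A} {κ' : P → B} {δ : 𝒞 n P} {c : 𝒞 m A} {d : 𝒞 l B}
  {b : P}

variable {h : Q → P} {α : 𝒞 k Q} {a : Q} {c' : 𝒞 m A} {e : Q → P}

/-- A face function that becomes smooth after composition with `h` pulls back to a face. -/
lemma PullAt.lift {r : Fin n} {i : Fin m} (hp : PullAt (fun y => c.invFun (κ y) i) δ (h a) r)
    (hc : ContinuousAt h a) (hr : r ∈ δ.act (h a)) (hi : i ∈ c.act (κ (h a)))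
    (hs : SmC (κ ∘ h) α c a) {R} (hrep : Rep h α δ a R) :
    (∀ᶠ y in 𝓝 a, δ.invFun (h y) r = 0) ∨ ∃ s, PullAt (fun y => δ.invFun (h y) r) α a s := by
  rcases hs.face i hi with h3 | ⟨s, h3⟩
  · left
    filter_upwards [h3, hc.eventually hp.zero] with y h4 h5 using h5.1 h4
  · right
    obtain ⟨H, μ, hH, hμ, h4⟩ := hp.rep
    obtain ⟨ν, hν, h5⟩ := h3.fderiv_eq (hH.comp hrep)
    refine ⟨s, h3.act, ?_, ?_, _, μ⁻¹ * ν, hrep.coord r, by positivity, fun t => ?_⟩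
    · filter_upwards [hc.eventually (δ.eventually_target hp.mem)] with y hy
      exact δ.nonneg hy hr.1
    · filter_upwards [h3.zero, hc.eventually hp.zero] with y h6 h7
      exact h7.symm.trans h6
    · have h6 := h5 t
      rw [hH.fderiv_comp hrep, ContinuousLinearMap.comp_apply, h4,
        ← hrep.chartDeriv_eq] at h6
      rw [hrep.fderiv_coord, mul_assoc, ← h6]
      field_simp

/-- A continuous map into a space is smooth if its compositions with initial maps are. -/
lemma InitAt.lift (H : InitAt κ κ' δ c d (h a)) (hc : ContinuousAt h a) (h1 : SmC (κ ∘ h) α c a)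
    (h2 : SmC (κ' ∘ h) α d a) :
    SmC h α δ a := by
  obtain ⟨G, hG⟩ := H.smC.rep
  obtain ⟨G', hG'⟩ := H.smC'.rep
  obtain ⟨K, hK⟩ := h1.rep
  obtain ⟨K', hK'⟩ := h2.rep
  obtain ⟨L, hL, hLe⟩ := (hG.smooth.prodMk hG'.smooth).exists_leftInverse fun t ht => by
    rw [(hG.smooth.differentiableAt.hasFDerivAt.prodMk
      hG'.smooth.differentiableAt.hasFDerivAt).fderiv] at ht
    have ht' := ht
    rw [Prod.mk_eq_zero] at ht'
    exact H.inj t (by rw [hG.chartDeriv_eq]; exact ht'.1) (by rw [hG'.chartDeriv_eq]; exact ht'.2)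
  have hrep : Rep h α δ a (fun x => L (K x, K' x)) := by
    refine ⟨⟨hK.mem, hL.comp (hK.smooth.prodMk hK'.smooth) ?_, ?_⟩, hG.mem, hc⟩
    · rw [hK.apply, hK'.apply, hG.apply, hG'.apply]; rfl
    · filter_upwards [hK.eq, hK'.eq, hc.eventually hG.eq, hc.eventually hG'.eq,
        hc.eventually ((δ.continuousAt_invFun hG.mem).eventually hLe)] with y e1 e2 e3 e4 e5
      rw [← e1, ← e2, comp_apply, comp_apply, e3, e4, e5]
  refine ⟨⟨_, hrep⟩, fun r hr => ?_⟩
  rcases H.face r hr with ⟨i, hi, hp⟩ | ⟨i, hi, hp⟩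
  · exact hp.lift hc hr hi h1 hrep
  · exact hp.lift hc hr hi h2 hrep

lemma InitAt.comp {ι : A → A'} {ι' : B → B'} {c' : 𝒞 m' A'} {d' : 𝒞 l' B'}
    (H : InitAt κ κ' δ c d b) (h1 : InitAt ι ι c c' c' (κ b)) (h2 : InitAt ι' ι' d d' d' (κ' b)) :
    InitAt (ι ∘ κ) (ι' ∘ κ') δ c' d' b := by
  obtain ⟨G, hG⟩ := H.smC.rep
  obtain ⟨G', hG'⟩ := H.smC'.rep
  obtain ⟨K, hK⟩ := h1.smC.rep
  obtain ⟨K', hK'⟩ := h2.smC.rep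
  refine ⟨h1.smC.comp H.smC, h2.smC.comp H.smC', fun t ht ht' => ?_, fun r hr => ?_⟩
  · rw [hK.chartDeriv_comp hG] at ht
    rw [hK'.chartDeriv_comp hG'] at ht'
    exact H.inj t (h1.inj _ ht ht) (h2.inj _ ht' ht')
  · rcases H.face r hr with ⟨i, hi, hp⟩ | ⟨i, hi, hp⟩
    · left
      obtain ⟨i', hi', hp'⟩ : ∃ i ∈ c'.act (ι (κ b)), _ := (h1.face i hi).elim id id
      exact ⟨i', hi', hp'.comp_rep hG hp⟩
    · right
      obtain ⟨i', hi', hp'⟩ : ∃ i ∈ d'.act (ι' (κ' b)), _ := (h2.face i hi).elim id id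
      exact ⟨i', hi', hp'.comp_rep hG' hp⟩

lemma InitAt.comp_left (H : InitAt κ κ' δ c d (e a)) (h1 : InitAt e e α δ δ a)
    : InitAt (κ ∘ e) (κ' ∘ e) α c d a := by
  obtain ⟨G, hG⟩ := H.smC.rep
  obtain ⟨G', hG'⟩ := H.smC'.rep
  obtain ⟨K, hK⟩ := h1.smC.rep
  refine ⟨H.smC.comp h1.smC, H.smC'.comp h1.smC, fun t ht ht' => ?_, fun r hr => ?_⟩
  · rw [hG.chartDeriv_comp hK] at ht
    rw [hG'.chartDeriv_comp hK] at ht'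
    have := H.inj _ ht ht'
    exact h1.inj t this this
  · obtain ⟨i', hi', hp'⟩ : ∃ i ∈ δ.act (e a), _ := (h1.face r hr).elim id id
    rcases H.face i' hi' with ⟨i, hi, hp⟩ | ⟨i, hi, hp⟩
    · exact Or.inl ⟨i, hi, hp.comp_rep hK hp'⟩
    · exact Or.inr ⟨i, hi, hp.comp_rep hK hp'⟩

lemma Compatible.initAt (h : Compatible c c') {x : A} (hx : x ∈ c.target) (hx' : x ∈ c'.target)
    : InitAt (id : A → A) id c c' c' x := by
  refine ⟨h.smC hx hx', h.smC hx hx', fun t ht _ => ?_, fun r hr => Or.inl ?_⟩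
  · exact (chartDeriv_bijective h hx hx').1 (ht.trans (map_zero _).symm)
  · obtain ⟨i, hi⟩ := h.symm.face hx' hx hr
    obtain ⟨r', hr'⟩ := h.face hx hx' hi.act
    obtain ⟨G, hG⟩ := h.rep hx hx'
    obtain rfl := (PullAt.comp_rep hi hG hr').unique (pullAt_coord hx hr)
    exact ⟨i, hi.act, hr'⟩

lemma InitAt.change (H : InitAt κ κ' δ c d b) {δ' : 𝒞 n P} {d' : 𝒞 l B}
    (hδ : Compatible δ' δ) (hc : Compatible c c') (hd : Compatible d d') (hb : b ∈ δ'.target)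
    (hκ : κ b ∈ c'.target) (hκ' : κ' b ∈ d'.target) :
    InitAt κ κ' δ' c' d' b :=
  InitAt.comp_left (κ := κ) (κ' := κ') (e := id)
    (InitAt.comp (ι := id) (ι' := id) H (hc.initAt H.smC.mem' hκ) (hd.initAt H.smC'.mem' hκ'))
    (hδ.initAt hb H.smC.mem)

lemma LiftAt.initAt {α : 𝒞 n Q} (h : LiftAt e α δ a) (hk : α.k = δ.k)
    : InitAt e e α δ δ a := by
  refine ⟨h.smC hk, h.smC hk, fun t ht _ => ?_, fun r hr => Or.inl ⟨r, h.act hk ▸ hr, ?_⟩⟩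
  · rw [h.rep.chartDeriv_eq, fderiv_id] at ht
    exact ht
  · exact (h.pullAt_iff hk).1 (pullAt_coord h.mem' (h.act hk ▸ hr))

lemma LiftAt.initAt_iff {α : 𝒞 n Q} (h : LiftAt e α δ a) (hk : α.k = δ.k)
    (H : InitAt (fun y => κ (e y)) (fun y => κ' (e y)) α c d a) :
    InitAt κ κ' δ c d (e a) := by
  obtain ⟨G, hG⟩ := H.smC.rep
  obtain ⟨G', hG'⟩ := H.smC'.rep
  refine ⟨(h.smC_iff hk).2 H.smC, (h.smC_iff hk).2 H.smC', fun t ht ht' => ?_, fun r hr => ?_⟩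
  · rw [h.chartDeriv_eq (h.rep_iff.2 hG)] at ht
    rw [h.chartDeriv_eq (h.rep_iff.2 hG')] at ht'
    exact H.inj t ht ht'
  · rcases H.face r (h.act hk ▸ hr) with ⟨i, hi, hp⟩ | ⟨i, hi, hp⟩
    · exact Or.inl ⟨i, hi, (h.pullAt_iff hk).2 hp⟩
    · exact Or.inr ⟨i, hi, (h.pullAt_iff hk).2 hp⟩

end

lemma CSpace.IsManifold.initAt_incl (hX : X.IsManifold) (hc : c ∈ X.charts (n + 1))
    (p₀ : ∃ p, IsFace c i p) (hp : IsFace c i p) :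
    InitAt BoundaryPt.pt BoundaryPt.pt (hX.faceChart hc i p₀) c c p := by
  have hrep := hX.rep_incl hc p₀ hp
  have hcoord : ∀ j ∈ (hX.faceChart hc i p₀).act p,
      PullAt (fun q : BoundaryPt X => c.invFun q.pt (i.succAbove j)) (hX.faceChart hc i p₀) p j :=
    fun j hj => pullAt_coord hp hj
  have hsm : SmC BoundaryPt.pt (hX.faceChart hc i p₀) c p := by
    refine ⟨⟨_, hrep⟩, fun j hj => ?_⟩
    rcases Fin.eq_self_or_eq_succAbove i j with rfl | ⟨j, rfl⟩
    · left
      filter_upwards [(hX.isOpen_isFace hc j).mem_nhds hp] with q hq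
      exact (IsFace.mem_act hq).2
    · right
      refine ⟨j, hcoord j ?_⟩
      rw [faceChart_act]; exact hj
  refine ⟨hsm, hsm, fun t ht _ => ?_, fun r hr => Or.inl ⟨i.succAbove r, ?_, hcoord r hr⟩⟩
  · rw [hrep.chartDeriv_eq, (insL i).fderiv] at ht
    exact insL_injective i (ht.trans (map_zero _).symm)
  · rw [faceChart_act] at hr; exact hr

lemma CSpace.IsManifold.chartDeriv_incl (hX : X.IsManifold) (hc : c ∈ X.charts (n + 1))
    (p₀ : ∃ p, IsFace c i p) (hp : IsFace c i p) :
    𝒟 BoundaryPt.pt (hX.faceChart hc i p₀) c p = insL i := by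
  rw [(hX.rep_incl hc p₀ hp).chartDeriv_eq, (insL i).fderiv]

lemma CSpace.IsManifold.smooth_incl (hX : X.IsManifold) :
    Smooth X.boundary X X.incl := by
  refine hX.boundary.smooth_of_smC hX fun p => ?_
  obtain ⟨n, c, hc, i, hi⟩ := hX.exists_faceChart p
  exact ⟨n, _, hX.faceChart_mem hc ⟨p, hi⟩, n + 1, c, hc, (hX.initAt_incl hc ⟨p, hi⟩ hi).smC⟩

end

/-! ### Initial maps between manifolds with corners -/

section
variable {A : Type u} {B : Type v} [TopologicalSpace A] [TopologicalSpace B] {m n l r : ℕ}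

lemma SmC.eventually {f : A → B} {c : 𝒞 m A} {d : 𝒞 n B} {x : A}
    (h : SmC f c d x) (hf : ∀ᶠ y in 𝓝 x, ContinuousAt f y) : ∀ᶠ y in 𝓝 x, SmC f c d y := by
  obtain ⟨G, hG⟩ := h.rep
  have h1 : ∀ᶠ y in 𝓝 x, ∀ j ∈ d.act (f x), d.invFun (f y) j = 0 →
      (∀ᶠ z in 𝓝 y, d.invFun (f z) j = 0) ∨ ∃ i, PullAt (fun z => d.invFun (f z) j) c y i := by
    simp only [eventually_all]
    intro j hj
    rcases h.face j hj with h0 | ⟨i, hi⟩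
    · filter_upwards [h0.eventually_nhds] with y hy _ using Or.inl hy
    · filter_upwards [hi.eventually, hi.zero] with y hy h0 hy0 using Or.inr ⟨i, hy (h0.1 hy0)⟩
  filter_upwards [h1, hG.eventually hf, h.cont.eventually (d.eventually_act_subset h.mem')]
    with y h2 h3 h4
  exact ⟨⟨G, h3⟩, fun j hj => h2 j (h4 hj) hj.2⟩

lemma InitAt.eventually {P : Type w} [TopologicalSpace P] {κ : P → A} {κ' : P → B}
    {δ : 𝒞 n P} {c : 𝒞 m A} {d : 𝒞 l B} {b : P}
    (h : InitAt κ κ' δ c d b) (hκ : Continuous κ) (hκ' : Continuous κ') :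
    ∀ᶠ y in 𝓝 b, InitAt κ κ' δ c d y := by
  obtain ⟨G, hG⟩ := h.smC.rep
  obtain ⟨G', hG'⟩ := h.smC'.rep
  have hface : ∀ᶠ y in 𝓝 b, ∀ r ∈ δ.act b, δ.invFun y r = 0 →
      (∃ i ∈ c.act (κ y), PullAt (fun y => c.invFun (κ y) i) δ y r) ∨
      ∃ i ∈ d.act (κ' y), PullAt (fun y => d.invFun (κ' y) i) δ y r := by
    simp only [eventually_all]
    intro r hr
    rcases h.face r hr with ⟨i, hi, hp⟩ | ⟨i, hi, hp⟩
    · filter_upwards [hp.eventually, hp.zero] with y hy h0 hy0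
      exact Or.inl ⟨i, ⟨hi.1, h0.2 hy0⟩, hy hy0⟩
    · filter_upwards [hp.eventually, hp.zero] with y hy h0 hy0
      exact Or.inr ⟨i, ⟨hi.1, h0.2 hy0⟩, hy hy0⟩
  have hpair : ∀ y t, GermSmooth G y → GermSmooth G' y →
      fderiv ℝ (fun a => (G a, G' a)) y t = (fderiv ℝ G y t, fderiv ℝ G' y t) := by
    intro y t h1 h2
    rw [(h1.differentiableAt.hasFDerivAt.prodMk h2.differentiableAt.hasFDerivAt).fderiv]
    rfl
  have hinj : ∀ᶠ y in 𝓝 b, Injective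
      (fderiv ℝ (fun a => (G a, G' a)) (δ.invFun y)) := by
    refine ((hG.smooth.prodMk hG'.smooth).continuousAt_fderiv.comp
      (δ.continuousAt_invFun h.smC.mem)).eventually_mem (IsOpen.mem_nhds
      (ContinuousLinearMap.isOpen_injective (𝕜 := ℝ)) ?_)
    refine (injective_iff_map_eq_zero _).2 fun t ht => ?_
    rw [comp_apply, hpair _ _ hG.smooth hG'.smooth, Prod.mk_eq_zero] at ht
    exact h.inj t (by rw [hG.chartDeriv_eq]; exact ht.1) (by rw [hG'.chartDeriv_eq]; exact ht.2)
  filter_upwards [h.smC.eventually (.of_forall fun _ => hκ.continuousAt),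
    h.smC'.eventually (.of_forall fun _ => hκ'.continuousAt), hface, hinj,
    hG.eventually (.of_forall fun _ => hκ.continuousAt),
    hG'.eventually (.of_forall fun _ => hκ'.continuousAt),
    δ.eventually_act_subset h.smC.mem] with y h1 h2 h3 h4 h5 h6 h7
  refine ⟨h1, h2, fun t ht ht' => ?_, fun r hr => h3 r (h7 hr) hr.2⟩
  rw [h5.chartDeriv_eq] at ht
  rw [h6.chartDeriv_eq] at ht'
  exact h4 (by rw [map_zero, hpair _ _ h5.smooth h6.smooth, ht, ht']; rfl)

end

/-- The maps `κ : P → A` and `κ' : P → B` jointly determine the smooth structure of `P`. -/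
def Init (P : CSpace.{u}) (A : CSpace.{v}) (B : CSpace.{w}) (κ : P → A) (κ' : P → B) : Prop :=
  ∀ b, ∃ n, ∃ δ ∈ P.charts n, ∃ m, ∃ c ∈ A.charts m, ∃ l, ∃ d ∈ B.charts l, InitAt κ κ' δ c d b

section
variable {P : CSpace.{u}} {A : CSpace.{v}} {B : CSpace.{w}} {Q : CSpace.{u'}} {A' : CSpace.{v'}}
  {κ : P → A} {κ' : P → B}

lemma Init.initAt (h : Init P A B κ κ') (hP : P.IsManifold) (hA : A.IsManifold)
    (hB : B.IsManifold) {n m l : ℕ} {δ : 𝒞 n P} (hδ : δ ∈ P.charts n)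
    {c : 𝒞 m A} (hc : c ∈ A.charts m) {d : 𝒞 l B} (hd : d ∈ B.charts l)
    {b : P} (hb : b ∈ δ.target) (h1 : κ b ∈ c.target) (h2 : κ' b ∈ d.target) :
    InitAt κ κ' δ c d b := by
  obtain ⟨n', δ', hδ', m', c', hc', l', d', hd', H⟩ := h b
  obtain rfl := hP.dim_unique hδ hδ'
  obtain rfl := hA.dim_unique hc hc'
  obtain rfl := hB.dim_unique hd hd'
  exact H.change (hP.compatible _ _ hδ _ hδ') (hA.compatible _ _ hc' _ hc)
    (hB.compatible _ _ hd' _ hd) hb h1 h2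

lemma Init.smooth_left (h : Init P A B κ κ') (hP : P.IsManifold) (hA : A.IsManifold) :
    Smooth P A κ := hP.smooth_of_smC hA fun b => by
  obtain ⟨n', δ', hδ', m', c', hc', l', d', hd', H⟩ := h b
  exact ⟨_, _, hδ', _, _, hc', H.smC⟩

lemma Init.smooth_right (h : Init P A B κ κ') (hP : P.IsManifold) (hB : B.IsManifold) :
    Smooth P B κ' := hP.smooth_of_smC hB fun b => by
  obtain ⟨n', δ', hδ', m', c', hc', l', d', hd', H⟩ := h b
  exact ⟨_, _, hδ', _, _, hd', H.smC'⟩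

lemma Init.lift (h : Init P A B κ κ') (hP : P.IsManifold) (hA : A.IsManifold)
    (hB : B.IsManifold) (hQ : Q.IsManifold) {φ : Q → P} (hφ : Continuous φ)
    (h1 : Smooth Q A (κ ∘ φ)) (h2 : Smooth Q B (κ' ∘ φ)) : Smooth Q P φ := by
  refine hQ.smooth_of_smC hP fun a => ?_
  obtain ⟨n, δ, hδ, m, c, hc, l, d, hd, H⟩ := h (φ a)
  obtain ⟨k, α, hα, ha⟩ := hQ.cover a
  exact ⟨k, α, hα, n, δ, hδ, H.lift hφ.continuousAt
    (hQ.smC_of_smooth hA h1 hα hc ha H.smC.mem') (hQ.smC_of_smooth hB h2 hα hd ha H.smC'.mem')⟩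

end

/-! ### Charts of fibre products -/

/-- A surjective linear map together with independent functionals extends to a linear coordinate
system. -/
lemma exists_coordinates {V : Type*} [AddCommGroup V] [Module ℝ V] [FiniteDimensional ℝ V]
    {r κ : ℕ} (H : V →ₗ[ℝ] ℝ^r) (ξ : V →ₗ[ℝ] ℝ^κ)
    (hs : Surjective (H.prod ξ)) :
    ∃ (p : ℕ) (θ : V →ₗ[ℝ] ℝ^(κ + p)), Module.finrank ℝ V = r + (κ + p) ∧
      Bijective (H.prod θ) ∧ ∀ v i, θ v (Fin.castAdd p i) = ξ v i := by
  let K := LinearMap.ker (H.prod ξ)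
  obtain ⟨π, hπ⟩ := K.subtype.exists_leftInverse_of_injective K.ker_subtype
  let b := Module.finBasis ℝ K
  let θ : V →ₗ[ℝ] (Fin (κ + Module.finrank ℝ K) → ℝ) :=
    LinearMap.pi (Fin.addCases (fun i => LinearMap.proj i ∘ₗ ξ)
      (fun i => LinearMap.proj i ∘ₗ b.equivFun.toLinearMap ∘ₗ π))
  have h1 : ∀ v i, θ v (Fin.castAdd _ i) = ξ v i := by intro v i; simp [θ]
  have h2 : ∀ v i, θ v (Fin.natAdd _ i) = b.equivFun (π v) i := by intro v i; simp [θ]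
  have hfin : Module.finrank ℝ V = r + (κ + Module.finrank ℝ K) := by
    have := LinearMap.finrank_range_add_finrank_ker (H.prod ξ)
    rw [LinearMap.range_eq_top.2 hs, finrank_top, Module.finrank_prod, Module.finrank_fin_fun,
      Module.finrank_fin_fun] at this
    change r + κ + Module.finrank ℝ K = _ at this
    omega
  have hinj : Injective (H.prod θ) := by
    refine (injective_iff_map_eq_zero _).2 fun v hv => ?_
    have hv' : (H v, θ v) = 0 := hv
    rw [Prod.mk_eq_zero] at hv'
    have hK : v ∈ K := by
      refine LinearMap.mem_ker.2 (Prod.ext hv'.1 (funext fun i => ?_))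
      have := h1 v i
      rw [hv'.2] at this
      exact this.symm
    have h3 : π v = 0 := by
      refine b.equivFun.injective (funext fun i => ?_)
      rw [← h2, hv'.2, map_zero]; rfl
    have h5 : π v = ⟨v, hK⟩ := LinearMap.congr_fun hπ ⟨v, hK⟩
    rw [h3] at h5
    exact (congrArg Subtype.val h5).symm
  refine ⟨_, θ, hfin, ⟨hinj, ?_⟩, h1⟩
  refine (LinearMap.injective_iff_surjective_of_finrank_eq_finrank ?_).1 hinj
  rw [hfin, Module.finrank_prod, Module.finrank_fin_fun, Module.finrank_fin_fun]

section
variable {A : Type u} {B : Type v} {C : Type w} [TopologicalSpace A] [TopologicalSpace B]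
  [TopologicalSpace C] {m l r : ℕ} {c : 𝒞 m A} {d : 𝒞 l B}
  {e : 𝒞 r C} {f : A → C} {g : B → C} {x : A} {y : B}

lemma contDiff_update_zero {n : ℕ} (i : Fin n) :
    ContDiff ℝ ∞ fun a : Fin n → ℝ => update a i 0 := by
  rw [contDiff_pi]
  intro j
  by_cases h : j = i
  · subst h; simpa using contDiff_const
  · simpa [update_of_ne h] using contDiff_apply ℝ ℝ j

/-- A map is represented by a germ whose components at the faces of the target change sign across
the corresponding faces of the source. -/
lemma Rep.exists_sign {G : ℝ^m → ℝ^r} (hG : Rep f c e x G) {i : e.act (f x) → Fin m}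
    (hp : ∀ j : e.act (f x), PullAt (fun y => e.invFun (f y) j) c x (i j)) :
    ∃ G', Rep f c e x G' ∧ ∀ᶠ a in 𝓝 (c.invFun x), ∀ j : e.act (f x), 0 ≤ G' a j → 0 ≤ a (i j) := by
  classical
  let G' : ℝ^m → ℝ^r := fun a j =>
    if hj : j ∈ e.act (f x) then G a j - G (update a (i ⟨j, hj⟩) 0) j else G a j
  refine ⟨G', ⟨⟨hG.mem, germSmooth_pi.2 fun j => ?_, ?_⟩, hG.mem', hG.cont⟩, ?_⟩
  · by_cases hj : j ∈ e.act (f x)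
    · simp only [G', dif_pos hj]
      refine (germSmooth_pi.1 hG.smooth j).sub ?_
      refine (germSmooth_pi.1 hG.smooth j).comp
        (ContDiff.germSmooth (contDiff_update_zero (i ⟨j, hj⟩)) _) ?_
      rw [← (hp ⟨j, hj⟩).act.2]
      exact update_eq_self _ _
    · simp only [G', dif_neg hj]
      exact germSmooth_pi.1 hG.smooth j
  · have h1 : ∀ᶠ y in 𝓝 x, ∀ j : e.act (f x),
        G (update (c.invFun y) (i j) 0) j = 0 := by
      simp only [eventually_all]
      intro j
      obtain ⟨h2, h3⟩ := c.tendsto_update hG.mem (hp j).act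
      filter_upwards [h2.eventually hG.eq, h2.eventually (hp j).zero, h3] with y h4 h5 h6
      rw [c.invTo h6] at h4 h5
      rw [← h4]
      exact h5.2 (update_self _ _ _)
    filter_upwards [h1, hG.eq] with y h2 h3
    funext j
    rw [h3]
    by_cases hj : j ∈ e.act (f x)
    · simp only [G', dif_pos hj, h2 ⟨j, hj⟩, sub_zero]
    · simp only [G', dif_neg hj]
  · simp only [eventually_all]
    intro j
    obtain ⟨μ, hμ, h1⟩ := (hp j).chartDeriv_eq hG
    have h2 := (germSmooth_pi.1 hG.smooth j).eventually_update_lt (hp j).act.2 (by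
      rw [hG.fderiv_coord, h1, Pi.single_eq_same]; linarith)
    filter_upwards [h2] with a ha h0
    simp only [G', dif_pos j.2] at h0
    by_contra! hneg
    linarith [ha.2 hneg]

end

section
variable {A : Type u} {B : Type v} {C : Type w} [TopologicalSpace A] [TopologicalSpace B]
  [TopologicalSpace C] {m l r : ℕ} {c : 𝒞 m A} {d : 𝒞 l B}
  {e : 𝒞 r C} {f : A → C} {g : B → C} {x : A} {y : B}

lemma CornerChart.eventually_mem_source (hx : x ∈ c.target) :
    ∀ᶠ s in 𝓝 (c.invFun x), (∀ i ∈ c.act x, 0 ≤ s i) → s ∈ c.source := by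
  obtain ⟨O, hO, h⟩ := c.source_open
  have hxO : c.invFun x ∈ O := by
    have := c.mapT hx
    rw [h] at this
    exact this.1
  have h1 : ∀ᶠ s : Fin m → ℝ in 𝓝 (c.invFun x), ∀ i : Fin m, (i : ℕ) < c.k →
      i ∉ c.act x → 0 < s i := by
    simp only [eventually_all]
    intro i hi hi'
    have : 0 < c.invFun x i := lt_of_le_of_ne (c.nonneg hx hi) fun h0 => hi' ⟨hi, h0.symm⟩
    exact (continuous_apply i).continuousAt.eventually_const_lt this
  filter_upwards [h1, hO.mem_nhds hxO] with s h2 h3 h4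
  rw [h]
  refine ⟨h3, fun i hi => ?_⟩
  by_cases hi' : i ∈ c.act x
  · exact h4 i hi'
  · exact (h2 i hi hi').le

lemma Rep.eventually_source {G} (h : Rep f c e x G) : ∀ᶠ s in 𝓝 (c.invFun x),
    s ∈ c.source → f (c.toFun s) ∈ e.target ∧ e.invFun (f (c.toFun s)) = G s := by
  rw [← eventually_nhdsWithin_iff]
  filter_upwards [(c.tendsto_toFun h.mem).eventually (h.cont.eventually
    (e.eventually_target h.mem')), (c.tendsto_toFun h.mem).eventually h.eq,
    self_mem_nhdsWithin] with s h1 h2 h3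
  rw [c.invTo h3] at h2
  exact ⟨h1, h2⟩

/-- A subset of `A × B` cut out by equations has a chart, if the equations and some linear
functions form a local coordinate system in which the equations vanish and the linear functions
range over a quadrant. -/
lemma exists_chart_of_equations {p : A × B → Prop} {n κ : ℕ} (hκ : κ ≤ n) (q : {s // p s})
    (Ψ : OpenPartialHomeomorph (ℝ^m × ℝ^l) (ℝ^r × ℝ^n))
    (H : ℝ^m × ℝ^l → ℝ^r) (θ : ℝ^m × ℝ^l → ℝ^n)
    (hθ : Continuous θ) (hΨ : ∀ v ∈ Ψ.source, Ψ v = (H v, θ v))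
    (hp : ∀ v ∈ Ψ.source, v.1 ∈ c.source → v.2 ∈ d.source →
      (p (c.toFun v.1, d.toFun v.2) ↔ H v = 0))
    (hs : ∀ v ∈ Ψ.source, H v = 0 → θ v ∈ quadrant n κ → v.1 ∈ c.source ∧ v.2 ∈ d.source)
    (hq : ∀ v : ℝ^m × ℝ^l, v.1 ∈ c.source → v.2 ∈ d.source → θ v ∈ quadrant n κ)
    (h1 : q.1.1 ∈ c.target) (h2 : q.1.2 ∈ d.target)
    (h3 : (c.invFun q.1.1, d.invFun q.1.2) ∈ Ψ.source) :
    ∃ φ : 𝒞 n {s // p s}, φ.k = κ ∧ q ∈ φ.target ∧ ∀ q' ∈ φ.target,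
      q'.1.1 ∈ c.target ∧ q'.1.2 ∈ d.target ∧
      φ.invFun q' = θ (c.invFun q'.1.1, d.invFun q'.1.2) ∧
      (0, φ.invFun q') ∈ Ψ.target ∧
      Ψ.symm (0, φ.invFun q') = (c.invFun q'.1.1, d.invFun q'.1.2) := by
  classical
  have key : ∀ v : Fin n → ℝ, (0, v) ∈ Ψ.target → v ∈ quadrant n κ →
      (Ψ.symm (0, v)).1 ∈ c.source ∧ (Ψ.symm (0, v)).2 ∈ d.source ∧
      p (c.toFun (Ψ.symm (0, v)).1, d.toFun (Ψ.symm (0, v)).2) ∧ θ (Ψ.symm (0, v)) = v := by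
    intro v hv hv'
    have h4 := Ψ.map_target hv
    have h5 := hΨ _ h4
    rw [Ψ.right_inv hv, Prod.mk.injEq] at h5
    have h6 := hs _ h4 h5.1.symm (by rw [← h5.2]; exact hv')
    exact ⟨h6.1, h6.2, (hp _ h4 h6.1 h6.2).2 h5.1.symm, h5.2.symm⟩
  have key' : ∀ q' : {s // p s}, q'.1.1 ∈ c.target → q'.1.2 ∈ d.target →
      (c.invFun q'.1.1, d.invFun q'.1.2) ∈ Ψ.source →
      Ψ (c.invFun q'.1.1, d.invFun q'.1.2) = (0, θ (c.invFun q'.1.1, d.invFun q'.1.2)) := by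
    intro q' h4 h5 h6
    rw [hΨ _ h6, (hp _ h6 (c.mapT h4) (d.mapT h5)).1 (by rw [c.toInv h4, d.toInv h5]; exact q'.2)]
  have hcont : ContinuousOn (fun v : Fin n → ℝ => (c.toFun (Ψ.symm (0, v)).1,
      d.toFun (Ψ.symm (0, v)).2)) {v | (0, v) ∈ Ψ.target ∧ v ∈ quadrant n κ} := by
    have hsymm : ContinuousOn (fun v : Fin n → ℝ => Ψ.symm ((0 : ℝ^r), v))
        {v | (0, v) ∈ Ψ.target ∧ v ∈ quadrant n κ} :=
      Ψ.continuousOn_symm.comp (by fun_prop) fun v hv => hv.1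
    exact (c.continuousOn_toFun.comp (continuous_fst.comp_continuousOn hsymm)
      fun v hv => (key v hv.1 hv.2).1).prodMk (d.continuousOn_toFun.comp
        (continuous_snd.comp_continuousOn hsymm) fun v hv => (key v hv.1 hv.2).2.1)
  let T : ℝ^n → {s // p s} := fun v =>
    if h : (0, v) ∈ Ψ.target ∧ v ∈ quadrant n κ then
      ⟨(c.toFun (Ψ.symm (0, v)).1, d.toFun (Ψ.symm (0, v)).2), (key v h.1 h.2).2.2.1⟩ else q
  have hT : ∀ v, (0, v) ∈ Ψ.target → v ∈ quadrant n κ →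
      (T v).1 = (c.toFun (Ψ.symm (0, v)).1, d.toFun (Ψ.symm (0, v)).2) := by
    intro v hv hv'
    simp only [T, dif_pos (And.intro hv hv')]
  have hmap : ∀ q' : {s // p s}, q'.1.1 ∈ c.target → q'.1.2 ∈ d.target →
      (c.invFun q'.1.1, d.invFun q'.1.2) ∈ Ψ.source →
      (0, θ (c.invFun q'.1.1, d.invFun q'.1.2)) ∈ Ψ.target ∧
      Ψ.symm (0, θ (c.invFun q'.1.1, d.invFun q'.1.2)) = (c.invFun q'.1.1, d.invFun q'.1.2) := by
    intro q' h4 h5 h6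
    rw [← key' q' h4 h5 h6]
    exact ⟨Ψ.map_source h6, Ψ.left_inv h6⟩
  let φ : 𝒞 n {s // p s} :=
    { toFun := T
      invFun := fun q' => θ (c.invFun q'.1.1, d.invFun q'.1.2)
      source := {v | (0, v) ∈ Ψ.target ∧ v ∈ quadrant n κ}
      target := {q' | q'.1.1 ∈ c.target ∧ q'.1.2 ∈ d.target ∧
        (c.invFun q'.1.1, d.invFun q'.1.2) ∈ Ψ.source}
      map_source' := by
        rintro v ⟨hv, hv'⟩
        obtain ⟨h4, h5, -, -⟩ := key v hv hv'
        rw [mem_ofPred_eq, hT v hv hv']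
        refine ⟨c.mapS h4, d.mapS h5, ?_⟩
        simp only [c.invTo h4, d.invTo h5]
        exact Ψ.map_target hv
      map_target' := by
        rintro q' ⟨h4, h5, h6⟩
        exact ⟨(hmap q' h4 h5 h6).1, hq _ (c.mapT h4) (d.mapT h5)⟩
      left_inv' := by
        rintro v ⟨hv, hv'⟩
        obtain ⟨h4, h5, -, h6⟩ := key v hv hv'
        simp only [hT v hv hv', c.invTo h4, d.invTo h5]
        exact h6
      right_inv' := by
        rintro q' ⟨h4, h5, h6⟩
        refine Subtype.ext ?_
        rw [hT _ (hmap q' h4 h5 h6).1 (hq _ (c.mapT h4) (d.mapT h5)), (hmap q' h4 h5 h6).2]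
        simp only [c.toInv h4, d.toInv h5]
      k := κ
      k_le := hκ
      source_nonempty := ⟨_, (hmap q h1 h2 h3).1, hq _ (c.mapT h1) (d.mapT h2)⟩
      source_open := ⟨{v | ((0 : ℝ^r), v) ∈ Ψ.target},
        Ψ.open_target.preimage (by fun_prop), rfl⟩
      target_open := by
        rw [isOpen_iff_mem_nhds]
        rintro q' ⟨h4, h5, h6⟩
        have e1 : ContinuousAt (fun q' : {s // p s} => q'.1.1) q' := by fun_prop
        have e2 : ContinuousAt (fun q' : {s // p s} => q'.1.2) q' := by fun_prop
        have e3 := (ContinuousAt.comp (f := fun q' : {s // p s} => q'.1.1) (c.continuousAt_invFun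
            h4) e1).prodMk (ContinuousAt.comp
            (d.continuousAt_invFun h5) e2)
        filter_upwards [e1.eventually (c.eventually_target h4),
          e2.eventually (d.eventually_target h5),
          e3.eventually (Ψ.open_source.mem_nhds h6)] with a h7 h8 h9 using ⟨h7, h8, h9⟩
      continuousOn_toFun := by
        refine IsInducing.subtypeVal.continuousOn_iff.2 ?_
        exact hcont.congr fun v hv => hT v hv.1 hv.2
      continuousOn_invFun := by
        rintro q' ⟨h4, h5, h6⟩
        exact (hθ.continuousAt.comp ((ContinuousAt.comp (f := fun q' : {s // p s} => q'.1.1)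
            (c.continuousAt_invFun h4) (by fun_prop)).prodMk (ContinuousAt.comp (f := fun q' : {s //
                p s} =>
            q'.1.2) (d.continuousAt_invFun h5) (by fun_prop)))).continuousWithinAt }
  refine ⟨φ, rfl, ⟨h1, h2, h3⟩, fun q' hq' => ⟨hq'.1, hq'.2.1, rfl, ?_⟩⟩
  exact hmap q' hq'.1 hq'.2.1 hq'.2.2

/-- At each face of the target, a b-submersive map is the pullback along a different face of the
source. -/
lemma SmC.exists_faces (hf : SmC f c e x)
    (hb : LinearMap.range (𝒟 f c e x).1 ⊔ e.stratumTangent (f x) = ⊤) :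
    ∃ i : e.act (f x) → Fin m, (∀ j : e.act (f x), PullAt (fun y => e.invFun (f y) j) c x (i j)) ∧
      Injective i := by
  have hsurj : ∀ w : Fin r → ℝ, ∃ t, ∀ j ∈ e.act (f x), 𝒟 f c e x t j = w j := by
    intro w
    have hw : w ∈ LinearMap.range (𝒟 f c e x).1 ⊔ e.stratumTangent (f x) :=
      hb ▸ Submodule.mem_top
    obtain ⟨_, ⟨t, rfl⟩, s, hs, rfl⟩ := Submodule.mem_sup.1 hw
    refine ⟨t, fun j hj => ?_⟩
    rw [Pi.add_apply, mem_stratumTangent.1 hs j hj, add_zero]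
    rfl
  obtain ⟨G, hG⟩ := hf.rep
  have h1 : ∀ j : e.act (f x), ∃ i, PullAt (fun y => e.invFun (f y) j) c x i := by
    intro ⟨j, hj⟩
    refine (hf.face j hj).resolve_left fun h0 => ?_
    obtain ⟨t, ht⟩ := hsurj (Pi.single j 1)
    have h2 := ht j hj
    rw [Pi.single_eq_same, ← hG.fderiv_coord] at h2
    rw [(hG.coord j).fderiv_unique (⟨hG.mem, ContDiff.germSmooth contDiff_const _, h0⟩)] at h2
    simp at h2
  choose i hi using h1
  refine ⟨i, hi, fun j j' hij => ?_⟩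
  by_contra hne
  obtain ⟨t, ht⟩ := hsurj (Pi.single j 1)
  obtain ⟨μ, hμ, h3⟩ := (hi j).chartDeriv_eq hG
  obtain ⟨ν, hν, h4⟩ := (hi j').chartDeriv_eq hG
  have h5 := ht j j.2
  have h6 := ht j' j'.2
  rw [h3, Pi.single_eq_same] at h5
  rw [h4, Pi.single_eq_of_ne (fun h => hne (Subtype.ext h.symm)), ← hij] at h6
  rcases mul_eq_zero.1 h6 with h7 | h7
  · exact hν.ne' h7
  · rw [h7, mul_zero] at h5; exact zero_ne_one h5

end

section
variable {A : Type u} {B : Type v} {C : Type w} [TopologicalSpace A] [TopologicalSpace B]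
  [TopologicalSpace C] {m l r : ℕ} {c : 𝒞 m A} {d : 𝒞 l B}
  {e : 𝒞 r C} {f : A → C} {g : B → C}

/-- The derivative of the equations of a fibre product is surjective on the vectors tangent to the
faces which are not pulled back from the target. -/
lemma exists_tangent_of_transverse {x : A} {y : B}
    (hT : (c.stratumTangent x).map (𝒟 f c e x).1 ⊔
      (d.stratumTangent y).map (𝒟 g d e y).1 = e.stratumTangent (f x))
    {i : e.act (f x) → Fin m} (hi : Injective i) {G} (hG : Rep f c e x G)
    (hp : ∀ j : e.act (f x), PullAt (fun y => e.invFun (f y) j) c x (i j)) (w : ℝ^r) :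
    ∃ s t, (∀ k ∈ c.act x, k ∉ range i → s k = 0) ∧ (∀ k ∈ d.act y, t k = 0) ∧
      𝒟 f c e x s - 𝒟 g d e y t = w := by
  classical
  choose μ hμ h1 using fun j => (hp j).chartDeriv_eq hG
  let s1 : Fin m → ℝ := fun k => if h : ∃ j, i j = k then w h.choose / μ h.choose else 0
  have hs1 : ∀ j, s1 (i j) = w j / μ j := by
    intro j
    have h : ∃ j', i j' = i j := ⟨j, rfl⟩
    simp only [s1, dif_pos h, hi h.choose_spec]
  have hw : w - 𝒟 f c e x s1 ∈ e.stratumTangent (f x) := by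
    refine mem_stratumTangent.2 fun j hj => ?_
    rw [Pi.sub_apply, h1 ⟨j, hj⟩, hs1]
    have := (hμ ⟨j, hj⟩).ne'
    field_simp
    ring
  rw [← hT] at hw
  obtain ⟨_, ⟨s2, hs2, rfl⟩, _, ⟨t2, ht2, rfl⟩, h3⟩ := Submodule.mem_sup.1 hw
  refine ⟨s1 + s2, -t2, fun k hk hk' => ?_, fun k hk => ?_, ?_⟩
  · have h : ¬ ∃ j, i j = k := hk'
    rw [Pi.add_apply, mem_stratumTangent.1 hs2 k hk]
    simp only [s1, dif_neg h, add_zero]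
  · rw [Pi.neg_apply, mem_stratumTangent.1 ht2 k hk, neg_zero]
  · rw [map_add, map_neg]
    have h4 : 𝒟 f c e x s2 + 𝒟 g d e y t2 = w - 𝒟 f c e x s1 := h3
    rw [sub_neg_eq_add, add_assoc, h4]
    abel

lemma exists_fibreChart {q : {p : A × B // f p.1 = g p.2}} (hf : SmC f c e q.1.1)
    (hg : SmC g d e q.1.2)
    (hT : (c.stratumTangent q.1.1).map (𝒟 f c e q.1.1).1 ⊔
      (d.stratumTangent q.1.2).map (𝒟 g d e q.1.2).1 =
        e.stratumTangent (f q.1.1))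
    (hb : LinearMap.range (𝒟 f c e q.1.1).1 ⊔ e.stratumTangent (f q.1.1) = ⊤) :
    ∃ (n : ℕ) (φ : 𝒞 n {p : A × B // f p.1 = g p.2}), n + r = m + l ∧ q ∈ φ.target ∧
      InitAt (·.1.1)
        (·.1.2) φ c d q := by
  classical
  obtain ⟨i, hip, hi⟩ := hf.exists_faces hb
  obtain ⟨G, hG, hsign⟩ := hf.rep.choose_spec.exists_sign hip
  obtain ⟨K, hK⟩ := hg.rep
  have hx := hf.mem
  have hy := hg.mem
  set a := c.invFun q.1.1 with ha
  set b := d.invFun q.1.2 with hbb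
  let I : Type := {k : Fin m // k ∈ c.act q.1.1 ∧ k ∉ range i} ⊕ {k : Fin l // k ∈ d.act q.1.2}
  let κ := Fintype.card I
  let σ : Fin κ ≃ I := (Fintype.equivFin I).symm
  let V := ℝ^m × ℝ^l
  let ξ : V →ₗ[ℝ] ℝ^κ := LinearMap.pi fun k => Sum.elim
    (fun i : {k : Fin m // k ∈ c.act q.1.1 ∧ k ∉ range i} =>
      LinearMap.proj i.1 ∘ₗ LinearMap.fst ℝ ℝ^m ℝ^l)
    (fun i : {k : Fin l // k ∈ d.act q.1.2} =>
      LinearMap.proj i.1 ∘ₗ LinearMap.snd ℝ ℝ^m ℝ^l) (σ k)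
  have hξ1 : ∀ k (h : k ∈ c.act q.1.1 ∧ k ∉ range i) (v : V),
      ξ v (σ.symm (Sum.inl ⟨k, h⟩)) = v.1 k := by intro k h v; simp [ξ]; rfl
  have hξ2 : ∀ k (h : k ∈ d.act q.1.2) (v : V),
      ξ v (σ.symm (Sum.inr ⟨k, h⟩)) = v.2 k := by intro k h v; simp [ξ]; rfl
  have hξ : ∀ k : Fin κ, (∃ j, ∃ h : j ∈ c.act q.1.1 ∧ j ∉ range i, k = σ.symm (Sum.inl ⟨j, h⟩)) ∨
      ∃ j, ∃ h : j ∈ d.act q.1.2, k = σ.symm (Sum.inr ⟨j, h⟩) := by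
    intro k
    rcases h : σ k with ⟨j, hj⟩ | ⟨j, hj⟩
    · exact Or.inl ⟨j, hj, by rw [← h, σ.symm_apply_apply]⟩
    · exact Or.inr ⟨j, hj, by rw [← h, σ.symm_apply_apply]⟩
  let D : V →L[ℝ] ℝ^r := (fderiv ℝ G a).comp (ContinuousLinearMap.fst ℝ _ _) -
    (fderiv ℝ K b).comp (ContinuousLinearMap.snd ℝ _ _)
  have hD : ∀ v : V, D v = fderiv ℝ G a v.1 - fderiv ℝ K b v.2 := fun v => rfl
  have hsurj : Surjective (D.toLinearMap.prod ξ) := by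
    rintro ⟨w, u⟩
    let v0 : V := (fun k => if h : k ∈ c.act q.1.1 ∧ k ∉ range i then
      u (σ.symm (Sum.inl ⟨k, h⟩)) else 0, fun k => if h : k ∈ d.act q.1.2 then
      u (σ.symm (Sum.inr ⟨k, h⟩)) else 0)
    obtain ⟨s, t, hs, ht, hst⟩ := exists_tangent_of_transverse hT hi hG hip (w - D v0)
    refine ⟨v0 + (s, t), Prod.ext ?_ (funext fun k => ?_)⟩
    · change D (v0 + (s, t)) = w
      rw [map_add, hD (s, t), ← hG.chartDeriv_eq, ← hK.chartDeriv_eq, hst]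
      abel
    · change ξ (v0 + (s, t)) k = u k
      rcases hξ k with ⟨j, h, rfl⟩ | ⟨j, h, rfl⟩
      · rw [hξ1]
        change v0.1 j + s j = _
        simp only [v0, dif_pos h, hs j h.1 h.2, add_zero]
      · rw [hξ2]
        change v0.2 j + t j = _
        simp only [v0, dif_pos h, ht j h, add_zero]
  obtain ⟨p, θ, hdim, hbij, hθ⟩ := exists_coordinates D.toLinearMap ξ hsurj
  have hdim' : κ + p + r = m + l := by
    rw [Module.finrank_prod, Module.finrank_fin_fun, Module.finrank_fin_fun] at hdim
    omega
  let θ' : V →L[ℝ] ℝ^(κ + p) := LinearMap.toContinuousLinearMap θ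
  let H : V → ℝ^r := fun v => G v.1 - K v.2
  have hH : GermSmooth H (a, b) := (hG.smooth.comp (ContDiff.germSmooth contDiff_fst _) rfl).sub
      (hK.smooth.comp (ContDiff.germSmooth contDiff_snd _) rfl)
  have hHd : HasFDerivAt H D (a, b) := by
    exact (hG.smooth.differentiableAt.hasFDerivAt.comp ((a, b) : V) hasFDerivAt_fst).sub
        (hK.smooth.differentiableAt.hasFDerivAt.comp ((a, b) : V) hasFDerivAt_snd)
  let E : V ≃L[ℝ] ℝ^r × ℝ^(κ + p) :=
    (LinearEquiv.ofBijective (D.toLinearMap.prod θ) hbij).toContinuousLinearEquiv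
  obtain ⟨Ψ₀, ha0, hΨ₀, hΨs, -⟩ := (hH.prodMk (ContDiff.germSmooth θ'.contDiff _)).exists_inverse E
    (by
      rw [(hHd.prodMk θ'.hasFDerivAt).fderiv]
      rfl)
  have hN : ∀ᶠ v : V in 𝓝 (a, b),
      ((∀ k ∈ c.act q.1.1, 0 ≤ v.1 k) → v.1 ∈ c.source) ∧
      ((∀ k ∈ d.act q.1.2, 0 ≤ v.2 k) → v.2 ∈ d.source) ∧
      (v.1 ∈ c.source → f (c.toFun v.1) ∈ e.target ∧ e.invFun (f (c.toFun v.1)) = G v.1) ∧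
      (v.2 ∈ d.source → g (d.toFun v.2) ∈ e.target ∧ e.invFun (g (d.toFun v.2)) = K v.2) ∧
      ∀ j : e.act (f q.1.1), 0 ≤ G v.1 j → 0 ≤ v.1 (i j) := by
    have h1 : Tendsto (Prod.fst : V → _) (𝓝 (a, b)) (𝓝 a) := continuousAt_fst
    have h2 : Tendsto (Prod.snd : V → _) (𝓝 (a, b)) (𝓝 b) := continuousAt_snd
    filter_upwards [h1.eventually (CornerChart.eventually_mem_source hx),
      h2.eventually (CornerChart.eventually_mem_source hy), h1.eventually hG.eventually_source,
      h2.eventually hK.eventually_source, h1.eventually hsign] with v h3 h4 h5 h6 h7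
      using ⟨h3, h4, h5, h6, h7⟩
  obtain ⟨N, hN, hNo, habN⟩ := eventually_nhds_iff.1 hN
  let Ψ := Ψ₀.restrOpen N hNo
  have hΨ : ∀ v ∈ Ψ.source, Ψ v = (H v, θ v) := fun v hv => hΨ₀ v hv.1
  have hθk := hθ
  have hcast : ∀ k : Fin (κ + p), (k : ℕ) < κ → ∃ k', k = Fin.castAdd p k' :=
    fun k hk => ⟨⟨k, hk⟩, rfl⟩
  have hcoord : ∀ (v : V), θ v ∈ quadrant (κ + p) κ →
      (∀ k ∈ c.act q.1.1, k ∉ range i → 0 ≤ v.1 k) ∧ ∀ k ∈ d.act q.1.2, 0 ≤ v.2 k := by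
    intro v hv
    refine ⟨fun k hk hk' => ?_, fun k hk => ?_⟩
    · rw [← hξ1 k ⟨hk, hk'⟩, ← hθk]
      exact hv _ (σ.symm (Sum.inl ⟨k, hk, hk'⟩)).2
    · rw [← hξ2 k hk, ← hθk]
      exact hv _ (σ.symm (Sum.inr ⟨k, hk⟩)).2
  have c1 : ∀ v ∈ Ψ.source, v.1 ∈ c.source → v.2 ∈ d.source →
      (f (c.toFun v.1) = g (d.toFun v.2) ↔ H v = 0) := by
    rintro v ⟨-, hv⟩ hv1 hv2
    obtain ⟨-, -, h3, h4, -⟩ := hN v hv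
    obtain ⟨h5, h6⟩ := h3 hv1
    obtain ⟨h7, h8⟩ := h4 hv2
    change _ ↔ G v.1 - K v.2 = 0
    rw [← h6, ← h8, sub_eq_zero]
    refine ⟨fun h => congrArg e.invFun h, fun h => ?_⟩
    rw [← e.toInv h5, h, e.toInv h7]
  have c2 : ∀ v ∈ Ψ.source, H v = 0 → θ v ∈ quadrant (κ + p) κ →
      v.1 ∈ c.source ∧ v.2 ∈ d.source := by
    rintro v ⟨-, hv⟩ hv0 hvq
    obtain ⟨h1, h2, h3, h4, h5⟩ := hN v hv
    obtain ⟨h6, h7⟩ := hcoord v hvq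
    have h8 := h2 h7
    refine ⟨h1 fun k hk => ?_, h8⟩
    by_cases hk' : k ∈ range i
    · obtain ⟨j, rfl⟩ := hk'
      refine h5 j ?_
      rw [sub_eq_zero.1 hv0, ← (h4 h8).2]
      exact e.nonneg (h4 h8).1 j.2.1
    · exact h6 k hk hk'
  have c3 : ∀ v : V, v.1 ∈ c.source → v.2 ∈ d.source → θ v ∈ quadrant (κ + p) κ := by
    intro v hv1 hv2 k hk
    obtain ⟨k, rfl⟩ := hcast k hk
    rw [hθk]
    rcases hξ k with ⟨j, h, rfl⟩ | ⟨j, h, rfl⟩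
    · rw [hξ1]; exact c.source_subset_quadrant hv1 j h.1.1
    · rw [hξ2]; exact d.source_subset_quadrant hv2 j h.1
  obtain ⟨φ, hφk, hqφ, hφ⟩ := exists_chart_of_equations (c := c) (d := d)
    (κ := κ) (Nat.le_add_right κ p) q Ψ H θ θ'.continuous hΨ c1 c2 c3
    hx hy ⟨ha0, habN⟩
  refine ⟨κ + p, φ, hdim', hqφ, ?_⟩
  let S : ℝ^(κ + p) → V := fun v => Ψ.symm (0, v)
  have hSs : GermSmooth S (φ.invFun q) := by
    have h1 : GermSmooth Ψ.symm (0, φ.invFun q) := by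
      filter_upwards [Ψ.open_target.mem_nhds ((hφ q hqφ).2.2.2.1)] with v hv
      exact hΨs v hv.1
    exact h1.comp (ContDiff.germSmooth (contDiff_const.prodMk contDiff_id) _) rfl
  have hrX : Rep (·.1.1) φ c q (fun v => (S v).1) := by
    refine ⟨⟨hqφ, (ContDiff.germSmooth contDiff_fst _).comp hSs rfl, ?_⟩, hx, by fun_prop⟩
    filter_upwards [φ.eventually_target hqφ] with q' hq'
    simp only [S, (hφ q' hq').2.2.2.2]
  have hrY : Rep (·.1.2) φ d q (fun v => (S v).2) := by
    refine ⟨⟨hqφ, (ContDiff.germSmooth contDiff_snd _).comp hSs rfl, ?_⟩, hy, by fun_prop⟩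
    filter_upwards [φ.eventually_target hqφ] with q' hq'
    simp only [S, (hφ q' hq').2.2.2.2]
  have hact : ∀ k : Fin κ, Fin.castAdd p k ∈ φ.act q := by
    intro k
    refine ⟨by rw [hφk]; exact k.2, ?_⟩
    rw [(hφ q hqφ).2.2.1, hθk]
    rcases hξ k with ⟨j, h, rfl⟩ | ⟨j, h, rfl⟩
    · rw [hξ1]; exact h.1.2
    · rw [hξ2]; exact h.2
  have hpX : ∀ k (h : k ∈ c.act q.1.1 ∧ k ∉ range i),
      PullAt (fun q' => c.invFun q'.1.1 k) φ q
        (Fin.castAdd p (σ.symm (Sum.inl ⟨k, h⟩))) := by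
    intro k h
    refine (pullAt_coord hqφ (hact _)).congr ?_
    filter_upwards [φ.eventually_target hqφ] with q' hq'
    rw [(hφ q' hq').2.2.1, hθk, hξ1]
  have hpY : ∀ k (h : k ∈ d.act q.1.2),
      PullAt (fun q' => d.invFun q'.1.2 k) φ q
        (Fin.castAdd p (σ.symm (Sum.inr ⟨k, h⟩))) := by
    intro k h
    refine (pullAt_coord hqφ (hact _)).congr ?_
    filter_upwards [φ.eventually_target hqφ] with q' hq'
    rw [(hφ q' hq').2.2.1, hθk, hξ2]
  have hsY : SmC (·.1.2) φ d q :=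
    ⟨⟨_, hrY⟩, fun k hk => Or.inr ⟨_, hpY k hk⟩⟩
  have hsX : SmC (·.1.1) φ c q := by
    refine ⟨⟨_, hrX⟩, fun k hk => ?_⟩
    by_cases hk' : k ∈ range i
    · obtain ⟨j, rfl⟩ := hk'
      exact PullAt.lift (hip j)
        hrX.cont (hip j).act j.2 ((hg.comp (f := fun q' : {p : A × B // f p.1 = g p.2} => q'.1.2)
            hsY).congr (.of_forall fun q' => q'.2)) hrX
    · exact Or.inr ⟨_, hpX k ⟨hk, hk'⟩⟩
  refine ⟨hsX, hsY, fun t ht ht' => ?_, fun k hk => ?_⟩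
  · have h1 : ∀ᶠ v in 𝓝 (φ.invFun q), θ (S v) = v := by
      have h2 : ContinuousAt (fun v : Fin (κ + p) → ℝ => ((0 : ℝ^r), v)) (φ.invFun q) := by
        fun_prop
      filter_upwards [h2.eventually (Ψ.open_target.mem_nhds (hφ q hqφ).2.2.2.1)] with v hv
      have h3 := hΨ _ (Ψ.map_target hv)
      rw [Ψ.right_inv hv, Prod.mk.injEq] at h3
      exact h3.2.symm
    rw [hrX.chartDeriv_eq] at ht
    rw [hrY.chartDeriv_eq] at ht'
    have h5 : fderiv ℝ S (φ.invFun q) t = 0 := by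
      have e1 := (hasFDerivAt_fst.comp (φ.invFun q) hSs.differentiableAt.hasFDerivAt).fderiv
      have e2 := (hasFDerivAt_snd.comp (φ.invFun q) hSs.differentiableAt.hasFDerivAt).fderiv
      have e2' := DFunLike.congr_fun e2 t
      exact Prod.ext ((DFunLike.congr_fun e1 t).symm.trans ht) (e2'.symm.trans ht')
    have h6 : θ' (fderiv ℝ S (φ.invFun q) t) = t := DFunLike.congr_fun ((θ'.hasFDerivAt.comp _
        hSs.differentiableAt.hasFDerivAt).unique ((hasFDerivAt_id _).congr_of_eventuallyEq h1)) t
    rw [← h6, h5, map_zero]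
  · obtain ⟨k, rfl⟩ := hcast k (lt_of_lt_of_eq hk.1 hφk)
    rcases hξ k with ⟨j, h, rfl⟩ | ⟨j, h, rfl⟩
    · exact Or.inl ⟨j, h.1, hpX j h⟩
    · exact Or.inr ⟨j, h, hpY j h⟩

end

section
variable {A : Type u} [TopologicalSpace A] {n : ℕ}

/-- The restriction of a chart to an open subset of its image. -/
def CornerChart.restr (c : 𝒞 n A) {N : Set A} (hN : IsOpen N)
    (hne : (c.target ∩ N).Nonempty) : 𝒞 n A where
  toFun := c.toFun
  invFun := c.invFun
  source := c.source ∩ c.toFun ⁻¹' N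
  target := c.target ∩ N
  map_source' := fun _ h => ⟨c.mapS h.1, h.2⟩
  map_target' := fun x h => ⟨c.mapT h.1, by rw [mem_preimage, c.toInv h.1]; exact h.2⟩
  left_inv' := fun _ h => c.invTo h.1
  right_inv' := fun _ h => c.toInv h.1
  k := c.k
  k_le := c.k_le
  source_nonempty := by
    obtain ⟨x, hx, hx'⟩ := hne
    exact ⟨c.invFun x, c.mapT hx, by rw [mem_preimage, c.toInv hx]; exact hx'⟩
  source_open := by
    obtain ⟨O, hO, h⟩ := c.source_open
    obtain ⟨O', hO', h'⟩ := continuousOn_iff'.1 c.continuousOn_toFun N hN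
    refine ⟨O ∩ O', hO.inter hO', ?_⟩
    rw [inter_comm, h', h]
    ext a
    simp only [mem_inter_iff]
    tauto
  target_open := c.target_open.inter hN
  continuousOn_toFun := c.continuousOn_toFun.mono inter_subset_left
  continuousOn_invFun := c.continuousOn_invFun.mono inter_subset_left

lemma CornerChart.restr_compatible (c : 𝒞 n A) {N : Set A} (hN : IsOpen N)
    (hne : (c.target ∩ N).Nonempty) : Compatible (c.restr hN hne) c :=
  compatible_iff.2 fun _ hx hx' =>
    ⟨⟨_, rep_of_invFun_eq hx hx' (.of_forall fun _ => rfl)⟩,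
      ⟨_, rep_of_invFun_eq hx' hx (.of_forall fun _ => rfl)⟩⟩

lemma InitAt.exists_restr {P : Type*} [TopologicalSpace P] {A : Type*} {B : Type*}
    [TopologicalSpace A] [TopologicalSpace B] {m l : ℕ} {κ : P → A} {κ' : P → B}
    {δ : 𝒞 n P} {c : 𝒞 m A} {d : 𝒞 l B} {b : P}
    (h : InitAt κ κ' δ c d b) (hκ : Continuous κ) (hκ' : Continuous κ') :
    ∃ δ' : 𝒞 n P, b ∈ δ'.target ∧ ∀ y ∈ δ'.target, InitAt κ κ' δ' c d y := by
  obtain ⟨N, hN, hNo, hbN⟩ := eventually_nhds_iff.1 (h.eventually hκ hκ')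
  have hb : b ∈ δ.target ∩ N := ⟨h.smC.mem, hbN⟩
  exact ⟨δ.restr hNo ⟨b, hb⟩, hb, fun y hy => (hN y hy.2).change (δ.restr_compatible hNo ⟨b, hb⟩)
    (compatible_self c) (compatible_self d) hy (hN y hy.2).smC.mem' (hN y hy.2).smC'.mem'⟩

end

section
variable {P : Type*} {A : Type*} {B : Type*} [TopologicalSpace P] [TopologicalSpace A]
  [TopologicalSpace B] {n m l : ℕ} {κ : P → A} {κ' : P → B} {δ φ : 𝒞 n P}
  {c : 𝒞 m A} {d : 𝒞 l B} {b : P}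

/-- A chart in which the maps of an initial pair are smooth and jointly immersive is smoothly
compatible with the given one. -/
lemma InitAt.rep (H : InitAt κ κ' δ c d b) (h1 : SmC κ φ c b) (h2 : SmC κ' φ d b)
    (hinj : ∀ t, 𝒟 κ φ c b t = 0 → 𝒟 κ' φ d b t = 0 → t = 0) :
    (∃ G, Rep (id : P → P) φ δ b G) ∧ ∃ G, Rep (id : P → P) δ φ b G := by
  obtain ⟨R, hR⟩ := (InitAt.lift H continuousAt_id h1 h2).rep
  refine ⟨⟨R, hR⟩, ?_⟩
  obtain ⟨L, hL, hLe⟩ := hR.smooth.exists_leftInverse fun t ht => by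
    obtain ⟨G, hG⟩ := H.smC.rep
    obtain ⟨G', hG'⟩ := H.smC'.rep
    rw [← hR.chartDeriv_eq] at ht
    refine hinj t ?_ ?_
    · rw [show κ = κ ∘ id from rfl, Rep.chartDeriv_comp hG hR,
        ContinuousLinearMap.comp_apply, ht, map_zero]
    · rw [show κ' = κ' ∘ id from rfl, Rep.chartDeriv_comp hG' hR,
        ContinuousLinearMap.comp_apply, ht, map_zero]
  rw [hR.apply] at hL
  refine ⟨L, ⟨⟨H.smC.mem, hL, ?_⟩, h1.mem, continuousAt_id⟩⟩
  filter_upwards [hR.eq, (φ.continuousAt_invFun h1.mem).eventually hLe] with y h3 h4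
  have h5 : δ.invFun y = R (φ.invFun y) := h3
  rw [h5, h4]; rfl

end

section
variable {X : CSpace.{u}} {Y : CSpace.{v}} {Z : CSpace.{w}} {f : X → Z} {g : Y → Z}

lemma smooth_domain_iff {A : Type u} [TopologicalSpace A] {n : ℕ} (c : 𝒞 n A)
    (hY : Y.IsManifold) {h : A → Y} :
    Smooth (CSpace.domain n c.source) Y (fun a => h (c.toFun a.1)) ↔
      ∀ x ∈ c.target, ∀ m, ∀ d ∈ Y.charts m, h x ∈ d.target → SmC h c d x := by
  obtain ⟨h1, h2⟩ := domain_isManifold c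
  constructor
  · intro hs x hx m d hd hhx
    have h3 := dom_liftAt c ⟨_, c.mapT hx⟩
    have h4 := h1.smC_of_smooth hY hs h2 hd h3.2.mem
      (by change h (c.toFun (c.invFun x)) ∈ _; rw [c.toInv hx]; exact hhx)
    have h5 := (h3.2.smC_iff rfl).2 h4
    rwa [c.toInv hx] at h5
  · intro hs
    refine h1.smooth_of_smC hY fun a => ?_
    obtain ⟨m, d, hd, hx⟩ := hY.cover (h (c.toFun a.1))
    exact ⟨n, _, h2, m, d, hd, ((dom_liftAt c a).2.smC_iff rfl).1 (hs _ (c.mapS a.2) m d hd hx)⟩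

lemma mem_fibre_charts (hX : X.IsManifold) (hY : Y.IsManifold) {n : ℕ}
    {φ : 𝒞 n (X.fibre Y Z f g)} : φ ∈ (X.fibre Y Z f g).charts n ↔
      (n : ℤ) = X.dim + Y.dim - Z.dim ∧ ∀ q ∈ φ.target, ∀ m, ∀ c ∈ X.charts m,
        ∀ l, ∀ d ∈ Y.charts l, q.1.1 ∈ c.target → q.1.2 ∈ d.target →
          SmC (·.1.1) φ c q ∧
          SmC (·.1.2) φ d q ∧
          ∀ t, 𝒟 (·.1.1) φ c q t = 0 →
            𝒟 (·.1.2) φ d q t = 0 → t = 0 := by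
  have hfst := smooth_domain_iff φ hX (h := fun r : X.fibre Y Z f g => r.1.1)
  have hsnd := smooth_domain_iff φ hY (h := fun r : X.fibre Y Z f g => r.1.2)
  constructor
  · rintro ⟨h1, h2, h3, h4⟩
    exact ⟨h1, fun q hq m c hc l d hd hqc hqd => ⟨hfst.1 h2 q hq m c hc hqc,
      hsnd.1 h3 q hq l d hd hqd, h4 q hq m c hc l d hd hqc hqd⟩⟩
  · rintro ⟨h1, h2⟩
    refine ⟨h1, hfst.2 fun q hq m c hc hqc => ?_, hsnd.2 fun q hq l d hd hqd => ?_,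
      fun q hq m c hc l d hd hqc hqd => (h2 q hq m c hc l d hd hqc hqd).2.2⟩
    · obtain ⟨l, d, hd, hqd⟩ := hY.cover q.1.2
      exact (h2 q hq m c hc l d hd hqc hqd).1
    · obtain ⟨m, c, hc, hqc⟩ := hX.cover q.1.1
      exact (h2 q hq m c hc l d hd hqc hqd).2.1

/-- The stratum part of transversality, at a single pair of points of a fibre product. -/
def StratumTransverse (X : CSpace.{u}) (Y : CSpace.{v}) (Z : CSpace.{w}) (f : X → Z) (g : Y → Z) :
    Prop :=
  ∀ (x : X) (y : Y), f x = g y → ∃ m, ∃ c ∈ X.charts m, ∃ n, ∃ d ∈ Y.charts n,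
    ∃ l, ∃ e ∈ Z.charts l, x ∈ c.target ∧ y ∈ d.target ∧ f x ∈ e.target ∧
    (c.stratumTangent x).map (𝒟 f c e x).1 ⊔
      (d.stratumTangent y).map (𝒟 g d e y).1 = e.stratumTangent (f x)

/-- The fibre product of smooth maps that are transverse on strata, the first one being
b-submersive, is a manifold with corners. -/
theorem fibre_isManifold (hX : X.IsManifold) (hY : Y.IsManifold) (hZ : Z.IsManifold)
    (hf : IsBSubmersive X Z f) (hg : Smooth Y Z g) (ht : StratumTransverse X Y Z f g) :
    (X.fibre Y Z f g).IsManifold ∧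
      Init (X.fibre Y Z f g) X Y (·.1.1) (·.1.2) := by
  have t2X := hX.t2
  have t2Y := hY.t2
  have t2Z := hZ.t2
  have pX := hX.paracompact
  have pY := hY.paracompact
  have wX := hX.weaklyLocallyCompactSpace
  have hpar : ParacompactSpace (X.fibre Y Z f g) := by
    have := paracompactSpace_prod (A := X) (B := Y)
    exact (isClosed_eq (hf.1.continuous.comp continuous_fst) (hg.continuous.comp
        continuous_snd)).isClosedEmbedding_subtypeVal.paracompactSpace
  have hchart : ∀ q : X.fibre Y Z f g, ∃ n, ∃ φ : 𝒞 n (X.fibre Y Z f g), q ∈ φ.target ∧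
      ((n : ℤ) = X.dim + Y.dim - Z.dim ∧ ∃ m, ∃ c ∈ X.charts m, ∃ l, ∃ d ∈ Y.charts l,
        ∀ q ∈ φ.target, InitAt (·.1.1)
          (·.1.2) φ c d q) := by
    intro q
    obtain ⟨m, c, hc, l, d, hd, r, e, he, hqc, hqd, hqe, hT⟩ := ht q.1.1 q.1.2 q.2
    obtain ⟨n, φ, hn, hq, hφ⟩ := exists_fibreChart
      (hX.smC_of_smooth hZ hf.1 hc he hqc hqe)
      (hY.smC_of_smooth hZ hg hd he hqd (q.2 ▸ hqe)) hT (hf.2 _ _ _ hc _ _ he hqc hqe)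
    obtain ⟨φ', hq', hφ'⟩ := hφ.exists_restr (by fun_prop) (by fun_prop)
    refine ⟨n, φ', hq', ?_, m, c, hc, l, d, hd, hφ'⟩
    rw [← hX.dim_eq _ c hc, ← hY.dim_eq _ d hd, ← hZ.dim_eq _ e he]
    omega
  have hinit : ∀ {n} {φ : 𝒞 n (X.fibre Y Z f g)}, (∃ m, ∃ c ∈ X.charts m, ∃ l,
      ∃ d ∈ Y.charts l, ∀ q ∈ φ.target, InitAt (·.1.1)
          (·.1.2) φ c d q) → ∀ q ∈ φ.target, ∀ m, ∀ c ∈ X.charts m,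
        ∀ l, ∀ d ∈ Y.charts l, q.1.1 ∈ c.target → q.1.2 ∈ d.target →
        InitAt (·.1.1) (·.1.2) φ c d q := by
    rintro n φ ⟨m, c, hc, l, d, hd, h⟩ q hq m' c' hc' l' d' hd' hqc hqd
    obtain rfl := hX.dim_unique hc hc'
    obtain rfl := hY.dim_unique hd hd'
    exact (h q hq).change (compatible_self φ) (hX.compatible _ _ hc _ hc')
      (hY.compatible _ _ hd _ hd') hq hqc hqd
  have main := isManifold_of_atlas (X.fibre Y Z f g) inferInstance hpar
    (fun n => {φ | (n : ℤ) = X.dim + Y.dim - Z.dim ∧ ∃ m, ∃ c ∈ X.charts m, ∃ l, ∃ d ∈ Y.charts l,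
        ∀ q ∈ φ.target, InitAt (·.1.1)
          (·.1.2) φ c d q})
    (fun n c hc => hc.1) (fun q => ?_) ?_ ?_
  · refine ⟨main.1, fun q => ?_⟩
    obtain ⟨n, φ, hq, hn, m, c, hc, l, d, hd, h⟩ := hchart q
    exact ⟨n, φ, main.2 n ⟨hn, m, c, hc, l, d, hd, h⟩, m, c, hc, l, d, hd, h q hq⟩
  · obtain ⟨n, φ, hq, h⟩ := hchart q
    exact ⟨n, φ, h, hq⟩
  · rintro n φ ⟨-, h⟩ φ' ⟨-, h'⟩
    refine compatible_iff.2 fun q hq hq' => ?_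
    obtain ⟨m, c, hc, hqc⟩ := hX.cover q.1.1
    obtain ⟨l, d, hd, hqd⟩ := hY.cover q.1.2
    have h1 := hinit h q hq m c hc l d hd hqc hqd
    exact (hinit h' q hq' m c hc l d hd hqc hqd).rep h1.smC h1.smC' h1.inj
  · intro n φ
    rw [mem_fibre_charts hX hY]
    refine and_congr_right fun hn => ⟨fun h ψ hψ => ?_, fun h q hq m c hc l d hd hqc hqd => ?_⟩
    · refine compatible_iff.2 fun q hq hq' => ?_
      obtain ⟨m, c, hc, hqc⟩ := hX.cover q.1.1
      obtain ⟨l, d, hd, hqd⟩ := hY.cover q.1.2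
      obtain ⟨h2, h3, h4⟩ := h q hq' m c hc l d hd hqc hqd
      exact ((hinit hψ.2 q hq m c hc l d hd hqc hqd).rep h2 h3 h4).symm
    · obtain ⟨n', ψ, hq', hn', h'⟩ := hchart q
      obtain rfl : n = n' := by omega
      have h1 := (hinit h' q hq' m c hc l d hd hqc hqd).change (h ψ ⟨hn', h'⟩).symm
        (compatible_self c) (compatible_self d) hq hqc hqd
      exact ⟨h1.smC, h1.smC', h1.inj⟩

end

/-! ### Change of charts for the conditions on differentials -/

section
variable {A : Type u} {B : Type v} {C : Type w} [TopologicalSpace A] [TopologicalSpace B]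
  [TopologicalSpace C] {m l r : ℕ} {c c' : 𝒞 m A} {d d' : 𝒞 l B}
  {e e' : 𝒞 r C} {f : A → C} {g : B → C} {x : A} {y : B}

lemma SmC.map_stratumTangent_le (h : SmC f c e x) :
    (c.stratumTangent x).map (𝒟 f c e x).1 ≤ e.stratumTangent (f x) := by
  rintro _ ⟨t, ht, rfl⟩
  exact mem_stratumTangent.2 (h.rep.choose_spec.chartDeriv_stratum (mem_stratumTangent.1 ht))

lemma Compatible.map_stratumTangent (h : Compatible c c') (hx : x ∈ c.target)
    (hx' : x ∈ c'.target) :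
    (c.stratumTangent x).map (𝒟 (id : A → A) c c' x).1 = c'.stratumTangent x := by
  refine le_antisymm (h.smC hx hx').map_stratumTangent_le fun t ht => ?_
  refine ⟨𝒟 (id : A → A) c' c x t, (h.symm.smC hx' hx).map_stratumTangent_le ⟨t, ht, rfl⟩,
    ?_⟩
  exact DFunLike.congr_fun (h.symm.chartDeriv_comp hx' hx) t

lemma Compatible.range_chartDeriv (h : Compatible c c') (hx : x ∈ c.target)
    (hx' : x ∈ c'.target) :
    LinearMap.range (𝒟 (id : A → A) c c' x).1 = ⊤ :=
  LinearMap.range_eq_top.2 (chartDeriv_bijective h hx hx').2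

lemma SmC.chartDeriv_change (h : SmC f c e x) (hc : Compatible c' c) (he : Compatible e e')
    (hx : x ∈ c'.target) (hfx : f x ∈ e'.target) :
    (𝒟 f c' e' x).1 = (𝒟 (id : C → C) e e' (f x)).1 ∘ₗ
      (𝒟 f c e x).1 ∘ₗ (𝒟 (id : A → A) c' c x).1 := by
  obtain ⟨G, hG⟩ := h.rep
  obtain ⟨R, hR⟩ := hc.rep hx h.mem
  obtain ⟨S, hS⟩ := he.rep h.mem' hfx
  have h2 := Rep.chartDeriv_comp (f := f ∘ id) hS
    (Rep.comp hG hR)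
  change 𝒟 f c' e' x = _ at h2
  rw [h2, Rep.chartDeriv_comp hG hR]
  rfl

lemma SmC.map_stratumTangent_change (h : SmC f c e x) (hc : Compatible c' c)
    (he : Compatible e e') (hx : x ∈ c'.target) (hfx : f x ∈ e'.target) :
    (c'.stratumTangent x).map (𝒟 f c' e' x).1 =
      ((c.stratumTangent x).map (𝒟 f c e x).1).map
        (𝒟 (id : C → C) e e' (f x)).1 := by
  rw [h.chartDeriv_change hc he hx hfx, Submodule.map_comp, Submodule.map_comp,
    hc.map_stratumTangent hx h.mem]

lemma SmC.range_change (h : SmC f c e x) (hc : Compatible c' c)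
    (he : Compatible e e') (hx : x ∈ c'.target) (hfx : f x ∈ e'.target) :
    LinearMap.range (𝒟 f c' e' x).1 =
      (LinearMap.range (𝒟 f c e x).1).map
        (𝒟 (id : C → C) e e' (f x)).1 := by
  rw [h.chartDeriv_change hc he hx hfx, LinearMap.range_comp, LinearMap.range_comp,
    hc.range_chartDeriv hx h.mem, Submodule.map_top]

/-- b-submersivity at a point, in terms of the coordinates that vanish there. -/
lemma range_sup_stratumTangent_eq_top (D : ℝ^m →L[ℝ] ℝ^r) (z : C) :
    LinearMap.range D.toLinearMap ⊔ e.stratumTangent z = ⊤ ↔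
      ∀ w : Fin r → ℝ, ∃ t, ∀ j ∈ e.act z, D t j = w j := by
  constructor
  · intro h w
    have hw : w ∈ LinearMap.range D.toLinearMap ⊔ e.stratumTangent z := h ▸ Submodule.mem_top
    obtain ⟨_, ⟨t, rfl⟩, s, hs, rfl⟩ := Submodule.mem_sup.1 hw
    refine ⟨t, fun j hj => ?_⟩
    rw [Pi.add_apply, mem_stratumTangent.1 hs j hj, add_zero]
    rfl
  · intro h
    refine Submodule.eq_top_iff'.2 fun w => ?_
    obtain ⟨t, ht⟩ := h w
    refine Submodule.mem_sup.2 ⟨D t, ⟨t, rfl⟩, w - D t, mem_stratumTangent.2 fun j hj => ?_,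
      by abel⟩
    rw [Pi.sub_apply, ht j hj, sub_self]

end

section
variable {X : CSpace.{u}} {Y : CSpace.{v}} {Z : CSpace.{w}} {f : X → Z} {g : Y → Z}

variable {m n l : ℕ} {e : 𝒞 l Z} {A : CSpace.{u'}} {ι : A → X} {a : A}
    {α : 𝒞 m A} {c : 𝒞 n X}

lemma IsSubmersion.isBSubmersive (h : IsSubmersion X Z f) : IsBSubmersive X Z f :=
  ⟨h.1, fun x m c hc n d hd hx hfx => by rw [(h.2 x m c hc n d hd hx hfx).1, top_sup_eq]⟩

lemma isBSubmersive_of_exists (hX : X.IsManifold) (hZ : Z.IsManifold) (hf : Smooth X Z f)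
    (h : ∀ x, ∃ m, ∃ c ∈ X.charts m, ∃ n, ∃ e ∈ Z.charts n, x ∈ c.target ∧ f x ∈ e.target ∧
      LinearMap.range (𝒟 f c e x).1 ⊔ e.stratumTangent (f x) = ⊤) :
    IsBSubmersive X Z f := by
  refine ⟨hf, fun x m' c' hc' n' e' he' hx hfx => ?_⟩
  obtain ⟨m, c, hc, n, e, he, hx', hfx', h1⟩ := h x
  obtain rfl := hX.dim_unique hc hc'
  obtain rfl := hZ.dim_unique he he'
  have hce := hZ.compatible _ _ he _ he'
  rw [(hX.smC_of_smooth hZ hf hc he hx' hfx').range_change (hX.compatible _ _ hc' _ hc) hce hx hfx,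
    ← hce.map_stratumTangent hfx' hfx, ← Submodule.map_sup, h1, Submodule.map_top,
    hce.range_chartDeriv hfx' hfx]

lemma isSubmersion_of_exists (hX : X.IsManifold) (hZ : Z.IsManifold) (hf : Smooth X Z f)
    (h : ∀ x, ∃ m, ∃ c ∈ X.charts m, ∃ n, ∃ e ∈ Z.charts n, x ∈ c.target ∧ f x ∈ e.target ∧
      LinearMap.range (𝒟 f c e x).1 = ⊤ ∧
      (c.stratumTangent x).map (𝒟 f c e x).1 = e.stratumTangent (f x)) :
    IsSubmersion X Z f := by
  refine ⟨hf, fun x m' c' hc' n' e' he' hx hfx => ?_⟩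
  obtain ⟨m, c, hc, n, e, he, hx', hfx', h1, h2⟩ := h x
  obtain rfl := hX.dim_unique hc hc'
  obtain rfl := hZ.dim_unique he he'
  have hce := hZ.compatible _ _ he _ he'
  have hs := hX.smC_of_smooth hZ hf hc he hx' hfx'
  rw [hs.range_change (hX.compatible _ _ hc' _ hc) hce hx hfx, h1, Submodule.map_top,
    hce.range_chartDeriv hfx' hfx, hs.map_stratumTangent_change (hX.compatible _ _ hc' _ hc) hce
      hx hfx, h2, hce.map_stratumTangent hfx' hfx]
  exact ⟨rfl, rfl⟩

lemma StratumTransverse.eq (h : StratumTransverse X Y Z f g) (hX : X.IsManifold) (hY : Y.IsManifold)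
    (hZ : Z.IsManifold) (hf : Smooth X Z f) (hg : Smooth Y Z g) {x : X} {y : Y} (hxy : f x = g y)
    {c : 𝒞 m X} (hc : c ∈ X.charts m) {d : 𝒞 n Y} (hd : d ∈ Y.charts n)
    (he : e ∈ Z.charts l) (hx : x ∈ c.target) (hy : y ∈ d.target) (hz : f x ∈ e.target) :
    (c.stratumTangent x).map (𝒟 f c e x).1 ⊔
      (d.stratumTangent y).map (𝒟 g d e y).1 = e.stratumTangent (f x) := by
  obtain ⟨m', c', hc', n', d', hd', l', e', he', hx', hy', hz', h1⟩ := h x y hxy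
  obtain rfl := hX.dim_unique hc hc'
  obtain rfl := hY.dim_unique hd hd'
  obtain rfl := hZ.dim_unique he he'
  have hce := hZ.compatible _ _ he' _ he
  rw [(hX.smC_of_smooth hZ hf hc' he' hx' hz').map_stratumTangent_change
      (hX.compatible _ _ hc _ hc') hce hx hz,
    (hY.smC_of_smooth hZ hg hd' he' hy' (hxy ▸ hz')).map_stratumTangent_change
      (hY.compatible _ _ hd _ hd') hce hy (hxy ▸ hz), ← hxy, ← Submodule.map_sup, h1,
    hce.map_stratumTangent hz' hz]

lemma StratumTransverse.areTransverse (h : StratumTransverse X Y Z f g) (hX : X.IsManifold)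
    (hY : Y.IsManifold) (hZ : Z.IsManifold) (hf : IsBSubmersive X Z f) (hg : Smooth Y Z g) :
    AreTransverse X Y Z f g := by
  refine ⟨hf.1, hg, fun x y hxy m c hc n d hd l e he hx hy hz => ?_⟩
  have h1 := h.eq hX hY hZ hf.1 hg hxy hc hd he hx hy hz
  refine ⟨?_, h1⟩
  rw [← top_le_iff, ← hf.2 x m c hc l e he hx hz, ← h1]
  refine sup_le le_sup_left (sup_le_sup ?_ ?_) <;> exact LinearMap.map_le_range

lemma AreTransverse.stratumTransverse (h : AreTransverse X Y Z f g) (hX : X.IsManifold)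
    (hY : Y.IsManifold) (hZ : Z.IsManifold) : StratumTransverse X Y Z f g := by
  intro x y hxy
  obtain ⟨m, c, hc, hx⟩ := hX.cover x
  obtain ⟨n, d, hd, hy⟩ := hY.cover y
  obtain ⟨l, e, he, hz⟩ := hZ.cover (f x)
  exact ⟨m, c, hc, n, d, hd, l, e, he, hx, hy, hz,
    (h.2.2 x y hxy m c hc n d hd l e he hx hy hz).2⟩

lemma IsSubmersion.stratumTransverse (hf : IsSubmersion X Z f) (hg : Smooth Y Z g)
    (hX : X.IsManifold) (hY : Y.IsManifold) (hZ : Z.IsManifold) :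
    StratumTransverse X Y Z f g := by
  intro x y hxy
  obtain ⟨m, c, hc, hx⟩ := hX.cover x
  obtain ⟨n, d, hd, hy⟩ := hY.cover y
  obtain ⟨l, e, he, hz⟩ := hZ.cover (f x)
  refine ⟨m, c, hc, n, d, hd, l, e, he, hx, hy, hz, ?_⟩
  rw [(hf.2 x m c hc l e he hx hz).2, sup_eq_left, hxy]
  exact (hY.smC_of_smooth hZ hg hd he hy (hxy ▸ hz)).map_stratumTangent_le

lemma CSpace.WithoutBoundary.act_eq_empty (h : Z.WithoutBoundary) (hZ : Z.IsManifold)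
    {e : 𝒞 n Z} (he : e ∈ Z.charts n) {z : Z} (hz : z ∈ e.target) : e.act z = ∅ := by
  obtain ⟨n', e', he', hk, hz'⟩ := h z
  obtain rfl := hZ.dim_unique he he'
  have h1 := (hZ.compatible _ _ he' _ he).ncard_act hz' hz
  have h2 : e'.act z = ∅ := by
    ext i
    simp [CornerChart.act, hk]
  rw [h2, ncard_empty, ncard_eq_zero] at h1
  exact h1

lemma CSpace.WithoutBoundary.isBSubmersive (h : Z.WithoutBoundary) (hX : X.IsManifold)
    (hZ : Z.IsManifold) (hf : Smooth X Z f) : IsBSubmersive X Z f := by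
  refine isBSubmersive_of_exists hX hZ hf fun x => ?_
  obtain ⟨m, c, hc, hx⟩ := hX.cover x
  obtain ⟨l, e, he, hz⟩ := hZ.cover (f x)
  refine ⟨m, c, hc, l, e, he, hx, hz, (range_sup_stratumTangent_eq_top _ _).2 fun w => ⟨0, ?_⟩⟩
  rw [h.act_eq_empty hZ he hz]
  simp

/-- Smooth maps that identify the tangent spaces of the strata. -/
def StratumIso (A : CSpace.{u}) (X : CSpace.{v}) (ι : A → X) : Prop :=
  Smooth A X ι ∧ ∀ a, ∃ m, ∃ α ∈ A.charts m, ∃ n, ∃ c ∈ X.charts n, SmC ι α c a ∧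
    (α.stratumTangent a).map (𝒟 ι α c a).1 = c.stratumTangent (ι a) ∧
    Injective (𝒟 ι α c a)

lemma StratumIso.eq (h : StratumIso A X ι) (hA : A.IsManifold) (hX : X.IsManifold)
    (hα : α ∈ A.charts m) (hc : c ∈ X.charts n) (ha : a ∈ α.target) (hx : ι a ∈ c.target) :
    (α.stratumTangent a).map (𝒟 ι α c a).1 = c.stratumTangent (ι a) := by
  obtain ⟨m', α', hα', n', c', hc', hs, h1, -⟩ := h.2 a
  obtain rfl := hA.dim_unique hα hα'
  obtain rfl := hX.dim_unique hc hc'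
  have hce := hX.compatible _ _ hc' _ hc
  rw [hs.map_stratumTangent_change (hA.compatible _ _ hα _ hα') hce ha hx, h1,
    hce.map_stratumTangent hs.mem' hx]

lemma StratumIso.map_comp (h : StratumIso A X ι) (hA : A.IsManifold) (hX : X.IsManifold)
    (hZ : Z.IsManifold) (hf : Smooth X Z f) (hα : α ∈ A.charts m) (hc : c ∈ X.charts n)
    (he : e ∈ Z.charts l) (ha : a ∈ α.target) (hx : ι a ∈ c.target) (hz : f (ι a) ∈ e.target) :
    (α.stratumTangent a).map (𝒟 (f ∘ ι) α e a).1 =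
      (c.stratumTangent (ι a)).map (𝒟 f c e (ι a)).1 := by
  obtain ⟨G, hG⟩ := (hX.smC_of_smooth hZ hf hc he hx hz).rep
  obtain ⟨H, hH⟩ := (hA.smC_of_smooth hX h.1 hα hc ha hx).rep
  rw [← h.eq hA hX hα hc ha hx, ← Submodule.map_comp, hG.chartDeriv_comp hH]
  rfl

lemma StratumTransverse.comp_left (h : StratumTransverse X Y Z f g) (hA : A.IsManifold)
    (hX : X.IsManifold) (hZ : Z.IsManifold) (hf : Smooth X Z f) (hι : StratumIso A X ι)
    : StratumTransverse A Y Z (f ∘ ι) g := by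
  intro a y hay
  obtain ⟨m, c, hc, n, d, hd, l, e, he, hx, hy, hz, h1⟩ := h (ι a) y hay
  obtain ⟨k, α, hα, ha⟩ := hA.cover a
  refine ⟨k, α, hα, n, d, hd, l, e, he, ha, hy, hz, ?_⟩
  rw [hι.map_comp hA hX hZ hf hα hc he ha hx hz, h1]
  rfl

lemma StratumTransverse.comp_right {B : CSpace.{u'}} {ι : B → Y} (h : StratumTransverse X Y Z f g)
    (hB : B.IsManifold) (hY : Y.IsManifold) (hZ : Z.IsManifold) (hg : Smooth Y Z g)
    (hι : StratumIso B Y ι) : StratumTransverse X B Z f (g ∘ ι) := by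
  intro x b hxb
  obtain ⟨m, c, hc, n, d, hd, l, e, he, hx, hy, hz, h1⟩ := h x (ι b) hxb
  obtain ⟨k, β, hβ, hb⟩ := hB.cover b
  refine ⟨m, c, hc, k, β, hβ, l, e, he, hx, hb, hz, ?_⟩
  rw [hι.map_comp hB hY hZ hg hβ hd he hb hy (by rw [show g (ι b) = f x from hxb.symm]; exact hz),
      h1]

lemma StratumTransverse.of_comp {Z' : CSpace.{u'}} {ι : Z' → Z} {f : X → Z'} {g : Y → Z'}
    (h : StratumTransverse X Y Z (ι ∘ f) (ι ∘ g)) (hX : X.IsManifold) (hY : Y.IsManifold)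
    (hZ : Z.IsManifold) (hZ' : Z'.IsManifold) (hf : Smooth X Z' f) (hg : Smooth Y Z' g)
    (hι : StratumIso Z' Z ι) : StratumTransverse X Y Z' f g := by
  intro x y hxy
  obtain ⟨k, ζ, hζ, l, e, he, hs, h2, hinj⟩ := hι.2 (f x)
  obtain ⟨m, c, hc, hx⟩ := hX.cover x
  obtain ⟨n, d, hd, hy⟩ := hY.cover y
  refine ⟨m, c, hc, n, d, hd, k, ζ, hζ, hx, hy, hs.mem, ?_⟩
  obtain ⟨G, hG⟩ := hs.rep
  obtain ⟨F, hF⟩ := (hX.smC_of_smooth hZ' hf hc hζ hx hs.mem).rep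
  obtain ⟨K, hK⟩ := (hY.smC_of_smooth hZ' hg hd hζ hy (hxy ▸ hs.mem)).rep
  apply Submodule.map_injective_of_injective (f := (𝒟 ι ζ e (f x)).1) hinj
  refine Eq.trans ?_ ((h.eq hX hY hZ (hι.1.comp' hX hZ' hZ hf) (hι.1.comp' hY hZ' hZ hg) (by simp
      [hxy]) hc hd he hx hy hs.mem').trans h2.symm)
  rw [Submodule.map_sup, ← Submodule.map_comp, ← Submodule.map_comp, hG.chartDeriv_comp hF,
    Rep.chartDeriv_comp (hxy ▸ hG) hK]
  congr 1
  rw [← hxy]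
  rfl

end

/-! ### Open and closed parts of the boundary -/

section
variable {A : CSpace.{u}} {B : CSpace.{v}}

lemma Etale.exists_chart {e : A → B} (he : Etale A B e) (hA : A.IsManifold) (hB : B.IsManifold)
    {n : ℕ} {d : 𝒞 n B} (hd : d ∈ B.charts n) {a : A} (ha : e a ∈ d.target) :
    ∃ c ∈ A.charts n, c.k = d.k ∧ LiftAt e c d a := by
  refine ⟨d.pull he.emb ⟨a, ha⟩, ?_, rfl, liftAt_pull d he.emb ⟨a, ha⟩ ha⟩
  refine hA.mem_charts fun x hx => ?_
  obtain ⟨m, c, hc, hxc⟩ := hA.cover x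
  obtain rfl := hB.dim_unique hd (he.charts _ c hc)
  have hxd := hx
  have hcomp := hB.compatible _ _ (he.charts _ c hc) _ hd
  have h1 := liftAt_push c he.emb hxc
  have h2 := liftAt_pull d he.emb ⟨a, ha⟩ hxd
  obtain ⟨G, hG⟩ := hcomp.rep h1.mem' hxd
  obtain ⟨H, hH⟩ := hcomp.symm.rep hxd h1.mem'
  exact ⟨c, hc, hxc, ⟨G, (LiftAt.rep_iff' h2).2 (h1.rep_iff.1 hG)⟩,
    ⟨H, (LiftAt.rep_iff' h1).2 (h2.rep_iff.1 hH)⟩⟩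

end

/-- The charts `α` of an open part of the boundary that come from the `i`-th face of the chart
`c`. -/
structure IsFaceChart {A : Type u} [TopologicalSpace A] {X : CSpace.{v}} {n : ℕ}
    (e : A → BoundaryPt X) (α : 𝒞 n A) (c : 𝒞 (n + 1) X) (i : Fin (n + 1))
    (a : A) : Prop where
  face : IsFace c i (e a)
  mem : a ∈ α.target
  initAt : InitAt (fun a => (e a).pt) (fun a => (e a).pt) α c c a
  deriv : 𝒟 (fun a => (e a).pt) α c a = insL i
  act : α.act a = {j | i.succAbove j ∈ c.act (e a).pt}

section
variable {A : CSpace.{u}} {X : CSpace.{v}} {e : A → X.boundary} {n : ℕ}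

variable {c : 𝒞 (n + 1) X} {i : Fin (n + 1)} {a : A} {α : 𝒞 n A}

lemma Etale.exists_faceChart (he : Etale A X.boundary e) (hA : A.IsManifold) (hX : X.IsManifold)
    (a : A) : ∃ n, ∃ c ∈ X.charts (n + 1), ∃ i, ∃ α ∈ A.charts n, IsFaceChart e α c i a := by
  obtain ⟨n, c, hc, i, hi⟩ := hX.exists_faceChart (e a)
  obtain ⟨α, hα, hk, h⟩ := he.exists_chart hA hX.boundary (hX.faceChart_mem hc ⟨_, hi⟩) hi
  refine ⟨n, c, hc, i, α, hα, hi, h.mem,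
    (hX.initAt_incl hc ⟨_, hi⟩ hi).comp_left (h.initAt hk), ?_, ?_⟩
  · rw [← hX.chartDeriv_incl hc ⟨_, hi⟩ hi]
    exact (h.chartDeriv_eq (hX.rep_incl hc ⟨_, hi⟩ hi)).symm
  · rw [← h.act hk, faceChart_act]

lemma IsFaceChart.mem_stratumTangent_iff (h : IsFaceChart e α c i a) {t : ℝ^n} :
    t ∈ α.stratumTangent a ↔ insL i t ∈ c.stratumTangent (e a).pt := by
  rw [mem_stratumTangent, mem_stratumTangent, h.act]
  constructor
  · intro h1 j hj
    rcases Fin.eq_self_or_eq_succAbove i j with rfl | ⟨j, rfl⟩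
    · exact insL_same _ _
    · rw [insL_succAbove]; exact h1 j hj
  · intro h1 j hj
    have := h1 _ hj
    rwa [insL_succAbove] at this

lemma IsFaceChart.map_stratumTangent (h : IsFaceChart e α c i a) :
    (α.stratumTangent a).map (𝒟 (fun a => (e a).pt) α c a).1 =
      c.stratumTangent (e a).pt := by
  rw [h.deriv]
  ext t
  constructor
  · rintro ⟨s, hs, rfl⟩
    exact h.mem_stratumTangent_iff.1 hs
  · intro ht
    have h0 := mem_stratumTangent.1 ht i h.face.mem_act
    refine ⟨remL i t, h.mem_stratumTangent_iff.2 ?_, insL_remL h0⟩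
    rw [insL_remL h0]; exact ht

lemma Etale.stratumIso (he : Etale A X.boundary e) (hA : A.IsManifold) (hX : X.IsManifold) :
    StratumIso A X (fun a => (e a).pt) := by
  refine ⟨hX.smooth_incl.comp' hA hX.boundary hX (he.smooth hA hX.boundary), fun a => ?_⟩
  obtain ⟨n, c, hc, i, α, hα, h⟩ := he.exists_faceChart hA hX a
  exact ⟨n, α, hα, n + 1, c, hc, h.initAt.smC, h.map_stratumTangent,
    by rw [h.deriv]; exact insL_injective i⟩

lemma Etale.smooth_pt (he : Etale A X.boundary e) (hA : A.IsManifold) (hX : X.IsManifold) :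
    Smooth A X (fun a => (e a).pt) := (he.stratumIso hA hX).1

lemma CSpace.IsManifold.init_incl (hX : X.IsManifold) :
    Init X.boundary X X BoundaryPt.pt BoundaryPt.pt := by
  intro p
  obtain ⟨n, c, hc, i, hi⟩ := hX.exists_faceChart p
  exact ⟨n, _, hX.faceChart_mem hc ⟨p, hi⟩, n + 1, c, hc, n + 1, c, hc,
    hX.initAt_incl hc ⟨p, hi⟩ hi⟩

/-- An open part of the boundary has the initial smooth structure. -/
lemma Etale.init_pt (he : Etale A X.boundary e) (hA : A.IsManifold) (hX : X.IsManifold) :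
    Init A X X (fun a => (e a).pt) (fun a => (e a).pt) := by
  intro a
  obtain ⟨n, c, hc, i, α, hα, h⟩ := he.exists_faceChart hA hX a
  exact ⟨n, α, hα, n + 1, c, hc, n + 1, c, hc, h.initAt⟩

end

/-! ### The decomposition of the boundary -/

section
variable {X : CSpace.{u}} {Z : CSpace.{v}} {f : X → Z} {m r : ℕ} {c : 𝒞 m X}
  {e : 𝒞 r Z} {i : Fin m} {p : BoundaryPt X}

lemma exists_xiMinus_iff (hX : X.IsManifold) (hZ : Z.IsManifold) (hf : Smooth X Z f)
    (hc : c ∈ X.charts m) (he : e ∈ Z.charts r) (hp : IsFace c i p) (hz : f p.pt ∈ e.target) :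
    (∃ q, XiMinus X Z f p q) ↔
      ∃ j ∈ e.act (f p.pt), PullAt (fun y => e.invFun (f y) j) c p.pt i := by
  constructor
  · rintro ⟨q, hq⟩
    have hq0 := hq.1
    obtain ⟨j, hj⟩ := hZ.exists_isFace he (hq0 ▸ hz)
    exact ⟨j, hq0 ▸ hj.mem_act, ((xiMinus_iff hX hZ hf hc he hp hj).1 hq).2⟩
  · rintro ⟨j, hj, h⟩
    obtain ⟨q, hq, hq'⟩ := hZ.exists_boundaryPt he hz hj
    exact ⟨q, (xiMinus_iff hX hZ hf hc he hp hq').2 ⟨hq.symm, h⟩⟩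

lemma PullAt.eventually_boundary {b : X → ℝ} (hX : X.IsManifold) (hc : c ∈ X.charts m)
    (hp : IsFace c i p) (h : PullAt b c p.pt i) :
    ∀ᶠ p' in 𝓝 p, IsFace c i p' ∧ PullAt b c p'.pt i := by
  filter_upwards [(hX.isOpen_isFace hc i).mem_nhds hp,
    continuous_pt.continuousAt.eventually h.eventually] with p' h1 h2
  exact ⟨h1, h2 (IsFace.mem_act h1).2⟩

lemma isClopen_xiMinus (hX : X.IsManifold) (hZ : Z.IsManifold) (hf : Smooth X Z f) :
    IsClopen {p : X.boundary | ∃ q : BoundaryPt Z, XiMinus X Z f p q} := by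
  have hcont := hf.continuous.comp continuous_pt
  constructor
  · rw [← isOpen_compl_iff, isOpen_iff_mem_nhds]
    intro p hp
    obtain ⟨m, c, hc, hx⟩ := hX.cover p.pt
    obtain ⟨r, e, he, hz⟩ := hZ.cover (f p.pt)
    obtain ⟨i, hi⟩ := hX.exists_isFace hc hx
    have h1 : ∀ᶠ p' in 𝓝 p, ∀ j ∈ e.act (f p.pt), e.invFun (f p'.pt) j = 0 →
        ¬ PullAt (fun y => e.invFun (f y) j) c p'.pt i := by
      simp only [eventually_all]
      intro j hj
      rcases (hX.smC_of_smooth hZ hf hc he hx hz).face j hj with h0 | ⟨i', hi'⟩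
      · filter_upwards [continuous_pt.continuousAt.eventually h0.eventually_nhds] with p' h2 _ h3
        exact h3.not_eventually_zero h2
      · filter_upwards [continuous_pt.continuousAt.eventually hi'.eventually,
          continuous_pt.continuousAt.eventually hi'.zero] with p' h2 h3 h4 h5
        obtain rfl := (h2 (h3.1 h4)).unique h5
        exact (fun h => hp ((exists_xiMinus_iff hX hZ hf hc he hi hz).2 h)) ⟨j, hj, hi'⟩
    filter_upwards [h1, (hX.isOpen_isFace hc i).mem_nhds hi,
      hcont.continuousAt.eventually (e.eventually_target hz),
      hcont.continuousAt.eventually (e.eventually_act_subset hz)] with p' h2 h3 h4 h5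
    intro h6
    obtain ⟨j, hj, h7⟩ := (exists_xiMinus_iff hX hZ hf hc he h3 h4).1 h6
    exact h2 j (h5 hj) hj.2 h7
  · rw [isOpen_iff_mem_nhds]
    intro p hp
    obtain ⟨m, c, hc, hx⟩ := hX.cover p.pt
    obtain ⟨r, e, he, hz⟩ := hZ.cover (f p.pt)
    obtain ⟨i, hi⟩ := hX.exists_isFace hc hx
    obtain ⟨j, hj, h⟩ := (exists_xiMinus_iff hX hZ hf hc he hi hz).1 hp
    filter_upwards [h.eventually_boundary hX hc hi,
      hcont.continuousAt.eventually (e.eventually_target hz),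
      continuous_pt.continuousAt.eventually h.zero] with p' h1 h2 h3
    refine (exists_xiMinus_iff hX hZ hf hc he h1.1 h2).2 ⟨j, ⟨hj.1, ?_⟩, h1.2⟩
    exact h3.2 h1.1.mem_act.2

lemma isClopen_not_xiMinus (hX : X.IsManifold) (hZ : Z.IsManifold) (hf : Smooth X Z f) :
    IsClopen {p : X.boundary | ¬ ∃ q : BoundaryPt Z, XiMinus X Z f p q} :=
  (isClopen_xiMinus hX hZ hf).compl

lemma bdMinus_isManifold (hX : X.IsManifold) (hZ : Z.IsManifold) (hf : Smooth X Z f) :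
    (bdMinus X Z f).IsManifold := hX.boundary.restrict (isClopen_xiMinus hX hZ hf)

lemma bdPlus_isManifold (hX : X.IsManifold) (hZ : Z.IsManifold) (hf : Smooth X Z f) :
    (bdPlus X Z f).IsManifold := hX.boundary.restrict (isClopen_not_xiMinus hX hZ hf)

lemma etale_bdMinus (hX : X.IsManifold) (hZ : Z.IsManifold) (hf : Smooth X Z f) :
    Etale (bdMinus X Z f) X.boundary Subtype.val :=
  hX.boundary.etale_restrict (isClopen_xiMinus hX hZ hf).isOpen

lemma etale_bdPlus (hX : X.IsManifold) (hZ : Z.IsManifold) (hf : Smooth X Z f) :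
    Etale (bdPlus X Z f) X.boundary Subtype.val :=
  hX.boundary.etale_restrict (isClopen_not_xiMinus hX hZ hf).isOpen

lemma xiMinus_fMinus (p : bdMinus X Z f) : XiMinus X Z f p.1 (fMinus X Z f p) := p.2.choose_spec

lemma xiMinus_unique (hX : X.IsManifold) (hZ : Z.IsManifold) (hf : IsBSubmersive X Z f)
    {p : BoundaryPt X} {q q' : BoundaryPt Z} (h : XiMinus X Z f p q) (h' : XiMinus X Z f p q') :
    q = q' := by
  have hq := h.1
  have hq' := h'.1
  obtain ⟨m, c, hc, hx⟩ := hX.cover p.pt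
  obtain ⟨r, e, he, hz⟩ := hZ.cover (f p.pt)
  obtain ⟨i, hi⟩ := hX.exists_isFace hc hx
  obtain ⟨j, hj⟩ := hZ.exists_isFace he (hq ▸ hz)
  obtain ⟨j', hj'⟩ := hZ.exists_isFace he (hq' ▸ hz)
  obtain ⟨i₀, hi₀, hinj⟩ := (hX.smC_of_smooth hZ hf.1 hc he hx hz).exists_faces
    (hf.2 _ _ _ hc _ _ he hx hz)
  have h3 := congrArg Subtype.val (hinj (((hi₀ ⟨j, hq ▸ hj.mem_act⟩).unique ((xiMinus_iff hX hZ hf.1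
      hc he hi hj).1 h).2).trans ((hi₀ ⟨j', hq' ▸ hj'.mem_act⟩).unique ((xiMinus_iff hX hZ hf.1 hc
          he hi hj').1 h').2).symm))
  subst h3
  exact hZ.isFace_inj he hj hj' (hq.symm.trans hq')

lemma fMinus_eq_iff (hX : X.IsManifold) (hZ : Z.IsManifold) (hf : IsBSubmersive X Z f)
    {p : bdMinus X Z f} {q : BoundaryPt Z} : fMinus X Z f p = q ↔ XiMinus X Z f p.1 q :=
  ⟨fun h => h ▸ xiMinus_fMinus p, fun h => xiMinus_unique hX hZ hf (xiMinus_fMinus p) h⟩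

lemma pt_fMinus (p : bdMinus X Z f) : (fMinus X Z f p).pt = f p.1.pt := (xiMinus_fMinus p).1.symm

lemma continuous_fMinus (hX : X.IsManifold) (hZ : Z.IsManifold) (hf : IsBSubmersive X Z f) :
    Continuous (fMinus X Z f) := by
  refine continuous_iff_continuousAt.2 fun p => ?_
  have hcont : Continuous fun p : bdMinus X Z f => f p.1.pt :=
    hf.1.continuous.comp (continuous_pt.comp continuous_subtype_val)
  obtain ⟨m, c, hc, hx⟩ := hX.cover p.1.pt
  obtain ⟨r, e, he, hz⟩ := hZ.cover (f p.1.pt)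
  obtain ⟨i, hi⟩ := hX.exists_isFace hc hx
  obtain ⟨j, hj⟩ := hZ.exists_isFace he (pt_fMinus p ▸ hz)
  rw [ContinuousAt, hZ.tendsto_boundary he hj]
  simp only [pt_fMinus]
  refine ⟨hcont.continuousAt, ?_⟩
  have h1 := ((xiMinus_iff hX hZ hf.1 hc he hi hj).1 (xiMinus_fMinus p)).2
  filter_upwards [continuous_subtype_val.continuousAt.eventually
      (h1.eventually_boundary hX hc hi), hcont.continuousAt.eventually (e.eventually_target hz),
    (continuous_pt.comp continuous_subtype_val).continuousAt.eventually h1.zero] with p' h2 h3 h4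
  obtain ⟨q, hq, hq'⟩ := hZ.exists_boundaryPt he h3 ⟨hj.2.1, h4.2 h2.1.mem_act.2⟩
  rw [(fMinus_eq_iff hX hZ hf).2 ((xiMinus_iff hX hZ hf.1 hc he h2.1 hq').2 ⟨hq.symm, h2.2⟩)]
  exact hq'

lemma smooth_fMinus (hX : X.IsManifold) (hZ : Z.IsManifold) (hf : IsBSubmersive X Z f) :
    Smooth (bdMinus X Z f) Z.boundary (fMinus X Z f) := by
  have hM := bdMinus_isManifold hX hZ hf.1
  have h1 : Smooth (bdMinus X Z f) Z (fun p => (fMinus X Z f p).pt) := by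
    simp only [pt_fMinus]
    exact hf.1.comp' hM hX hZ ((etale_bdMinus hX hZ hf.1).smooth_pt hM hX)
  exact hZ.init_incl.lift hZ.boundary hZ hZ hM (continuous_fMinus hX hZ hf) h1 h1

/-- In face charts, the differential of `f₋` is the restriction of the differential of `f`. -/
lemma exists_fMinus_charts (hX : X.IsManifold) (hZ : Z.IsManifold) (hf : IsBSubmersive X Z f)
    (p : bdMinus X Z f) : ∃ n, ∃ c ∈ X.charts (n + 1), ∃ i, ∃ α ∈ (bdMinus X Z f).charts n,
      ∃ s, ∃ e ∈ Z.charts (s + 1), ∃ j, ∃ ζ ∈ Z.boundary.charts s,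
      IsFaceChart Subtype.val α c i p ∧ IsFaceChart id ζ e j (fMinus X Z f p) ∧
      f p.1.pt ∈ e.target ∧ PullAt (fun y => e.invFun (f y) j) c p.1.pt i ∧
      ∀ t, insL j (𝒟 (fMinus X Z f) α ζ p t) = 𝒟 f c e p.1.pt (insL i t) := by
  have hM := bdMinus_isManifold hX hZ hf.1
  obtain ⟨n, c, hc, i, α, hα, hα'⟩ := (etale_bdMinus hX hZ hf.1).exists_faceChart hM hX p
  obtain ⟨s, e, he, j, ζ, hζ, hζ'⟩ :=
    hZ.boundary.etale_id.exists_faceChart hZ.boundary hZ (fMinus X Z f p)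
  have hz := pt_fMinus p ▸ hζ'.face.1
  refine ⟨n, c, hc, i, α, hα, s, e, he, j, ζ, hζ, hα', hζ', hz,
    ((xiMinus_iff hX hZ hf.1 hc he hα'.face hζ'.face).1 (xiMinus_fMinus p)).2, fun t => ?_⟩
  obtain ⟨G, hG⟩ := (hX.smC_of_smooth hZ hf.1 hc he hα'.face.1 hz).rep
  obtain ⟨H, hH⟩ := hα'.initAt.smC.rep
  obtain ⟨K, hK⟩ := hζ'.initAt.smC.rep
  obtain ⟨L, hL⟩ := (hM.smC_of_smooth hZ.boundary (smooth_fMinus hX hZ hf) hα hζ hα'.mem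
    hζ'.mem).rep
  have h1 := Rep.chartDeriv_comp (f := fun a : bdMinus X Z f => a.1.pt) hG hH
  have h3 : (f ∘ fun a : bdMinus X Z f => a.1.pt) =
      (fun a : Z.boundary => (id a : BoundaryPt Z).pt) ∘ fMinus X Z f := by
    funext a; exact (pt_fMinus a).symm
  rw [h3, hK.chartDeriv_comp hL, hα'.deriv, hζ'.deriv] at h1
  exact DFunLike.congr_fun h1 t

lemma exists_chartDeriv_eq (hb : SmC f c e p.pt)
    (hf : LinearMap.range (𝒟 f c e p.pt).1 ⊔ e.stratumTangent (f p.pt) = ⊤)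
    (i : Fin m) (w : ℝ^r) :
    ∃ t, t i = 0 ∧ ∀ j ∈ e.act (f p.pt), ¬ PullAt (fun y => e.invFun (f y) j) c p.pt i →
      𝒟 f c e p.pt t j = w j := by
  classical
  obtain ⟨i₀, hi₀, hinj⟩ := hb.exists_faces hf
  obtain ⟨t, ht⟩ := (range_sup_stratumTangent_eq_top _ _).1 hf w
  obtain ⟨G, hG⟩ := hb.rep
  refine ⟨update t i 0, update_self _ _ _, fun j hj hn => ?_⟩
  obtain ⟨μ, hμ, h1⟩ := (hi₀ ⟨j, hj⟩).chartDeriv_eq hG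
  have hne : i₀ ⟨j, hj⟩ ≠ i := by
    rintro rfl
    exact hn (hi₀ ⟨j, hj⟩)
  rw [h1, update_of_ne hne, ← h1, ht j hj]

lemma isBSubmersive_fPlus (hX : X.IsManifold) (hZ : Z.IsManifold) (hf : IsBSubmersive X Z f) :
    IsBSubmersive (bdPlus X Z f) Z (fPlus X Z f) := by
  have hM := bdPlus_isManifold hX hZ hf.1
  have het := etale_bdPlus hX hZ hf.1
  refine isBSubmersive_of_exists hM hZ (hf.1.comp' hM hX hZ (het.smooth_pt hM hX)) fun p => ?_
  obtain ⟨n, c, hc, i, α, hα, hα'⟩ := het.exists_faceChart hM hX p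
  obtain ⟨r, e, he, hz⟩ := hZ.cover (f p.1.pt)
  have hs := hX.smC_of_smooth hZ hf.1 hc he hα'.face.1 hz
  refine ⟨n, α, hα, r, e, he, hα'.mem, hz, (range_sup_stratumTangent_eq_top _ _).2 fun w => ?_⟩
  obtain ⟨t, ht, h1⟩ := exists_chartDeriv_eq hs (hf.2 _ _ _ hc _ _ he hα'.face.1 hz) i w
  refine ⟨remL i t, fun j hj => ?_⟩
  obtain ⟨G, hG⟩ := hs.rep
  obtain ⟨H, hH⟩ := hα'.initAt.smC.rep
  rw [show fPlus X Z f = f ∘ fun a : bdPlus X Z f => a.1.pt from rfl,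
    Rep.chartDeriv_comp (f := fun a : bdPlus X Z f => a.1.pt) hG hH,
    hα'.deriv, ContinuousLinearMap.comp_apply, insL_remL ht]
  exact h1 j hj fun h => p.2 ((exists_xiMinus_iff hX hZ hf.1 hc he hα'.face hz).2 ⟨j, hj, h⟩)

lemma isBSubmersive_fMinus (hX : X.IsManifold) (hZ : Z.IsManifold) (hf : IsBSubmersive X Z f) :
    IsBSubmersive (bdMinus X Z f) Z.boundary (fMinus X Z f) := by
  refine isBSubmersive_of_exists (bdMinus_isManifold hX hZ hf.1) hZ.boundary (smooth_fMinus hX hZ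
      hf) fun p => ?_
  obtain ⟨n, c, hc, i, α, hα, s, e, he, j, ζ, hζ, hα', hζ', hz, hp, hd⟩ :=
    exists_fMinus_charts hX hZ hf p
  have hs := hX.smC_of_smooth hZ hf.1 hc he hα'.face.1 hz
  have hb := hf.2 _ _ _ hc _ _ he hα'.face.1 hz
  refine ⟨n, α, hα, s, ζ, hζ, hα'.mem, hζ'.mem,
    (range_sup_stratumTangent_eq_top _ _).2 fun w => ?_⟩
  obtain ⟨t, ht, h1⟩ := exists_chartDeriv_eq hs hb i (insL j w)
  refine ⟨remL i t, fun k hk => ?_⟩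
  rw [← insL_succAbove j (𝒟 (fMinus X Z f) α ζ p (remL i t)), hd, insL_remL ht,
    ← insL_succAbove j w]
  have hk' : j.succAbove k ∈ e.act (f p.1.pt) := by
    rw [hζ'.act] at hk
    rw [← pt_fMinus p]
    exact hk
  refine h1 _ hk' fun h => ?_
  obtain ⟨i₀, hi₀, hinj⟩ := hs.exists_faces hb
  exact Fin.succAbove_ne j k (congrArg Subtype.val (hinj (((hi₀ ⟨_, hk'⟩).unique h).trans ((hi₀ ⟨j,
      (by rw [← pt_fMinus p]; exact hζ'.face.mem_act)⟩).unique hp).symm)))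

lemma isSubmersion_fMinus (hX : X.IsManifold) (hZ : Z.IsManifold) (hf : IsSubmersion X Z f) :
    IsSubmersion (bdMinus X Z f) Z.boundary (fMinus X Z f) := by
  have hM := bdMinus_isManifold hX hZ hf.1
  refine isSubmersion_of_exists hM hZ.boundary (smooth_fMinus hX hZ hf.isBSubmersive) fun p => ?_
  obtain ⟨n, c, hc, i, α, hα, s, e, he, j, ζ, hζ, hα', hζ', hz, hp, hd⟩ :=
    exists_fMinus_charts hX hZ hf.isBSubmersive p
  obtain ⟨h1, h2⟩ := hf.2 _ _ _ hc _ _ he hα'.face.1 hz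
  obtain ⟨G, hG⟩ := (hX.smC_of_smooth hZ hf.1 hc he hα'.face.1 hz).rep
  obtain ⟨μ, hμ, h3⟩ := hp.chartDeriv_eq hG
  have key : ∀ w t, 𝒟 f c e p.1.pt t = insL j w →
      t i = 0 ∧ 𝒟 (fMinus X Z f) α ζ p (remL i t) = w := by
    intro w t h
    have h4 : t i = 0 := by
      have := h3 t
      rw [h, insL_same] at this
      exact (mul_eq_zero.1 this.symm).resolve_left hμ.ne'
    refine ⟨h4, insL_injective j ?_⟩
    rw [hd, insL_remL h4, h]
  refine ⟨n, α, hα, s, ζ, hζ, hα'.mem, hζ'.mem, LinearMap.range_eq_top.2 fun w => ?_,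
    le_antisymm ?_ fun w hw => ?_⟩
  · obtain ⟨t, ht⟩ := LinearMap.range_eq_top.1 h1 (insL j w)
    exact ⟨remL i t, (key w t ht).2⟩
  · exact (hM.smC_of_smooth hZ.boundary (smooth_fMinus hX hZ hf.isBSubmersive) hα hζ hα'.mem
      hζ'.mem).map_stratumTangent_le
  · have hw' : insL j w ∈ e.stratumTangent (f p.1.pt) := by
      rw [← pt_fMinus p]
      exact (IsFaceChart.mem_stratumTangent_iff (e := id) hζ').1 hw
    rw [← h2] at hw'
    obtain ⟨t, ht, h4⟩ := hw'
    obtain ⟨h5, h6⟩ := key w t h4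
    refine ⟨remL i t, hα'.mem_stratumTangent_iff.2 ?_, h6⟩
    rw [insL_remL h5]
    exact ht

end

/-! ### Tangent spaces and faces of fibre products -/

lemma exists_common_preimage {n m l r : ℕ} {U : ℝ^n →ₗ[ℝ] ℝ^m}
    {U' : ℝ^n →ₗ[ℝ] ℝ^l} {D : ℝ^m →ₗ[ℝ] ℝ^r}
    {D' : ℝ^l →ₗ[ℝ] ℝ^r} (hdim : n + r = m + l)
    (hinj : ∀ t, U t = 0 → U' t = 0 → t = 0) (hcomm : ∀ t, D (U t) = D' (U' t))
    (hsurj : ∀ w, ∃ s t, D s - D' t = w) {s : ℝ^m} {t : ℝ^l} (h : D s = D' t) :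
    ∃ τ, U τ = s ∧ U' τ = t := by
  let K := D ∘ₗ LinearMap.fst ℝ _ _ - D' ∘ₗ LinearMap.snd ℝ ℝ^m ℝ^l
  have hK : ∀ v, K v = D v.1 - D' v.2 := fun v => rfl
  have hKs : LinearMap.range K = ⊤ := LinearMap.range_eq_top.2 fun w => by
    obtain ⟨s, t, h⟩ := hsurj w
    exact ⟨(s, t), h⟩
  have hle : LinearMap.range (U.prod U') ≤ LinearMap.ker K := by
    rintro _ ⟨τ, rfl⟩
    rw [LinearMap.mem_ker, hK, sub_eq_zero]
    exact hcomm τ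
  have h1 := LinearMap.finrank_range_add_finrank_ker K
  rw [hKs, finrank_top, Module.finrank_prod, Module.finrank_fin_fun, Module.finrank_fin_fun,
    Module.finrank_fin_fun] at h1
  have h2 : Module.finrank ℝ (LinearMap.range (U.prod U')) = n := by
    rw [LinearMap.finrank_range_of_inj, Module.finrank_fin_fun]
    refine (injective_iff_map_eq_zero _).2 fun τ hτ => ?_
    have hτ' := hτ
    rw [Prod.mk_eq_zero] at hτ'
    exact hinj τ hτ'.1 hτ'.2
  have h4 : (s, t) ∈ LinearMap.range (U.prod U') := by
    rw [(Submodule.eq_of_le_of_finrank_eq hle (by omega)), LinearMap.mem_ker, hK, h, sub_self]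
  obtain ⟨τ, hτ⟩ := h4
  have hτ' := hτ
  rw [Prod.mk.injEq] at hτ'
  exact ⟨τ, hτ'⟩

/-- Charts near a point of a fibre product. -/
structure FibreCharts {A : Type*} {B : Type*} {C : Type*} [TopologicalSpace A]
    [TopologicalSpace B] [TopologicalSpace C] {n m l r : ℕ} (f : A → C) (g : B → C)
    (φ : 𝒞 n {p : A × B // f p.1 = g p.2}) (c : 𝒞 m A) (d : 𝒞 l B)
    (e : 𝒞 r C) (q : {p : A × B // f p.1 = g p.2}) : Prop where
  initAt : InitAt (·.1.1)
    (·.1.2) φ c d q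
  left : SmC f c e q.1.1
  right : SmC g d e q.1.2
  transverse : (c.stratumTangent q.1.1).map (𝒟 f c e q.1.1).1 ⊔
      (d.stratumTangent q.1.2).map (𝒟 g d e q.1.2).1 =
        e.stratumTangent (f q.1.1)
  bsub : LinearMap.range (𝒟 f c e q.1.1).1 ⊔ e.stratumTangent (f q.1.1) = ⊤
  dim : n + r = m + l

namespace FibreCharts

section
variable {A : Type u} {B : Type v} {C : Type w} [TopologicalSpace A] [TopologicalSpace B]
  [TopologicalSpace C] {n m l r : ℕ} {f : A → C} {g : B → C}
  {φ : 𝒞 n {p : A × B // f p.1 = g p.2}} {c : 𝒞 m A} {d : 𝒞 l B}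
  {e : 𝒞 r C} {q : {p : A × B // f p.1 = g p.2}} (h : FibreCharts f g φ c d e q)
include h

variable {s : Fin n} {i : Fin m} {k : Fin l}

lemma comm (τ : ℝ^n) :
    𝒟 f c e q.1.1 (𝒟 (·.1.1) φ c q τ) =
    𝒟 g d e q.1.2 (𝒟 (·.1.2) φ d q τ) := by
  obtain ⟨F, hF⟩ := h.left.rep
  obtain ⟨G, hG⟩ := h.right.rep
  obtain ⟨P, hP⟩ := h.initAt.smC.rep
  obtain ⟨Q, hQ⟩ := h.initAt.smC'.rep
  have h1 := Rep.chartDeriv_comp (f := fun q : {p : A × B // f p.1 = g p.2} => q.1.1) hF hP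
  have h2 := Rep.chartDeriv_comp (f := fun q : {p : A × B // f p.1 = g p.2} => q.1.2) hG hQ
  have h3 : (f ∘ fun q : {p : A × B // f p.1 = g p.2} => q.1.1) =
      g ∘ fun q : {p : A × B // f p.1 = g p.2} => q.1.2 := funext fun q => q.2
  rw [h3, h2] at h1
  exact (DFunLike.congr_fun h1 τ).symm

lemma exists_faces : ∃ i : e.act (f q.1.1) → Fin m,
    (∀ j : e.act (f q.1.1), PullAt (fun y => e.invFun (f y) j) c q.1.1 (i j)) ∧
    Injective i ∧ ∀ w : Fin r → ℝ,
    ∃ s t, (∀ k ∈ c.act q.1.1, k ∉ range i → s k = 0) ∧ (∀ k ∈ d.act q.1.2, t k = 0) ∧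
      𝒟 f c e q.1.1 s - 𝒟 g d e q.1.2 t = w := by
  obtain ⟨i, hi, hinj⟩ := h.left.exists_faces h.bsub
  exact ⟨i, hi, hinj, fun w => exists_tangent_of_transverse h.transverse hinj
    h.left.rep.choose_spec hi w⟩

lemma surjective (w : ℝ^r) : ∃ s t,
    𝒟 f c e q.1.1 s - 𝒟 g d e q.1.2 t = w := by
  obtain ⟨i, -, -, h1⟩ := h.exists_faces
  obtain ⟨s, t, -, -, h2⟩ := h1 w
  exact ⟨s, t, h2⟩

lemma exists_tangent {s : ℝ^m} {t : ℝ^l}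
    (hst : 𝒟 f c e q.1.1 s = 𝒟 g d e q.1.2 t) :
    ∃ τ, 𝒟 (·.1.1) φ c q τ = s ∧
      𝒟 (·.1.2) φ d q τ = t :=
  exists_common_preimage (U := (𝒟 (·.1.1)
      φ c q).1)
    (U' := (𝒟 (·.1.2) φ d q).1)
    (D := (𝒟 f c e q.1.1).1) (D' := (𝒟 g d e q.1.2).1)
    h.dim h.initAt.inj h.comm h.surjective hst

omit h in
/-- The faces of `A` at `q` which are not pulled back from faces of `C`. -/
def free (f : A → C) (c : 𝒞 m A) (e : 𝒞 r C) (x : A) : Set (Fin m) :=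
  {i | i ∈ c.act x ∧ ∀ j ∈ e.act (f x), ¬ PullAt (fun y => e.invFun (f y) j) c x i}

lemma free_left (hi : i ∈ free f c e q.1.1) :
    ∃ τ, 𝒟 (·.1.1) φ c q τ i = 1 ∧
      (∀ k ∈ free f c e q.1.1, k ≠ i →
        𝒟 (·.1.1) φ c q τ k = 0) ∧
      ∀ k ∈ d.act q.1.2,
        𝒟 (·.1.2) φ d q τ k = 0 := by
  obtain ⟨i₀, hi₀, -, h1⟩ := h.exists_faces
  have hr : ∀ k ∈ free f c e q.1.1, k ∉ range i₀ := by
    rintro k hk ⟨j, rfl⟩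
    exact hk.2 j j.2 (hi₀ j)
  obtain ⟨s, t, hs, ht, h2⟩ := h1 (-𝒟 f c e q.1.1 (Pi.single i 1))
  obtain ⟨τ, hτ, hτ'⟩ := h.exists_tangent (s := s + Pi.single i 1) (by
    rw [map_add]
    rw [sub_eq_iff_eq_add] at h2
    rw [h2]; abel)
  refine ⟨τ, ?_, fun k hk hki => ?_, fun k hk => ?_⟩
  · rw [hτ, Pi.add_apply, hs i hi.1 (hr i hi), Pi.single_eq_same, zero_add]
  · rw [hτ, Pi.add_apply, hs k hk.1 (hr k hk), Pi.single_eq_of_ne hki, zero_add]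
  · rw [hτ', ht k hk]

lemma free_right {i : Fin l} (hi : i ∈ d.act q.1.2) :
    ∃ τ, 𝒟 (·.1.2) φ d q τ i = 1 ∧
      (∀ k ∈ d.act q.1.2, k ≠ i →
        𝒟 (·.1.2) φ d q τ k = 0) ∧
      ∀ k ∈ free f c e q.1.1,
        𝒟 (·.1.1) φ c q τ k = 0 := by
  obtain ⟨i₀, hi₀, -, h1⟩ := h.exists_faces
  have hr : ∀ k ∈ free f c e q.1.1, k ∉ range i₀ := by
    rintro k hk ⟨j, rfl⟩
    exact hk.2 j j.2 (hi₀ j)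
  obtain ⟨s, t, hs, ht, h2⟩ := h1 (𝒟 g d e q.1.2 (Pi.single i 1))
  obtain ⟨τ, hτ, hτ'⟩ := h.exists_tangent (s := s) (t := t + Pi.single i 1) (by
    rw [map_add]
    rw [sub_eq_iff_eq_add] at h2
    rw [h2]; abel)
  refine ⟨τ, ?_, fun k hk hki => ?_, fun k hk => ?_⟩
  · rw [hτ', Pi.add_apply, ht i hi, Pi.single_eq_same, zero_add]
  · rw [hτ', Pi.add_apply, ht k hk, Pi.single_eq_of_ne hki, zero_add]
  · rw [hτ, hs k hk.1 (hr k hk)]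

omit h in
lemma _root_.Corners.SmC.pullAt_of_deriv {D E : Type*} [TopologicalSpace D] [TopologicalSpace E]
    {F : D → E} {φ : 𝒞 n D} {c : 𝒞 m E} {x : D} (h : SmC F φ c x)
    (hi : i ∈ c.act (F x)) {τ : ℝ^n} (hτ : 𝒟 F φ c x τ i ≠ 0) :
    ∃ r, PullAt (fun y => c.invFun (F y) i) φ x r := by
  refine (h.face i hi).resolve_left fun h0 => hτ ?_
  obtain ⟨G, hG⟩ := h.rep
  rw [← hG.fderiv_coord, (hG.coord i).fderiv_unique (⟨hG.mem, ContDiff.germSmooth contDiff_const _,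
      h0⟩)]
  simp

lemma pull_left (hi : i ∈ free f c e q.1.1) : ∃ s,
    PullAt (fun q' => c.invFun q'.1.1 i) φ q s := by
  obtain ⟨τ, h1, -⟩ := h.free_left hi
  exact h.initAt.smC.pullAt_of_deriv hi.1
    (by rw [h1]; exact one_ne_zero)

lemma pull_right {i : Fin l} (hi : i ∈ d.act q.1.2) : ∃ s,
    PullAt (fun q' => d.invFun q'.1.2 i) φ q s := by
  obtain ⟨τ, h1, -⟩ := h.free_right hi
  exact h.initAt.smC'.pullAt_of_deriv hi
    (by rw [h1]; exact one_ne_zero)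

/-- A face of `C` which pulls back to a face of `A` and to a face of `B` identifies the faces of the
fibre product over these. -/
lemma pullAt_left_of_right {j : Fin r} (hj : j ∈ e.act (f q.1.1))
    (hi : PullAt (fun y => e.invFun (f y) j) c q.1.1 i)
    (hk : PullAt (fun y => e.invFun (g y) j) d q.1.2 k)
    (hs : PullAt (fun q' => d.invFun q'.1.2 k) φ q s) :
    PullAt (fun q' => c.invFun q'.1.1 i) φ q s := by
  obtain ⟨P, hP⟩ := h.initAt.smC.rep
  obtain ⟨Q, hQ⟩ := h.initAt.smC'.rep
  have h1 : PullAt (fun q' => e.invFun (f q'.1.1) j) φ q s :=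
    (PullAt.comp_rep (f := fun q' : {p : A × B // f p.1 = g p.2} => q'.1.2) hk hQ hs).congr
      (.of_forall fun q' => by simp only [q'.2])
  rcases PullAt.lift (h := fun q' : {p : A × B // f p.1 = g p.2} => q'.1.1) hi hP.cont hi.act hj
    (h.left.comp (f := fun q' : {p : A × B // f p.1 = g p.2} => q'.1.1) h.initAt.smC) hP
    with h0 | ⟨s', h2⟩
  · refine absurd ?_ h1.not_eventually_zero
    filter_upwards [h0, hP.cont.eventually hi.zero] with q' h3 h4 using h4.2 h3
  · have h3 := PullAt.comp_rep (f := fun q' : {p : A × B // f p.1 = g p.2} => q'.1.1) hi hP h2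
    obtain rfl := h3.unique h1
    exact h2

lemma face_cases (hs : s ∈ φ.act q) :
    (∃ i ∈ free f c e q.1.1,
      PullAt (fun q' => c.invFun q'.1.1 i) φ q s) ∨
    ∃ i ∈ d.act q.1.2,
      PullAt (fun q' => d.invFun q'.1.2 i) φ q s := by
  rcases h.initAt.face s hs with ⟨i, hi, hp⟩ | h1
  · by_cases hfree : ∀ j ∈ e.act (f q.1.1), ¬ PullAt (fun y => e.invFun (f y) j) c q.1.1 i
    · exact Or.inl ⟨i, ⟨hi, hfree⟩, hp⟩
    · push Not at hfree
      obtain ⟨j, hj, hij⟩ := hfree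
      obtain ⟨P, hP⟩ := h.initAt.smC.rep
      obtain ⟨Q, hQ⟩ := h.initAt.smC'.rep
      have h1 : PullAt (fun q' => e.invFun (g q'.1.2) j) φ q s :=
        (PullAt.comp_rep (f := fun q' : {p : A × B // f p.1 = g p.2} => q'.1.1) hij hP hp).congr
          (.of_forall fun q' => by simp only [q'.2])
      have hj' : j ∈ e.act (g q.1.2) := by rw [← q.2]; exact hj
      rcases h.right.face j hj' with h0 | ⟨k, hk⟩
      · exact absurd (hQ.cont.eventually h0) h1.not_eventually_zero
      · rcases PullAt.lift (h := fun q' : {p : A × B // f p.1 = g p.2} => q'.1.2) hk hQ.cont hk.act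
          hj' (h.right.comp (f := fun q' : {p : A × B // f p.1 = g p.2} => q'.1.2)
            h.initAt.smC') hQ with h0 | ⟨s', h2⟩
        · refine absurd ?_ h1.not_eventually_zero
          filter_upwards [h0, hQ.cont.eventually hk.zero] with q' h3 h4 using h4.2 h3
        · have h3 := PullAt.comp_rep (f := fun q' : {p : A × B // f p.1 = g p.2} => q'.1.2)
            hk hQ h2
          obtain rfl := h3.unique h1
          exact Or.inr ⟨k, hk.act, h2⟩
  · exact Or.inr h1

lemma left_unique {i' : Fin m} (hi : i ∈ free f c e q.1.1) (hi' : i' ∈ free f c e q.1.1)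
    (h1 : PullAt (fun q' => c.invFun q'.1.1 i) φ q s)
    (h2 : PullAt (fun q' => c.invFun q'.1.1 i') φ q s) : i = i' := by
  by_contra hne
  obtain ⟨τ, e1, e2, -⟩ := h.free_left hi
  obtain ⟨P, hP⟩ := h.initAt.smC.rep
  obtain ⟨μ, hμ, e3⟩ := h1.chartDeriv_eq hP
  obtain ⟨ν, hν, e4⟩ := h2.chartDeriv_eq hP
  have e5 := e4 τ
  rw [e2 i' hi' (Ne.symm hne)] at e5
  have e6 := e3 τ
  rw [e1, (mul_eq_zero.1 e5.symm).resolve_left hν.ne', mul_zero] at e6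
  exact one_ne_zero e6

lemma right_unique {i i' : Fin l} (hi : i ∈ d.act q.1.2) (hi' : i' ∈ d.act q.1.2)
    (h1 : PullAt (fun q' => d.invFun q'.1.2 i) φ q s)
    (h2 : PullAt (fun q' => d.invFun q'.1.2 i') φ q s) : i = i' := by
  by_contra hne
  obtain ⟨τ, e1, e2, -⟩ := h.free_right hi
  obtain ⟨P, hP⟩ := h.initAt.smC'.rep
  obtain ⟨μ, hμ, e3⟩ := h1.chartDeriv_eq hP
  obtain ⟨ν, hν, e4⟩ := h2.chartDeriv_eq hP
  have e5 := e4 τ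
  rw [e2 i' hi' (Ne.symm hne)] at e5
  have e6 := e3 τ
  rw [e1, (mul_eq_zero.1 e5.symm).resolve_left hν.ne', mul_zero] at e6
  exact one_ne_zero e6

lemma not_both (hi : i ∈ free f c e q.1.1) (hk : k ∈ d.act q.1.2)
    (h1 : PullAt (fun q' => c.invFun q'.1.1 i) φ q s)
    (h2 : PullAt (fun q' => d.invFun q'.1.2 k) φ q s) : False := by
  obtain ⟨τ, e1, -, e2⟩ := h.free_left hi
  obtain ⟨P, hP⟩ := h.initAt.smC.rep
  obtain ⟨Q, hQ⟩ := h.initAt.smC'.rep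
  obtain ⟨μ, hμ, e3⟩ := h1.chartDeriv_eq hP
  obtain ⟨ν, hν, e4⟩ := h2.chartDeriv_eq hQ
  have e5 := e4 τ
  rw [e2 k hk] at e5
  have e6 := e3 τ
  rw [e1, (mul_eq_zero.1 e5.symm).resolve_left hν.ne', mul_zero] at e6
  exact one_ne_zero e6

end

end FibreCharts

section
variable {X : CSpace.{u}} {Y : CSpace.{v}} {Z : CSpace.{w}} {f : X → Z} {g : Y → Z}

/-- The hypotheses on `f` and `g` under which the boundary of `X ×_Z Y` is described. -/
structure FibreData (X : CSpace.{u}) (Y : CSpace.{v}) (Z : CSpace.{w}) (f : X → Z) (g : Y → Z) :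
    Prop where
  hX : X.IsManifold
  hY : Y.IsManifold
  hZ : Z.IsManifold
  hf : IsBSubmersive X Z f
  hg : Smooth Y Z g
  ht : StratumTransverse X Y Z f g

namespace FibreData
variable (h : FibreData X Y Z f g)
include h

lemma hW : (X.fibre Y Z f g).IsManifold := (fibre_isManifold h.hX h.hY h.hZ h.hf h.hg h.ht).1

lemma init : Init (X.fibre Y Z f g) X Y (·.1.1) (·.1.2) :=
  (fibre_isManifold h.hX h.hY h.hZ h.hf h.hg h.ht).2

lemma smooth_fst : Smooth (X.fibre Y Z f g) X (·.1.1) := h.init.smooth_left h.hW h.hX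

lemma smooth_snd : Smooth (X.fibre Y Z f g) Y (·.1.2) := h.init.smooth_right h.hW h.hY

lemma areTransverse : AreTransverse X Y Z f g := h.ht.areTransverse h.hX h.hY h.hZ h.hf h.hg

lemma fibreCharts {q : X.fibre Y Z f g} {n m l r : ℕ} {φ : 𝒞 n (X.fibre Y Z f g)}
    (hφ : φ ∈ (X.fibre Y Z f g).charts n) {c : 𝒞 m X} (hc : c ∈ X.charts m)
    {d : 𝒞 l Y} (hd : d ∈ Y.charts l) {e : 𝒞 r Z} (he : e ∈ Z.charts r)
    (hq : q ∈ φ.target) (hx : q.1.1 ∈ c.target) (hy : q.1.2 ∈ d.target)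
    (hz : f q.1.1 ∈ e.target) : FibreCharts f g φ c d e q where
  initAt := h.init.initAt h.hW h.hX h.hY hφ hc hd hq hx hy
  left := h.hX.smC_of_smooth h.hZ h.hf.1 hc he hx hz
  right := h.hY.smC_of_smooth h.hZ h.hg hd he hy (q.2 ▸ hz)
  transverse := h.ht.eq h.hX h.hY h.hZ h.hf.1 h.hg q.2 hc hd he hx hy hz
  bsub := h.hf.2 _ _ _ hc _ _ he hx hz
  dim := by
    have h2 := h.hX.dim_eq _ c hc
    have h3 := h.hY.dim_eq _ d hd
    have h4 := h.hZ.dim_eq _ e he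
    have h5 : (n : ℤ) = X.dim + Y.dim - Z.dim := h.hW.dim_eq _ φ hφ
    omega

lemma exists_fibreCharts (q : X.fibre Y Z f g) : ∃ n, ∃ φ ∈ (X.fibre Y Z f g).charts n,
    ∃ m, ∃ c ∈ X.charts m, ∃ l, ∃ d ∈ Y.charts l, ∃ r, ∃ e ∈ Z.charts r,
      FibreCharts f g φ c d e q := by
  obtain ⟨n, φ, hφ, hq⟩ := h.hW.cover q
  obtain ⟨m, c, hc, hx⟩ := h.hX.cover q.1.1
  obtain ⟨l, d, hd, hy⟩ := h.hY.cover q.1.2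
  obtain ⟨r, e, he, hz⟩ := h.hZ.cover (f q.1.1)
  exact ⟨n, φ, hφ, m, c, hc, l, d, hd, r, e, he, h.fibreCharts hφ hc hd he hq hx hy hz⟩

end FibreData

end

/-! ### Lifting boundary points along smooth maps -/

section
variable {W : CSpace.{u}} {X : CSpace.{v}} {h : W → X}

variable {p : BoundaryPt W} {q : BoundaryPt X}

lemma XiMinus.left_unique (hW : W.IsManifold) (hX : X.IsManifold) (hh : Smooth W X h)
    {p' : BoundaryPt W} (hp : XiMinus W X h p q) (hp' : XiMinus W X h p' q) (hpp : p.pt = p'.pt)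
    : p = p' := by
  obtain ⟨m, c, hc, hx⟩ := hX.cover q.pt
  obtain ⟨n, φ, hφ, hw⟩ := hW.cover p.pt
  obtain ⟨i, hi⟩ := hX.exists_isFace hc hx
  obtain ⟨s, hs⟩ := hW.exists_isFace hφ hw
  obtain ⟨s', hs'⟩ := hW.exists_isFace hφ (hpp ▸ hw)
  have h2 := ((xiMinus_iff hW hX hh hφ hc hs' hi).1 hp').2
  rw [← hpp] at h2
  obtain rfl := (((xiMinus_iff hW hX hh hφ hc hs hi).1 hp).2).unique h2
  exact hW.isFace_inj hφ hs hs' hpp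

lemma XiMinus.eventually_right (hW : W.IsManifold) (hX : X.IsManifold) (hh : Smooth W X h)
    (hp : XiMinus W X h p q) {T : Set (BoundaryPt X)} (hT : T ∈ 𝓝 q)
    : ∀ᶠ p' in 𝓝 p, ∃ q' ∈ T, XiMinus W X h p' q' := by
  obtain ⟨m, c, hc, hx⟩ := hX.cover q.pt
  obtain ⟨n, φ, hφ, hw⟩ := hW.cover p.pt
  obtain ⟨i, hi⟩ := hX.exists_isFace hc hx
  obtain ⟨s, hs⟩ := hW.exists_isFace hφ hw
  have h1 := ((xiMinus_iff hW hX hh hφ hc hs hi).1 hp).2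
  have h2 := hX.eventually_boundary hc hi hT
  rw [← hp.1] at h2
  filter_upwards [h1.eventually_boundary hW hφ hs,
    (hh.continuous.comp continuous_pt).continuousAt.eventually h2,
    continuous_pt.continuousAt.eventually h1.zero] with p' h3 h4 h5
  obtain ⟨q', hq', h6, h7⟩ := h4 (h5.2 h3.1.mem_act.2)
  exact ⟨q', hq', (xiMinus_iff hW hX hh hφ hc h3.1 h7).2 ⟨h6.symm, h3.2⟩⟩

lemma XiMinus.eventually_left (hW : W.IsManifold) (hX : X.IsManifold) (hh : Smooth W X h)
    (hp : XiMinus W X h p q) {T : Set (BoundaryPt W)} (hT : T ∈ 𝓝 p)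
    : ∀ᶠ y in 𝓝 (q, p.pt), y.1.pt = h y.2 →
      ∃ p' ∈ T, p'.pt = y.2 ∧ XiMinus W X h p' y.1 := by
  obtain ⟨m, c, hc, hx⟩ := hX.cover q.pt
  obtain ⟨n, φ, hφ, hw⟩ := hW.cover p.pt
  obtain ⟨i, hi⟩ := hX.exists_isFace hc hx
  obtain ⟨s, hs⟩ := hW.exists_isFace hφ hw
  have h1 := ((xiMinus_iff hW hX hh hφ hc hs hi).1 hp).2
  have csnd : Tendsto (Prod.snd : BoundaryPt X × W → _) (𝓝 (q, p.pt)) (𝓝 p.pt) :=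
    continuousAt_snd
  filter_upwards [continuousAt_fst.eventually ((hX.isOpen_isFace hc i).mem_nhds hi),
    csnd.eventually h1.zero, csnd.eventually h1.eventually,
    csnd.eventually (hW.eventually_boundary hφ hs hT)] with y h2 h3 h4 h5 h6
  have h7 := h3.1 (by rw [← h6]; exact (IsFace.mem_act h2).2)
  obtain ⟨p', hp', h8, h9⟩ := h5 h7
  refine ⟨p', hp', h8, (xiMinus_iff hW hX hh hφ hc h9 h2).2 ⟨by rw [h8, h6], ?_⟩⟩
  rw [h8]
  exact h4 h7

lemma XiMinus.of_pullAt (hW : W.IsManifold) (hX : X.IsManifold) (hh : Smooth W X h) {n m : ℕ}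
    {φ : 𝒞 n W} (hφ : φ ∈ W.charts n) {c : 𝒞 m X} (hc : c ∈ X.charts m)
    {i : Fin m} (hq : IsFace c i q) {w : W} (hw : q.pt = h w) {s : Fin n}
    (hs : PullAt (fun y => c.invFun (h y) i) φ w s) :
    ∃ p : BoundaryPt W, p.pt = w ∧ XiMinus W X h p q := by
  obtain ⟨p, rfl, hp⟩ := hW.exists_boundaryPt hφ hs.mem hs.act
  exact ⟨p, rfl, (xiMinus_iff hW hX hh hφ hc hp hq).2 ⟨hw.symm, hs⟩⟩

end

/-! ### The boundary points of a fibre product -/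

namespace FibreData

section
variable {X : CSpace.{u}} {Y : CSpace.{v}} {Z : CSpace.{w}} {f : X → Z} {g : Y → Z}
  (h : FibreData X Y Z f g)
include h

variable {q : BoundaryPt X} {w : X.fibre Y Z f g} {p : BoundaryPt (X.fibre Y Z f g)}
    {q' : BoundaryPt Y} {z : BoundaryPt Z}

lemma mem_free_iff {m r : ℕ} {c : 𝒞 m X} (hc : c ∈ X.charts m) {e : 𝒞 r Z}
    (he : e ∈ Z.charts r) {i : Fin m} (hq : IsFace c i q) (hz : f q.pt ∈ e.target) :
    i ∈ FibreCharts.free f c e q.pt ↔ ¬ ∃ z, XiMinus X Z f q z := by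
  rw [exists_xiMinus_iff h.hX h.hZ h.hf.1 hc he hq hz]
  push Not
  exact and_iff_right hq.mem_act

lemma exists_left (hq : ¬ ∃ z, XiMinus X Z f q z) (hw : q.pt = w.1.1)
    : ∃ p : BoundaryPt (X.fibre Y Z f g), p.pt = w ∧
      XiMinus (X.fibre Y Z f g) X (·.1.1) p q := by
  obtain ⟨n, φ, hφ, m, c, hc, l, d, hd, r, e, he, H⟩ := h.exists_fibreCharts w
  obtain ⟨i, hi⟩ := h.hX.exists_isFace hc (by rw [hw]; exact H.initAt.smC.mem')
  have h1 := (h.mem_free_iff hc he hi (by rw [hw]; exact H.left.mem')).2 hq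
  rw [hw] at h1
  obtain ⟨s, hs⟩ := H.pull_left h1
  exact XiMinus.of_pullAt h.hW h.hX h.smooth_fst hφ hc hi hw hs

lemma exists_right {q : BoundaryPt Y} (hw : q.pt = w.1.2)
    : ∃ p : BoundaryPt (X.fibre Y Z f g), p.pt = w ∧
      XiMinus (X.fibre Y Z f g) Y (·.1.2) p q := by
  obtain ⟨n, φ, hφ, m, c, hc, l, d, hd, r, e, he, H⟩ := h.exists_fibreCharts w
  obtain ⟨i, hi⟩ := h.hY.exists_isFace hd (by rw [hw]; exact H.initAt.smC'.mem')
  obtain ⟨s, hs⟩ := H.pull_right (hw ▸ hi.mem_act)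
  exact XiMinus.of_pullAt h.hW h.hY h.smooth_snd hφ hd hi hw hs

/-- If a boundary component of the fibre product comes from a boundary component of `Y` over `Z`,
then it comes from a boundary component of `X` over `Z`. -/
lemma xiMinus_left_of_right (h1 : XiMinus (X.fibre Y Z f g) Y (·.1.2) p q')
    (h2 : XiMinus Y Z g q' z) (h3 : XiMinus X Z f q z) (h4 : q.pt = p.pt.1.1) :
    XiMinus (X.fibre Y Z f g) X (·.1.1) p q := by
  obtain ⟨n, φ, hφ, m, c, hc, l, d, hd, r, e, he, H⟩ := h.exists_fibreCharts p.pt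
  have hz := h3.1
  have hq' := h1.1
  obtain ⟨i, hi⟩ := h.hX.exists_isFace hc (by rw [h4]; exact H.initAt.smC.mem')
  obtain ⟨k, hk⟩ := h.hY.exists_isFace hd (by rw [← hq']; exact H.initAt.smC'.mem')
  obtain ⟨j, hj⟩ := h.hZ.exists_isFace he (by rw [← hz, h4]; exact H.left.mem')
  obtain ⟨s, hs⟩ := h.hW.exists_isFace hφ H.initAt.smC.mem
  have e2 := ((xiMinus_iff h.hY h.hZ h.hg hd he hk hj).1 h2).2
  have e3 := ((xiMinus_iff h.hX h.hZ h.hf.1 hc he hi hj).1 h3).2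
  have e4 := hz ▸ hj.mem_act
  rw [← hq'] at e2
  rw [h4] at e3 e4
  exact (xiMinus_iff h.hW h.hX h.smooth_fst hφ hc hs hi).2
    ⟨h4.symm, H.pullAt_left_of_right e4 e3 e2 (((xiMinus_iff h.hW h.hY h.smooth_snd hφ hd hs hk).1
        h1).2)⟩

omit h in
lemma _root_.Corners.XiMinus.exists_of_pt (hX : X.IsManifold) (hZ : Z.IsManifold)
    (hf : IsBSubmersive X Z f) {x : X} (hx : f x = z.pt) :
    ∃ q : BoundaryPt X, q.pt = x ∧ XiMinus X Z f q z := by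
  obtain ⟨m, c, hc, hx'⟩ := hX.cover x
  obtain ⟨r, e, he, hz⟩ := hZ.cover z.pt
  obtain ⟨j, hj⟩ := hZ.exists_isFace he hz
  rw [← hx] at hz
  obtain ⟨i, hi, -⟩ := (hX.smC_of_smooth hZ hf.1 hc he hx' hz).exists_faces
    (hf.2 _ _ _ hc _ _ he hx' hz)
  exact XiMinus.of_pullAt hX hZ hf.1 hc he hj hx.symm (hi ⟨j, hx ▸ hj.mem_act⟩)

lemma face_cases (p : BoundaryPt (X.fibre Y Z f g)) :
    (∃ q, (¬ ∃ z, XiMinus X Z f q z) ∧ XiMinus (X.fibre Y Z f g) X (·.1.1) p q) ∨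
    ∃ q, XiMinus (X.fibre Y Z f g) Y (·.1.2) p q := by
  obtain ⟨n, φ, hφ, m, c, hc, l, d, hd, r, e, he, H⟩ := h.exists_fibreCharts p.pt
  obtain ⟨s, hs⟩ := h.hW.exists_isFace hφ H.initAt.smC.mem
  rcases H.face_cases hs.mem_act with ⟨i, hi, h1⟩ | ⟨i, hi, h1⟩
  · obtain ⟨q, hq, hq'⟩ := h.hX.exists_boundaryPt hc H.initAt.smC.mem' hi.1
    refine Or.inl ⟨q, ?_, (xiMinus_iff h.hW h.hX h.smooth_fst hφ hc hs hq').2 ⟨hq.symm, h1⟩⟩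
    rw [← h.mem_free_iff hc he hq' (by rw [hq]; exact H.left.mem'), hq]
    exact hi
  · obtain ⟨q, hq, hq'⟩ := h.hY.exists_boundaryPt hd H.initAt.smC'.mem' hi
    exact Or.inr ⟨q, (xiMinus_iff h.hW h.hY h.smooth_snd hφ hd hs hq').2 ⟨hq.symm, h1⟩⟩

lemma left_unique {q' : BoundaryPt X} (hq : ¬ ∃ z, XiMinus X Z f q z)
    (hq' : ¬ ∃ z, XiMinus X Z f q' z) (h1 : XiMinus (X.fibre Y Z f g) X (·.1.1) p q)
    (h2 : XiMinus (X.fibre Y Z f g) X (·.1.1) p q') : q = q' := by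
  obtain ⟨n, φ, hφ, m, c, hc, l, d, hd, r, e, he, H⟩ := h.exists_fibreCharts p.pt
  have e1 := h1.1
  have e2 := h2.1
  obtain ⟨s, hs⟩ := h.hW.exists_isFace hφ H.initAt.smC.mem
  obtain ⟨i, hi⟩ := h.hX.exists_isFace hc (by rw [← e1]; exact H.initAt.smC.mem')
  obtain ⟨i', hi'⟩ := h.hX.exists_isFace hc (by rw [← e2]; exact H.initAt.smC.mem')
  have f1 := (h.mem_free_iff hc he hi (by rw [← e1]; exact H.left.mem')).2 hq
  have f2 := (h.mem_free_iff hc he hi' (by rw [← e2]; exact H.left.mem')).2 hq'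
  rw [← e1] at f1
  rw [← e2] at f2
  obtain rfl := H.left_unique f1 f2 ((xiMinus_iff h.hW h.hX h.smooth_fst hφ hc hs hi).1 h1).2
    ((xiMinus_iff h.hW h.hX h.smooth_fst hφ hc hs hi').1 h2).2
  exact h.hX.isFace_inj hc hi hi' (e1.symm.trans e2)

lemma right_unique {q : BoundaryPt Y} (h1 : XiMinus (X.fibre Y Z f g) Y (·.1.2) p q)
    (h2 : XiMinus (X.fibre Y Z f g) Y (·.1.2) p q') : q = q' := by
  obtain ⟨n, φ, hφ, m, c, hc, l, d, hd, r, e, he, H⟩ := h.exists_fibreCharts p.pt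
  have e1 : p.pt.1.2 = q.pt := h1.1
  have e2 : p.pt.1.2 = q'.pt := h2.1
  obtain ⟨s, hs⟩ := h.hW.exists_isFace hφ H.initAt.smC.mem
  obtain ⟨i, hi⟩ := h.hY.exists_isFace hd (by rw [← e1]; exact H.initAt.smC'.mem')
  obtain ⟨i', hi'⟩ := h.hY.exists_isFace hd (by rw [← e2]; exact H.initAt.smC'.mem')
  obtain rfl := H.right_unique (e1 ▸ hi.mem_act) (e2 ▸ hi'.mem_act)
    ((xiMinus_iff h.hW h.hY h.smooth_snd hφ hd hs hi).1 h1).2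
    ((xiMinus_iff h.hW h.hY h.smooth_snd hφ hd hs hi').1 h2).2
  exact h.hY.isFace_inj hd hi hi' (e1.symm.trans e2)

lemma not_both (hq : ¬ ∃ z, XiMinus X Z f q z) (h1 : XiMinus (X.fibre Y Z f g) X (·.1.1) p q)
    (h2 : XiMinus (X.fibre Y Z f g) Y (·.1.2) p q') : False := by
  obtain ⟨n, φ, hφ, m, c, hc, l, d, hd, r, e, he, H⟩ := h.exists_fibreCharts p.pt
  have e1 := h1.1
  have e2 : p.pt.1.2 = q'.pt := h2.1
  obtain ⟨s, hs⟩ := h.hW.exists_isFace hφ H.initAt.smC.mem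
  obtain ⟨i, hi⟩ := h.hX.exists_isFace hc (by rw [← e1]; exact H.initAt.smC.mem')
  obtain ⟨i', hi'⟩ := h.hY.exists_isFace hd (by rw [← e2]; exact H.initAt.smC'.mem')
  have f1 := (h.mem_free_iff hc he hi (by rw [← e1]; exact H.left.mem')).2 hq
  rw [← e1] at f1
  exact H.not_both f1 (e2 ▸ hi'.mem_act)
    ((xiMinus_iff h.hW h.hX h.smooth_fst hφ hc hs hi).1 h1).2
    ((xiMinus_iff h.hW h.hY h.smooth_snd hφ hd hs hi').1 h2).2

end

end FibreData

/-! ### Pieces of the boundary -/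

/-- `P` is an open part of `∂W`: the relation `R` between the points of `∂W` and those of `P` is the
inverse of an open embedding of `P` which covers `k : P → W`. -/
structure BdPiece (W : CSpace.{u}) (P : Type v) [TopologicalSpace P] (k : P → W)
    (R : BoundaryPt W → P → Prop) : Prop where
  pt : ∀ p a, R p a → p.pt = k a
  exists_left : ∀ a, ∃ p, R p a
  unique_left : ∀ a p p', R p a → R p' a → p = p'
  unique_right : ∀ p a a', R p a → R p a' → a = a'
  lift_left : ∀ p a, R p a → ∀ T ∈ 𝓝 a, ∀ᶠ p' in 𝓝 p, ∃ a' ∈ T, R p' a'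
  lift_right : ∀ p a, R p a → ∀ T ∈ 𝓝 p, ∀ᶠ a' in 𝓝 a, ∃ p' ∈ T, R p' a'

section
variable {W : CSpace.{u}} {P : Type v} [TopologicalSpace P] {Q : Type w} [TopologicalSpace Q]
  {k : P → W} {R : BoundaryPt W → P → Prop} {k' : Q → W} {R' : BoundaryPt W → Q → Prop}

/-- The relation for a disjoint union. -/
def sumRel (R : BoundaryPt W → P → Prop) (R' : BoundaryPt W → Q → Prop) :
    BoundaryPt W → P ⊕ Q → Prop := fun p => Sum.elim (R p) (R' p)

lemma BdPiece.sum (h : BdPiece W P k R) (h' : BdPiece W Q k' R')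
    (hdisj : ∀ p a b, R p a → R' p b → False) :
    BdPiece W (P ⊕ Q) (Sum.elim k k') (sumRel R R') where
  pt := by
    rintro p (a | a) ha
    · exact h.pt p a ha
    · exact h'.pt p a ha
  exists_left := by
    rintro (a | a)
    · exact h.exists_left a
    · exact h'.exists_left a
  unique_left := by
    rintro (a | a) p p' hp hp'
    · exact h.unique_left a p p' hp hp'
    · exact h'.unique_left a p p' hp hp'
  unique_right := by
    rintro p (a | a) (a' | a') ha ha'
    · rw [h.unique_right p a a' ha ha']
    · exact (hdisj p a a' ha ha').elim
    · exact (hdisj p a' a ha' ha).elim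
    · rw [h'.unique_right p a a' ha ha']
  lift_left := by
    rintro p (a | a) ha T hT
    · filter_upwards [h.lift_left p a ha _ (continuous_inl.continuousAt.preimage_mem_nhds hT)]
        with p' ⟨a', h1, h2⟩ using ⟨Sum.inl a', h1, h2⟩
    · filter_upwards [h'.lift_left p a ha _ (continuous_inr.continuousAt.preimage_mem_nhds hT)]
        with p' ⟨a', h1, h2⟩ using ⟨Sum.inr a', h1, h2⟩
  lift_right := by
    rintro p (a | a) ha T hT
    · rw [← IsOpenEmbedding.inl.map_nhds_eq, eventually_map]
      exact h.lift_right p a ha T hT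
    · rw [← IsOpenEmbedding.inr.map_nhds_eq, eventually_map]
      exact h'.lift_right p a ha T hT

lemma BdPiece.exists_homeomorph (h : BdPiece W P k R) (hsurj : ∀ p, ∃ a, R p a) :
    ∃ (Φ : BoundaryPt W → P) (Ψ : P → BoundaryPt W), Continuous Φ ∧ Continuous Ψ ∧
      LeftInverse Ψ Φ ∧ RightInverse Ψ Φ ∧ (∀ a, R (Ψ a) a) := by
  choose Φ hΦ using hsurj
  choose Ψ hΨ using h.exists_left
  refine ⟨Φ, Ψ, ?_, ?_, fun p => h.unique_left _ _ _ (hΨ _) (hΦ p),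
    fun a => h.unique_right _ _ _ (hΦ _) (hΨ a), hΨ⟩
  · refine continuous_iff_continuousAt.2 fun p T hT => ?_
    refine mem_map.2 ?_
    filter_upwards [h.lift_left p _ (hΦ p) T hT] with p' ⟨a', h1, h2⟩
    rw [mem_preimage, h.unique_right _ _ _ (hΦ p') h2]
    exact h1
  · refine continuous_iff_continuousAt.2 fun a T hT => ?_
    refine mem_map.2 ?_
    filter_upwards [h.lift_right _ a (hΨ a) T hT] with a' ⟨p', h1, h2⟩
    rw [mem_preimage, h.unique_left _ _ _ (hΨ a') h2]
    exact h1

end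

section
variable {X : CSpace.{u}} {Y : CSpace.{v}} {A : CSpace.{u'}} {B : CSpace.{v'}}

variable {κ : A → X} {κ' : A → Y}

lemma Init.sum (hA : A.IsManifold) (hB : B.IsManifold) (hd : A.dim = B.dim) {ι : B → X} {ι' : B → Y}
    (h : Init A X Y κ κ') (h' : Init B X Y ι ι') :
    Init (A.sum B) X Y (Sum.elim κ ι) (Sum.elim κ' ι') := by
  obtain ⟨-, hl, hr⟩ := sum_isManifold hA hB hd
  rintro (a | a)
  · obtain ⟨n, δ, hδ, m, c, hc, l, d, hd, H⟩ := h a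
    refine ⟨n, _, hl.charts n δ hδ, m, c, hc, l, d, hd, ?_⟩
    exact (liftAt_push δ hl.emb H.smC.mem).initAt_iff
      rfl H
  · obtain ⟨n, δ, hδ, m, c, hc, l, d, hd, H⟩ := h' a
    refine ⟨n, _, hr.charts n δ hδ, m, c, hc, l, d, hd, ?_⟩
    exact (liftAt_push δ hr.emb H.smC.mem).initAt_iff
      rfl H

lemma Init.comp {X' : CSpace.{w}} {Y' : CSpace.{w'}} (h : Init A X Y κ κ') (hX : X.IsManifold)
    (hY : Y.IsManifold) (hX' : X'.IsManifold) (hY' : Y'.IsManifold) {ι : X → X'} {ι' : Y → Y'}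
    (h1 : Init X X' X' ι ι) (h2 : Init Y Y' Y' ι' ι') : Init A X' Y' (ι ∘ κ) (ι' ∘ κ') := by
  intro a
  obtain ⟨n, δ, hδ, m, c, hc, l, d, hd, H⟩ := h a
  obtain ⟨m', c', hc', hx'⟩ := hX'.cover (ι (κ a))
  obtain ⟨l', d', hd', hy'⟩ := hY'.cover (ι' (κ' a))
  exact ⟨n, δ, hδ, m', c', hc', l', d', hd', H.comp
    (h1.initAt hX hX' hX' hc hc' hc' H.smC.mem' hx' hx')
    (h2.initAt hY hY' hY' hd hd' hd' H.smC'.mem' hy' hy')⟩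

lemma CSpace.IsManifold.init_id (hX : X.IsManifold) : Init X X X id id := by
  intro x
  obtain ⟨n, c, hc, hx⟩ := hX.cover x
  exact ⟨n, c, hc, n, c, hc, n, c, hc, (compatible_self c).initAt hx hx⟩

end

/-- The fibre product of `∂₋X` and `∂₋Y` over `∂Z`. -/
abbrev minusFibre (X : CSpace.{u}) (Y : CSpace.{v}) (Z : CSpace.{w}) (f : X → Z) (g : Y → Z) :
    CSpace.{max u v} :=
  (bdMinus X Z f).fibre (bdMinus Y Z g) Z.boundary (fMinus X Z f) (fMinus Y Z g)

namespace FibreData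

section
variable {X : CSpace.{u}} {Y : CSpace.{v}} {Z : CSpace.{w}} {f : X → Z} {g : Y → Z}
  {A : CSpace.{u'}} {B : CSpace.{v'}} (h : FibreData X Y Z f g)
include h

/-! ### The piece `∂₊X ×_Z Y` -/

omit h in
/-- The projection of `A ×_Z Y` to `X ×_Z Y`, for an open part `A` of `∂X`. -/
def leftMap {e : A → X.boundary} {f' : A → Z} (hf' : ∀ a, f' a = f (e a).pt)
    (a : A.fibre Y Z f' g) : X.fibre Y Z f g :=
  ⟨((e a.1.1).pt, a.1.2), (hf' _).symm.trans a.2⟩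

/-- A boundary point of `X ×_Z Y` corresponds to a point of `A ×_Z Y`. -/
def leftRel (_ : FibreData X Y Z f g) (e : A → X.boundary) (f' : A → Z)
    (p : BoundaryPt (X.fibre Y Z f g)) (a : A.fibre Y Z f' g) : Prop :=
  p.pt.1 = ((e a.1.1).pt, a.1.2) ∧ XiMinus (X.fibre Y Z f g) X (·.1.1) p (e a.1.1)

variable {e : A → X.boundary} {f' : A → Z} {g' : B → Z}

lemma left (hA : A.IsManifold) (he : Etale A X.boundary e) (hf' : ∀ a, f' a = f (e a).pt)
    (hb : IsBSubmersive A Z f') : FibreData A Y Z f' g where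
  hX := hA
  hY := h.hY
  hZ := h.hZ
  hf := hb
  hg := h.hg
  ht := by
    obtain rfl : f' = f ∘ fun a => (e a).pt := funext hf'
    exact h.ht.comp_left hA h.hX h.hZ h.hf.1 (he.stratumIso hA h.hX)

omit h in
lemma _root_.Corners.exists_fibre_nhds {q : A.fibre B Z f' g'} {T : Set (A.fibre B Z f' g')}
    (hT : T ∈ 𝓝 q) : ∃ T1 ∈ 𝓝 q.1.1, ∃ T2 ∈ 𝓝 q.1.2, ∀ q' : A.fibre B Z f' g',
      q'.1.1 ∈ T1 → q'.1.2 ∈ T2 → q' ∈ T := by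
  obtain ⟨S, hS, hST⟩ := mem_nhds_subtype _ _ _ |>.1 hT
  obtain ⟨T1, h1, T2, h2, h3⟩ := mem_nhds_prod_iff.1 hS
  exact ⟨T1, h1, T2, h2, fun q' h4 h5 => hST (h3 ⟨h4, h5⟩)⟩

lemma init_left (hA : A.IsManifold) (he : Etale A X.boundary e) (hf' : ∀ a, f' a = f (e a).pt)
    (hb : IsBSubmersive A Z f') :
    Init (A.fibre Y Z f' g) X Y (fun a => (e a.1.1).pt) (·.1.2) :=
  (h.left hA he hf' hb).init.comp hA h.hY h.hX h.hY (he.init_pt hA h.hX) h.hY.init_id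

lemma bdPiece_left (he : Etale A X.boundary e) (hf' : ∀ a, f' a = f (e a).pt)
    (hfree : ∀ a, ¬ ∃ z, XiMinus X Z f (e a) z) :
    BdPiece (X.fibre Y Z f g) (A.fibre Y Z f' g) (leftMap hf') (h.leftRel e f') where
  pt p a hp := Subtype.ext hp.1
  exists_left a := by
    obtain ⟨p, h1, h2⟩ := h.exists_left (hfree a.1.1) (w := leftMap hf' a) rfl
    exact ⟨p, by rw [h1]; rfl, h2⟩
  unique_left a p p' hp hp' := XiMinus.left_unique h.hW h.hX h.smooth_fst hp.2 hp'.2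
    (Subtype.ext (hp.1.trans hp'.1.symm))
  unique_right p a a' hp hp' := by
    have h2 := hp.1.symm.trans hp'.1
    rw [Prod.mk.injEq] at h2
    exact Subtype.ext (Prod.ext (he.emb.injective (h.left_unique (hfree _) (hfree _) hp.2 hp'.2))
        h2.2)
  lift_left p a hp T hT := by
    obtain ⟨T1, hT1, T2, hT2, hT'⟩ := exists_fibre_nhds hT
    have h2 : p.pt.1.2 = a.1.2 := by rw [hp.1]
    rw [← h2] at hT2
    filter_upwards [hp.2.eventually_right h.hW h.hX h.smooth_fst (he.emb.image_mem_nhds.2 hT1),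
      (h.smooth_snd.continuous.comp continuous_pt).continuousAt.preimage_mem_nhds hT2] with p' ⟨_,
          ⟨a1, ha1, rfl⟩, h3⟩ h4
    have h5 := h3.1
    refine ⟨⟨(a1, p'.pt.1.2), ?_⟩, hT' _ ha1 h4, Prod.ext h5 rfl, h3⟩
    rw [hf', ← h5]
    exact p'.pt.2
  lift_right p a hp T hT := by
    have h1 : Continuous fun a : A.fibre Y Z f' g => (e a.1.1, leftMap hf' a) := by
      have h2 : Continuous fun a : A.fibre Y Z f' g => e a.1.1 :=
        he.emb.continuous.comp (by fun_prop)
      exact h2.prodMk (((continuous_pt.comp h2).prodMk (by fun_prop)).subtype_mk _)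
    have h2 : p.pt = leftMap hf' a := Subtype.ext hp.1
    have h3 := hp.2.eventually_left h.hW h.hX h.smooth_fst hT
    rw [h2] at h3
    filter_upwards [h1.continuousAt.eventually h3] with a' h4
    obtain ⟨p', hp', h5, h6⟩ := h4 rfl
    exact ⟨p', hp', by rw [h5]; rfl, h6⟩

/-! ### The piece `X ×_Z ∂Y` -/

omit h in
/-- The projection of `X ×_Z B` to `X ×_Z Y`, for an open part `B` of `∂Y`. -/
def rightMap {e : B → Y.boundary} {g' : B → Z} (hg' : ∀ b, g' b = g (e b).pt)
    (a : X.fibre B Z f g') : X.fibre Y Z f g :=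
  ⟨(a.1.1, (e a.1.2).pt), a.2.trans (hg' _)⟩

/-- A boundary point of `X ×_Z Y` corresponds to a point of `X ×_Z B`. -/
def rightRel (_ : FibreData X Y Z f g) (e : B → Y.boundary) (g' : B → Z)
    (p : BoundaryPt (X.fibre Y Z f g)) (a : X.fibre B Z f g') : Prop :=
  p.pt.1 = (a.1.1, (e a.1.2).pt) ∧ XiMinus (X.fibre Y Z f g) Y (·.1.2) p (e a.1.2)

lemma right (hB : B.IsManifold) {e : B → Y.boundary} (he : Etale B Y.boundary e)
    (hg' : ∀ b, g' b = g (e b).pt) : FibreData X B Z f g' := by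
  obtain rfl : g' = g ∘ fun a => (e a).pt := funext hg'
  exact
    { hX := h.hX
      hY := hB
      hZ := h.hZ
      hf := h.hf
      hg := h.hg.comp' hB h.hY h.hZ (he.smooth_pt hB h.hY)
      ht := h.ht.comp_right hB h.hY h.hZ h.hg (he.stratumIso hB h.hY) }

lemma init_right (hB : B.IsManifold) {e : B → Y.boundary} (he : Etale B Y.boundary e)
    (hg' : ∀ b, g' b = g (e b).pt) :
    Init (X.fibre B Z f g') X Y (·.1.1) (fun a => (e a.1.2).pt) :=
  (h.right hB he hg').init.comp h.hX hB h.hX h.hY h.hX.init_id (he.init_pt hB h.hY)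

lemma bdPiece_right {e : B → Y.boundary} (he : Etale B Y.boundary e) (hg' : ∀ b, g' b = g (e b).pt)
    :
    BdPiece (X.fibre Y Z f g) (X.fibre B Z f g') (rightMap hg') (h.rightRel e g') where
  pt p a hp := Subtype.ext hp.1
  exists_left a := by
    obtain ⟨p, h1, h2⟩ := h.exists_right (w := rightMap hg' a) rfl
    exact ⟨p, by rw [h1]; rfl, h2⟩
  unique_left a p p' hp hp' := XiMinus.left_unique h.hW h.hY h.smooth_snd hp.2 hp'.2
    (Subtype.ext (hp.1.trans hp'.1.symm))
  unique_right p a a' hp hp' := by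
    have h2 := hp.1.symm.trans hp'.1
    rw [Prod.mk.injEq] at h2
    exact Subtype.ext (Prod.ext h2.1 (he.emb.injective (h.right_unique hp.2 hp'.2)))
  lift_left p a hp T hT := by
    obtain ⟨T1, hT1, T2, hT2, hT'⟩ := exists_fibre_nhds hT
    have h2 : p.pt.1.1 = a.1.1 := by rw [hp.1]
    rw [← h2] at hT1
    filter_upwards [hp.2.eventually_right h.hW h.hY h.smooth_snd (he.emb.image_mem_nhds.2 hT2),
      (h.smooth_fst.continuous.comp continuous_pt).continuousAt.preimage_mem_nhds hT1] with p' ⟨_,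
          ⟨a1, ha1, rfl⟩, h3⟩ h4
    have h5 := h3.1
    refine ⟨⟨(p'.pt.1.1, a1), ?_⟩, hT' _ h4 ha1, Prod.ext rfl h5, h3⟩
    rw [hg', ← h5]
    exact p'.pt.2
  lift_right p a hp T hT := by
    have h1 : Continuous fun a : X.fibre B Z f g' => (e a.1.2, rightMap hg' a) := by
      have h2 : Continuous fun a : X.fibre B Z f g' => e a.1.2 :=
        he.emb.continuous.comp (by fun_prop)
      have h3 : Continuous fun a : X.fibre B Z f g' => a.1.1 := by fun_prop
      exact h2.prodMk ((h3.prodMk (continuous_pt.comp h2)).subtype_mk _)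
    have h2 : p.pt = rightMap hg' a := Subtype.ext hp.1
    have h3 := hp.2.eventually_left h.hW h.hY h.smooth_snd hT
    rw [h2] at h3
    filter_upwards [h1.continuousAt.eventually h3] with a' h4
    obtain ⟨p', hp', h5, h6⟩ := h4 rfl
    exact ⟨p', hp', by rw [h5]; rfl, h6⟩

/-! ### The piece `∂₋X ×_{∂Z} ∂₋Y` -/

omit h in
/-- The projection of `∂₋X ×_{∂Z} ∂₋Y` to `X ×_Z Y`. -/
def cornerMap (a : minusFibre X Y Z f g) :
    X.fibre Y Z f g :=
  ⟨(a.1.1.1.pt, a.1.2.1.pt), by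
    have := congrArg BoundaryPt.pt a.2
    rwa [pt_fMinus, pt_fMinus] at this⟩

/-- A boundary point of `X ×_Z Y` corresponds to a point of `∂₋X ×_{∂Z} ∂₋Y`. -/
def cornerRel (_ : FibreData X Y Z f g) (p : BoundaryPt (X.fibre Y Z f g))
    (a : minusFibre X Y Z f g) : Prop :=
  p.pt.1 = (a.1.1.1.pt, a.1.2.1.pt) ∧
    XiMinus (X.fibre Y Z f g) X (·.1.1) p a.1.1.1 ∧
    XiMinus (X.fibre Y Z f g) Y (·.1.2) p a.1.2.1

lemma corner (hb : IsBSubmersive Y Z g) :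
    FibreData (bdMinus X Z f) (bdMinus Y Z g) Z.boundary (fMinus X Z f) (fMinus Y Z g) where
  hX := bdMinus_isManifold h.hX h.hZ h.hf.1
  hY := bdMinus_isManifold h.hY h.hZ h.hg
  hZ := h.hZ.boundary
  hf := isBSubmersive_fMinus h.hX h.hZ h.hf
  hg := smooth_fMinus h.hY h.hZ hb
  ht := by
    have hX := bdMinus_isManifold h.hX h.hZ h.hf.1
    have hY := bdMinus_isManifold h.hY h.hZ h.hg
    refine StratumTransverse.of_comp (ι := fun z : Z.boundary => z.pt) ?_ hX hY h.hZ h.hZ.boundary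
      (smooth_fMinus h.hX h.hZ h.hf) (smooth_fMinus h.hY h.hZ hb)
      (h.hZ.boundary.etale_id.stratumIso h.hZ.boundary h.hZ)
    have e3 : (fun z : Z.boundary => z.pt) ∘ fMinus X Z f = f ∘ fun a => a.1.pt :=
      funext fun a => pt_fMinus a
    have e4 : (fun z : Z.boundary => z.pt) ∘ fMinus Y Z g = g ∘ fun a => a.1.pt :=
      funext fun a => pt_fMinus a
    rw [e3, e4]
    exact (h.ht.comp_left hX h.hX h.hZ h.hf.1 ((etale_bdMinus h.hX h.hZ h.hf.1).stratumIso hX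
        h.hX)).comp_right hY h.hY h.hZ h.hg ((etale_bdMinus h.hY h.hZ h.hg).stratumIso hY h.hY)

lemma init_corner (hb : IsBSubmersive Y Z g) :
    Init (minusFibre X Y Z f g) X Y
      (fun a => a.1.1.1.pt) (fun a => a.1.2.1.pt) := by
  have hX := bdMinus_isManifold h.hX h.hZ h.hf.1
  have hY := bdMinus_isManifold h.hY h.hZ h.hg
  exact (h.corner hb).init.comp hX hY h.hX h.hY
    ((etale_bdMinus h.hX h.hZ h.hf.1).init_pt hX h.hX)
    ((etale_bdMinus h.hY h.hZ h.hg).init_pt hY h.hY)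

omit h in
lemma _root_.Corners.xiMinus_eq_of_pt (hX : X.IsManifold) (hZ : Z.IsManifold)
    (hf : Smooth X Z f) {q q' : BoundaryPt X} {z : BoundaryPt Z} (h1 : XiMinus X Z f q z)
    (h2 : XiMinus X Z f q' z) (h3 : q.pt = q'.pt) : q = q' :=
  XiMinus.left_unique hX hZ hf h1 h2 h3

lemma bdPiece_corner (hb : IsBSubmersive Y Z g) :
    BdPiece (X.fibre Y Z f g)
      (minusFibre X Y Z f g)
      cornerMap h.cornerRel where
  pt p a hp := Subtype.ext hp.1
  exists_left a := by
    obtain ⟨p, h1, h2⟩ := h.exists_right (w := cornerMap a) rfl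
    refine ⟨p, by rw [h1]; rfl, ?_, h2⟩
    refine h.xiMinus_left_of_right h2 (xiMinus_fMinus a.1.2) ?_ (by rw [h1]; rfl)
    rw [← a.2]
    exact xiMinus_fMinus a.1.1
  unique_left a p p' hp hp' := XiMinus.left_unique h.hW h.hY h.smooth_snd hp.2.2 hp'.2.2
    (Subtype.ext (hp.1.trans hp'.1.symm))
  unique_right p a a' hp hp' := by
    have h1 := Subtype.ext (h.right_unique hp.2.2 hp'.2.2)
    have h2 := hp.1.symm.trans hp'.1
    rw [Prod.mk.injEq] at h2
    refine Subtype.ext (Prod.ext (Subtype.ext ?_) h1)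
    refine xiMinus_eq_of_pt h.hX h.hZ h.hf.1 (xiMinus_fMinus a.1.1) ?_ h2.1
    rw [a.2, h1, ← a'.2]
    exact xiMinus_fMinus a'.1.1
  lift_left p a hp T hT := by
    obtain ⟨T1, hT1, T2, hT2, hT'⟩ := exists_fibre_nhds hT
    obtain ⟨r, e, he, hz⟩ := h.hZ.cover (fMinus X Z f a.1.1).pt
    obtain ⟨j, hj⟩ := h.hZ.exists_isFace he hz
    have hO := (h.hZ.isOpen_isFace he j).mem_nhds hj
    filter_upwards [hp.2.1.eventually_right h.hW h.hX h.smooth_fst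
        ((etale_bdMinus h.hX h.hZ h.hf.1).emb.image_mem_nhds.2 (inter_mem hT1 ((continuous_fMinus
            h.hX h.hZ h.hf).continuousAt.preimage_mem_nhds hO))),
      hp.2.2.eventually_right h.hW h.hY h.smooth_snd
        ((etale_bdMinus h.hY h.hZ h.hg).emb.image_mem_nhds.2 (inter_mem hT2 ((continuous_fMinus h.hY
            h.hZ hb).continuousAt.preimage_mem_nhds (a.2 ▸ hO))))]
      with p' ⟨_, ⟨a1, ha1, rfl⟩, h3⟩ ⟨_, ⟨a2, ha2, rfl⟩, h4⟩
    have h5 := h3.1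
    have h6 := h4.1
    refine ⟨⟨(a1, a2), h.hZ.isFace_inj he ha1.2 ha2.2 ?_⟩, hT' _ ha1.1 ha2.1,
      Prod.ext h5 h6, h3, h4⟩
    rw [pt_fMinus, pt_fMinus, ← h5, ← h6]
    exact p'.pt.2
  lift_right p a hp T hT := by
    have h1 : Continuous fun a : minusFibre X Y Z f g => (a.1.2.1, cornerMap a) := by
      have h2 : Continuous fun a : minusFibre X Y Z f g => a.1.2.1 := by fun_prop
      exact h2.prodMk (((continuous_pt.comp (by fun_prop)).prodMk (continuous_pt.comp
          h2)).subtype_mk _)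
    have h2 : p.pt = cornerMap a := Subtype.ext hp.1
    have h3 := hp.2.2.eventually_left h.hW h.hY h.smooth_snd hT
    rw [h2] at h3
    filter_upwards [h1.continuousAt.eventually h3] with a' h4
    obtain ⟨p', hp', h5, h6⟩ := h4 rfl
    refine ⟨p', hp', by rw [h5]; rfl, ?_, h6⟩
    refine h.xiMinus_left_of_right h6 (xiMinus_fMinus a'.1.2) ?_ (by rw [h5]; rfl)
    rw [← a'.2]
    exact xiMinus_fMinus a'.1.1

/-- An open part of `∂W` which is all of `∂W` is diffeomorphic to `∂W`. -/
lemma exists_diffeo {P : CSpace.{u'}} (hP : P.IsManifold) {κ : P → X} {κ' : P → Y}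
    (hI : Init P X Y κ κ') {k : P → X.fibre Y Z f g} (hk : ∀ a, (k a).1 = (κ a, κ' a))
    {R : BoundaryPt (X.fibre Y Z f g) → P → Prop} (hR : BdPiece (X.fibre Y Z f g) P k R)
    (hsurj : ∀ p, ∃ a, R p a) :
    ∃ (Φ : (X.fibre Y Z f g).boundary → P) (Ψ : P → (X.fibre Y Z f g).boundary),
      Smooth (X.fibre Y Z f g).boundary P Φ ∧ Smooth P (X.fibre Y Z f g).boundary Ψ ∧
      LeftInverse Ψ Φ ∧ RightInverse Ψ Φ ∧ ∀ a, R (Ψ a) a := by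
  obtain ⟨Φ, Ψ, hΦ, hΨ, h1, h2, h3⟩ := hR.exists_homeomorph hsurj
  have h4 := fun a => hR.pt _ _ (h3 a)
  have hκ := hI.smooth_left hP h.hX
  have hκ' := hI.smooth_right hP h.hY
  refine ⟨Φ, Ψ, hI.lift hP h.hX h.hY h.hW.boundary hΦ ?_ ?_, ?_, h1, h2, h3⟩
  · have h5 : κ ∘ Φ = (·.1.1) ∘ (X.fibre Y Z f g).incl := by
      funext p
      change κ (Φ p) = p.pt.1.1
      rw [← h1 p, h4, hk, h1 p]
    rw [h5]
    exact h.smooth_fst.comp' h.hW.boundary h.hW h.hX h.hW.smooth_incl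
  · have h5 : κ' ∘ Φ = (·.1.2) ∘ (X.fibre Y Z f g).incl := by
      funext p
      change κ' (Φ p) = p.pt.1.2
      rw [← h1 p, h4, hk, h1 p]
    rw [h5]
    exact h.smooth_snd.comp' h.hW.boundary h.hW h.hY h.hW.smooth_incl
  · have hkc : Continuous k := by
      refine continuous_induced_rng.2 ?_
      rw [show Subtype.val ∘ k = fun a => (κ a, κ' a) from funext hk]
      exact hκ.continuous.prodMk hκ'.continuous
    have h6 : Smooth P (X.fibre Y Z f g) k := by
      refine h.init.lift h.hW h.hX h.hY hP hkc ?_ ?_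
      · rw [show (·.1.1) ∘ k = κ from
          funext fun a => congrArg Prod.fst (hk a)]
        exact hκ
      · rw [show (·.1.2) ∘ k = κ' from
          funext fun a => congrArg Prod.snd (hk a)]
        exact hκ'
    have h7 : BoundaryPt.pt ∘ Ψ = k := funext h4
    exact h.hW.init_incl.lift h.hW.boundary h.hW h.hW hP hΨ (h7 ▸ h6) (h7 ▸ h6)

end

end FibreData

/-! ### Signs of real numbers -/

/-- The nonzero real number `x` has sign `s`. -/
def Sg (s : ℤˣ) (x : ℝ) : Prop := 0 < ((s : ℤ) : ℝ) * x

section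
variable {s : ℤˣ} {x : ℝ} {t : ℤˣ} {y : ℝ} {n : ℕ} {a b : Fin (n + 1)}
    {D : ℝ^(n + 1) →ₗ[ℝ] ℝ^(n + 1)} {T : ℝ^n →ₗ[ℝ] ℝ^n} {N r : ℕ}

lemma Sg.ne_zero (h : Sg s x) : x ≠ 0 := fun h0 => by
  simp [Sg, h0] at h

lemma Sg.mul (h : Sg s x) (h' : Sg t y) : Sg (s * t) (x * y) := by
  have := mul_pos h h'
  unfold Sg
  push_cast
  linarith

lemma units_mul_self_real (s : ℤˣ) : ((s : ℤ) : ℝ) * ((s : ℤ) : ℝ) = 1 := by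
  rcases Int.units_eq_one_or s with rfl | rfl <;> simp

lemma exists_sg (h : x ≠ 0) : ∃ s : ℤˣ, Sg s x := by
  rcases lt_or_gt_of_ne h with h | h
  · exact ⟨-1, by simpa [Sg] using h⟩
  · exact ⟨1, by simpa [Sg] using h⟩

lemma Sg.unique (h : Sg s x) (h' : Sg t x) : s = t := by
  rcases Int.units_eq_one_or s with rfl | rfl <;> rcases Int.units_eq_one_or t with rfl | rfl <;>
    simp [Sg] at h h' ⊢ <;> linarith

lemma Sg.of_mul (h : Sg s (x * y)) (h' : Sg t y) : Sg (s * t) x := by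
  obtain ⟨r, hr⟩ := exists_sg (left_ne_zero_of_mul h.ne_zero)
  have := h.unique (hr.mul h')
  rw [this, mul_assoc, Int.units_mul_self, mul_one]
  exact hr

lemma sg_one : Sg 1 x ↔ 0 < x := by simp [Sg]

lemma sg_neg_one_pow (n : ℕ) : Sg ((-1) ^ n) ((-1) ^ n) := by
  unfold Sg
  rcases Nat.even_or_odd n with h | h <;> simp [h.neg_one_pow]

lemma sg_units (s : ℤˣ) : Sg s ((s : ℤ) : ℝ) := by
  unfold Sg
  rw [units_mul_self_real]
  exact one_pos

lemma Sg.inv (h : Sg s x) (hxy : x * y = 1) : Sg s y := by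
  have : Sg (s * s) (x * y) := by rw [hxy, Int.units_mul_self]; exact sg_one.2 one_pos
  have h2 := (mul_comm x y ▸ this).of_mul h
  rwa [Int.units_mul_self, one_mul] at h2

lemma sg_ite {P : Prop} [Decidable P] (h0 : x ≠ 0) (h : P ↔ 0 < x) :
    Sg (if P then 1 else -1) x := by
  by_cases hP : P
  · rw [if_pos hP]; exact sg_one.2 (h.1 hP)
  · rw [if_neg hP]
    have := lt_of_le_of_ne (not_lt.1 fun h1 => hP (h.2 h1)) h0
    simpa [Sg] using this

/-! ### Determinants -/

lemma insL_single (a : Fin (n + 1)) (j : Fin n) :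
    insL a (Pi.single j 1) = Pi.single (M := fun _ => ℝ) (a.succAbove j) 1 := by
  funext k
  rcases Fin.eq_self_or_eq_succAbove a k with rfl | ⟨k, rfl⟩
  · rw [insL_same, Pi.single_eq_of_ne (Fin.succAbove_ne _ _).symm]
  · rw [insL_succAbove]
    by_cases h : k = j
    · subst h; simp
    · rw [Pi.single_eq_of_ne h, Pi.single_eq_of_ne (fun h' => h (Fin.succAbove_right_injective h'))]

/-- Laplace expansion for a map of coordinate spaces which maps one coordinate hyperplane to
another. -/
lemma det_insL (h : ∀ t, D (insL a t) = insL b (T t)) :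
    det D = (-1) ^ ((a : ℕ) + b) * D (Pi.single a 1) b * det T := by
  rw [← det_toMatrix', Matrix.det_succ_row _ b, Finset.sum_eq_single a]
  · rw [← det_toMatrix' T, add_comm (b : ℕ)]
    congr 2
    ext k l
    rw [Matrix.submatrix_apply, LinearMap.toMatrix'_apply, LinearMap.toMatrix'_apply]
    have := congrFun (h (Pi.single l 1)) (b.succAbove k)
    rw [insL_succAbove, insL_single] at this
    exact this
  · intro j _ hj
    obtain rfl | ⟨j, rfl⟩ := Fin.eq_self_or_eq_succAbove a j
    · exact (hj rfl).elim
    · have := congrFun (h (Pi.single j 1)) b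
      rw [insL_same, insL_single] at this
      rw [LinearMap.toMatrix'_apply, this]
      simp
  · simp

lemma det_insL_mul {M : ℝ^n →ₗ[ℝ] ℝ^n} (h : ∀ t, D (insL a (M t)) = insL b (T t)) :
    det D * det M =
      (-1) ^ ((a : ℕ) + b) * D (Pi.single a 1) b * det T := by
  let M' : ℝ^(n + 1) →ₗ[ℝ] ℝ^(n + 1) :=
    (insL a).toLinearMap ∘ₗ M ∘ₗ (remL a).toLinearMap +
      (LinearMap.proj a : ℝ^(n + 1) →ₗ[ℝ] ℝ).smulRight (Pi.single a 1)
  have h1 : ∀ t, M' (insL a t) = insL a (M t) := fun t => by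
    have : M' (insL a t) = insL a (M (remL a (insL a t))) +
      (insL a t a) • Pi.single a (1 : ℝ) := rfl
    rw [this, remL_insL, insL_same, zero_smul, add_zero]
  have h2 : M' (Pi.single a 1) = Pi.single a 1 := by
    have : M' (Pi.single a 1) = insL a (M (remL a (Pi.single a 1))) +
      (Pi.single (M := fun _ => ℝ) a (1 : ℝ) a) • Pi.single (M := fun _ => ℝ) a (1 : ℝ) := rfl
    have h0 : remL a (Pi.single a 1) = 0 := by
      funext k
      exact Pi.single_eq_of_ne (Fin.succAbove_ne _ _) _
    rw [this, h0, map_zero, map_zero, Pi.single_eq_same, one_smul, zero_add]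
  have h3 := det_insL h1
  rw [h2, Pi.single_eq_same, mul_one, Even.neg_one_pow ⟨_, rfl⟩, one_mul] at h3
  have h4 := det_insL (D := D ∘ₗ M') (fun t => by rw [LinearMap.comp_apply, h1, h])
  rw [det_comp, LinearMap.comp_apply, h2, h3] at h4
  exact h4

/-- The identification of `ℝⁿ × ℝʳ` with `ℝᴺ` for `N = n + r`. -/
def appE {N n r : ℕ} (h : N = n + r) : (ℝ^n × ℝ^r) ≃ₗ[ℝ] ℝ^N where
  toFun v i := Fin.append v.1 v.2 (Fin.cast h i)
  map_add' v v' := by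
    funext i
    obtain ⟨i, rfl⟩ := (finCongr h).symm.surjective i
    induction i using Fin.addCases <;> simp
  map_smul' s v := by
    funext i
    obtain ⟨i, rfl⟩ := (finCongr h).symm.surjective i
    induction i using Fin.addCases <;> simp
  invFun x := (fun i => x (Fin.cast h.symm (Fin.castAdd r i)),
    fun i => x (Fin.cast h.symm (Fin.natAdd n i)))
  left_inv v := by
    ext i <;> simp
  right_inv x := by
    funext i
    obtain ⟨i, rfl⟩ := (finCongr h).symm.surjective i
    induction i using Fin.addCases <;> simp

lemma appE_castAdd (h : N = n + r) (v : ℝ^n × ℝ^r) (i : Fin n) :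
    appE h v (Fin.cast h.symm (Fin.castAdd r i)) = v.1 i := by
  simp [appE]

lemma appE_natAdd (h : N = n + r) (v : ℝ^n × ℝ^r) (i : Fin r) :
    appE h v (Fin.cast h.symm (Fin.natAdd n i)) = v.2 i := by
  simp [appE]

lemma appE_ext (h : N = n + r) {v : ℝ^n × ℝ^r} {x : ℝ^N}
    (h1 : ∀ i, v.1 i = x (Fin.cast h.symm (Fin.castAdd r i)))
    (h2 : ∀ i, v.2 i = x (Fin.cast h.symm (Fin.natAdd n i))) : appE h v = x := by
  rw [← (appE h).apply_symm_apply x]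
  congr 1
  exact Prod.ext (funext h1) (funext h2)

/-- The determinant of a map `ℝⁿ × ℝʳ → ℝᵐ × ℝˡ` if `n + r = m + l`. -/
def fdet {n r m l : ℕ} (h : n + r = m + l)
    (L : (ℝ^n × ℝ^r) →ₗ[ℝ] (ℝ^m × ℝ^l)) : ℝ :=
  det ((appE h).toLinearMap ∘ₗ L ∘ₗ (appE rfl).symm.toLinearMap)

section
variable {n r m l : ℕ} (h : n + r = m + l)
  (L : (ℝ^n × ℝ^r) →ₗ[ℝ] (ℝ^m × ℝ^l))

variable {M : (ℝ^n × ℝ^r) →ₗ[ℝ] (ℝ^n × ℝ^r)} {P : ℝ^n →ₗ[ℝ] ℝ^n} {R : ℝ^r →ₗ[ℝ] ℝ^r}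

lemma fdet_eq {N : ℕ} (h1 : N = n + r) (h2 : N = m + l) :
    fdet h L = det ((appE h2).toLinearMap ∘ₗ L ∘ₗ (appE h1).symm.toLinearMap) := by
  subst h1; rfl

lemma fdet_comp (M : (ℝ^n × ℝ^r) →ₗ[ℝ] (ℝ^n × ℝ^r)) :
    fdet h (L ∘ₗ M) = fdet h L * det M := by
  rw [← det_conj M (appE rfl), fdet, fdet, ← det_comp]
  congr 1
  refine LinearMap.ext fun x => ?_
  simp

lemma fdet_comp_left (M : (ℝ^m × ℝ^l) →ₗ[ℝ] (ℝ^m × ℝ^l)) :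
    fdet h (M ∘ₗ L) = det M * fdet h L := by
  rw [← det_conj M (appE h), fdet, fdet, ← det_comp]
  congr 1
  refine LinearMap.ext fun x => ?_
  simp

variable {L} in
lemma fdet_ne_zero (hL : Injective L) : fdet h L ≠ 0 := by
  have h1 : Injective ((appE h).toLinearMap ∘ₗ L ∘ₗ (appE rfl).symm.toLinearMap) :=
    (appE h).injective.comp (hL.comp (appE rfl).symm.injective)
  exact (LinearEquiv.ofInjectiveEndo _ h1).isUnit_det'.ne_zero

/-- The determinant of a block triangular map. -/
lemma det_triangular (h1 : ∀ t, M (t, 0) = (P t, 0)) (h2 : ∀ w, (M (0, w)).2 = R w) :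
    det M = det P * det R := by
  rw [← det_toMatrix ((Pi.basisFun ℝ (Fin n)).prod (Pi.basisFun ℝ (Fin r))) M,
    ← det_toMatrix (Pi.basisFun ℝ (Fin n)) P,
    ← det_toMatrix (Pi.basisFun ℝ (Fin r)) R,
    ← Matrix.det_fromBlocks_zero₂₁ _ (Matrix.of fun i j => (M (0, Pi.single j 1)).1 i)]
  congr 1
  ext (i | i) (j | j)
  · simp [LinearMap.toMatrix_apply, h1]
  · simp [LinearMap.toMatrix_apply]
  · simp [LinearMap.toMatrix_apply, h1]
  · simp [LinearMap.toMatrix_apply, h2]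

lemma det_lowerTriangular (h1 : ∀ w, M (0, w) = (0, R w)) (h2 : ∀ t, (M (t, 0)).1 = P t) :
    det M = det P * det R := by
  rw [← det_toMatrix ((Pi.basisFun ℝ (Fin n)).prod (Pi.basisFun ℝ (Fin r))) M,
    ← det_toMatrix (Pi.basisFun ℝ (Fin n)) P,
    ← det_toMatrix (Pi.basisFun ℝ (Fin r)) R,
    ← Matrix.det_fromBlocks_zero₁₂ _ (Matrix.of fun i j => (M (Pi.single j 1, 0)).2 i)]
  congr 1
  ext (i | i) (j | j)
  · simp [LinearMap.toMatrix_apply, h2]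
  · simp [LinearMap.toMatrix_apply, h1]
  · simp [LinearMap.toMatrix_apply]
  · simp [LinearMap.toMatrix_apply, h1]

end

/-- Up to the identifications with `ℝᴺ`, `J` inserts a zero at the place `a`, where `e` is the
basis vector and `ξ` the coordinate at this place. -/
def InsAt {n r n' r' : ℕ} (J : (Fin n' → ℝ) × (Fin r' → ℝ) → ℝ^n × ℝ^r) (a : ℕ)
    (e : ℝ^n × ℝ^r) (ξ : ℝ^n × ℝ^r → ℝ) : Prop :=
  ∀ K (h : K + 1 = n + r) (h' : K = n' + r'), ∃ a' : Fin (K + 1), (a' : ℕ) = a ∧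
    (∀ v, appE h (J v) = insL a' (appE h' v)) ∧ appE h e = Pi.single a' 1 ∧ ∀ v, appE h v a' = ξ v

lemma insAt_fst (a : Fin (n + 1)) : InsAt (n := n + 1) (r := r) (n' := n) (r' := r)
    (fun v => (insL a v.1, v.2)) a (Pi.single a 1, 0) (fun v => v.1 a) := by
  intro K h h'
  have key := fun v => appE_castAdd h v a
  subst h'
  refine ⟨Fin.cast h.symm (Fin.castAdd r a), by simp, fun v => ?_, ?_, key⟩
  · funext x
    rcases Fin.eq_self_or_eq_succAbove (Fin.cast h.symm (Fin.castAdd r a)) x with rfl | ⟨y, rfl⟩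
    · rw [key, insL_same]; exact insL_same _ _
    · rw [insL_succAbove]
      induction y using Fin.addCases with
      | left y =>
        have : Fin.succAbove (Fin.cast h.symm (Fin.castAdd r a)) (Fin.castAdd r y) =
            Fin.cast h.symm (Fin.castAdd r (a.succAbove y)) := by
          ext
          simp only [Fin.succAbove, Fin.lt_def, Fin.val_castSucc, Fin.val_cast, Fin.val_castAdd]
          split_ifs <;> simp
        rw [this, appE_castAdd]
        change insL a v.1 (a.succAbove y) = _
        rw [insL_succAbove, show Fin.castAdd r y =
          Fin.cast rfl (Fin.castAdd r y) from rfl, appE_castAdd]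
      | right y =>
        have : Fin.succAbove (Fin.cast h.symm (Fin.castAdd r a)) (Fin.natAdd n y) =
            Fin.cast h.symm (Fin.natAdd (n + 1) y) := by
          ext
          have := a.2
          simp only [Fin.succAbove, Fin.lt_def, Fin.val_castSucc, Fin.val_cast, Fin.val_castAdd,
            Fin.val_natAdd]
          split_ifs
          · omega
          · simp; omega
        rw [this, appE_natAdd, show Fin.natAdd n y = Fin.cast rfl (Fin.natAdd n y) from rfl,
          appE_natAdd]
  · refine appE_ext _ (fun i => ?_) fun i => ?_
    · change Pi.single a 1 i = _
      by_cases hi : i = a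
      · subst hi; simp
      · rw [Pi.single_eq_of_ne hi, Pi.single_eq_of_ne]
        intro h1
        exact hi (by simpa [Fin.ext_iff] using h1)
    · rw [Pi.single_eq_of_ne]
      · rfl
      · intro h1
        have := a.2
        simp [Fin.ext_iff] at h1
        omega

lemma insAt_snd (a : Fin (r + 1)) : InsAt (n := n) (r := r + 1) (n' := n) (r' := r)
    (fun v => (v.1, insL a v.2)) (n + a) (0, Pi.single a 1) (fun v => v.2 a) := by
  intro K h h'
  have key := fun v => appE_natAdd h v a
  subst h'
  refine ⟨Fin.cast h.symm (Fin.natAdd n a), by simp, fun v => ?_, ?_, key⟩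
  · funext x
    rcases Fin.eq_self_or_eq_succAbove (Fin.cast h.symm (Fin.natAdd n a)) x with rfl | ⟨y, rfl⟩
    · rw [key, insL_same]; exact insL_same _ _
    · rw [insL_succAbove]
      induction y using Fin.addCases with
      | left y =>
        have : Fin.succAbove (Fin.cast h.symm (Fin.natAdd n a)) (Fin.castAdd r y) =
            Fin.cast h.symm (Fin.castAdd (r + 1) y) := by
          ext
          have := y.2
          simp only [Fin.succAbove, Fin.lt_def, Fin.val_castSucc, Fin.val_cast, Fin.val_castAdd,
            Fin.val_natAdd]
          split_ifs
          · simp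
          · omega
        rw [this, appE_castAdd, show Fin.castAdd r y =
          Fin.cast rfl (Fin.castAdd r y) from rfl, appE_castAdd]
      | right y =>
        have : Fin.succAbove (Fin.cast h.symm (Fin.natAdd n a)) (Fin.natAdd n y) =
            Fin.cast h.symm (Fin.natAdd n (a.succAbove y)) := by
          ext
          simp only [Fin.succAbove, Fin.lt_def, Fin.val_castSucc, Fin.val_cast, Fin.val_natAdd]
          split_ifs <;> simp <;> omega
        rw [this, appE_natAdd]
        change insL a v.2 (a.succAbove y) = _
        rw [insL_succAbove,
          show Fin.natAdd n y = Fin.cast rfl (Fin.natAdd n y) from rfl, appE_natAdd]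
  · refine appE_ext _ (fun i => ?_) fun i => ?_
    · rw [Pi.single_eq_of_ne]
      · rfl
      · intro h1
        have := i.2
        simp [Fin.ext_iff] at h1
        omega
    · change Pi.single a 1 i = _
      by_cases hi : i = a
      · subst hi; simp
      · rw [Pi.single_eq_of_ne hi, Pi.single_eq_of_ne]
        intro h1
        exact hi (by simpa [Fin.ext_iff] using h1)

/-- Laplace expansion along a row with a single nonzero entry. -/
lemma fdet_insAt {m l n' r' m' l' : ℕ} {h : n + r = m + l} {h' : n' + r' = m' + l'}
    (hd : n + r = n' + r' + 1) {L : (ℝ^n × ℝ^r) →ₗ[ℝ] (ℝ^m × ℝ^l)}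
    {L' : ((Fin n' → ℝ) × (Fin r' → ℝ)) →ₗ[ℝ] ((Fin m' → ℝ) × (Fin l' → ℝ))}
    {M : ((Fin n' → ℝ) × (Fin r' → ℝ)) →ₗ[ℝ] ((Fin n' → ℝ) × (Fin r' → ℝ))} {J J' a b e e' ξ ξ'}
    (hJ : InsAt (n := n) (r := r) (n' := n') (r' := r') J a e ξ)
    (hJ' : InsAt (n := m) (r := l) (n' := m') (r' := l') J' b e' ξ')
    (hL : ∀ v, L (J (M v)) = J' (L' v)) :
    fdet h L * det M = (-1) ^ (a + b) * ξ' (L e) * fdet h' L' := by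
  obtain ⟨a, rfl, h1, h2, -⟩ := hJ (n' + r') hd.symm rfl
  obtain ⟨b, rfl, h4, -, h6⟩ := hJ' (n' + r') (hd.symm.trans h) h'
  rw [fdet_eq h L hd.symm (hd.symm.trans h), fdet_eq h' L' rfl h',
    ← det_conj M (appE rfl)]
  rw [det_insL_mul (T := (appE h').toLinearMap ∘ₗ L' ∘ₗ
    (appE rfl).symm.toLinearMap)]
  · congr 2
    rw [← h2]
    simp [h6]
  · intro t
    simp [← h1, h4, hL]

end

/-! ### Splittings -/

section
variable {n r m l : ℕ} (h : n + r = m + l)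

/-- The sign of this number compares the orientations of the middle term and of the outer terms of
the exact sequence with maps `(U, U')` and `H`; here `s` is a splitting up to automorphisms. -/
def splitDet (U : ℝ^n →ₗ[ℝ] ℝ^m) (U' : ℝ^n →ₗ[ℝ] ℝ^l)
    (H : ℝ^m × ℝ^l →ₗ[ℝ] ℝ^r)
    (s : ℝ^r →ₗ[ℝ] ℝ^m × ℝ^l) : ℝ :=
  det (H ∘ₗ s) * fdet h ((U.prod U').coprod s)

variable {U : ℝ^n →ₗ[ℝ] ℝ^m} {U' : ℝ^n →ₗ[ℝ] ℝ^l}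
  {H : ℝ^m × ℝ^l →ₗ[ℝ] ℝ^r}
  {s s' : ℝ^r →ₗ[ℝ] ℝ^m × ℝ^l}

lemma injective_of_det_ne_zero {V : Type*} [AddCommGroup V] [Module ℝ V] [FiniteDimensional ℝ V]
    {R : V →ₗ[ℝ] V} (hR : det R ≠ 0) : Injective R :=
  (LinearMap.equivOfDetNeZero R hR).injective

lemma injective_coprod (hinj : ∀ t, U t = 0 → U' t = 0 → t = 0) (hH : ∀ t, H (U t, U' t) = 0)
    (hs : det (H ∘ₗ s) ≠ 0) : Injective ((U.prod U').coprod s) := by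
  rw [← LinearMap.ker_eq_bot, LinearMap.ker_eq_bot']
  rintro ⟨t, w⟩ h0
  have h1 : (U t, U' t) + s w = 0 := h0
  have h2 : H (s w) = 0 := by
    have := congrArg H h1
    rwa [map_add, hH, zero_add, map_zero] at this
  have h3 : w = 0 := injective_of_det_ne_zero hs (by simpa using h2)
  rw [h3, map_zero, add_zero, Prod.mk_eq_zero] at h1
  rw [h3, hinj t h1.1 h1.2]
  rfl

lemma splitDet_ne_zero (hinj : ∀ t, U t = 0 → U' t = 0 → t = 0) (hH : ∀ t, H (U t, U' t) = 0)
    (hs : det (H ∘ₗ s) ≠ 0) : splitDet h U U' H s ≠ 0 :=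
  mul_ne_zero hs (fdet_ne_zero h (injective_coprod hinj hH hs))

lemma splitDet_mul_pos (hinj : ∀ t, U t = 0 → U' t = 0 → t = 0) (hH : ∀ t, H (U t, U' t) = 0)
    (hs : det (H ∘ₗ s) ≠ 0) (hs' : det (H ∘ₗ s') ≠ 0) :
    0 < splitDet h U U' H s * splitDet h U U' H s' := by
  let L := LinearMap.linearEquivOfInjective _ (injective_coprod hinj hH hs) (by simp [h])
  let M := L.symm.toLinearMap ∘ₗ (U.prod U').coprod s'
  have hM : ∀ v, (U.prod U').coprod s (M v) = (U.prod U').coprod s' v :=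
    fun v => L.apply_symm_apply _
  let R := LinearMap.snd ℝ _ _ ∘ₗ M ∘ₗ LinearMap.inr ℝ ℝ^n ℝ^r
  have h1 : det M = det R := by
    rw [det_triangular (R := R) (fun t => ?_) fun w => rfl, det_id,
      one_mul]
    refine L.injective ((L.apply_symm_apply _).trans ?_)
    change (U t, U' t) + s' 0 = (U t, U' t) + s 0
    rw [map_zero, map_zero]
  have h2 : H ∘ₗ s' = (H ∘ₗ s) ∘ₗ R := by
    refine LinearMap.ext fun w => ?_
    have h3 : (U.prod U') (M (0, w)).1 + s (M (0, w)).2 = (U.prod U') 0 + s' w := hM (0, w)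
    have h4 := congrArg H h3
    rw [map_zero, zero_add, map_add] at h4
    have h5 : H ((U.prod U') (M (0, w)).1) = 0 := hH _
    rw [h5, zero_add] at h4
    exact h4.symm
  have h3 : (U.prod U').coprod s' = (U.prod U').coprod s ∘ₗ M :=
    LinearMap.ext fun v => (hM v).symm
  have h4 : splitDet h U U' H s' = splitDet h U U' H s * det R ^ 2 := by
    rw [splitDet, splitDet, h2, h3, fdet_comp, det_comp, h1]
    ring
  have h5 := splitDet_ne_zero h hinj hH hs
  have h6 := splitDet_ne_zero h hinj hH hs'
  rw [h4] at h6 ⊢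
  have h7 : det R ≠ 0 := fun h0 => h6 (by rw [h0]; ring)
  have : splitDet h U U' H s * (splitDet h U U' H s * det R ^ 2) =
    (splitDet h U U' H s * det R) ^ 2 := by ring
  rw [this]
  positivity

lemma splitDet_change {A : ℝ^m →ₗ[ℝ] ℝ^m} {B : ℝ^l →ₗ[ℝ] ℝ^l}
    {C : ℝ^r →ₗ[ℝ] ℝ^r} {P : ℝ^n →ₗ[ℝ] ℝ^n}
    {V : ℝ^n →ₗ[ℝ] ℝ^m} {V' : ℝ^n →ₗ[ℝ] ℝ^l}
    {K : ℝ^m × ℝ^l →ₗ[ℝ] ℝ^r}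
    (hV : ∀ t, V (P t) = A (U t)) (hV' : ∀ t, V' (P t) = B (U' t))
    (hK : ∀ v, K (A v.1, B v.2) = C (H v)) :
    splitDet h V V' K (A.prodMap B ∘ₗ s) * det P =
      splitDet h U U' H s * (det A * det B * det C) := by
  have h1 : K ∘ₗ A.prodMap B ∘ₗ s = C ∘ₗ H ∘ₗ s := LinearMap.ext fun w => hK (s w)
  have h2 : (V.prod V').coprod (A.prodMap B ∘ₗ s) ∘ₗ P.prodMap LinearMap.id =
      A.prodMap B ∘ₗ (U.prod U').coprod s := by
    refine LinearMap.ext fun v => ?_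
    change (V (P v.1), V' (P v.1)) + A.prodMap B (s v.2) = A.prodMap B ((U v.1, U' v.1) + s v.2)
    rw [map_add, hV, hV']
    rfl
  have h3 := congrArg (fdet h) h2
  rw [fdet_comp, fdet_comp_left, det_prodMap, det_prodMap, det_id,
    mul_one] at h3
  rw [splitDet, splitDet, h1, mul_assoc, h3, det_comp]
  ring

end

/-! ### Orientations and charts -/

section
variable {A : Type u} {B : Type v} [TopologicalSpace A] [TopologicalSpace B] {m n : ℕ}

lemma Rep.continuousAt_chartDeriv {f : A → B} {c : 𝒞 m A} {d : 𝒞 n B} {x : A}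
    {G} (h : Rep f c d x G) (hf : ∀ᶠ y in 𝓝 x, ContinuousAt f y) :
    ContinuousAt (𝒟 f c d) x := by
  refine (ContinuousAt.comp h.smooth.continuousAt_fderiv (c.continuousAt_invFun
      h.mem)).congr ?_
  filter_upwards [h.eventually hf] with y hy using hy.chartDeriv_eq.symm

lemma clmDet_comp (D E : ℝ^n →L[ℝ] ℝ^n) : (D.comp E).det = D.det * E.det :=
  det_comp _ _

lemma Compatible.det_mul_det {c d : 𝒞 n A} (h : Compatible c d) {x : A}
    (hc : x ∈ c.target) (hd : x ∈ d.target) :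
    (𝒟 (id : A → A) d c x).det * (𝒟 (id : A → A) c d x).det = 1 := by
  rw [← clmDet_comp, h.chartDeriv_comp hc hd]
  exact det_id

lemma Tendsto.eventually_sg {ι : Type*} {F : ι → ℝ} {l : Filter ι} {y : ℝ}
    (h : Tendsto F l (𝓝 y)) {s : ℤˣ} (hs : Sg s y) : ∀ᶠ x in l, Sg s (F x) :=
  (h.const_mul ((s : ℤ) : ℝ)).eventually (lt_mem_nhds hs)

end

section
variable {X : CSpace.{u}} {o : SignData X}

lemma isOrientation_of_local (hX : X.IsManifold)
    (h : ∀ x, ∃ n, ∃ c ∈ X.charts n, x ∈ c.target ∧ ∃ ε : ℤˣ, ∀ᶠ x' in 𝓝 x, ∀ d ∈ X.charts n,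
      x' ∈ d.target → Sg (o n d x' * ε) (𝒟 (id : X → X) d c x').det) :
    IsOrientation X o where
  locallyConstant n d hd x hx := by
    obtain ⟨n', c, hc, hxc, ε, hε⟩ := h x
    obtain rfl := hX.dim_unique hd hc
    obtain ⟨G, hG⟩ := (hX.compatible n d hd c hc).rep hx hxc
    have h1 := (ContinuousLinearMap.continuous_det (𝕜 := ℝ)).continuousAt.comp
      (hG.continuousAt_chartDeriv (.of_forall fun _ => continuousAt_id))
    filter_upwards [hε, d.eventually_target hx,
      Tendsto.eventually_sg h1 (hε.self_of_nhds d hd hx)] with x' h2 h3 h4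
    exact mul_right_cancel ((h2 d hd h3).unique h4)
  transition n c hc d hd x hxc hxd := by
    obtain ⟨n', e, he, hxe, ε, hε⟩ := h x
    obtain rfl := hX.dim_unique hc he
    have h1 := hε.self_of_nhds c hc hxc
    obtain ⟨G, hG⟩ := (hX.compatible n c hc d hd).rep hxc hxd
    obtain ⟨K, hK⟩ := (hX.compatible n d hd e he).rep hxd hxe
    have h3 : 𝒟 (id : X → X) c e x = _ := Rep.chartDeriv_comp (f := (id : X → X)) hK hG
    rw [h3, clmDet_comp, mul_comm (ContinuousLinearMap.det _)] at h1
    have h4 := h1.of_mul (hε.self_of_nhds d hd hxd)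
    have h5 : o n c x * ε * (o n d x * ε) = o n c x * o n d x := by
      rw [mul_mul_mul_comm, Int.units_mul_self, mul_one]
    rw [h5] at h4
    exact h4

lemma IsOrientation.sg (h : IsOrientation X o) {n : ℕ} {c d : 𝒞 n X}
    (hc : c ∈ X.charts n) (hd : d ∈ X.charts n) {x : X} (hxc : x ∈ c.target) (hxd : x ∈ d.target) :
    Sg (o n c x * o n d x) (𝒟 (id : X → X) c d x).det := h.transition n c hc d hd x hxc hxd

lemma IsOrientedManifold.signed (h : IsOrientedManifold X o) (s : ℤˣ) :
    IsOrientedManifold X (signed s o) where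
  isManifold := h.1
  isOrientation :=
    { locallyConstant := fun n c hc x hx => by
        filter_upwards [h.2.locallyConstant n c hc x hx] with x' h'
        rw [Corners.signed, Corners.signed, h']
      transition := fun n c hc d hd x hxc hxd => by
        have h1 : Corners.signed s o n c x * Corners.signed s o n d x = o n c x * o n d x := by
          rw [Corners.signed, Corners.signed, mul_mul_mul_comm, Int.units_mul_self, one_mul]
        rw [h1]
        exact h.2.transition n c hc d hd x hxc hxd }

end

section
variable {A : CSpace.{u}} {B : CSpace.{v}} {oA : SignData A} {oB : SignData B}

/-- `f` is a local diffeomorphism at `a` which preserves orientations. -/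
def PosAt (oA : SignData A) (oB : SignData B) (f : A → B) (a : A) : Prop :=
  ∃ n, ∃ c ∈ A.charts n, ∃ d ∈ B.charts n, (∃ G, Rep f c d a G) ∧
    Sg (oA n c a * oB n d (f a)) (𝒟 f c d a).det

lemma PosAt.sg (hA : IsOrientedManifold A oA) (hB : IsOrientedManifold B oB) {f : A → B} {a : A}
    (h : PosAt oA oB f a) {n : ℕ} {c : 𝒞 n A} (hc : c ∈ A.charts n)
    {d : 𝒞 n B} (hd : d ∈ B.charts n) (hac : a ∈ c.target) (hfa : f a ∈ d.target) :
    Sg (oA n c a * oB n d (f a)) (𝒟 f c d a).det := by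
  obtain ⟨n', c', hc', d', hd', ⟨G, hG⟩, hs⟩ := h
  obtain rfl := hA.1.dim_unique hc hc'
  obtain ⟨H, hH⟩ := (hA.1.compatible n c hc c' hc').rep hac hG.mem
  obtain ⟨K, hK⟩ := (hB.1.compatible n d' hd' d hd).rep hG.mem' hfa
  have h1 := Rep.comp hK hG
  have h3 : 𝒟 f c d a = _ := Rep.chartDeriv_comp h1 hH
  rw [h3, clmDet_comp]
  change Sg _ ((𝒟 (id ∘ f) c' d a).det * _)
  rw [Rep.chartDeriv_comp hK hG, clmDet_comp]
  convert! (((hB.2.sg hd' hd hG.mem' hfa).mul hs).mul (hA.2.sg hc hc' hac hG.mem)) using 1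
  generalize oA n c a = a1
  generalize oA n c' a = a2
  generalize oB n d (f a) = a3
  generalize oB n d' (f a) = a4
  rcases Int.units_eq_one_or a2 with rfl | rfl <;> rcases Int.units_eq_one_or a4 with rfl | rfl <;>
    simp [mul_comm]

lemma isOrientedDiffeo_of_posAt (hA : IsOrientedManifold A oA) (hB : IsOrientedManifold B oB)
    {Φ : A → B} {Ψ : B → A} (hΦ : Smooth A B Φ) (hΨ : Smooth B A Ψ) (h1 : LeftInverse Ψ Φ)
    (h2 : RightInverse Ψ Φ) (h : ∀ b, PosAt oB oA Ψ b) : IsOrientedDiffeo A B oA oB Φ where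
  source := hA
  target := hB
  smooth := hΦ
  smooth_inverse := ⟨Ψ, hΨ, h1, h2⟩
  orientation n c hc d hd a hac had := by
    obtain ⟨G, hG⟩ := (hA.1.smC_of_smooth hB.1 hΦ hc hd hac had).rep
    have hac' : Ψ (Φ a) ∈ c.target := by rwa [h1]
    have h3 := (h (Φ a)).sg hB hA hd hc had hac'
    obtain ⟨H, hH⟩ := (hB.1.smC_of_smooth hA.1 hΨ hd hc had hac').rep
    have h4 := hH.chartDeriv_comp hG
    rw [h1.comp_eq_id, chartDeriv_id c hac] at h4
    rw [h1, mul_comm] at h3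
    exact h3.inv (by rw [← clmDet_comp, ← h4]; exact det_id)

lemma isOrientedDiffeo_of_posAt' (hA : IsOrientedManifold A oA) (hB : IsOrientedManifold B oB)
    {Φ : A → B} {Ψ : B → A} (hΦ : Smooth A B Φ) (hΨ : Smooth B A Ψ) (h1 : LeftInverse Ψ Φ)
    (h2 : RightInverse Ψ Φ) (h : ∀ a, PosAt oA oB Φ a) :
    IsOrientedDiffeo A B oA oB Φ where
  source := hA
  target := hB
  smooth := hΦ
  smooth_inverse := ⟨Ψ, hΨ, h1, h2⟩
  orientation _ _ hc _ hd a hac had := (h a).sg hA hB hc hd hac had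

end

/-! ### The orientation of an open subset -/

section
variable {X : CSpace.{u}} {S : Set X} {o : SignData X}

lemma restrictOr_eq (hX : X.IsManifold) (ho : IsOrientation X o) (hS : IsOpen S) {n : ℕ}
    {d : 𝒞 n (X.restrict S)} (hd : d ∈ (X.restrict S).charts n) {x : S}
    (hx : x ∈ d.target) : restrictOr o S n d x = o n (d.push hS.isOpenEmbedding_subtypeVal) x := by
  have hd' := (hX.mem_restrict_charts hS).1 hd
  have key : ∀ c ∈ X.charts n, c.source = d.source → (∀ a ∈ d.source, c.toFun a = (d.toFun a : X)) →
      o n c x.1 = o n (d.push hS.isOpenEmbedding_subtypeVal) x := by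
    intro c hc h1 h2
    have hxc : x.1 ∈ c.target := by
      rw [← d.toInv hx, ← h2 _ (d.mapT hx)]
      exact c.mapS (h1 ▸ d.mapT hx)
    have hL := liftAt_push d hS.isOpenEmbedding_subtypeVal hx
    have h3 : Rep (id : X → X) c (d.push hS.isOpenEmbedding_subtypeVal) x.1 id := by
      refine rep_of_invFun_eq hxc hL.mem' ?_
      refine hL.eventually_iff.2 ?_
      filter_upwards [d.eventually_target hx] with y hy
      rw [CornerChart.push_invFun]
      refine (c.left_inv' (h1 ▸ d.mapT hy)).symm.trans ?_
      rw [h2 _ (d.mapT hy), d.toInv hy]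
    have h4 := ho.sg hc hd' hxc hL.mem'
    rw [h3.chartDeriv_eq, fderiv_id] at h4
    have h5 : (ContinuousLinearMap.id ℝ ℝ^n).det = 1 := det_id
    rw [h5] at h4
    rw [← mul_one (o n c x.1), ← Int.units_mul_self (o n (d.push _) x.1), ← mul_assoc, h4.unique
        (sg_one.2 one_pos), one_mul]
  unfold restrictOr
  split_ifs with hP
  · obtain ⟨c, hc, h1, h2, h3⟩ := hP
    rw [← key c hc h1 h2, h3]
  · rcases Int.units_eq_one_or (o n (d.push hS.isOpenEmbedding_subtypeVal) x) with h | h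
    · exact (hP ⟨_, hd', rfl, fun a ha => rfl, h⟩).elim
    · exact h.symm

lemma IsOrientedManifold.restrict (h : IsOrientedManifold X o) (hS : IsClopen S) :
    IsOrientedManifold (X.restrict S) (restrictOr o S) where
  isManifold := h.1.restrict hS
  isOrientation :=
    { locallyConstant := fun n d hd x hx => by
        have hd' := (h.1.mem_restrict_charts hS.2).1 hd
        have hL := liftAt_push d hS.2.isOpenEmbedding_subtypeVal hx
        filter_upwards [hL.eventually_iff.1 (h.2.locallyConstant n _ hd' _ hL.mem'),
          d.eventually_target hx] with x' h1 h2
        rw [restrictOr_eq h.1 h.2 hS.2 hd h2,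
          restrictOr_eq h.1 h.2 hS.2 hd hx]
        exact h1
      transition := fun n c hc d hd x hxc hxd => by
        have hc' := (h.1.mem_restrict_charts hS.2).1 hc
        have hd' := (h.1.mem_restrict_charts hS.2).1 hd
        have hL := liftAt_push c hS.2.isOpenEmbedding_subtypeVal hxc
        have hL' := liftAt_push d hS.2.isOpenEmbedding_subtypeVal hxd
        rw [restrictOr_eq h.1 h.2 hS.2 hc hxc,
          restrictOr_eq h.1 h.2 hS.2 hd hxd]
        have h1 := h.2.sg hc' hd' hL.mem' hL'.mem'
        obtain ⟨G, hG⟩ := (h.1.compatible n _ hc' _ hd').rep hL.mem' hL'.mem'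
        rw [hL.chartDeriv_eq hG] at h1
        have h2 := hL.rep_iff.1 hG
        have h3 : Rep (id : X.restrict S → X.restrict S) c d x G := hL'.rep_iff'.2 h2
        have h4 := hL'.chartDeriv_eq' (f := (id : X.restrict S → X.restrict S)) h3
        change Sg _ (𝒟 (fun y : X.restrict S => (y : X)) c _ x).det at h1
        rw [← h4]
        exact h1 }

end

/-! ### The orientation of the boundary -/

lemma units_eq_of_mul {a b : ℤˣ} (h : a * b = 1) : a = b := by
  rw [← mul_one a, ← Int.units_mul_self b, ← mul_assoc, h, one_mul]

lemma det_vecCons {n : ℕ} (i : Fin (n + 1)) (ν : ℝ^(n + 1))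
    (T : ℝ^n →ₗ[ℝ] ℝ^n) :
    (Matrix.of (Matrix.vecCons ν fun j => insL i (T (Pi.single j 1)))).det =
      (-1) ^ (i : ℕ) * ν i * det T := by
  rw [Matrix.det_succ_column _ i, Finset.sum_eq_single 0]
  · rw [← det_toMatrix' T, ← Matrix.det_transpose (LinearMap.toMatrix' T)]
    congr 2
    · simp
    · ext k l
      rw [Matrix.submatrix_apply, Matrix.transpose_apply, LinearMap.toMatrix'_apply,
        Fin.zero_succAbove]
      exact insL_succAbove _ _ _
  · intro k _ hk
    obtain ⟨k, rfl⟩ := Fin.exists_succ_eq.2 hk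
    have : Matrix.of (Matrix.vecCons ν fun j => insL i (T (Pi.single j 1))) k.succ i = 0 :=
      insL_same i _
    rw [this]
    simp
  · simp

section
variable {X : CSpace.{u}} {o : SignData X}

variable {n : ℕ} {d : 𝒞 n X.boundary} {p : BoundaryPt X} {c : 𝒞 (n + 1) X}
    {i : Fin (n + 1)}

lemma boundaryOr_sg (h : IsOrientedManifold X o) (hd : d ∈ X.boundary.charts n) (hp : p ∈ d.target)
    (hc : c ∈ X.charts (n + 1)) (hi : IsFace c i p) {T : ℝ^n →ₗ[ℝ] ℝ^n}
    (hT : ∀ t, 𝒟 X.incl d c p t = insL i (T t)) (hT0 : det T ≠ 0) :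
    Sg (boundaryOr o n d p * (-(-1) ^ (i : ℕ) * o (n + 1) c p.pt)) (det T) := by
  have hX := h.1
  have key : Sg (boundaryOr o n d p)
      ((((-(-1) ^ (i : ℕ) * o (n + 1) c p.pt : ℤˣ) : ℤ) : ℝ) * det T) := by classical
    refine sg_ite (mul_ne_zero (sg_units _).ne_zero hT0) ⟨?_, fun hpos => ⟨c, hc, i, hi, -Pi.single
        i 1, by simp, ?_⟩⟩
    · rintro ⟨c', hc', i', hi', ν, hν, hdet⟩
      obtain ⟨G, hG⟩ := (hX.boundary.smC_of_smooth hX hX.smooth_incl hd hc hp hi.1).rep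
      obtain ⟨K, hK⟩ := (hX.compatible _ c hc c' hc').rep hi.1 hi'.1
      have h1 : 𝒟 X.incl d c' p = _ := Rep.chartDeriv_comp (f := X.incl) hK hG
      obtain ⟨μ, hμ, hrow⟩ := (hX.pullAt_of_isFace hc hc' hi hi').chartDeriv_eq
        (f := (id : X → X)) hK
      let T' := (remL i').toLinearMap ∘ₗ (𝒟 X.incl d c' p).1
      have h2 : ∀ t, 𝒟 X.incl d c' p t = insL i' (T' t) := by
        intro t
        refine (insL_remL ?_).symm
        rw [h1]
        change 𝒟 (id : X → X) c c' p.pt (𝒟 X.incl d c p t) i' = 0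
        rw [hrow, hT, insL_same, mul_zero]
      have h3 := det_insL_mul (D := (𝒟 (id : X → X) c c' p.pt).1)
        (a := i) (fun t => by rw [← h2, h1, ← hT]; rfl)
      have h5 : (𝒟 (id : X → X) c c' p.pt).1 (Pi.single i 1) i' = μ := by
        have := hrow (Pi.single i 1)
        rwa [Pi.single_eq_same, mul_one] at this
      rw [h5] at h3
      have h6 : (Matrix.of (Matrix.vecCons ν
          fun j => 𝒟 X.incl d c' p (Pi.single j 1))).det =
          (-1) ^ (i' : ℕ) * ν i' * det T' := by
        rw [← det_vecCons]
        simp only [h2]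
      rw [h6] at hdet
      have h7 : Sg (o (n + 1) c' p.pt) ((-1) ^ (i' : ℕ) * ν i' * det T') := hdet
      have h8 : Sg (o (n + 1) c' p.pt * ((-1) ^ (i' : ℕ) * -1)) (det T') := by
        rw [mul_comm _ (det T')] at h7
        refine h7.of_mul ((sg_neg_one_pow _).mul ?_)
        simpa [Sg] using hν
      have h9 : Sg ((-1) ^ ((i : ℕ) + i') * 1 * (o (n + 1) c' p.pt * ((-1) ^ (i' : ℕ) * -1)))
          ((-1) ^ ((i : ℕ) + i') * μ * det T') :=
        ((sg_neg_one_pow _).mul (sg_one.2 hμ)).mul h8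
      rw [← h3, mul_comm (det _)] at h9
      refine sg_one.1 ?_
      convert (sg_units _).mul (Sg.of_mul h9 (h.2.sg hc hc' hi.1 hi'.1)) using 1
      generalize o (n + 1) c p.pt = a1
      generalize o (n + 1) c' p.pt = a2
      rw [pow_add]
      rcases Int.units_eq_one_or a1 with rfl | rfl <;>
        rcases Int.units_eq_one_or a2 with rfl | rfl <;>
        rcases Nat.even_or_odd (i : ℕ) with h | h <;>
        rcases Nat.even_or_odd (i' : ℕ) with h' | h' <;>
        simp [h.neg_one_pow, h'.neg_one_pow]
    · have h6 : (Matrix.of (Matrix.vecCons (-Pi.single i 1)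
          fun j => 𝒟 X.incl d c p (Pi.single j 1))).det =
          (-1) ^ (i : ℕ) * (-Pi.single i 1 : ℝ^(n + 1)) i * det T := by
        rw [← det_vecCons]
        simp only [hT]
      rw [h6]
      simp only [Pi.neg_apply, Pi.single_eq_same]
      push_cast at hpos
      linarith
  rw [mul_comm] at key
  exact key.of_mul (sg_units _)

lemma boundaryOr_sg' (h : IsOrientedManifold X o) (hd : d ∈ X.boundary.charts n) (hp : p ∈ d.target)
    (hc : c ∈ X.charts (n + 1)) (hi : IsFace c i p) :
    Sg (boundaryOr o n d p * (-(-1) ^ (i : ℕ) * o (n + 1) c p.pt))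
      (𝒟 (id : X.boundary → X.boundary) d (h.1.faceChart hc i ⟨p, hi⟩) p).det := by
  have hX := h.1
  have hpf := hi
  have hcomp := hX.boundary.compatible n d hd _ (hX.faceChart_mem hc ⟨p, hi⟩)
  obtain ⟨G, hG⟩ := hcomp.rep hp hpf
  have h1 : 𝒟 X.incl d c p = _ :=
    Rep.chartDeriv_comp (f := (id : X.boundary → X.boundary)) (hX.rep_incl hc ⟨p, hi⟩ hi) hG
  refine boundaryOr_sg h hd hp hc hi (fun t => ?_) ?_
  · rw [h1]
    change 𝒟 BoundaryPt.pt _ c p _ = _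
    rw [hX.chartDeriv_incl hc ⟨p, hi⟩ hi]
  · exact right_ne_zero_of_mul (a := (𝒟 (id : X.boundary → X.boundary) _ d p).det)
      (by rw [hcomp.det_mul_det hp hpf]; exact one_ne_zero)

lemma IsOrientedManifold.boundary (h : IsOrientedManifold X o) :
    IsOrientedManifold X.boundary (boundaryOr o) where
  isManifold := h.1.boundary
  isOrientation := by
    have hX := h.1
    refine isOrientation_of_local hX.boundary fun p => ?_
    obtain ⟨n, c, hc, i, hi⟩ := hX.exists_faceChart p
    refine ⟨n, _, hX.faceChart_mem hc ⟨p, hi⟩, hi, -(-1) ^ (i : ℕ) * o (n + 1) c p.pt, ?_⟩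
    filter_upwards [(hX.isOpen_isFace hc i).mem_nhds hi, continuous_pt.continuousAt.eventually
      (h.2.locallyConstant _ c hc _ hi.1)] with p' hp' ho d hd hpd
    rw [← ho]
    exact boundaryOr_sg' h hd hpd hc hp'

/-- The orientation `oA` of an open part `A` of `∂X` is the boundary orientation. -/
def IsBoundaryOr {A : CSpace.{v}} (oX : SignData X) (oA : SignData A) (e : A → X.boundary) : Prop :=
  ∀ n, ∀ α ∈ A.charts n, ∀ c ∈ X.charts (n + 1), ∀ i a, IsFaceChart e α c i a →
    oA n α a = -(-1) ^ (i : ℕ) * oX (n + 1) c (e a).pt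

lemma isBoundaryOr_id (h : IsOrientedManifold X o) : IsBoundaryOr o (boundaryOr o) id := by
  intro n α hα c hc i a H
  have h1 := boundaryOr_sg h hα H.mem hc H.face (T := LinearMap.id) (fun t => by
    have := H.deriv
    exact DFunLike.congr_fun this t) (by simp)
  rw [det_id] at h1
  exact units_eq_of_mul (h1.unique (sg_one.2 one_pos))

lemma isBoundaryOr_restrict (h : IsOrientedManifold X o) {S : Set X.boundary} (hS : IsClopen S) :
    IsBoundaryOr o (restrictOr (boundaryOr o) S) Subtype.val := by
  intro n α hα c hc i a H
  have hX := h.1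
  rw [restrictOr_eq hX.boundary h.boundary.2 hS.2 hα H.mem]
  have hα' := (hX.boundary.mem_restrict_charts hS.2).1 hα
  have hL := liftAt_push α hS.2.isOpenEmbedding_subtypeVal H.mem
  obtain ⟨G, hG⟩ := (hX.boundary.smC_of_smooth hX hX.smooth_incl hα' hc hL.mem' H.face.1).rep
  have h1 := boundaryOr_sg h hα' hL.mem' hc H.face (T := LinearMap.id) (fun t => by
    rw [hL.chartDeriv_eq hG]
    exact DFunLike.congr_fun H.deriv t) (by simp)
  rw [det_id] at h1
  exact units_eq_of_mul (h1.unique (sg_one.2 one_pos))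

end

/-! ### The orientation of a disjoint union -/

section
variable {A : CSpace.{u}} {B : CSpace.{v}} {oA : SignData A} {oB : SignData B}

variable {Q : CSpace.{w}} {e : A → Q} {n : ℕ} {c : 𝒞 n A} {d : 𝒞 n Q} {a : A}
    {oQ : SignData Q}

lemma Etale.rep_push (he : Etale A Q e) (hQ : Q.IsManifold) (hc : c ∈ A.charts n)
    (hd : d ∈ Q.charts n) (hac : a ∈ c.target) (had : e a ∈ d.target) : (∃ G, Rep e c d a G) ∧
      𝒟 (id : Q → Q) (c.push he.emb) d (e a) = 𝒟 e c d a := by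
  have hL := liftAt_push c he.emb hac
  obtain ⟨G, hG⟩ := (hQ.compatible _ _ (he.charts n c hc) _ hd).rep hL.mem' had
  exact ⟨⟨G, hL.rep_iff.1 hG⟩, hL.chartDeriv_eq hG⟩

lemma Etale.sg_change (he : Etale A Q e) (hA : IsOrientedManifold A oA) (hQ : Q.IsManifold)
    {c' : 𝒞 n A} (hc : c ∈ A.charts n) (hc' : c' ∈ A.charts n) (hd : d ∈ Q.charts n)
    (hac : a ∈ c.target) (hac' : a ∈ c'.target) (had : e a ∈ d.target)
    (h : Sg (oA n c a) (𝒟 e c d a).det) : Sg (oA n c' a) (𝒟 e c' d a).det := by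
  obtain ⟨⟨G, hG⟩, -⟩ := he.rep_push hQ hc hd hac had
  obtain ⟨H, hH⟩ := (hA.1.compatible n c' hc' c hc).rep hac' hac
  have h1 : 𝒟 e c' d a = _ := Rep.chartDeriv_comp hG hH
  rw [h1, clmDet_comp]
  convert! h.mul (hA.2.sg hc' hc hac' hac) using 1
  rw [mul_comm (oA n c' a), ← mul_assoc, Int.units_mul_self, one_mul]

lemma Etale.det_ne_zero (he : Etale A Q e) (hQ : Q.IsManifold) (hc : c ∈ A.charts n)
    (hd : d ∈ Q.charts n) (hac : a ∈ c.target) (had : e a ∈ d.target)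
    : (𝒟 e c d a).det ≠ 0 := by
  obtain ⟨-, h⟩ := he.rep_push hQ hc hd hac had
  rw [← h]
  exact right_ne_zero_of_mul (a := (𝒟 (id : Q → Q) d (c.push he.emb) (e a)).det)
    (by rw [(hQ.compatible _ _ (he.charts n c hc) _ hd).det_mul_det (liftAt_push c he.emb hac).mem'
        had]; exact one_ne_zero)

lemma sumOr_inl (hA : IsOrientedManifold A oA) (hB : IsOrientedManifold B oB) (hd : A.dim = B.dim)
    {d : 𝒞 n (A ⊕ B)} (hdc : d ∈ (A.sum B).charts n) (had : Sum.inl a ∈ d.target)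
    (hc : c ∈ A.charts n) (hac : a ∈ c.target) :
    Sg (oA n c a * sumOr oA oB n d (Sum.inl a)) (𝒟 (Sum.inl : A → A ⊕ B) c d a).det := by
  obtain ⟨hS, hl, hr⟩ := sum_isManifold hA.1 hB.1 hd
  have key : Sg (sumOr oA oB n d (Sum.inl a))
      (((oA n c a : ℤ) : ℝ) * (𝒟 (Sum.inl : A → A ⊕ B) c d a).det) := by classical
    refine sg_ite (mul_ne_zero (sg_units _).ne_zero (hl.det_ne_zero hS hc hdc hac had))
      ⟨?_, fun h => Or.inl ⟨a, rfl, c, hc, hac, h⟩⟩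
    rintro (⟨a', h1, c', hc', hac', h2⟩ | ⟨b, h1, -⟩)
    · obtain rfl := Sum.inl_injective h1
      exact hl.sg_change hA hS hc' hc hdc hac' hac had h2
    · exact (Sum.inl_ne_inr h1).elim
  rw [mul_comm] at key ⊢
  exact key.of_mul (sg_units _)

lemma sumOr_inr (hA : IsOrientedManifold A oA) (hB : IsOrientedManifold B oB) (hd : A.dim = B.dim)
    {d : 𝒞 n (A ⊕ B)} (hdc : d ∈ (A.sum B).charts n) {b : B} (hbd : Sum.inr b ∈ d.target)
    {c : 𝒞 n B} (hc : c ∈ B.charts n) (hbc : b ∈ c.target) :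
    Sg (oB n c b * sumOr oA oB n d (Sum.inr b)) (𝒟 (Sum.inr : B → A ⊕ B) c d b).det := by
  obtain ⟨hS, hl, hr⟩ := sum_isManifold hA.1 hB.1 hd
  have key : Sg (sumOr oA oB n d (Sum.inr b))
      (((oB n c b : ℤ) : ℝ) * (𝒟 (Sum.inr : B → A ⊕ B) c d b).det) := by classical
    refine sg_ite (mul_ne_zero (sg_units _).ne_zero (hr.det_ne_zero hS hc hdc hbc hbd))
      ⟨?_, fun h => Or.inr ⟨b, rfl, c, hc, hbc, h⟩⟩
    rintro (⟨a, h1, -⟩ | ⟨b', h1, c', hc', hbc', h2⟩)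
    · exact (Sum.inr_ne_inl h1).elim
    · obtain rfl := Sum.inr_injective h1
      exact hr.sg_change hB hS hc' hc hdc hbc' hbc hbd h2
  rw [mul_comm] at key ⊢
  exact key.of_mul (sg_units _)

/-- If an étale map carries one orientation to given sign data, these are an orientation on its
image. -/
lemma Etale.eventually_sg (he : Etale A Q e) (hA : IsOrientedManifold A oA) (hQ : Q.IsManifold) (h :
      ∀ n, ∀ d ∈ Q.charts n, ∀ a, e a ∈ d.target → ∀ c ∈ A.charts n, a ∈ c.target → Sg (oA n c a *
      oQ n d (e a)) (𝒟 e c d a).det) (a : A) :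
    ∃ n, ∃ c ∈ Q.charts n, e a ∈ c.target ∧ ∃ ε : ℤˣ, ∀ᶠ x' in 𝓝 (e a), ∀ d ∈ Q.charts n,
      x' ∈ d.target → Sg (oQ n d x' * ε) (𝒟 (id : Q → Q) d c x').det := by
  obtain ⟨n, c, hc, hac⟩ := hA.1.cover a
  have hL := liftAt_push c he.emb hac
  refine ⟨n, _, he.charts n c hc, hL.mem', oA n c a, ?_⟩
  refine hL.eventually_iff.2 ?_
  filter_upwards [hA.2.locallyConstant n c hc a hac, c.eventually_target hac]
    with a' h1 h2 d hd had
  rw [← h1, mul_comm]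
  refine (h n d hd a' had c hc h2).inv ?_
  rw [← ((he.rep_push hQ hc hd h2 had).2), mul_comm]
  exact (hQ.compatible _ _ (he.charts n c hc) _ hd).det_mul_det (liftAt_push c he.emb h2).mem' had

lemma IsOrientedManifold.sum (hA : IsOrientedManifold A oA) (hB : IsOrientedManifold B oB)
    (hd : A.dim = B.dim) : IsOrientedManifold (A.sum B) (sumOr oA oB) := by
  obtain ⟨hS, hl, hr⟩ := sum_isManifold hA.1 hB.1 hd
  refine ⟨hS, isOrientation_of_local hS ?_⟩
  rintro (a | b)
  · exact hl.eventually_sg hA hS (fun n d hdc a had c hc hac =>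
      sumOr_inl hA hB hd hdc had hc hac) a
  · exact hr.eventually_sg hB hS (fun n d hdc b hbd c hc hbc =>
      sumOr_inr hA hB hd hdc hbd hc hbc) b

/-- Orientation preservation can be tested after a local diffeomorphism into the source. -/
lemma Etale.posAt (he : Etale A Q e) (hQ : Q.IsManifold) (h : ∀ n, ∀ d ∈ Q.charts n, ∀ a, e a ∈
      d.target → ∀ c ∈ A.charts n, a ∈ c.target → Sg (oA n c a * oQ n d (e a)) (𝒟 e c d
      a).det) {F : Q → B} (hB : B.IsManifold) (hF : Smooth Q B F) (hP : PosAt oA oB (F ∘ e) a)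
    : PosAt oQ oB F (e a) := by
  obtain ⟨n, c, hc, b, hb, ⟨G, hG⟩, hs⟩ := hP
  have hL := liftAt_push c he.emb hG.mem
  have hc' := he.charts n c hc
  obtain ⟨H, hH⟩ := (hQ.smC_of_smooth hB hF hc' hb hL.mem' hG.mem').rep
  refine ⟨n, _, hc', b, hb, ⟨H, hH⟩, ?_⟩
  rw [hL.chartDeriv_eq hH]
  have h1 := h n _ hc' a hL.mem' c hc hG.mem
  rw [hL.rep.chartDeriv_eq, fderiv_id] at h1
  have h2 := h1.unique (sg_one.2 (show 0 < (ContinuousLinearMap.id ℝ ℝ^n).det from by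
    rw [show (ContinuousLinearMap.id ℝ ℝ^n).det = 1 from det_id]; exact one_pos))
  rw [(units_eq_of_mul h2).symm]
  exact hs

lemma posAt_sum (hA : IsOrientedManifold A oA) (hB : IsOrientedManifold B oB) (hd : A.dim = B.dim)
    (hQ : Q.IsManifold) {F : A ⊕ B → Q} (hF : Smooth (A.sum B) Q F)
    (h1 : ∀ a, PosAt oA oQ (fun a => F (Sum.inl a)) a)
    (h2 : ∀ b, PosAt oB oQ (fun b => F (Sum.inr b)) b) (x : A ⊕ B) :
    PosAt (A := A.sum B) (sumOr oA oB) oQ F x := by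
  obtain ⟨hS, hl, hr⟩ := sum_isManifold hA.1 hB.1 hd
  obtain a | b := x
  · exact hl.posAt hS (fun n d hdc a had c hc hac =>
      sumOr_inl hA hB hd hdc had hc hac) hQ hF (h1 a)
  · exact hr.posAt hS (fun n d hdc b hbd c hc hbc =>
      sumOr_inr hA hB hd hdc hbd hc hbc) hQ hF (h2 b)

end

/-! ### The orientation of a fibre product -/

lemma det_append {n r m l : ℕ} (h : m + l = n + r) (U : ℝ^n →ₗ[ℝ] ℝ^m)
    (U' : ℝ^n →ₗ[ℝ] ℝ^l) (s : ℝ^r →ₗ[ℝ] ℝ^m × ℝ^l) :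
    (Matrix.of fun i : Fin (m + l) => Fin.append
      (fun j : Fin n => Fin.append (U (Pi.single j 1)) (U' (Pi.single j 1)))
      (fun j : Fin r => Fin.append (s (Pi.single j 1)).1 (s (Pi.single j 1)).2)
      (Fin.cast h i)).det = fdet h.symm ((U.prod U').coprod s) := by
  rw [fdet_eq _ _ h rfl, ← det_toMatrix', ← Matrix.det_transpose]
  congr 1
  ext i j
  rw [Matrix.transpose_apply, Matrix.of_apply, LinearMap.toMatrix'_apply]
  obtain ⟨j, rfl⟩ := (finCongr h).symm.surjective j
  simp only [finCongr_symm, finCongr_apply, Fin.cast_cast, Fin.cast_eq_self, LinearMap.comp_apply]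
  have key : ∀ v : ℝ^n × ℝ^r, appE h v = Pi.single (Fin.cast h.symm j) 1 →
      (appE h).symm.toLinearMap (Pi.single (Fin.cast h.symm j) 1) = v := fun v hv => by
    rw [← hv]; exact (appE h).symm_apply_apply v
  induction j using Fin.addCases with
  | left j =>
    rw [key (Pi.single j 1, 0)]
    · rw [Fin.append_left, LinearMap.coprod_apply, map_zero, add_zero]
      rfl
    · refine appE_ext h (fun k => ?_) fun k => ?_
      · by_cases hk : k = j
        · subst hk; simp
        · rw [Pi.single_eq_of_ne (by simpa [Fin.ext_iff] using hk)]
          exact Pi.single_eq_of_ne hk _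
      · rw [Pi.single_eq_of_ne]
        · rfl
        · intro h1
          have := j.2
          simp [Fin.ext_iff] at h1
          omega
  | right j =>
    rw [key (0, Pi.single j 1)]
    · rw [Fin.append_right, LinearMap.coprod_apply, map_zero, zero_add]
      rfl
    · refine appE_ext h (fun k => ?_) fun k => ?_
      · rw [Pi.single_eq_of_ne]
        · rfl
        · intro h1
          have := k.2
          simp [Fin.ext_iff] at h1
          omega
      · by_cases hk : k = j
        · subst hk; simp
        · rw [Pi.single_eq_of_ne (by simpa [Fin.ext_iff] using hk)]
          exact Pi.single_eq_of_ne hk _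

lemma continuousAt_det {ι : Type*} [TopologicalSpace ι] {N : ℕ}
    {F : ι → ℝ^N →ₗ[ℝ] ℝ^N} {x : ι} (h : ∀ v, ContinuousAt (fun y => F y v) x) :
    ContinuousAt (fun y => det (F y)) x := by
  simp only [← det_toMatrix']
  refine ContinuousAt.comp
      continuous_id.matrix_det.continuousAt ?_
  refine continuousAt_pi.2 fun i => continuousAt_pi.2 fun j => ?_
  exact continuousAt_pi.1 (h _) i

/-- The map `df - dg` in charts. -/
def diffH {A : Type*} {B : Type*} {C : Type*} [TopologicalSpace A] [TopologicalSpace B]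
    [TopologicalSpace C] {m l r : ℕ} (f : A → C) (g : B → C) (c : 𝒞 m A)
    (d : 𝒞 l B) (e : 𝒞 r C) (x : A) (y : B) :
    ℝ^m × ℝ^l →ₗ[ℝ] ℝ^r :=
  (𝒟 f c e x).1.coprod (-(𝒟 g d e y).1)

lemma diffH_apply {A : Type*} {B : Type*} {C : Type*} [TopologicalSpace A] [TopologicalSpace B]
    [TopologicalSpace C] {m l r : ℕ} (f : A → C) (g : B → C) (c : 𝒞 m A)
    (d : 𝒞 l B) (e : 𝒞 r C) (x : A) (y : B) (v : ℝ^m × ℝ^l) :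
    diffH f g c d e x y v = 𝒟 f c e x v.1 - 𝒟 g d e y v.2 :=
  (sub_eq_add_neg _ _).symm

section
variable {A : Type u} {B : Type v} {C : Type w} [TopologicalSpace A] [TopologicalSpace B]
  [TopologicalSpace C] {n m l r : ℕ} {f : A → C} {g : B → C}

/-- `splitDet` for the fibre product in charts. -/
def fibreDet (f : A → C) (g : B → C) (φ : 𝒞 n {p : A × B // f p.1 = g p.2})
    (c : 𝒞 m A) (d : 𝒞 l B) (e : 𝒞 r C)
    (q : {p : A × B // f p.1 = g p.2}) (h : n + r = m + l)
    (s : ℝ^r →ₗ[ℝ] ℝ^m × ℝ^l) : ℝ :=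
  splitDet h (𝒟 (·.1.1) φ c q).1
    (𝒟 (·.1.2) φ d q).1
    (diffH f g c d e q.1.1 q.1.2) s

variable {φ : 𝒞 n {p : A × B // f p.1 = g p.2}} {c : 𝒞 m A}
  {d : 𝒞 l B} {e : 𝒞 r C} {q : {p : A × B // f p.1 = g p.2}}

variable {hd : n + r = m + l} {s : ℝ^r →ₗ[ℝ] ℝ^m × ℝ^l}

lemma FibreCharts.diffH_comp (h : FibreCharts f g φ c d e q) (t : ℝ^n) :
    diffH f g c d e q.1.1 q.1.2
      ((𝒟 (·.1.1) φ c q).1 t,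
        (𝒟 (·.1.2) φ d q).1 t) = 0 := by
  rw [diffH_apply]
  exact sub_eq_zero.2 (h.comm t)

lemma FibreCharts.fibreDet_ne_zero (h : FibreCharts f g φ c d e q)
    (hs : det (diffH f g c d e q.1.1 q.1.2 ∘ₗ s) ≠ 0) :
    fibreDet f g φ c d e q hd s ≠ 0 :=
  splitDet_ne_zero hd h.initAt.inj h.diffH_comp hs

lemma FibreCharts.fibreDet_mul_pos (h : FibreCharts f g φ c d e q) {s' : ℝ^r →ₗ[ℝ] ℝ^m × ℝ^l}
    (hs : det (diffH f g c d e q.1.1 q.1.2 ∘ₗ s) ≠ 0)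
    (hs' : det (diffH f g c d e q.1.1 q.1.2 ∘ₗ s') ≠ 0) :
    0 < fibreDet f g φ c d e q hd s * fibreDet f g φ c d e q hd s' :=
  splitDet_mul_pos hd h.initAt.inj h.diffH_comp hs hs'

lemma FibreCharts.exists_splitting (h : FibreCharts f g φ c d e q) :
    ∃ s : ℝ^r →ₗ[ℝ] ℝ^m × ℝ^l,
      diffH f g c d e q.1.1 q.1.2 ∘ₗ s = LinearMap.id :=
  LinearMap.exists_rightInverse_of_surjective _ (LinearMap.range_eq_top.2 fun w => by
    obtain ⟨s, t, hst⟩ := h.surjective w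
    exact ⟨(s, t), (diffH_apply _ _ _ _ _ _ _ _).trans hst⟩)

/-- The effect of a change of charts. -/
lemma FibreCharts.fibreDet_change (h : FibreCharts f g φ c d e q)
    {φ' : 𝒞 n {p : A × B // f p.1 = g p.2}} {c' : 𝒞 m A}
    {d' : 𝒞 l B} {e' : 𝒞 r C} (h' : FibreCharts f g φ' c' d' e' q)
    (hφ : Compatible φ φ') (hc : Compatible c c') (hd : Compatible d d') (he : Compatible e e')
    {hdim : n + r = m + l} (s : ℝ^r →ₗ[ℝ] ℝ^m × ℝ^l) :
    ∃ s', fibreDet f g φ' c' d' e' q hdim s' *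
        (𝒟 (id : {p : A × B // f p.1 = g p.2} → _) φ φ' q).det =
      fibreDet f g φ c d e q hdim s * ((𝒟 (id : A → A) c c' q.1.1).det *
        (𝒟 (id : B → B) d d' q.1.2).det *
          (𝒟 (id : C → C) e e' (f q.1.1)).det) ∧
      det (diffH f g c' d' e' q.1.1 q.1.2 ∘ₗ s') =
        (𝒟 (id : C → C) e e' (f q.1.1)).det *
          det (diffH f g c d e q.1.1 q.1.2 ∘ₗ s) := by
  obtain ⟨G, hG⟩ := h.initAt.smC.rep
  obtain ⟨G2, hG2⟩ := h.initAt.smC'.rep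
  obtain ⟨G', hG'⟩ := h'.initAt.smC.rep
  obtain ⟨G2', hG2'⟩ := h'.initAt.smC'.rep
  obtain ⟨F, hF⟩ := h.left.rep
  obtain ⟨F2, hF2⟩ := h.right.rep
  obtain ⟨F', hF'⟩ := h'.left.rep
  obtain ⟨F2', hF2'⟩ := h'.right.rep
  obtain ⟨K, hK⟩ := hφ.rep hG.mem hG'.mem
  obtain ⟨K1, hK1⟩ := hc.rep hG.mem' hG'.mem'
  obtain ⟨K2, hK2⟩ := hd.rep hG2.mem' hG2'.mem'
  obtain ⟨K3, hK3⟩ := he.rep hF.mem' hF'.mem'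
  have e1 : ∀ t, 𝒟 (·.1.1) φ' c' q
      (𝒟 (id : {p : A × B // f p.1 = g p.2} → _) φ φ' q t) =
      𝒟 (id : A → A) c c' q.1.1
        (𝒟 (·.1.1) φ c q t) := fun t => by
    have h2 := Rep.chartDeriv_comp (f := fun q : {p : A × B // f p.1 = g p.2} => q.1.1) hK1 hG
    exact DFunLike.congr_fun ((Rep.chartDeriv_comp hG' hK).symm.trans h2) t
  have e2 : ∀ t, 𝒟 (·.1.2) φ' d' q
      (𝒟 (id : {p : A × B // f p.1 = g p.2} → _) φ φ' q t) =
      𝒟 (id : B → B) d d' q.1.2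
        (𝒟 (·.1.2) φ d q t) := fun t => by
    have h2 := Rep.chartDeriv_comp (f := fun q : {p : A × B // f p.1 = g p.2} => q.1.2) hK2 hG2
    exact DFunLike.congr_fun ((Rep.chartDeriv_comp hG2' hK).symm.trans h2) t
  have e3 : ∀ t, 𝒟 f c' e' q.1.1 (𝒟 (id : A → A) c c' q.1.1 t) =
      𝒟 (id : C → C) e e' (f q.1.1) (𝒟 f c e q.1.1 t) := fun t => by
    have h1 := Rep.chartDeriv_comp (f := (id : A → A)) hF' hK1
    have h2 := Rep.chartDeriv_comp hK3 hF
    exact DFunLike.congr_fun (h1.symm.trans h2) t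
  have e4 : ∀ t, 𝒟 g d' e' q.1.2 (𝒟 (id : B → B) d d' q.1.2 t) =
      𝒟 (id : C → C) e e' (f q.1.1) (𝒟 g d e q.1.2 t) := fun t => by
    have h1 := Rep.chartDeriv_comp (f := (id : B → B)) hF2' hK2
    have h2 := Rep.chartDeriv_comp (q.2 ▸ hK3) hF2
    rw [q.2]
    exact DFunLike.congr_fun (h1.symm.trans h2) t
  have e5 : ∀ v : ℝ^m × ℝ^l, diffH f g c' d' e' q.1.1 q.1.2
      (𝒟 (id : A → A) c c' q.1.1 v.1, 𝒟 (id : B → B) d d' q.1.2 v.2) =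
      𝒟 (id : C → C) e e' (f q.1.1) (diffH f g c d e q.1.1 q.1.2 v) := fun v => by
    rw [diffH_apply, diffH_apply, e3, e4, map_sub]
  refine ⟨(𝒟 (id : A → A) c c' q.1.1).1.prodMap
    (𝒟 (id : B → B) d d' q.1.2).1 ∘ₗ s, splitDet_change hdim
    (P := (𝒟 (id : {p : A × B // f p.1 = g p.2} → _) φ φ' q).1)
    (C := (𝒟 (id : C → C) e e' (f q.1.1)).1) e1 e2 e5, ?_⟩
  rw [← det_comp]
  congr 1
  exact LinearMap.ext fun w => e5 (s w)

end

section
variable {X : CSpace.{u}} {Y : CSpace.{v}} {Z : CSpace.{w}} {f : X → Z} {g : Y → Z}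
  {oX : SignData X} {oY : SignData Y} {oZ : SignData Z}

/-- The sign which compares `fibreOr` with `fibreDet`. -/
def fibreSign (oX : SignData X) (oY : SignData Y) (oZ : SignData Z) {m l r : ℕ}
    (c : 𝒞 m X) (d : 𝒞 l Y) (e : 𝒞 r Z) (x : X) (y : Y) (z : Z) :
    ℤˣ :=
  Int.negOnePow (Y.dim * Z.dim) * oX m c x * oY l d y * oZ r e z

lemma FibreData.fibreOr_sg (h : FibreData X Y Z f g) (hX : IsOrientation X oX)
    (hY : IsOrientation Y oY) (hZ : IsOrientation Z oZ) {n m l r : ℕ} {q : X.fibre Y Z f g}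
    {φ : 𝒞 n (X.fibre Y Z f g)}
    (hφ : φ ∈ (X.fibre Y Z f g).charts n) {c : 𝒞 m X} (hc : c ∈ X.charts m)
    {d : 𝒞 l Y} (hd : d ∈ Y.charts l) {e : 𝒞 r Z} (he : e ∈ Z.charts r)
    (H : FibreCharts f g φ c d e q) (hdim : n + r = m + l)
    {s : ℝ^r →ₗ[ℝ] ℝ^m × ℝ^l}
    (hs : det (diffH f g c d e q.1.1 q.1.2 ∘ₗ s) ≠ 0) :
    Sg (fibreOr oX oY oZ f g n φ q * fibreSign oX oY oZ c d e q.1.1 q.1.2 (f q.1.1))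
      (fibreDet f g φ c d e q hdim s) := by
  have hne := H.fibreDet_ne_zero (hd := hdim) hs
  have hdet : ∀ s', diffH f g c d e q.1.1 q.1.2 ∘ₗ s' = LinearMap.id →
      0 < fibreDet f g φ c d e q hdim s * fibreDet f g φ c d e q hdim s' := fun s' hs' =>
    H.fibreDet_mul_pos hs (by rw [hs', det_id]; exact one_ne_zero)
  have key : Sg (fibreOr oX oY oZ f g n φ q)
      (((fibreSign oX oY oZ c d e q.1.1 q.1.2 (f q.1.1) : ℤ) : ℝ) *
        fibreDet f g φ c d e q hdim s) := by classical
    refine sg_ite (mul_ne_zero (sg_units _).ne_zero hne) ⟨?_, fun hpos => ?_⟩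
    · rintro ⟨m', c', hc', l', d', hd', r', e', he', h1, h2, h3, h4, s', hs', hpos⟩
      obtain rfl := h.hX.dim_unique hc hc'
      obtain rfl := h.hY.dim_unique hd hd'
      obtain rfl := h.hZ.dim_unique he he'
      have H' := h.fibreCharts hφ hc' hd' he' H.initAt.smC.mem h1 h2 h3
      obtain ⟨s2, e1, e2⟩ := H.fibreDet_change H' (h.hW.compatible n φ hφ φ hφ) (h.hX.compatible m c
          hc c' hc')
        (h.hY.compatible l d hd d' hd') (h.hZ.compatible r e he e' he') s
      rw [chartDeriv_id φ H.initAt.smC.mem] at e1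
      have h0 : (ContinuousLinearMap.id ℝ ℝ^n).det = 1 := det_id
      rw [h0, mul_one] at e1
      have hs'' : diffH f g c' d' e' q.1.1 q.1.2 ∘ₗ s' = LinearMap.id :=
        LinearMap.ext fun t => (diffH_apply _ _ _ _ _ _ _ _).trans (hs' t)
      have sZ := hZ.sg he he' H.left.mem' h3
      have hdet' : 0 < fibreDet f g φ c' d' e' q hdim s2 * fibreDet f g φ c' d' e' q hdim s' :=
        H'.fibreDet_mul_pos (by rw [e2]; exact mul_ne_zero sZ.ne_zero hs)
          (by rw [hs'', det_id]; exact one_ne_zero)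
      have h5 : fibreDet f g φ c' d' e' q hdim s' = fdet hdim
          (((𝒟 (·.1.1) φ c' q).1.prod
            (𝒟 (·.1.2) φ d' q).1).coprod s') := by rw [fibreDet, splitDet, hs'', det_id, one_mul]
      have h7 : Sg (fibreSign oX oY oZ c' d' e' q.1.1 q.1.2 (f q.1.1))
          (fibreDet f g φ c' d' e' q hdim s') := by
        rw [h5, ← (det_append h4 (𝒟 (·.1.1) φ c' q).1 (𝒟 (·.1.2) φ d' q).1 s')]
        exact hpos
      rw [e1, mul_assoc] at hdet'
      have h8 : Sg (fibreSign oX oY oZ c' d' e' q.1.1 q.1.2 (f q.1.1) *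
          (oX m c q.1.1 * oX m c' q.1.1 * (oY l d q.1.2 * oY l d' q.1.2) *
            (oZ r e (f q.1.1) * oZ r e' (f q.1.1)))) (fibreDet f g φ c d e q hdim s) := by
        obtain ⟨σ, hσ⟩ := exists_sg hne
        rw [units_eq_of_mul ((hσ.mul ((((hX.sg hc hc' H.initAt.smC.mem' h1).mul (hY.sg hd hd'
            H.initAt.smC'.mem' h2)).mul sZ).mul
            h7)).unique (sg_one.2 hdet')),
            mul_comm] at hσ
        exact hσ
      change Sg (fibreSign oX oY oZ c d e q.1.1 q.1.2 (f q.1.1)) _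
      convert! h8 using 1
      unfold fibreSign
      generalize oX m c q.1.1 = a1
      generalize oY l d q.1.2 = a2
      generalize oZ r e (f q.1.1) = a3
      rcases Int.units_eq_one_or (oX m c' q.1.1) with h | h <;>
        rcases Int.units_eq_one_or (oY l d' q.1.2) with h' | h' <;>
        rcases Int.units_eq_one_or (oZ r e' (f q.1.1)) with h'' | h'' <;>
        rw [h, h', h''] <;> simp [mul_assoc]
    · obtain ⟨s', hs'⟩ := H.exists_splitting
      refine ⟨m, c, hc, l, d, hd, r, e, he, H.initAt.smC.mem', H.initAt.smC'.mem', H.left.mem',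
        hdim.symm, s', fun t => ?_, ?_⟩
      · rw [← diffH_apply]
        exact DFunLike.congr_fun hs' t
      · have h5 : fibreDet f g φ c d e q hdim s' = fdet hdim
            (((𝒟 (·.1.1) φ c q).1.prod
              (𝒟 (·.1.2) φ d q).1).coprod s') := by rw [fibreDet, splitDet, hs', det_id, one_mul]
        have h7 : Sg (fibreSign oX oY oZ c d e q.1.1 q.1.2 (f q.1.1))
            (fibreDet f g φ c d e q hdim s') := by
          have h8 : Sg (fibreSign oX oY oZ c d e q.1.1 q.1.2 (f q.1.1))
            (fibreDet f g φ c d e q hdim s) := hpos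
          obtain ⟨σ, hσ⟩ := exists_sg (right_ne_zero_of_mul (hdet s' hs').ne')
          rw [units_eq_of_mul ((h8.mul hσ).unique (sg_one.2 (hdet s' hs')))]
          exact hσ
        rw [h5, ← (det_append hdim.symm (𝒟 (·.1.1) φ c q).1 (𝒟 (·.1.2) φ d q).1 s')] at h7
        exact h7
  rw [mul_comm] at key
  exact key.of_mul (sg_units _)

lemma FibreData.isOrientedManifold (h : FibreData X Y Z f g) (hX : IsOrientation X oX)
    (hY : IsOrientation Y oY) (hZ : IsOrientation Z oZ) :
    IsOrientedManifold (X.fibre Y Z f g) (fibreOr oX oY oZ f g) := by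
  refine ⟨h.hW, isOrientation_of_local h.hW fun q => ?_⟩
  obtain ⟨n, φ, hφ, m, c, hc, l, d, hd, r, e, he, H⟩ := h.exists_fibreCharts q
  have hqφ := H.initAt.smC.mem
  obtain ⟨s, hs⟩ := H.exists_splitting
  have hs0 : det (diffH f g c d e q.1.1 q.1.2 ∘ₗ s) ≠ 0 := by rw [hs, det_id]; exact one_ne_zero
  obtain ⟨σ, hσ⟩ := exists_sg (H.fibreDet_ne_zero hs0)
  have c1 := h.smooth_fst.continuous
  have c2 := h.smooth_snd.continuous
  have k4 := H.initAt.smC'.rep.choose_spec.continuousAt_chartDeriv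
    (.of_forall fun _ => c2.continuousAt)
  have k5 : ContinuousAt (fun q' => det (diffH f g c d e q'.1.1 q'.1.2 ∘ₗ s)) q := by
    refine continuousAt_det fun v => ?_
    exact ((ContinuousAt.comp (f := fun q : X.fibre Y Z f g => q.1.1)
        (H.left.rep.choose_spec.continuousAt_chartDeriv (.of_forall fun _ =>
        h.hf.1.continuous.continuousAt)) c1.continuousAt).clm_apply continuousAt_const).sub
        ((ContinuousAt.comp (f := fun q : X.fibre Y Z f g =>
        q.1.2) (H.right.rep.choose_spec.continuousAt_chartDeriv (.of_forall fun _ =>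
        h.hg.continuous.continuousAt)) c2.continuousAt).clm_apply continuousAt_const)
  have k6 : ContinuousAt (fun q' => fibreDet f g φ c d e q' H.dim s) q := by
    refine k5.mul (continuousAt_det fun v => ?_)
    refine ContinuousAt.comp (g := (appE H.dim).toLinearMap)
      (LinearMap.continuous_of_finiteDimensional _).continuousAt ?_
    exact (((H.initAt.smC.rep.choose_spec.continuousAt_chartDeriv (.of_forall fun _ =>
        c1.continuousAt)).clm_apply continuousAt_const).prodMk (k4.clm_apply
        continuousAt_const)).add
      continuousAt_const
  refine ⟨n, φ, hφ, hqφ, fibreSign oX oY oZ c d e q.1.1 q.1.2 (f q.1.1) * σ, ?_⟩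
  have hz := H.left.mem'
  have c3 : Continuous fun q : X.fibre Y Z f g => f q.1.1 := h.hf.1.continuous.comp c1
  filter_upwards [Tendsto.eventually_sg k6 hσ, φ.eventually_target hqφ,
    c1.continuousAt.eventually (c.eventually_target H.initAt.smC.mem'),
    c2.continuousAt.eventually (d.eventually_target H.initAt.smC'.mem'),
    c3.continuousAt.eventually (e.eventually_target hz),
    c1.continuousAt.eventually (hX.locallyConstant m c hc _ H.initAt.smC.mem'),
    c2.continuousAt.eventually (hY.locallyConstant l d hd _ H.initAt.smC'.mem'),
    c3.continuousAt.eventually (hZ.locallyConstant r e he _ hz),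
    k5.eventually_ne hs0] with q' hσ' h1 h2 h3 h4 h5 h6 h7 h8 φ' hφ' hq'
  have H' := h.fibreCharts hφ' hc hd he hq' h2 h3 h4
  have H2 := h.fibreCharts hφ hc hd he h1 h2 h3 h4
  have h9 := h.fibreOr_sg hX hY hZ hφ' hc hd he H' H.dim h8
  obtain ⟨s2, e1, e2⟩ := H'.fibreDet_change H2 (h.hW.compatible n φ' hφ' φ hφ)
    (compatible_self c) (compatible_self d) (compatible_self e) s
  have e0 : ∀ k, (ContinuousLinearMap.id ℝ ℝ^k).det = 1 := fun k => det_id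
  rw [chartDeriv_id c h2, chartDeriv_id d h3, chartDeriv_id e h4, e0, e0, e0, mul_one, mul_one,
    mul_one] at e1
  rw [chartDeriv_id e h4, e0, one_mul] at e2
  rw [← e1] at h9
  have h10 : Sg σ (fibreDet f g φ c d e q' H.dim s2) := by
    have h11 := H2.fibreDet_mul_pos (hd := H.dim) h8 (by rw [e2]; exact h8)
    obtain ⟨τ, hτ⟩ := exists_sg (right_ne_zero_of_mul h11.ne')
    rw [units_eq_of_mul ((hσ'.mul hτ).unique (sg_one.2 h11))]
    exact hτ
  rw [mul_comm (fibreDet f g φ c d e q' H.dim s2)] at h9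
  have h13 := h9.of_mul h10
  have h14 : fibreSign oX oY oZ c d e q'.1.1 q'.1.2 (f q'.1.1) =
      fibreSign oX oY oZ c d e q.1.1 q.1.2 (f q.1.1) := by
    unfold fibreSign
    rw [h5, h6, h7]
  rw [h14, mul_assoc] at h13
  exact h13

end

section
variable {W : CSpace.{u}} {X : CSpace.{v}} {h : W → X} {n m : ℕ} {φ : 𝒞 n W}
    {c : 𝒞 m X}

lemma units_mul_cancel_left (a b : ℤˣ) : a * (a * b) = b := by
  rw [← mul_assoc, Int.units_mul_self, one_mul]

section
variable {A : CSpace.{u}} {X : CSpace.{v}} {e : A → X.boundary} {n : ℕ} {α : 𝒞 n A}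
  {c : 𝒞 (n + 1) X} {i : Fin (n + 1)} {a : A}

lemma IsFaceChart.chartDeriv_comp (h : IsFaceChart e α c i a) {C : Type*} [TopologicalSpace C]
    {r : ℕ} {d : 𝒞 r C} {f : X → C} (hf : ∃ G, Rep f c d (e a).pt G) (t : ℝ^n) :
    𝒟 (fun a => f (e a).pt) α d a t = 𝒟 f c d (e a).pt (insL i t) := by
  obtain ⟨G, hG⟩ := hf
  obtain ⟨K, hK⟩ := h.initAt.smC.rep
  have h1 := Rep.chartDeriv_comp (f := fun a => (e a).pt) hG hK
  rw [h.deriv] at h1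
  exact DFunLike.congr_fun h1 t

lemma IsFaceChart.insL_chartDeriv (h : IsFaceChart e α c i a) {P : Type*} [TopologicalSpace P]
    {r : ℕ} {φ : 𝒞 r P} {κ : P → A} {p : P} (hp : κ p = a) (hκ : ∃ G, Rep κ φ α p G)
    (t : ℝ^r) :
    𝒟 (fun p => (e (κ p)).pt) φ c p t = insL i (𝒟 κ φ α p t) := by
  subst hp
  obtain ⟨G, hG⟩ := hκ
  obtain ⟨K, hK⟩ := h.initAt.smC.rep
  have h1 := Rep.chartDeriv_comp hK hG
  rw [h.deriv] at h1
  exact DFunLike.congr_fun h1 t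

end

/-- Charts for a smooth map to the boundary. -/
lemma exists_boundary_charts {P : CSpace.{v}} {oW : SignData W} (hW : IsOrientedManifold W oW)
    (hP : P.IsManifold) (hd : P.dim = W.dim - 1) {Ψ : P → W.boundary} (hΨ : Smooth P W.boundary Ψ)
    {k : P → W} (hk : ∀ a, (Ψ a).pt = k a) (a : P)
    : ∃ n, ∃ φ ∈ W.charts (n + 1), ∃ ρ, IsFace φ ρ (Ψ a) ∧ ∃ φ' ∈ P.charts n,
      ∃ ψ ∈ W.boundary.charts n, (∃ G, Rep Ψ φ' ψ a G) ∧ (∃ G, Rep k φ' φ a G) ∧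
      boundaryOr oW n ψ (Ψ a) = -(-1) ^ (ρ : ℕ) * oW (n + 1) φ (k a) ∧
      ∀ t, 𝒟 k φ' φ a t = insL ρ (𝒟 Ψ φ' ψ a t) := by
  obtain ⟨n, φ, hφ, ρ, ψ, hψ, H⟩ :=
    hW.1.boundary.etale_id.exists_faceChart hW.1.boundary hW.1 (Ψ a)
  obtain ⟨n', φ', hφ', ha⟩ := hP.cover a
  have h1 := hP.dim_eq _ _ hφ'
  have h2 := hW.1.dim_eq _ _ hφ
  obtain rfl : n' = n := by push_cast at h2; omega
  obtain ⟨G, hG⟩ := (hP.smC_of_smooth hW.1.boundary hΨ hφ' hψ ha H.mem).rep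
  obtain ⟨K, hK⟩ := H.initAt.smC.rep
  have hk' := funext fun p => (hk p).symm
  have hk2 : ∃ G, Rep k φ' φ a G := by
    rw [hk']
    exact ⟨_, Rep.comp hK hG⟩
  refine ⟨n', φ, hφ, ρ, H.face, φ', hφ', ψ, hψ, ⟨G, hG⟩, hk2, ?_, fun t => ?_⟩
  · rw [← hk]
    exact isBoundaryOr_id hW n' ψ hψ φ hφ ρ (Ψ a) H
  · rw [hk']
    exact H.insL_chartDeriv rfl ⟨G, hG⟩ t

lemma pullAt_of_xiMinus (hW : W.IsManifold) (hX : X.IsManifold) (hh : Smooth W X h)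
    (hφ : φ ∈ W.charts n) (hc : c ∈ X.charts m) {p : BoundaryPt W} {q : BoundaryPt X} {ρ i}
    (hp : IsFace φ ρ p) (hq : IsFace c i q) (hpq : XiMinus W X h p q) :
    ∃ μ : ℝ, 0 < μ ∧ ∀ t, 𝒟 h φ c p.pt t i = μ * t ρ := by
  obtain ⟨G, hG⟩ := (hW.smC_of_smooth hX hh hφ hc hp.1 (by rw [hpq.1]; exact hq.1)).rep
  exact (((xiMinus_iff hW hX hh hφ hc hp hq).1 hpq).2).chartDeriv_eq hG

lemma rep_of_smooth (hW : W.IsManifold) (hX : X.IsManifold) (hh : Smooth W X h)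
    (hφ : φ ∈ W.charts n) (hc : c ∈ X.charts m) {x : W} (hx : x ∈ φ.target) (hy : h x ∈ c.target) :
    ∃ G, Rep h φ c x G := (hW.smC_of_smooth hX hh hφ hc hx hy).rep

end

namespace FibreData

variable {X : CSpace.{u}} {Y : CSpace.{v}} {Z : CSpace.{w}} {f : X → Z} {g : Y → Z}
  {oX : SignData X} {oY : SignData Y} {oZ : SignData Z} {A : CSpace.{u'}} {B : CSpace.{v'}}
  {oA : SignData A} {oB : SignData B} (h : FibreData X Y Z f g)
include h

lemma posAt_left (hX : IsOrientation X oX) (hY : IsOrientation Y oY) (hZ : IsOrientation Z oZ)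
    (hA : IsOrientedManifold A oA) (hdim : A.dim = X.dim - 1) {e : A → X.boundary}
    (he : Etale A X.boundary e) {f' : A → Z} (hf' : ∀ a, f' a = f (e a).pt)
    (hb : IsBSubmersive A Z f') (hor : IsBoundaryOr oX oA e)
    {Ψ : A.fibre Y Z f' g → (X.fibre Y Z f g).boundary}
    (hΨ : Smooth (A.fibre Y Z f' g) (X.fibre Y Z f g).boundary Ψ)
    (hR : ∀ a, h.leftRel e f' (Ψ a) a) (a : A.fibre Y Z f' g) :
    PosAt (fibreOr oA oY oZ f' g) (boundaryOr (fibreOr oX oY oZ f g)) Ψ a := by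
  have h' := h.left hA.1 he hf' hb
  have hk : ∀ a, (Ψ a).pt = leftMap hf' a := fun a => Subtype.ext (hR a).1
  obtain ⟨n, φ, hφ, ρ, hρ, φ', hφ', ψ, hψ, hrep, ⟨G, hG⟩, hbo, hT⟩ := exists_boundary_charts
      (h.isOrientedManifold hX hY hZ) h'.hW
    (show A.dim + Y.dim - Z.dim = X.dim + Y.dim - Z.dim - 1 by omega) hΨ hk a
  refine ⟨n, φ', hφ', ψ, hψ, hrep, ?_⟩
  obtain ⟨m, c, hc, i, α, hα, hi⟩ := he.exists_faceChart hA.1 h.hX a.1.1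
  obtain ⟨l, d, hd, hyd⟩ := h.hY.cover a.1.2
  obtain ⟨r, ζ, hζ, hzζ⟩ := h.hZ.cover (f' a.1.1)
  have H' := h'.fibreCharts hφ' hα hd hζ hG.mem hi.mem hyd hzζ
  have H := h.fibreCharts hφ hc hd hζ hG.mem' hi.face.1 hyd (hf' a.1.1 ▸ hzζ)
  obtain ⟨s', hs'⟩ := H'.exists_splitting
  let s : ℝ^r →ₗ[ℝ] ℝ^(m + 1) × ℝ^l :=
    (insL i).toLinearMap.prodMap LinearMap.id ∘ₗ s'
  have hD : ∀ t, 𝒟 f' α ζ a.1.1 t = 𝒟 f c ζ (e a.1.1).pt (insL i t) := fun t => by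
    rw [← hi.chartDeriv_comp H.left.rep]
    congr 2
    exact funext hf'
  have hs : diffH f g c d ζ (leftMap hf' a).1.1 (leftMap hf' a).1.2 ∘ₗ s = LinearMap.id := by
    rw [← hs']
    refine LinearMap.ext fun w => ?_
    refine (diffH_apply _ _ _ _ _ _ _ _).trans (Eq.trans ?_ (diffH_apply _ _ _ _ _ _ _ _).symm)
    rw [hD]
    rfl
  obtain ⟨μ, hμ, hpull⟩ := pullAt_of_xiMinus h.hW h.hX h.smooth_fst hφ hc hρ hi.face (hR a).2
  rw [hk] at hpull
  have hU : ∀ t, 𝒟 (·.1.1) φ c (leftMap hf' a)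
      (insL ρ (𝒟 Ψ φ' ψ a t)) =
      insL i (𝒟 (·.1.1) φ' α a t) := fun t => by
    rw [← hT, ← hi.insL_chartDeriv (κ := fun q : A.fibre Y Z f' g => q.1.1) rfl H'.initAt.smC.rep]
    obtain ⟨K, hK⟩ := H.initAt.smC.rep
    exact (DFunLike.congr_fun (Rep.chartDeriv_comp hK hG) t).symm
  have hU' : ∀ t, 𝒟 (·.1.2) φ d (leftMap hf' a)
      (insL ρ (𝒟 Ψ φ' ψ a t)) =
      𝒟 (·.1.2) φ' d a t := fun t => by
    rw [← hT]
    obtain ⟨K, hK⟩ := H.initAt.smC'.rep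
    exact (DFunLike.congr_fun (Rep.chartDeriv_comp (f := leftMap hf') hK hG) t).symm
  have k1 := h.fibreOr_sg hX hY hZ hφ hc hd hζ H H.dim (by rw [hs, det_id]; exact one_ne_zero)
  have k2 := h'.fibreOr_sg hA.2 hY hZ hφ' hα hd hζ H' H'.dim (by rw [hs', det_id]; exact
      one_ne_zero)
  rw [fibreDet, splitDet, hs, det_id, one_mul] at k1
  rw [fibreDet, splitDet, hs', det_id, one_mul] at k2
  have k3 := fdet_insAt (h := H.dim) (h' := H'.dim) (by omega)
    (M := (𝒟 Ψ φ' ψ a).1.prodMap LinearMap.id)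
    (L := ((𝒟 (·.1.1) φ c (leftMap hf' a)).1.prod
      (𝒟 (·.1.2) φ d (leftMap hf' a)).1).coprod s)
    (L' := ((𝒟 (·.1.1) φ' α a).1.prod
      (𝒟 (·.1.2) φ' d a).1).coprod s')
    (insAt_fst ρ) (insAt_fst i) (fun v => by
      refine Prod.ext ?_ ?_
      · change 𝒟 (·.1.1) φ c (leftMap hf' a)
          (insL ρ (𝒟 Ψ φ' ψ a v.1)) + insL i (s' v.2).1 = insL i (_ + _)
        rw [hU, map_add]
        rfl
      · change 𝒟 (·.1.2) φ d (leftMap hf' a)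
          (insL ρ (𝒟 Ψ φ' ψ a v.1)) + (s' v.2).2 = _ + _
        rw [hU']
        rfl)
  have k4 : (((𝒟 (·.1.1) φ c (leftMap hf' a)).1.prod
      (𝒟 (·.1.2) φ d (leftMap hf' a)).1).coprod s
      (Pi.single ρ 1, 0)).1 i = μ := by
    rw [LinearMap.coprod_apply, map_zero, add_zero]
    refine (hpull _).trans ?_
    change μ * (Pi.single ρ 1 : ℝ^(n + 1)) ρ = μ
    rw [Pi.single_eq_same, mul_one]
  rw [det_prodMap, det_id, mul_one] at k3
  have k5 := ((sg_neg_one_pow ((ρ : ℕ) + i)).mul (sg_one.2 hμ)).mul k2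
  rw [← k4, ← k3, mul_comm (fdet _ _)] at k5
  have k7 : (𝒟 Ψ φ' ψ a).det = det (𝒟 Ψ φ' ψ a).1 := rfl
  rw [k7, hbo]
  convert! (k5.of_mul k1) using 1
  have k10 : (leftMap hf' a).1.1 = (e a.1.1).pt := rfl
  have k11 : (leftMap hf' a).1.2 = a.1.2 := rfl
  unfold fibreSign
  rw [hor m α hα c hc i _ hi, hf' _, k10, k11]
  simp only [pow_add, mul_assoc, mul_comm, mul_left_comm, units_mul_cancel_left, neg_mul, mul_neg,
    one_mul]

end FibreData

lemma IsFaceChart.fMinus_chartDeriv {X : CSpace.{u}} {Z : CSpace.{v}} {f : X → Z}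
    (hX : X.IsManifold) (hZ : Z.IsManifold) (hf : IsBSubmersive X Z f) {p : bdMinus X Z f}
    {n r : ℕ} {α : 𝒞 n (bdMinus X Z f)} (hα : α ∈ (bdMinus X Z f).charts n)
    {c : 𝒞 (n + 1) X} (hc : c ∈ X.charts (n + 1)) {i : Fin (n + 1)}
    {ζ : 𝒞 r Z.boundary} (hζ : ζ ∈ Z.boundary.charts r) {e : 𝒞 (r + 1) Z}
    (he : e ∈ Z.charts (r + 1)) {j : Fin (r + 1)} (h : IsFaceChart Subtype.val α c i p)
    (h' : IsFaceChart id ζ e j (fMinus X Z f p)) (t : ℝ^n) :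
    insL j (𝒟 (fMinus X Z f) α ζ p t) = 𝒟 f c e p.1.pt (insL i t) := by
  rw [← h.chartDeriv_comp (rep_of_smooth hX hZ hf.1 hc he h.face.1 (pt_fMinus p ▸ h'.face.1)),
    ← h'.insL_chartDeriv rfl
      (rep_of_smooth (bdMinus_isManifold hX hZ hf.1) hZ.boundary (smooth_fMinus hX hZ hf) hα hζ
        h.mem h'.mem)]
  congr 2
  exact funext fun a => pt_fMinus a

lemma CSpace.IsManifold.negOnePow_dim {X : CSpace.{u}} (hX : X.IsManifold) {n : ℕ}
    {c : 𝒞 n X} (hc : c ∈ X.charts n) : Int.negOnePow X.dim = (-1) ^ n := by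
  rw [← hX.dim_eq n c hc, Int.negOnePow_def, zpow_natCast]

/-- The splitting of `TX ⊕ TY → TZ` at a corner made from a splitting for the faces. -/
def cornerSplit {r m l : ℕ} (i : Fin (m + 1)) (i' : Fin (l + 1)) (j : Fin (r + 1))
    (s : ℝ^r →ₗ[ℝ] ℝ^m × ℝ^l) :
    ℝ^(r + 1) →ₗ[ℝ] ℝ^(m + 1) × ℝ^(l + 1) :=
  (insL i).toLinearMap.prodMap (insL i').toLinearMap ∘ₗ s ∘ₗ (remL j).toLinearMap +
    (LinearMap.proj j : ℝ^(r + 1) →ₗ[ℝ] ℝ).smulRight (Pi.single i 1, 0)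

section
variable {n r m l : ℕ} {i : Fin (m + 1)} {i' : Fin (l + 1)} {j : Fin (r + 1)}
  {s : ℝ^r →ₗ[ℝ] ℝ^m × ℝ^l}

lemma remL_single {n : ℕ} (j : Fin (n + 1)) : remL j (Pi.single j 1) = 0 := by
  funext k
  exact Pi.single_eq_of_ne (Fin.succAbove_ne _ _) _

lemma cornerSplit_insL (w : ℝ^r) :
    cornerSplit i i' j s (insL j w) = (insL i (s w).1, insL i' (s w).2) := by
  have : cornerSplit i i' j s (insL j w) = (insL i (s (remL j (insL j w))).1,
    insL i' (s (remL j (insL j w))).2) +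
      (insL j w j) • ((Pi.single i 1, 0) : ℝ^(m + 1) × ℝ^(l + 1)) := rfl
  rw [this, remL_insL, insL_same, zero_smul, add_zero]

lemma cornerSplit_single : cornerSplit i i' j s (Pi.single j 1) = (Pi.single i 1, 0) := by
  have : cornerSplit i i' j s (Pi.single j 1) = (insL i (s (remL j (Pi.single j 1))).1,
    insL i' (s (remL j (Pi.single j 1))).2) + (Pi.single j 1 : ℝ^(r + 1)) j •
      ((Pi.single i 1, 0) : ℝ^(m + 1) × ℝ^(l + 1)) := rfl
  rw [this, remL_single, map_zero, Pi.single_eq_same, one_smul]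
  simp

lemma fdet_cornerSplit {h : n + 1 + (r + 1) = m + 1 + (l + 1)} {h' : n + r = m + l}
    {ρ : Fin (n + 1)} {U : ℝ^(n + 1) →ₗ[ℝ] ℝ^(m + 1)}
    {U' : ℝ^(n + 1) →ₗ[ℝ] ℝ^(l + 1)} {V : ℝ^n →ₗ[ℝ] ℝ^m}
    {V' : ℝ^n →ₗ[ℝ] ℝ^l} {T : ℝ^n →ₗ[ℝ] ℝ^n} {μ : ℝ}
    (hU : ∀ t, U (insL ρ (T t)) = insL i (V t)) (hU' : ∀ t, U' (insL ρ (T t)) = insL i' (V' t))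
    (hμ : ∀ t, U' t i' = μ * t ρ) :
    fdet h ((U.prod U').coprod (cornerSplit i i' j s)) * det T =
      (-1) ^ ((ρ : ℕ) + (m + 1 + i')) * μ *
        ((-1) ^ (n + (j : ℕ) + i) * fdet h' ((V.prod V').coprod s)) := by
  have h1 : n + (r + 1) = m + 1 + l := by omega
  let s₁ : ℝ^(r + 1) →ₗ[ℝ] ℝ^(m + 1) × ℝ^l :=
    LinearMap.id.prodMap (remL i').toLinearMap ∘ₗ cornerSplit i i' j s
  have e1 : ∀ w, insL i' (s₁ w).2 = (cornerSplit i i' j s w).2 := fun w => by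
    change insL i' (remL i' (cornerSplit i i' j s w).2) = _
    refine insL_remL ?_
    have : (cornerSplit i i' j s w).2 i' = insL i' (s (remL j w)).2 i' +
      w j * (0 : ℝ^(l + 1)) i' := rfl
    rw [this, insL_same, Pi.zero_apply, mul_zero, add_zero]
  have e2 : ∀ w, s₁ (insL j w) = (insL i (s w).1, (s w).2) := fun w => by
    change ((cornerSplit i i' j s (insL j w)).1, remL i' (cornerSplit i i' j s (insL j w)).2) = _
    rw [cornerSplit_insL, remL_insL]
  have e3 : s₁ (Pi.single j 1) = (Pi.single i 1, 0) := by
    change ((cornerSplit i i' j s (Pi.single j 1)).1,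
      remL i' (cornerSplit i i' j s (Pi.single j 1)).2) = _
    rw [cornerSplit_single, map_zero]
  have k3 := fdet_insAt (h := h) (h' := h1) (by omega) (M := T.prodMap LinearMap.id)
    (L := (U.prod U').coprod (cornerSplit i i' j s))
    (L' := (((insL i).toLinearMap ∘ₗ V).prod V').coprod s₁)
    (insAt_fst ρ) (insAt_snd i') (fun v => by
      refine Prod.ext ?_ ?_
      · change U (insL ρ (T v.1)) + (cornerSplit i i' j s v.2).1 = insL i (V v.1) + _
        rw [hU]
        rfl
      · change U' (insL ρ (T v.1)) + (cornerSplit i i' j s v.2).2 = insL i' (V' v.1 + (s₁ v.2).2)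
        rw [hU', map_add, e1])
  have l3 := fdet_insAt (h := h1) (h' := h') (by omega) (M := LinearMap.id)
    (L := (((insL i).toLinearMap ∘ₗ V).prod V').coprod s₁) (L' := (V.prod V').coprod s)
    (insAt_snd j) (insAt_fst i) (fun v => by
      change (insL i (V v.1), V' v.1) + s₁ (insL j v.2) = (insL i (V v.1 + _), V' v.1 + _)
      rw [e2, Prod.mk_add_mk, map_add]
      rfl)
  have k4 : ((U.prod U').coprod (cornerSplit i i' j s) (Pi.single ρ 1, 0)).2 i' = μ := by
    rw [LinearMap.coprod_apply, map_zero, add_zero]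
    refine (hμ _).trans ?_
    change μ * (Pi.single ρ 1 : ℝ^(n + 1)) ρ = μ
    rw [Pi.single_eq_same, mul_one]
  have l4 : ((((insL i).toLinearMap ∘ₗ V).prod V').coprod s₁ (0, Pi.single j 1)).1 i = 1 := by
    rw [LinearMap.coprod_apply, map_zero, zero_add, e3]
    exact Pi.single_eq_same _ _
  rw [det_id, mul_one, l4, mul_one] at l3
  rw [det_prodMap, det_id, mul_one, l3, k4] at k3
  exact k3

end

namespace FibreData

variable {X : CSpace.{u}} {Y : CSpace.{v}} {Z : CSpace.{w}} {f : X → Z} {g : Y → Z}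
  {oX : SignData X} {oY : SignData Y} {oZ : SignData Z} {A : CSpace.{u'}} {B : CSpace.{v'}}
  {oA : SignData A} {oB : SignData B} (h : FibreData X Y Z f g)
include h

lemma posAt_right (hX : IsOrientation X oX) (hY : IsOrientation Y oY) (hZ : IsOrientation Z oZ)
    (hB : IsOrientedManifold B oB) (hdim : B.dim = Y.dim - 1) {e : B → Y.boundary}
    (he : Etale B Y.boundary e) {g' : B → Z} (hg' : ∀ b, g' b = g (e b).pt)
    (hor : IsBoundaryOr oY oB e)
    {Ψ : X.fibre B Z f g' → (X.fibre Y Z f g).boundary}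
    (hΨ : Smooth (X.fibre B Z f g') (X.fibre Y Z f g).boundary Ψ)
    (hR : ∀ a, h.rightRel e g' (Ψ a) a) (a : X.fibre B Z f g') :
    PosAt (signed (Int.negOnePow (X.dim + Z.dim)) (fibreOr oX oB oZ f g'))
      (boundaryOr (fibreOr oX oY oZ f g)) Ψ a := by
  have h' := h.right hB.1 he hg'
  have hk : ∀ a, (Ψ a).pt = rightMap hg' a := fun a => Subtype.ext (hR a).1
  obtain ⟨n, φ, hφ, ρ, hρ, φ', hφ', ψ, hψ, hrep, ⟨G, hG⟩, hbo, hT⟩ := exists_boundary_charts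
      (h.isOrientedManifold hX hY hZ) h'.hW
    (show X.dim + B.dim - Z.dim = X.dim + Y.dim - Z.dim - 1 by omega) hΨ hk a
  refine ⟨n, φ', hφ', ψ, hψ, hrep, ?_⟩
  obtain ⟨l, d, hd, i, α, hα, hi⟩ := he.exists_faceChart hB.1 h.hY a.1.2
  obtain ⟨m, c, hc, hxc⟩ := h.hX.cover a.1.1
  obtain ⟨r, ζ, hζ, hzζ⟩ := h.hZ.cover (f a.1.1)
  have H' := h'.fibreCharts hφ' hc hα hζ hG.mem hxc hi.mem hzζ
  have H := h.fibreCharts hφ hc hd hζ hG.mem' hxc hi.face.1 hzζ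
  obtain ⟨s', hs'⟩ := H'.exists_splitting
  let s : ℝ^r →ₗ[ℝ] ℝ^m × ℝ^(l + 1) :=
    LinearMap.id.prodMap (insL i).toLinearMap ∘ₗ s'
  have hD : ∀ t, 𝒟 g' α ζ a.1.2 t = 𝒟 g d ζ (e a.1.2).pt (insL i t) := fun t => by
    rw [← hi.chartDeriv_comp H.right.rep]
    congr 2
    exact funext hg'
  have hs : diffH f g c d ζ (rightMap hg' a).1.1 (rightMap hg' a).1.2 ∘ₗ s = LinearMap.id := by
    rw [← hs']
    refine LinearMap.ext fun w => ?_
    refine (diffH_apply _ _ _ _ _ _ _ _).trans (Eq.trans ?_ (diffH_apply _ _ _ _ _ _ _ _).symm)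
    rw [hD]
    rfl
  obtain ⟨μ, hμ, hpull⟩ := pullAt_of_xiMinus h.hW h.hY h.smooth_snd hφ hd hρ hi.face (hR a).2
  rw [hk] at hpull
  have hU : ∀ t, 𝒟 (·.1.1) φ c (rightMap hg' a)
      (insL ρ (𝒟 Ψ φ' ψ a t)) =
      𝒟 (·.1.1) φ' c a t := fun t => by
    rw [← hT]
    obtain ⟨K, hK⟩ := H.initAt.smC.rep
    exact (DFunLike.congr_fun (Rep.chartDeriv_comp hK hG) t).symm
  have hU' : ∀ t, 𝒟 (·.1.2) φ d (rightMap hg' a)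
      (insL ρ (𝒟 Ψ φ' ψ a t)) =
      insL i (𝒟 (·.1.2) φ' α a t) := fun t => by
    rw [← hT, ← hi.insL_chartDeriv (κ := fun q : X.fibre B Z f g' => q.1.2) rfl H'.initAt.smC'.rep]
    obtain ⟨K, hK⟩ := H.initAt.smC'.rep
    exact (DFunLike.congr_fun (Rep.chartDeriv_comp (f := rightMap hg') hK hG) t).symm
  have k1 := h.fibreOr_sg hX hY hZ hφ hc hd hζ H H.dim (by rw [hs, det_id]; exact one_ne_zero)
  have k2 := h'.fibreOr_sg hX hB.2 hZ hφ' hc hα hζ H' H'.dim (by rw [hs', det_id]; exact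
      one_ne_zero)
  rw [fibreDet, splitDet, hs, det_id, one_mul] at k1
  rw [fibreDet, splitDet, hs', det_id, one_mul] at k2
  have k3 := fdet_insAt (h := H.dim) (h' := H'.dim) (by omega)
    (M := (𝒟 Ψ φ' ψ a).1.prodMap LinearMap.id)
    (L := ((𝒟 (·.1.1) φ c (rightMap hg' a)).1.prod
      (𝒟 (·.1.2) φ d (rightMap hg' a)).1).coprod s)
    (L' := ((𝒟 (·.1.1) φ' c a).1.prod
      (𝒟 (·.1.2) φ' α a).1).coprod s')
    (insAt_fst ρ) (insAt_snd i) (fun v => by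
      refine Prod.ext ?_ ?_
      · change 𝒟 (·.1.1) φ c (rightMap hg' a)
          (insL ρ (𝒟 Ψ φ' ψ a v.1)) + (s' v.2).1 = _ + _
        rw [hU]
        rfl
      · change 𝒟 (·.1.2) φ d (rightMap hg' a)
          (insL ρ (𝒟 Ψ φ' ψ a v.1)) + insL i (s' v.2).2 = insL i (_ + _)
        rw [hU', map_add]
        rfl)
  have k4 : (((𝒟 (·.1.1) φ c (rightMap hg' a)).1.prod
      (𝒟 (·.1.2) φ d (rightMap hg' a)).1).coprod s
      (Pi.single ρ 1, 0)).2 i = μ := by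
    rw [LinearMap.coprod_apply, map_zero, add_zero]
    refine (hpull _).trans ?_
    change μ * (Pi.single ρ 1 : ℝ^(n + 1)) ρ = μ
    rw [Pi.single_eq_same, mul_one]
  rw [det_prodMap, det_id, mul_one] at k3
  have k5 := ((sg_neg_one_pow ((ρ : ℕ) + (m + i))).mul (sg_one.2 hμ)).mul k2
  rw [← k4, ← k3, mul_comm (fdet _ _)] at k5
  have k7 : (𝒟 Ψ φ' ψ a).det = det (𝒟 Ψ φ' ψ a).1 := rfl
  rw [k7, hbo]
  convert! (k5.of_mul k1) using 1
  have k10 : (rightMap hg' a).1.1 = a.1.1 := rfl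
  have k11 : (rightMap hg' a).1.2 = (e a.1.2).pt := rfl
  unfold fibreSign signed
  rw [hor l α hα d hd i _ hi, k10, k11, hdim, sub_mul, one_mul, Int.negOnePow_sub,
      Int.negOnePow_add,
    h.hX.negOnePow_dim hc]
  simp only [pow_add, mul_assoc, mul_comm, mul_left_comm, units_mul_cancel_left, neg_mul, mul_neg,
    one_mul]

lemma posAt_corner (hX : IsOrientation X oX) (hY : IsOrientation Y oY)
    (hZ : IsOrientedManifold Z oZ) (hb : IsBSubmersive Y Z g)
    {oA : SignData (bdMinus X Z f)} (hA : IsOrientedManifold (bdMinus X Z f) oA)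
    (horA : IsBoundaryOr oX oA Subtype.val)
    {oB : SignData (bdMinus Y Z g)} (hB : IsOrientedManifold (bdMinus Y Z g) oB)
    (horB : IsBoundaryOr oY oB Subtype.val)
    {Ψ : minusFibre X Y Z f g →
      (X.fibre Y Z f g).boundary}
    (hΨ : Smooth (minusFibre X Y Z f g)
      (X.fibre Y Z f g).boundary Ψ)
    (hR : ∀ a, h.cornerRel (Ψ a) a)
    (a : minusFibre X Y Z f g) :
    PosAt (fibreOr oA oB (boundaryOr oZ) (fMinus X Z f) (fMinus Y Z g))
      (boundaryOr (fibreOr oX oY oZ f g)) Ψ a := by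
  have h' := h.corner hb
  have hW := h.isOrientedManifold hX hY hZ.2
  have hk : ∀ a, (Ψ a).pt = cornerMap a := fun a => Subtype.ext (hR a).1
  obtain ⟨n, φ, hφ, ρ, hρ, φ', hφ', ψ, hψ, hrep, ⟨G, hG⟩, hbo, hT⟩ :=
    exists_boundary_charts hW h'.hW
    (show X.dim - 1 + (Y.dim - 1) - (Z.dim - 1) = X.dim + Y.dim - Z.dim - 1 by omega) hΨ hk a
  refine ⟨n, φ', hφ', ψ, hψ, hrep, ?_⟩
  obtain ⟨m, c, hc, i, α, hα, hi⟩ := (etale_bdMinus h.hX h.hZ h.hf.1).exists_faceChart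
    hA.1 h.hX a.1.1
  obtain ⟨l, d, hd, i', β, hβ, hi'⟩ := (etale_bdMinus h.hY h.hZ h.hg).exists_faceChart
    hB.1 h.hY a.1.2
  obtain ⟨r, ε, hε, j, ζ, hζ, hj⟩ :=
    h.hZ.boundary.etale_id.exists_faceChart h.hZ.boundary h.hZ (fMinus X Z f a.1.1)
  have H' := h'.fibreCharts hφ' hα hβ hζ hG.mem hi.mem hi'.mem hj.mem
  have H := h.fibreCharts hφ hc hd hε hG.mem' hi.face.1 hi'.face.1 (pt_fMinus
      a.1.1 ▸ hj.face.1)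
  obtain ⟨s', hs'⟩ := H'.exists_splitting
  obtain ⟨ν, hν, hpull'⟩ := pullAt_of_xiMinus h.hX h.hZ h.hf.1 hc hε hi.face hj.face
    (xiMinus_fMinus a.1.1)
  have hdet : det
      (diffH f g c d ε (cornerMap a).1.1 (cornerMap a).1.2 ∘ₗ cornerSplit i i' j s') = ν := by
    rw [det_insL (a := j) (b := j) (fun w => ?_), det_id, mul_one,
      Even.neg_one_pow ⟨_, rfl⟩, one_mul]
    · rw [LinearMap.comp_apply, cornerSplit_single, diffH_apply, map_zero, sub_zero]
      refine (hpull' _).trans ?_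
      change ν * (Pi.single i 1 : ℝ^(m + 1)) i = ν
      rw [Pi.single_eq_same, mul_one]
    · have h2 := DFunLike.congr_fun hs' w
      rw [LinearMap.comp_apply, diffH_apply] at h2
      rw [LinearMap.comp_apply, cornerSplit_insL, diffH_apply]
      change 𝒟 f c ε a.1.1.1.pt (insL i (s' w).1) -
        𝒟 g d ε a.1.2.1.pt (insL i' (s' w).2) = _
      rw [← hi.fMinus_chartDeriv h.hX h.hZ h.hf hα hc hζ hε hj,
        ← hi'.fMinus_chartDeriv h.hY h.hZ hb hβ hd hζ hε (a.2 ▸ hj), ← map_sub, h2]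
  obtain ⟨μ, hμ, hpull⟩ := pullAt_of_xiMinus h.hW h.hY h.smooth_snd hφ hd hρ hi'.face (hR a).2.2
  rw [hk] at hpull
  have hU : ∀ t, 𝒟 (·.1.1) φ c (cornerMap a)
      (insL ρ (𝒟 Ψ φ' ψ a t)) =
      insL i (𝒟 (fun q : minusFibre X Y Z f g => q.1.1) φ' α a t) := fun t => by
    rw [← hT, ← hi.insL_chartDeriv rfl H'.initAt.smC.rep]
    obtain ⟨K, hK⟩ := H.initAt.smC.rep
    exact (DFunLike.congr_fun (Rep.chartDeriv_comp hK hG) t).symm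
  have hU' : ∀ t, 𝒟 (·.1.2) φ d (cornerMap a)
      (insL ρ (𝒟 Ψ φ' ψ a t)) =
      insL i' (𝒟 (fun q : minusFibre X Y Z f g => q.1.2) φ' β a t) := fun t => by
    rw [← hT, ← hi'.insL_chartDeriv rfl H'.initAt.smC'.rep]
    obtain ⟨K, hK⟩ := H.initAt.smC'.rep
    exact (DFunLike.congr_fun (Rep.chartDeriv_comp (f := cornerMap) hK hG) t).symm
  have k1 := h.fibreOr_sg hX hY hZ.2 hφ hc hd hε H H.dim (by rw [hdet]; exact hν.ne')
  have k2 := h'.fibreOr_sg hA.2 hB.2 hZ.boundary.2 hφ' hα hβ hζ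
    H' H'.dim (by rw [hs', det_id]; exact one_ne_zero)
  rw [fibreDet, splitDet, hdet] at k1
  rw [fibreDet, splitDet, hs', det_id, one_mul] at k2
  have k3 := fdet_cornerSplit (h := H.dim) (h' := H'.dim) (j := j) (s := s')
    hU hU' hpull
  have k5 := ((sg_neg_one_pow ((ρ : ℕ) + (m + 1 + i'))).mul (sg_one.2 hμ)).mul
    ((sg_neg_one_pow (n + j + i)).mul k2)
  rw [← k3, mul_comm (fdet _ _)] at k5
  have k6 := k5.of_mul ((mul_comm ν _ ▸ k1).of_mul (sg_one.2 hν))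
  have k7 : (𝒟 Ψ φ' ψ a).det = det (𝒟 Ψ φ' ψ a).1 := rfl
  rw [k7, hbo]
  convert! k6 using 1
  have k11 : (cornerMap a).1.1 = a.1.1.1.pt := rfl
  have k12 : (cornerMap a).1.2 = a.1.2.1.pt := rfl
  have k13 : ((id (fMinus X Z f a.1.1) : BoundaryPt Z)).pt = f a.1.1.1.pt := pt_fMinus _
  have k14 : Int.negOnePow ((bdMinus Y Z g).dim * Z.boundary.dim) =
      Int.negOnePow (Y.dim * Z.dim) * (-1) ^ l * (-1) ^ r * -1 := by
    rw [sub_mul, mul_sub, one_mul, mul_one, Int.negOnePow_sub, Int.negOnePow_sub,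
      Int.negOnePow_sub, h.hY.negOnePow_dim hd, h.hZ.negOnePow_dim hε, pow_succ, pow_succ,
      Int.negOnePow_one]
    simp [mul_assoc]
  have k15 : ((-1 : ℤˣ)) ^ n * (-1) ^ r = (-1) ^ m * (-1) ^ l := by
    rw [← pow_add, ← pow_add, H'.dim]
  have k16 : ((-1 : ℤˣ)) ^ n = (-1) ^ m * (-1) ^ l * (-1) ^ r := by
    rw [← k15, mul_assoc, Int.units_mul_self, mul_one]
  unfold fibreSign
  rw [horA m α hα c hc i _ hi, horB l β hβ d hd i' _ hi', isBoundaryOr_id hZ r ζ hζ ε hε j _ hj,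
      k11, k12, k13, k14]
  generalize oX (m + 1) c a.1.1.1.pt = x
  generalize oY (l + 1) d a.1.2.1.pt = y
  generalize oZ (r + 1) ε (f a.1.1.1.pt) = z
  generalize fibreOr oX oY oZ f g (n + 1) φ (cornerMap a) = F
  generalize fibreOr oA oB (boundaryOr oZ) (fMinus X Z f) (fMinus Y Z g) n φ' a = F'
  generalize Int.negOnePow (Y.dim * Z.dim) = N
  clear * - k16
  simp only [pow_add, k16, pow_one, mul_assoc, mul_comm, mul_left_comm, units_mul_cancel_left,
    neg_mul, mul_neg, neg_neg, mul_one, one_mul, Int.units_mul_self]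

end FibreData

section
variable {X : CSpace.{u}} {Y : CSpace.{v}} {f : X → Y}

lemma IsSubmersion.fibreData_incl (hX : X.IsManifold) (hY : Y.IsManifold)
    (hf : IsSubmersion X Y f) : FibreData X Y.boundary Y f Y.incl where
  hX := hX
  hY := hY.boundary
  hZ := hY
  hf := hf.isBSubmersive
  hg := hY.smooth_incl
  ht := hf.stratumTransverse hY.smooth_incl hX hY.boundary hY

/-- The diffeomorphism of `∂₋X` with `X ×_Y ∂Y`. -/
def bdMinusMap (X : CSpace.{u}) (Y : CSpace.{v}) (f : X → Y) (p : bdMinus X Y f) :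
    X.fibre Y.boundary Y f Y.incl :=
  ⟨(p.1.pt, fMinus X Y f p), (pt_fMinus p).symm⟩

lemma smooth_bdMinusMap (hX : X.IsManifold) (hY : Y.IsManifold) (hf : IsSubmersion X Y f) :
    Smooth (bdMinus X Y f) (X.fibre Y.boundary Y f Y.incl) (bdMinusMap X Y f) := by
  have h := hf.fibreData_incl hX hY
  have hA := bdMinus_isManifold hX hY hf.1
  have h1 := (etale_bdMinus hX hY hf.1).smooth_pt hA hX
  have h2 := smooth_fMinus hX hY h.hf
  exact h.init.lift h.hW hX hY.boundary hA
    ((h1.continuous.prodMk h2.continuous).subtype_mk _) h1 h2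

lemma exists_bdMinusMap_inverse (hX : X.IsManifold) (hY : Y.IsManifold)
    (hf : IsSubmersion X Y f) : ∃ Ψ : X.fibre Y.boundary Y f Y.incl → bdMinus X Y f,
      Smooth (X.fibre Y.boundary Y f Y.incl) (bdMinus X Y f) Ψ ∧
      LeftInverse Ψ (bdMinusMap X Y f) ∧ RightInverse Ψ (bdMinusMap X Y f) := by
  have h := hf.fibreData_incl hX hY
  have hA := bdMinus_isManifold hX hY hf.1
  have key : ∀ w : X.fibre Y.boundary Y f Y.incl, ∃ p : BoundaryPt X, p.pt = w.1.1 ∧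
      XiMinus X Y f p w.1.2 := fun w => XiMinus.exists_of_pt hX hY h.hf w.2
  choose Ψ h1 h2 using key
  have hcont : Continuous fun w => (⟨Ψ w, _, h2 w⟩ : bdMinus X Y f) := by
    refine Continuous.subtype_mk (continuous_iff_continuousAt.2 fun w T hT => ?_) _
    have h3 := (h2 w).eventually_left hX hY hf.1 hT
    rw [h1] at h3
    have h4 : Continuous fun w : X.fibre Y.boundary Y f Y.incl => (w.1.2, w.1.1) := by fun_prop
    refine mem_map.2 ?_
    filter_upwards [h4.continuousAt.eventually h3] with w' h5
    obtain ⟨p', hp', h6, h7⟩ := h5 w'.2.symm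
    rw [mem_preimage, XiMinus.left_unique hX hY hf.1 (h2 w') h7 ((h1 w').trans h6.symm)]
    exact hp'
  refine ⟨fun w => ⟨Ψ w, _, h2 w⟩, ?_, fun p => ?_, fun w => ?_⟩
  · have h3 : (fun p : bdMinus X Y f => p.1.pt) ∘ (fun w => (⟨Ψ w, _, h2 w⟩ : bdMinus X Y f)) =
        fun w => w.1.1 := funext h1
    exact ((etale_bdMinus hX hY hf.1).init_pt hA hX).lift hA hX hX h.hW hcont
      (h3 ▸ h.smooth_fst) (h3 ▸ h.smooth_fst)
  · exact Subtype.ext (XiMinus.left_unique hX hY hf.1 (h2 (bdMinusMap X Y f p)) (xiMinus_fMinus p)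
      (h1 (bdMinusMap X Y f p)))
  · exact Subtype.ext (Prod.ext (h1 w) ((fMinus_eq_iff hX hY h.hf).2 (h2 w)))

variable {oX : SignData X} {oY : SignData Y}

lemma posAt_bdMinusMap (hX : IsOrientedManifold X oX) (hY : IsOrientedManifold Y oY)
    (hf : IsSubmersion X Y f) {oA : SignData (bdMinus X Y f)} (hor : IsBoundaryOr oX oA Subtype.val)
    (p : bdMinus X Y f) :
    PosAt oA (signed (Int.negOnePow (X.dim + Y.dim)) (fibreOr oX (boundaryOr oY) oY f Y.incl))
      (bdMinusMap X Y f) p := by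
  have h := hf.fibreData_incl hX.1 hY.1
  have hA := bdMinus_isManifold hX.1 hY.1 hf.1
  obtain ⟨m, c, hc, i, α, hα, hi⟩ := (etale_bdMinus hX.1 hY.1
    hf.1).exists_faceChart hA hX.1 p
  obtain ⟨r, e, he, j, ζ, hζ, hj⟩ := h.hY.etale_id.exists_faceChart h.hY hY.1
    (fMinus X Y f p)
  obtain ⟨n, φ, hφ, hpφ⟩ := h.hW.cover (bdMinusMap X Y f p)
  obtain rfl : m = n := by
    have h2 := hX.1.dim_eq _ _ hc
    have h3 : (n : ℤ) = X.dim + (Y.dim - 1) - Y.dim := h.hW.dim_eq _ _ hφ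
    push_cast at h2
    omega
  have H := h.fibreCharts hφ hc hζ he hpφ hi.face.1 hj.mem (pt_fMinus p ▸
      hj.face.1)
  obtain ⟨G, hG⟩ := (hA.smC_of_smooth h.hW (smooth_bdMinusMap hX.1 hY.1 hf) hα hφ hi.mem hpφ).rep
  refine ⟨m, α, hα, φ, hφ, ⟨G, hG⟩, ?_⟩
  let s : ℝ^(r + 1) →ₗ[ℝ] ℝ^(m + 1) × ℝ^r :=
    ((LinearMap.proj j : ℝ^(r + 1) →ₗ[ℝ] ℝ).smulRight (Pi.single i 1)).prod
      (-(remL j).toLinearMap)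
  have hs₁ : ∀ w, s (insL j w) = (0, -w) := fun w => by
    change ((insL j w j) • (Pi.single i 1 : ℝ^(m + 1)), -remL j (insL j w)) = _
    rw [remL_insL, insL_same, zero_smul]
  have hs₂ : s (Pi.single j 1) = (Pi.single i 1, 0) := by
    change (((Pi.single j 1 : ℝ^(r + 1)) j) • (Pi.single i 1 : ℝ^(m + 1)),
      -remL j (Pi.single j 1)) = _
    rw [remL_single, Pi.single_eq_same, one_smul, neg_zero]
  obtain ⟨ν, hν, hpull⟩ := pullAt_of_xiMinus hX.1 hY.1 hf.1 hc he hi.face hj.face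
    (xiMinus_fMinus p)
  have hdet : det (diffH f Y.incl c ζ e (bdMinusMap X Y f p).1.1
      (bdMinusMap X Y f p).1.2 ∘ₗ s) = ν := by
    rw [det_insL (a := j) (b := j) (fun w => ?_), det_id, mul_one,
      Even.neg_one_pow ⟨_, rfl⟩, one_mul]
    · rw [LinearMap.comp_apply, hs₂, diffH_apply, map_zero, sub_zero]
      refine (hpull _).trans ?_
      change ν * (Pi.single i 1 : ℝ^(m + 1)) i = ν
      rw [Pi.single_eq_same, mul_one]
    · rw [LinearMap.comp_apply, hs₁, diffH_apply, map_zero, zero_sub, map_neg, neg_neg]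
      exact DFunLike.congr_fun hj.deriv w
  have hU : ∀ t, 𝒟 (fun q : X.fibre Y.boundary Y f Y.incl => q.1.1) φ c
      (bdMinusMap X Y f p) (𝒟 (bdMinusMap X Y f) α φ p t) = insL i t := fun t => by
    obtain ⟨K, hK⟩ := H.initAt.smC.rep
    refine (DFunLike.congr_fun (Rep.chartDeriv_comp hK hG) t).symm.trans ?_
    exact DFunLike.congr_fun hi.deriv t
  have hU' : ∀ t, 𝒟 (fun q : X.fibre Y.boundary Y f Y.incl => q.1.2) φ ζ
      (bdMinusMap X Y f p) (𝒟 (bdMinusMap X Y f) α φ p t) =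
      𝒟 (fMinus X Y f) α ζ p t := fun t => by
    obtain ⟨K, hK⟩ := H.initAt.smC'.rep
    exact (DFunLike.congr_fun (Rep.chartDeriv_comp hK hG) t).symm
  have k1 := h.fibreOr_sg hX.2 hY.boundary.2 hY.2 hφ hc hζ he H
    H.dim (by rw [hdet]; exact hν.ne')
  rw [fibreDet, splitDet, hdet] at k1
  let L' : (ℝ^m × ℝ^r) →ₗ[ℝ] ℝ^m × ℝ^r :=
    (LinearMap.id.prod (𝒟 (fMinus X Y f) α ζ p).1).coprod
      (LinearMap.inr ℝ _ _ ∘ₗ (-LinearMap.id))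
  have k2 : fdet rfl L' = (-1) ^ r := by
    rw [fdet, det_conj, det_lowerTriangular (R := -LinearMap.id)
      (fun w => ?_) fun t => ?_, det_id, one_mul, ← neg_one_smul ℝ LinearMap.id,
      LinearMap.det_smul, det_id]
    · simp
    · simp [L']
    · simp [L']
  have k3 := fdet_insAt (h := H.dim) (h' := rfl) (by omega)
    (M := (𝒟 (bdMinusMap X Y f) α φ p).1.prodMap LinearMap.id)
    (L := ((𝒟 (fun q : X.fibre Y.boundary Y f Y.incl => q.1.1) φ c
      (bdMinusMap X Y f p)).1.prod
      (𝒟 (fun q : X.fibre Y.boundary Y f Y.incl => q.1.2) φ ζ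
        (bdMinusMap X Y f p)).1).coprod s)
    (L' := L') (insAt_snd j) (insAt_fst i) (fun v => by
      have h0 : L' v = (v.1, 𝒟 (fMinus X Y f) α ζ p v.1) + (0, -v.2) := rfl
      rw [h0]
      change (𝒟 (fun q : X.fibre Y.boundary Y f Y.incl => q.1.1) φ c
        (bdMinusMap X Y f p) (𝒟 (bdMinusMap X Y f) α φ p v.1),
        𝒟 (fun q : X.fibre Y.boundary Y f Y.incl => q.1.2) φ ζ
        (bdMinusMap X Y f p) (𝒟 (bdMinusMap X Y f) α φ p v.1)) + s (insL j v.2) = _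
      rw [hU, hU', hs₁, Prod.mk_add_mk, Prod.mk_add_mk, add_zero, add_zero])
  have k4 : (((𝒟 (fun q : X.fibre Y.boundary Y f Y.incl => q.1.1) φ c
      (bdMinusMap X Y f p)).1.prod
      (𝒟 (fun q : X.fibre Y.boundary Y f Y.incl => q.1.2) φ ζ
        (bdMinusMap X Y f p)).1).coprod s (0, Pi.single j 1)).1 i = 1 := by
    rw [LinearMap.coprod_apply, map_zero, zero_add, hs₂]
    exact Pi.single_eq_same _ _
  rw [det_prodMap, det_id, mul_one, k4, mul_one, k2] at k3
  have k5 := (sg_neg_one_pow (m + (j : ℕ) + i)).mul (sg_neg_one_pow r)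
  rw [← k3, mul_comm (fdet _ _)] at k5
  have k6 := k5.of_mul ((mul_comm ν _ ▸ k1).of_mul (sg_one.2 hν))
  have k7 : (𝒟 (bdMinusMap X Y f) α φ p).det =
    det (𝒟 (bdMinusMap X Y f) α φ p).1 := rfl
  rw [k7]
  convert! k6 using 1
  have k11 : (bdMinusMap X Y f p).1.1 = p.1.pt := rfl
  have k12 : (bdMinusMap X Y f p).1.2 = fMinus X Y f p := rfl
  have k13 : ((id (fMinus X Y f p) : BoundaryPt Y)).pt = f p.1.pt := pt_fMinus _
  have k14 : Int.negOnePow (Y.boundary.dim * Y.dim) = 1 := by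
    rw [sub_mul, one_mul, Int.negOnePow_sub, Int.negOnePow_mul_self, Int.units_mul_self]
  unfold fibreSign signed
  rw [hor m α hα c hc i _ hi, k11, k12, isBoundaryOr_id hY r ζ hζ e he j _ hj, k13, k14,
      Int.negOnePow_add,
      hX.1.negOnePow_dim hc,
    hY.1.negOnePow_dim he]
  generalize oX (m + 1) c p.1.pt = x
  generalize oY (r + 1) e (f p.1.pt) = y
  generalize fibreOr oX (boundaryOr oY) oY f Y.incl m φ (bdMinusMap X Y f p) = F
  clear * -
  simp only [pow_add, pow_one, mul_assoc, mul_comm, mul_left_comm, units_mul_cancel_left,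
    neg_mul, mul_neg, neg_neg, mul_one, one_mul, Int.units_mul_self]

end

lemma CSpace.WithoutBoundary.not_xiMinus {X : CSpace.{u}} {Z : CSpace.{w}} {f : X → Z}
    (h : Z.WithoutBoundary) (hZ : Z.IsManifold) (q : BoundaryPt X) :
    ¬ ∃ z, XiMinus X Z f q z := by
  rintro ⟨z, -⟩
  obtain ⟨n, e, he, hz⟩ := hZ.cover z.pt
  obtain ⟨i, hi⟩ := hZ.exists_isFace he hz
  have h1 : i ∈ e.act z.pt := ⟨hi.2.1, hi.2.2.1⟩
  rw [h.act_eq_empty hZ he hz] at h1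
  exact h1

lemma posAt_sum_of_smooth {A : CSpace.{u}} {B : CSpace.{v}} {oA : SignData A} {oB : SignData B}
    {Q : CSpace.{w}} {oQ : SignData Q} (hA : IsOrientedManifold A oA) (hB : IsOrientedManifold B oB)
    (hd : A.dim = B.dim) (hQ : Q.IsManifold) {F : A ⊕ B → Q} (hF : Smooth (A.sum B) Q F)
    (h1 : Smooth A Q (fun a => F (Sum.inl a)) → ∀ a, PosAt oA oQ (fun a => F (Sum.inl a)) a)
    (h2 : Smooth B Q (fun b => F (Sum.inr b)) → ∀ b, PosAt oB oQ (fun b => F (Sum.inr b)) b)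
    (x : A ⊕ B) : PosAt (A := A.sum B) (sumOr oA oB) oQ F x := by
  obtain ⟨hS, hl, hr⟩ := sum_isManifold hA.1 hB.1 hd
  exact posAt_sum hA hB hd hQ hF
    (h1 (hF.comp' hA.1 hS hQ (hl.smooth hA.1 hS)))
    (h2 (hF.comp' hB.1 hS hQ (hr.smooth hB.1 hS))) x

namespace FibreData

variable {X : CSpace.{u}} {Y : CSpace.{v}} {Z : CSpace.{w}} {f : X → Z} {g : Y → Z}
  {oX : SignData X} {oY : SignData Y} {oZ : SignData Z} (h : FibreData X Y Z f g)
include h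

lemma exists_orientedDiffeo_sum {A : CSpace.{u'}} {oA : SignData A}
    (hX : IsOrientedManifold X oX) (hY : IsOrientedManifold Y oY) (hZ : IsOrientedManifold Z oZ)
    (hA : IsOrientedManifold A oA) (hdim : A.dim = X.dim - 1) {e : A → X.boundary}
    (he : Etale A X.boundary e) {f' : A → Z} (hf' : ∀ a, f' a = f (e a).pt)
    (hb : IsBSubmersive A Z f') (hor : IsBoundaryOr oX oA e)
    (hfree : ∀ a, ¬ ∃ z, XiMinus X Z f (e a) z)
    (hrange : ∀ q, (¬ ∃ z, XiMinus X Z f q z) → ∃ a, e a = q) :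
    ∃ Φ : (X.fibre Y Z f g).boundary →
        (A.fibre Y Z f' g).sum (X.fibre Y.boundary Z f (g ∘ Y.incl)),
      IsOrientedDiffeo (X.fibre Y Z f g).boundary
        ((A.fibre Y Z f' g).sum (X.fibre Y.boundary Z f (g ∘ Y.incl)))
        (boundaryOr (fibreOr oX oY oZ f g))
        (sumOr (fibreOr oA oY oZ f' g)
          (signed (Int.negOnePow (X.dim + Z.dim))
            (fibreOr oX (boundaryOr oY) oZ f (g ∘ Y.incl)))) Φ ∧
      ∀ p, Sum.elim (fun a => ((e a.1.1).pt, a.1.2)) (fun a => (a.1.1, a.1.2.pt)) (Φ p)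
        = p.pt.1 := by
  have hY' := hY.boundary
  have he' := hY'.1.etale_id
  have hg' : ∀ b, (g ∘ Y.incl) b = g (id b : Y.boundary).pt := fun _ => rfl
  have hL := h.left hA.1 he hf' hb
  have hR := h.right hY'.1 he' hg'
  have oL := hL.isOrientedManifold hA.2 hY.2 hZ.2
  have oR := (hR.isOrientedManifold hX.2 hY'.2 hZ.2).signed
    (Int.negOnePow (X.dim + Z.dim))
  have hd : (A.fibre Y Z f' g).dim = (X.fibre Y.boundary Z f (g ∘ Y.incl)).dim := by
    change A.dim + Y.dim - Z.dim = X.dim + (Y.dim - 1) - Z.dim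
    omega
  have oS := oL.sum oR hd
  obtain ⟨Φ, Ψ, hΦ, hΨ, h1, h2, h3⟩ := h.exists_diffeo oS.1
    (Init.sum hL.hW hR.hW hd (h.init_left hA.1 he hf' hb)
      (h.init_right hY'.1 he' hg')) (by rintro (a | a) <;> rfl) ((h.bdPiece_left he hf' hfree).sum
          (h.bdPiece_right he' hg') fun p a b h1 h2 => h.not_both (hfree _) h1.2 h2.2) fun p => by
      rcases h.face_cases p with ⟨q, hq, hpq⟩ | ⟨q, hpq⟩
      · obtain ⟨a, rfl⟩ := hrange q hq
        exact ⟨Sum.inl ⟨(a, p.pt.1.2), (hf' a).trans ((congrArg f hpq.1.symm).trans p.pt.2)⟩,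
          Prod.ext hpq.1 rfl, hpq⟩
      · exact ⟨Sum.inr ⟨(p.pt.1.1, q), p.pt.2.trans (congrArg g hpq.1)⟩, Prod.ext rfl hpq.1, hpq⟩
  refine ⟨Φ, isOrientedDiffeo_of_posAt (h.isOrientedManifold hX.2 hY.2 hZ.2).boundary oS hΦ hΨ h1 h2
      fun x => ?_, fun p => ?_⟩
  · exact posAt_sum_of_smooth oL oR hd h.hW.boundary hΨ
      (fun hs => h.posAt_left hX.2 hY.2 hZ.2 hA hdim he hf' hb
        hor hs fun a => h3 (Sum.inl a))
      (fun hs => h.posAt_right hX.2 hY.2 hZ.2 hY' rfl he' hg'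
        (isBoundaryOr_id hY) hs fun a => h3 (Sum.inr a)) x
  · have h4 := h3 (Φ p)
    rw [h1] at h4
    generalize Φ p = x at h4
    rcases x with a | a <;> exact h4.1.symm

lemma exists_orientedDiffeo_sum_sum (hX : IsOrientedManifold X oX) (hY : IsOrientedManifold Y oY)
    (hZ : IsOrientedManifold Z oZ) (hb : IsBSubmersive Y Z g) :
    ∃ Φ : (X.fibre Y Z f g).boundary →
        (((bdPlus X Z f).fibre Y Z (fPlus X Z f) g).sum
          (X.fibre (bdPlus Y Z g) Z f (fPlus Y Z g))).sum
          (minusFibre X Y Z f g),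
      IsOrientedDiffeo (X.fibre Y Z f g).boundary
        ((((bdPlus X Z f).fibre Y Z (fPlus X Z f) g).sum
          (X.fibre (bdPlus Y Z g) Z f (fPlus Y Z g))).sum
          (minusFibre X Y Z f g))
        (boundaryOr (fibreOr oX oY oZ f g))
        (sumOr
          (sumOr (fibreOr (restrictOr (boundaryOr oX) _) oY oZ (fPlus X Z f) g)
            (signed (Int.negOnePow (X.dim + Z.dim))
              (fibreOr oX (restrictOr (boundaryOr oY) _) oZ f (fPlus Y Z g))))
          (fibreOr (restrictOr (boundaryOr oX) _) (restrictOr (boundaryOr oY) _)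
            (boundaryOr oZ) (fMinus X Z f) (fMinus Y Z g))) Φ ∧
      ∀ p, Sum.elim
          (Sum.elim (fun a => (a.1.1.1.pt, a.1.2)) (fun a => (a.1.1, a.1.2.1.pt)))
          (fun a => (a.1.1.1.pt, a.1.2.1.pt)) (Φ p)
        = p.pt.1 := by
  have sX := isClopen_not_xiMinus h.hX h.hZ h.hf.1
  have sY := isClopen_not_xiMinus h.hY h.hZ h.hg
  have tX := isClopen_xiMinus h.hX h.hZ h.hf.1
  have tY := isClopen_xiMinus h.hY h.hZ h.hg
  have hA := hX.boundary.restrict sX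
  have hB := hY.boundary.restrict sY
  have hC := hX.boundary.restrict tX
  have hD := hY.boundary.restrict tY
  have he := etale_bdPlus h.hX h.hZ h.hf.1
  have he' := etale_bdPlus h.hY h.hZ h.hg
  have hf' : ∀ a, fPlus X Z f a = f (Subtype.val a).pt := fun _ => rfl
  have hg' : ∀ b, fPlus Y Z g b = g (Subtype.val b).pt := fun _ => rfl
  have hbA := isBSubmersive_fPlus h.hX h.hZ h.hf
  have hL := h.left hA.1 he hf' hbA
  have hR := h.right hB.1 he' hg'
  have hN := h.corner hb
  have oL := hL.isOrientedManifold hA.2 hY.2 hZ.2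
  have oR := (hR.isOrientedManifold hX.2 hB.2 hZ.2).signed
    (Int.negOnePow (X.dim + Z.dim))
  have oN := hN.isOrientedManifold hC.2 hD.2 hZ.boundary.2
  have hd : ((bdPlus X Z f).fibre Y Z (fPlus X Z f) g).dim =
      (X.fibre (bdPlus Y Z g) Z f (fPlus Y Z g)).dim := by
    change X.dim - 1 + Y.dim - Z.dim = X.dim + (Y.dim - 1) - Z.dim
    omega
  have hd' : (((bdPlus X Z f).fibre Y Z (fPlus X Z f) g).sum
      (X.fibre (bdPlus Y Z g) Z f (fPlus Y Z g))).dim = (minusFibre X Y Z f g).dim := by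
    change X.dim - 1 + Y.dim - Z.dim = X.dim - 1 + (Y.dim - 1) - (Z.dim - 1)
    omega
  have hP := ((h.bdPiece_left he hf' fun a => a.2).sum (h.bdPiece_right he' hg')
    fun p a b h1 h2 => h.not_both a.1.1.2 h1.2 h2.2).sum (h.bdPiece_corner hb) (by
      rintro p (a | a) b h1 h2
      · exact h.not_both a.1.1.2 h1.2 h2.2.2
      · exact a.1.2.2 ((h.right_unique h1.2 h2.2.2) ▸ b.1.2.2))
  have oLR := oL.sum oR hd
  have oS := oLR.sum oN hd'
  obtain ⟨Φ, Ψ, hΦ, hΨ, h1, h2, h3⟩ := h.exists_diffeo oS.1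
    (Init.sum oLR.1 hN.hW hd' (Init.sum hL.hW hR.hW hd (h.init_left hA.1 he hf' hbA)
      (h.init_right hB.1 he' hg')) (h.init_corner hb))
      (by rintro ((a | a) | a) <;> rfl) hP fun p => by
      rcases h.face_cases p with ⟨q, hq, hpq⟩ | ⟨q, hpq⟩
      · exact ⟨Sum.inl (Sum.inl ⟨(⟨q, hq⟩, p.pt.1.2), (congrArg f hpq.1.symm).trans p.pt.2⟩),
          Prod.ext hpq.1 rfl, hpq⟩
      · by_cases hq : ∃ z, XiMinus Y Z g q z
        · obtain ⟨z, hz⟩ := hq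
          obtain ⟨q', h5, h6⟩ := XiMinus.exists_of_pt h.hX h.hZ h.hf ((p.pt.2.trans (congrArg g
              hpq.1)).trans hz.1)
          exact ⟨Sum.inr ⟨(⟨q', z, h6⟩, ⟨q, z, hz⟩), ((fMinus_eq_iff h.hX h.hZ h.hf).2 h6).trans
            ((fMinus_eq_iff h.hY h.hZ hb).2 hz).symm⟩, Prod.ext h5.symm hpq.1,
            h.xiMinus_left_of_right hpq hz h6 h5, hpq⟩
        · exact ⟨Sum.inl (Sum.inr ⟨(p.pt.1.1, ⟨q, hq⟩), p.pt.2.trans (congrArg g hpq.1)⟩),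
            Prod.ext rfl hpq.1, hpq⟩
  refine ⟨Φ, isOrientedDiffeo_of_posAt (h.isOrientedManifold hX.2 hY.2 hZ.2).boundary oS hΦ hΨ h1 h2
      fun x => ?_, fun p => ?_⟩
  · exact posAt_sum_of_smooth oLR oN hd' h.hW.boundary hΨ
      (fun hs => posAt_sum_of_smooth oL oR hd h.hW.boundary hs
        (fun hs => h.posAt_left hX.2 hY.2 hZ.2 hA rfl he hf' hbA
          (isBoundaryOr_restrict hX sX) hs fun a => h3 (Sum.inl (Sum.inl a)))
        (fun hs => h.posAt_right hX.2 hY.2 hZ.2 hB rfl he' hg'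
          (isBoundaryOr_restrict hY sY) hs fun a => h3 (Sum.inl (Sum.inr a))))
      (fun hs => h.posAt_corner hX.2 hY.2 hZ hb hC
        (isBoundaryOr_restrict hX tX) hD (isBoundaryOr_restrict hY tY) hs
        fun a => h3 (Sum.inr a)) x
  · have h4 := h3 (Φ p)
    rw [h1] at h4
    generalize Φ p = x at h4
    rcases x with (a | a) | a <;> exact h4.1.symm

end FibreData

end Corners

end

open Corners

theorem proposition7p4 (X : CSpace.{u}) (Y : CSpace.{v}) (oX : SignData X) (oY : SignData Y)
    (hX : IsOrientedManifold X oX) (hY : IsOrientedManifold Y oY) :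
    -- `∂_-^f X ≅ (-1)^(dim X + dim Y) X ×_Y ∂Y`
    (∀ f : X → Y, IsSubmersion X Y f →
      IsSubmersion (bdMinus X Y f) Y.boundary (fMinus X Y f) ∧
      AreTransverse X Y.boundary Y f Y.incl ∧
      ∃ Φ : bdMinus X Y f → X.fibre Y.boundary Y f Y.incl,
        IsOrientedDiffeo (bdMinus X Y f) (X.fibre Y.boundary Y f Y.incl)
          (restrictOr (boundaryOr oX) _)
          (signed (Int.negOnePow (X.dim + Y.dim)) (fibreOr oX (boundaryOr oY) oY f Y.incl)) Φ ∧
        ∀ p, (Φ p).1.1 = p.1.pt ∧ (Φ p).1.2 = fMinus X Y f p) ∧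
    ∀ (Z : CSpace.{w}) (oZ : SignData Z), IsOrientedManifold Z oZ →
    ∀ (f : X → Z) (g : Y → Z),
    -- `∂(X ×_Z Y) ≅ (∂X ×_Z Y) ⊔ (-1)^(dim X + dim Z) (X ×_Z ∂Y)` if `∂Z = ∅`
    (Z.WithoutBoundary → AreTransverse X Y Z f g →
      IsOrientedManifold (X.fibre Y Z f g) (fibreOr oX oY oZ f g) ∧
      AreTransverse X.boundary Y Z (f ∘ X.incl) g ∧
      AreTransverse X Y.boundary Z f (g ∘ Y.incl) ∧
      ∃ Φ : (X.fibre Y Z f g).boundary →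
          (X.boundary.fibre Y Z (f ∘ X.incl) g).sum (X.fibre Y.boundary Z f (g ∘ Y.incl)),
        IsOrientedDiffeo (X.fibre Y Z f g).boundary
          ((X.boundary.fibre Y Z (f ∘ X.incl) g).sum (X.fibre Y.boundary Z f (g ∘ Y.incl)))
          (boundaryOr (fibreOr oX oY oZ f g))
          (sumOr (fibreOr (boundaryOr oX) oY oZ (f ∘ X.incl) g)
            (signed (Int.negOnePow (X.dim + Z.dim))
              (fibreOr oX (boundaryOr oY) oZ f (g ∘ Y.incl)))) Φ ∧
        ∀ p, Sum.elim (fun a => (a.1.1.pt, a.1.2)) (fun a => (a.1.1, a.1.2.pt)) (Φ p)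
          = p.pt.1) ∧
    -- `∂(X ×_Z Y) ≅ (∂_+^f X ×_Z Y) ⊔ (-1)^(dim X + dim Z) (X ×_Z ∂Y)`
    ((IsSubmersion X Z f ∧ Smooth Y Z g) ∨ (AreTransverse X Y Z f g ∧ IsBSubmersive X Z f) →
      IsOrientedManifold (X.fibre Y Z f g) (fibreOr oX oY oZ f g) ∧
      AreTransverse (bdPlus X Z f) Y Z (fPlus X Z f) g ∧
      AreTransverse X Y.boundary Z f (g ∘ Y.incl) ∧
      ∃ Φ : (X.fibre Y Z f g).boundary →
          ((bdPlus X Z f).fibre Y Z (fPlus X Z f) g).sum (X.fibre Y.boundary Z f (g ∘ Y.incl)),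
        IsOrientedDiffeo (X.fibre Y Z f g).boundary
          (((bdPlus X Z f).fibre Y Z (fPlus X Z f) g).sum
            (X.fibre Y.boundary Z f (g ∘ Y.incl)))
          (boundaryOr (fibreOr oX oY oZ f g))
          (sumOr (fibreOr (restrictOr (boundaryOr oX) _) oY oZ (fPlus X Z f) g)
            (signed (Int.negOnePow (X.dim + Z.dim))
              (fibreOr oX (boundaryOr oY) oZ f (g ∘ Y.incl)))) Φ ∧
        ∀ p, Sum.elim (fun a => (a.1.1.1.pt, a.1.2)) (fun a => (a.1.1, a.1.2.pt)) (Φ p)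
          = p.pt.1) ∧
    -- `∂(X ×_Z Y) ≅`
    -- `(∂_+^f X ×_Z Y) ⊔ (-1)^(dim X + dim Z) (X ×_Z ∂_+^g Y) ⊔ (∂_-^f X ×_{∂Z} ∂_-^g Y)`
    ((IsSubmersion X Z f ∧ IsSubmersion Y Z g) ∨
        (AreTransverse X Y Z f g ∧ IsBSubmersive X Z f ∧ IsBSubmersive Y Z g) →
      IsOrientedManifold (X.fibre Y Z f g) (fibreOr oX oY oZ f g) ∧
      AreTransverse (bdPlus X Z f) Y Z (fPlus X Z f) g ∧
      AreTransverse X (bdPlus Y Z g) Z f (fPlus Y Z g) ∧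
      AreTransverse (bdMinus X Z f) (bdMinus Y Z g) Z.boundary (fMinus X Z f) (fMinus Y Z g) ∧
      ∃ Φ : (X.fibre Y Z f g).boundary →
          (((bdPlus X Z f).fibre Y Z (fPlus X Z f) g).sum
            (X.fibre (bdPlus Y Z g) Z f (fPlus Y Z g))).sum
            ((bdMinus X Z f).fibre (bdMinus Y Z g) Z.boundary (fMinus X Z f) (fMinus Y Z g)),
        IsOrientedDiffeo (X.fibre Y Z f g).boundary
          ((((bdPlus X Z f).fibre Y Z (fPlus X Z f) g).sum
            (X.fibre (bdPlus Y Z g) Z f (fPlus Y Z g))).sum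
            ((bdMinus X Z f).fibre (bdMinus Y Z g) Z.boundary (fMinus X Z f) (fMinus Y Z g)))
          (boundaryOr (fibreOr oX oY oZ f g))
          (sumOr
            (sumOr (fibreOr (restrictOr (boundaryOr oX) _) oY oZ (fPlus X Z f) g)
              (signed (Int.negOnePow (X.dim + Z.dim))
                (fibreOr oX (restrictOr (boundaryOr oY) _) oZ f (fPlus Y Z g))))
            (fibreOr (restrictOr (boundaryOr oX) _) (restrictOr (boundaryOr oY) _)
              (boundaryOr oZ) (fMinus X Z f) (fMinus Y Z g))) Φ ∧
        ∀ p, Sum.elim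
            (Sum.elim (fun a => (a.1.1.1.pt, a.1.2)) (fun a => (a.1.1, a.1.2.1.pt)))
            (fun a => (a.1.1.1.pt, a.1.2.1.pt)) (Φ p)
          = p.pt.1) := by
  refine ⟨fun f hf => ?_, fun Z oZ hZ f g => ⟨fun hZb ht => ?_, fun hc => ?_, fun hc => ?_⟩⟩
  · have h := hf.fibreData_incl hX.1 hY.1
    have hS := isClopen_xiMinus hX.1 hY.1 hf.1
    obtain ⟨Ψ, hΨ, h1, h2⟩ := exists_bdMinusMap_inverse hX.1 hY.1 hf
    exact ⟨isSubmersion_fMinus hX.1 hY.1 hf, h.areTransverse, bdMinusMap X Y f,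
      isOrientedDiffeo_of_posAt' (hX.boundary.restrict hS)
        ((h.isOrientedManifold hX.2 hY.boundary.2
          hY.2).signed _) (smooth_bdMinusMap hX.1 hY.1 hf) hΨ h1 h2
        (posAt_bdMinusMap hX hY hf (isBoundaryOr_restrict hX hS)), fun p => ⟨rfl, rfl⟩⟩
  · have h : FibreData X Y Z f g := ⟨hX.1, hY.1, hZ.1,
      hZb.isBSubmersive hX.1 hZ.1 ht.1, ht.2.1,
      ht.stratumTransverse hX.1 hY.1 hZ.1⟩
    have he := h.hX.boundary.etale_id
    have hb := hZb.isBSubmersive h.hX.boundary h.hZ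
      (h.hf.1.comp' h.hX.boundary h.hX h.hZ h.hX.smooth_incl)
    exact ⟨h.isOrientedManifold hX.2 hY.2 hZ.2,
      (h.left h.hX.boundary he (fun _ => rfl) hb).areTransverse,
      (h.right h.hY.boundary h.hY.boundary.etale_id fun _ => rfl).areTransverse,
      h.exists_orientedDiffeo_sum hX hY hZ hX.boundary rfl he (fun _ => rfl) hb
        (isBoundaryOr_id hX) (fun a => hZb.not_xiMinus h.hZ _) fun q _ => ⟨q, rfl⟩⟩
  · have h : FibreData X Y Z f g := by
      rcases hc with ⟨hf, hg⟩ | ⟨ht, hf⟩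
      · exact ⟨hX.1, hY.1, hZ.1, hf.isBSubmersive, hg,
          hf.stratumTransverse hg hX.1 hY.1 hZ.1⟩
      · exact ⟨hX.1, hY.1, hZ.1, hf, ht.2.1,
          ht.stratumTransverse hX.1 hY.1 hZ.1⟩
    have hS := isClopen_not_xiMinus h.hX h.hZ h.hf.1
    have hA := hX.boundary.restrict hS
    have he := etale_bdPlus h.hX h.hZ h.hf.1
    have hb := isBSubmersive_fPlus h.hX h.hZ h.hf
    exact ⟨h.isOrientedManifold hX.2 hY.2 hZ.2,
      (h.left hA.1 he (fun _ => rfl) hb).areTransverse,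
      (h.right h.hY.boundary h.hY.boundary.etale_id fun _ => rfl).areTransverse,
      h.exists_orientedDiffeo_sum hX hY hZ hA rfl he (fun _ => rfl) hb
        (isBoundaryOr_restrict hX hS) (fun a => a.2) fun q hq => ⟨⟨q, hq⟩, rfl⟩⟩
  · have h : FibreData X Y Z f g ∧ IsBSubmersive Y Z g := by
      rcases hc with ⟨hf, hg⟩ | ⟨ht, hf, hg⟩
      · exact ⟨⟨hX.1, hY.1, hZ.1, hf.isBSubmersive, hg.1,
          hf.stratumTransverse hg.1 hX.1 hY.1 hZ.1⟩, hg.isBSubmersive⟩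
      · exact ⟨⟨hX.1, hY.1, hZ.1, hf, ht.2.1,
          ht.stratumTransverse hX.1 hY.1 hZ.1⟩, hg⟩
    obtain ⟨h, hb⟩ := h
    exact ⟨h.isOrientedManifold hX.2 hY.2 hZ.2,
      (h.left (bdPlus_isManifold h.hX h.hZ h.hf.1) (etale_bdPlus h.hX h.hZ h.hf.1)
        (fun _ => rfl) (isBSubmersive_fPlus h.hX h.hZ h.hf)).areTransverse,
      (h.right (bdPlus_isManifold h.hY h.hZ h.hg) (etale_bdPlus h.hY h.hZ h.hg)
        fun _ => rfl).areTransverse,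
      (h.corner hb).areTransverse, h.exists_orientedDiffeo_sum_sum hX hY hZ hb⟩
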